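/- For $(X,Y)\in\mathbb R^2$ let $u=u_{X,Y}$ be the maximal smooth solution of the focusing cubic wave equation $$\partial_t^2u-\Delta u=u^3,\qquad u(0,x)=\frac{2X}{1+|x|^2},\quad \partial_tu(0,x)=\frac{4Y}{(1+|x|^2)^2},\qquad x\in\mathbb R^3,$$ that is, the smooth solution on $(t_-,t_+)\times\mathbb R^3$, with $-\infty\le t_-<0<t_+\le+\infty$, of which every smooth solution with the same data on a strip $(a,b)\times\mathbb R^3$, $a<0<b$, is a restriction. Write $\boldsymbol u(t)=(u(t,\cdot),\partial_tu(t,\cdot))$, and $\mathcal H^s=\dot H^s(\mathbb R^3)\times\dot H^{s-1}(\mathbb R^3)$ with homogeneous $L^2$ Sobolev spaces. There is a strictly decreasing $C^\infty$ function $\beta:\mathbb R\to\mathbb R$ with $\lim_{X\to\pm\infty}\beta(X)=\mp\infty$ and $\beta(X)>-\beta(-X)$ for all $X$, such that for every $(X,Y)\in\mathbb R^2$ the maximal smooth solution $u_{X,Y}$ exists, $\boldsymbol u_{X,Y}(t)\in\mathcal H^s$ for all $t\in(t_-,t_+)$ and all $s\ge\frac12$, and one and only one of the following three behaviours occurs,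 each of them exactly under the stated condition: * (Blow-up) if and only if $Y>\beta(X)$ or $Y<-\beta(-X)$: $t_+<\infty$, and $\|\boldsymbol u_{X,Y}(t)\|_{\mathcal H^s}\to\infty$ as $t\nearrow t_+$ for every $s\ge\frac12$; * (Scattering) if and only if $-\beta(-X)<Y<\beta(X)$: $t_+=+\infty$, and there is a smooth solution $v$ on $\mathbb R\times\mathbb R^3$ of the linear wave equation $\partial_t^2v=\Delta v$, with $\sup_{t\in\mathbb R}\|\boldsymbol v(t)\|_{\mathcal H^{1/2}}<\infty$, such that $\|\boldsymbol u_{X,Y}(t)-\boldsymbol v(t)\|_{\mathcal H^{1/2}}\to0$ as $t\to\infty$; * (Threshold) if and only if $Y=\beta(X)$ or $Y=-\beta(-X)$: $t_+=+\infty$, and $\|\boldsymbol u_{X,Y}(t)\|_{\mathcal H^{1/2}}\to\infty$ as $t\to\infty$. -/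

import Mathlib

open Set Filter Topology MeasureTheory
open scoped ENNReal ContDiff FourierTransform SchwartzMap

noncomputable section

namespace CubicWave

/-- Physical space `ℝ³` with its Euclidean structure. -/
abbrev Space : Type := EuclideanSpace ℝ (Fin 3)

/-- `f` is a function on `ℝ³` that defines a tempered distribution, and `g` is a function that
defines a tempered distribution and is the Fourier transform of `f`, in the sense of tempered
distributions (frequency convention `e^{-2π i x·ξ}`).  Such a `g` is locally integrable, and it is
determined by `f` up to null sets. -/
def IsFourierTransformOf (f : Space → ℝ) (g : Space → ℂ) : Prop :=
  (∀ φ : 𝓢(Space, ℂ), Integrable (fun x => φ x * (f x : ℂ))) ∧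
  (∀ φ : 𝓢(Space, ℂ), Integrable (fun ξ => φ ξ * g ξ)) ∧
  ∀ φ : 𝓢(Space, ℂ), ∫ x, (𝓕 φ) x * (f x : ℂ) = ∫ ξ, φ ξ * g ξ

/-- The norm of the homogeneous Sobolev space `Ḣ^s(ℝ³)`, that is, the `L²` norm of
`(2π|ξ|)^s f̂(ξ)`.  It is `∞` when `f` has no Fourier transform which is a function, so that
`f ∈ Ḣ^s` exactly when the value is finite.  The infimum is over a single class modulo
equality almost everywhere. -/
def sobolevNorm (s : ℝ) (f : Space → ℝ) : ℝ≥0∞ :=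
  ⨅ (g : Space → ℂ) (_ : IsFourierTransformOf f g),
    eLpNorm (fun ξ => ((2 * Real.pi * ‖ξ‖) ^ s : ℝ) • g ξ) 2 volume

/-- The norm of the pair `(f, h)` in `𝓗^s = Ḣ^s(ℝ³) × Ḣ^{s-1}(ℝ³)`. -/
def pairNorm (s : ℝ) (f h : Space → ℝ) : ℝ≥0∞ :=
  (sobolevNorm s f ^ 2 + sobolevNorm (s - 1) h ^ 2) ^ (1 / 2 : ℝ)

/-- The time derivative `∂ₜ u(t, ·)`. -/
def timeDeriv (u : ℝ → Space → ℝ) (t : ℝ) : Space → ℝ :=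
  fun x => deriv (fun τ => u τ x) t

/-- The wave operator `∂ₜ² u - Δ u` at the point `(t, x)`. -/
def waveOp (u : ℝ → Space → ℝ) (t : ℝ) (x : Space) : ℝ :=
  iteratedDeriv 2 (fun τ => u τ x) t - Laplacian.laplacian (u t) x

/-- `u` is a smooth solution on `(a, b) × ℝ³` of `∂ₜ² u - Δ u = u³` with
`u(0, x) = 2X / (1 + |x|²)` and `∂ₜ u(0, x) = 4Y / (1 + |x|²)²`.
The values of `u` at times outside `(a, b)` are irrelevant. -/
structure IsSolution (X Y : ℝ) (a b : EReal) (u : ℝ → Space → ℝ) : Prop where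
  zero_mem : a < 0 ∧ 0 < b
  smooth : ContDiffOn ℝ ∞ (fun p : ℝ × Space => u p.1 p.2)
    {p | a < (p.1 : EReal) ∧ (p.1 : EReal) < b}
  eqn : ∀ t : ℝ, a < (t : EReal) → (t : EReal) < b → ∀ x, waveOp u t x = u t x ^ 3
  init : ∀ x, u 0 x = 2 * X / (1 + ‖x‖ ^ 2)
  init_deriv : ∀ x, timeDeriv u 0 x = 4 * Y / (1 + ‖x‖ ^ 2) ^ 2

/-- `u` is the maximal smooth solution with the data given by `(X, Y)`, and `(tm, tp)` is its
maximal time interval: every smooth solution with these data, on any time interval, is a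
restriction of `u`. -/
structure IsMaximalSolution (X Y : ℝ) (tm tp : EReal) (u : ℝ → Space → ℝ) : Prop where
  isSolution : IsSolution X Y tm tp u
  maximal : ∀ (a b : EReal) (w : ℝ → Space → ℝ), IsSolution X Y a b w →
    tm ≤ a ∧ b ≤ tp ∧
      ∀ t : ℝ, a < (t : EReal) → (t : EReal) < b → ∀ x, w t x = u t x

/-- The forward maximal time `tp` is finite, and all norms in `𝓗^s`, `s ≥ 1/2`, go to infinity
there. -/
def BlowsUp (tp : EReal) (u : ℝ → Space → ℝ) : Prop :=
  ∃ T : ℝ, tp = (T : EReal) ∧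
    ∀ s : ℝ, 1 / 2 ≤ s →
      Tendsto (fun t => pairNorm s (u t) (timeDeriv u t)) (𝓝[<] T) (𝓝 ⊤)

/-- `u` is global forward in time and is asymptotic in `𝓗^{1/2}` to a smooth solution `v` of the
linear wave equation on `ℝ × ℝ³`, whose `𝓗^{1/2}` norm is (finite and) bounded in time. -/
def Scatters (tp : EReal) (u : ℝ → Space → ℝ) : Prop :=
  tp = ⊤ ∧ ∃ v : ℝ → Space → ℝ,
    ContDiff ℝ ∞ (fun p : ℝ × Space => v p.1 p.2) ∧
    (∀ t x, waveOp v t x = 0) ∧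
    (∃ M : ℝ≥0∞, M < ⊤ ∧ ∀ t, pairNorm (1 / 2) (v t) (timeDeriv v t) ≤ M) ∧
    Tendsto (fun t => pairNorm (1 / 2) (u t - v t) (timeDeriv u t - timeDeriv v t))
      atTop (𝓝 0)

/-- `u` is global forward in time and its `𝓗^{1/2}` norm goes to infinity. -/
def GrowsUp (tp : EReal) (u : ℝ → Space → ℝ) : Prop :=
  tp = ⊤ ∧ Tendsto (fun t => pairNorm (1 / 2) (u t) (timeDeriv u t)) atTop (𝓝 ⊤)

end CubicWave

end

/-!
The Penrose compactification turns the problem into an ordinary differential equation: these data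
are constant on the sphere `S³`, so that `u = Ω φ(T)` (`sol`) with explicit conformal factor `Ω`
and conformal time `T(t, |x|) ∈ (-π, π)`, where `φ'' = φ³ - φ`, `φ(0) = X`, `φ'(0) = Y`. The angle
`θ` with `φ = tan θ` and the energy `E` solves a globally regular equation, and poles of `φ` are
the zeros of `cos θ`. As `t → ∞` corresponds to `T = π`, there is blow-up, threshold behaviour or
scattering according to whether the first pole comes before `π`, at `π`, or not on `[0, π]`.

The solution of energy `E` with a pole `+∞` at time `π`, followed backwards over the time `π`
(`poleAngle`), has initial angle `arctan X`; solving this for `E` gives `β(X)` (`threshold`). It is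
smooth, by `smooth_dependence` and the implicit function theorem, since the angle is strictly
decreasing in `E`; `β` decreases because the velocity is monotone in `E`, too
(`variation_at_pi_neg`). For `-1 < X < 0` this needs explicit numerical bounds. Two solutions with
the same `X` are ordered by a Sturm comparison, as `π` is the length of a nodal interval of the
sine (`DataSolution.le`); hence the first pole is located by comparing `Y` with `β(X)` and
`-β(-X)` (`DataSolution.exists_pole`, `DataSolution.regular`, `DataSolution.pole_at_pi`).

* Uniqueness of smooth solutions is an energy estimate with a smooth cutoff to a backward cone
  (`eq_zero_of_wave`); the solution is maximal since it is unbounded at a pole.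
* The Sobolev norms are finite by the decay of the derivatives (`pairNorm_sol_lt_top`).
* Blow-up: near the pole, `u` rescaled concentrates to a multiple of `1 / (α + κ |y|²)`; pairing
  with a rescaled Schwartz function bounds every norm below (`Profile.blowsUp`).
* Scattering: `v` is the radial linear solution with the radiation field of `u`, and `r (u - v)`
  and its derivatives are `O(1 / (t + r))`; by Hardy's inequality and the bounds for radial
  functions in `Ḣ^{±1/2}` the difference tends to zero (`Profile.exists_pairNorm_sub_le`).
* Threshold: `t u(t, t y)` tends to a multiple of the indicator of the unit ball, which is not in
  `Ḣ^{1/2}`; summing dyadic translations makes this quantitative (`tendsto_sobolevNorm_half_top`).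
-/

noncomputable section

namespace CubicWave

open Real
open ENNReal (ofReal ofReal_mul ofReal_pow ofReal_le_ofReal ofReal_ofNat ofReal_ne_top ofReal_sum_of_nonneg)
open Complex (I ofRealCLM norm_real imCLM normSq slitPlane arg)
open Finset (mul_sum sum_congr sum_le_sum sum_mul sum_neg_distrib sum_const card_univ
  sum_add_distrib)
open Metric (ball mem_ball closedBall)

/-! ### Second order autonomous equations: existence, uniqueness, smooth dependence on parameters -/

/-- The pair `(θ, v)` solves `θ' = v`, `v' = g (θ)` at all times in the set `s`. -/
def SolvesOn (g : ℝ → ℝ) (θ v : ℝ → ℝ) (s : Set ℝ) : Prop :=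
  ∀ t ∈ s, HasDerivAt θ (v t) t ∧ HasDerivAt v (g (θ t)) t

lemma SolvesOn.mono {g θ v : ℝ → ℝ} {s s' : Set ℝ} (h : SolvesOn g θ v s) (hs : s' ⊆ s) :
    SolvesOn g θ v s' := fun t ht => h t (hs ht)

lemma lipschitz_firstOrder {g : ℝ → ℝ} {K : NNReal} (hg : LipschitzWith K g) :
    LipschitzWith (max 1 K) (fun p : ℝ × ℝ => (p.2, g p.1)) := by
  have h1 : LipschitzWith 1 (fun p : ℝ × ℝ => p.2) := LipschitzWith.prod_snd
  have h2 : LipschitzWith K (fun p : ℝ × ℝ => g p.1) := by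
    simpa [Function.comp_def] using hg.comp (LipschitzWith.prod_fst (α := ℝ) (β := ℝ))
  exact h1.prodMk h2

/-- Existence for `θ'' = g (θ)` with bounded `g`: clamping the velocity makes the first order
vector field bounded, and the a priori bound on the velocity shows that the clamp is not active. -/
lemma exists_solvesOn {g : ℝ → ℝ} {K : NNReal} (hg : LipschitzWith K g) {M : ℝ}
    (hM : ∀ x, |g x| ≤ M) (θ₀ v₀ L : ℝ) (hL : 0 < L) :
    ∃ θ v : ℝ → ℝ, θ 0 = θ₀ ∧ v 0 = v₀ ∧ SolvesOn g θ v (Ioo (-L) L) := by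
  have hM0 : 0 ≤ M := (abs_nonneg _).trans (hM 0)
  set R : ℝ := |v₀| + M * L + 1
  have hR0 : 0 ≤ R := by positivity
  set f : ℝ × ℝ → ℝ × ℝ := fun p => (max (-R) (min p.2 R), g p.1) with hf
  have h1 : LipschitzWith 1 (fun p : ℝ × ℝ => max (-R) (min p.2 R)) :=
    (LipschitzWith.prod_snd.min_const R).const_max (-R)
  have h2 : LipschitzWith K (fun p : ℝ × ℝ => g p.1) := by
    simpa [Function.comp_def] using hg.comp (LipschitzWith.prod_fst (α := ℝ) (β := ℝ))
  have hlip : LipschitzWith (max 1 K) f := h1.prodMk h2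
  set C : NNReal := ⟨max R M, le_max_of_le_left hR0⟩
  have hbd : ∀ p, ‖f p‖ ≤ C := fun p => by
    rw [Prod.norm_def]
    apply max_le_max
    · simp only [hf, norm_eq_abs]; rw [abs_le]
      exact ⟨le_max_left _ _, max_le (by linarith) (min_le_right _ _)⟩
    · exact hM _
  have h0 : (0 : ℝ) ∈ Icc (-L) L := ⟨by linarith, hL.le⟩
  have hpl : IsPicardLindelof (fun _ => f) (⟨0, h0⟩ : Icc (-L) L) (θ₀, v₀)
      (C * ⟨L, hL.le⟩) 0 C (max 1 K) := by
    refine ⟨fun t _ => hlip.lipschitzOnWith, fun x _ => continuousOn_const, fun t _ x _ => hbd x, ?_⟩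
    simp; exact le_rfl
  obtain ⟨α, hα0, hα⟩ := hpl.exists_eq_forall_mem_Icc_hasDerivWithinAt₀
  have hα' : ∀ t ∈ Ioo (-L) L, HasDerivAt α (f (α t)) t := fun t ht =>
    (hα t (Ioo_subset_Icc_self ht)).hasDerivAt (Icc_mem_nhds ht.1 ht.2)
  have hfst : ∀ t ∈ Ioo (-L) L, HasDerivAt (fun t => (α t).1) (max (-R) (min (α t).2 R)) t :=
    fun t ht => (hα' t ht).fst
  have hsnd : ∀ t ∈ Ioo (-L) L, HasDerivAt (fun t => (α t).2) (g (α t).1) t :=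
    fun t ht => (hα' t ht).snd
  have hα00 : (α 0) = (θ₀, v₀) := hα0
  have hv : ∀ t ∈ Ioo (-L) L, |(α t).2| ≤ R := fun t ht => by
    have h := (convex_Ioo (-L) L).norm_image_sub_le_of_norm_hasDerivWithin_le
      (f := fun t => (α t).2) (f' := fun t => g (α t).1) (C := M)
      (fun x hx => (hsnd x hx).hasDerivWithinAt) (fun x _ => hM _)
      (show (0 : ℝ) ∈ Ioo (-L) L from ⟨by linarith, hL⟩) ht
    simp only [hα00, norm_eq_abs, sub_zero] at h
    have h3 : |t| ≤ L := abs_le.2 ⟨ht.1.le, ht.2.le⟩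
    have h4 := mul_le_mul_of_nonneg_left h3 hM0
    have h5 := abs_sub_abs_le_abs_sub (α t).2 v₀
    linarith
  refine ⟨fun t => (α t).1, fun t => (α t).2, by simp [hα00], by simp [hα00], fun t ht => ⟨?_, ?_⟩⟩
  · have := hfst t ht
    have h3 := abs_le.1 (hv t ht)
    rwa [min_eq_left h3.2, max_eq_right h3.1] at this
  · exact hsnd t ht

lemma SolvesOn.unique {g : ℝ → ℝ} {K : NNReal} (hg : LipschitzWith K g) {θ v θ' v' : ℝ → ℝ}
    {a b t₀ : ℝ} (h : SolvesOn g θ v (Ioo a b)) (h' : SolvesOn g θ' v' (Ioo a b))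
    (ht : t₀ ∈ Ioo a b) (h1 : θ t₀ = θ' t₀) (h2 : v t₀ = v' t₀) :
    ∀ t ∈ Ioo a b, θ t = θ' t ∧ v t = v' t := by
  have := ODE_solution_unique_of_mem_Ioo (v := fun _ p => (p.2, g p.1)) (s := fun _ => univ)
    (K := max 1 K) (f := fun t => (θ t, v t)) (g := fun t => (θ' t, v' t))
    (fun t _ => (lipschitz_firstOrder hg).lipschitzOnWith) ht
    (fun t ht => ⟨(h t ht).1.prodMk (h t ht).2, mem_univ _⟩)
    (fun t ht => ⟨(h' t ht).1.prodMk (h' t ht).2, mem_univ _⟩) (by simp [h1, h2])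
  intro t ht; simpa using this ht

/-- Smoothness of superposition operators on `C(X, ℝ)`. -/
lemma hasFDerivAt_superposition {X : Type*} [TopologicalSpace X] [CompactSpace X]
    {f : ℝ → ℝ} (hf : ContDiff ℝ ∞ f) (hf' : Continuous (deriv f)) (w : C(X, ℝ)) :
    HasFDerivAt (fun w : C(X, ℝ) => (⟨f, hf.continuous⟩ : C(ℝ, ℝ)).comp w)
      (ContinuousLinearMap.mul ℝ C(X, ℝ) ((⟨deriv f, hf'⟩ : C(ℝ, ℝ)).comp w)) w := by
  have hd1 : ContDiff ℝ ∞ (deriv f) := (contDiff_infty_iff_deriv.1 hf).2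
  have hd2 : ContDiff ℝ ∞ (deriv (deriv f)) := (contDiff_infty_iff_deriv.1 hd1).2
  obtain ⟨C, hC⟩ := (isCompact_Icc (a := -(‖w‖ + 1)) (b := ‖w‖ + 1)).exists_bound_of_continuousOn
    hd2.continuous.continuousOn
  have hC0 : 0 ≤ C := (norm_nonneg _).trans (hC 0 ⟨by linarith [norm_nonneg w], by positivity⟩)
  have key : ∀ x h : ℝ, |x| ≤ ‖w‖ → |h| ≤ 1 → |f (x + h) - f x - deriv f x * h| ≤ C * h ^ 2 := fun x h hx hh => by
    have hx' := abs_le.1 hx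
    have hh' := abs_le.1 hh
    have hd : Differentiable ℝ f := hf.differentiable (by simp)
    have hdd : Differentiable ℝ (deriv f) := hd1.differentiable (by simp)
    have hseg : ∀ z ∈ uIcc x (x + h), z ∈ Icc (-(‖w‖ + 1)) (‖w‖ + 1) ∧ |z - x| ≤ |h| := fun z hz => by
      constructor
      · rcases mem_uIcc.1 hz with h1 | h1 <;> constructor <;> linarith [h1.1, h1.2]
      · have := abs_sub_left_of_mem_uIcc hz
        simpa using this
    have h1 : ∀ z ∈ uIcc x (x + h), |deriv f z - deriv f x| ≤ C * |h| := fun z hz => by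
      have := (convex_Icc (-(‖w‖ + 1)) (‖w‖ + 1)).norm_image_sub_le_of_norm_deriv_le
        (f := deriv f) (fun y _ => hdd y) hC (hseg x left_mem_uIcc).1 (hseg z hz).1
      exact this.trans (mul_le_mul_of_nonneg_left (hseg z hz).2 hC0)
    have h2 := (convex_uIcc x (x + h)).norm_image_sub_le_of_norm_hasDerivWithin_le
      (f := fun z => f z - deriv f x * z) (f' := fun z => deriv f z - deriv f x * 1)
      (fun z _ => ((hd z).hasDerivAt.sub ((hasDerivAt_id z).const_mul _)).hasDerivWithinAt)
      (C := C * |h|) (fun z hz => by simpa using h1 z hz) left_mem_uIcc right_mem_uIcc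
    have e1 : f (x + h) - f x - deriv f x * h
        = f (x + h) - deriv f x * (x + h) - (f x - deriv f x * x) := by ring
    rw [e1]
    calc _ ≤ C * |h| * ‖x + h - x‖ := h2
      _ = C * h ^ 2 := by rw [add_sub_cancel_left, norm_eq_abs, mul_assoc, ← sq, sq_abs]
  rw [hasFDerivAt_iff_isLittleO_nhds_zero]
  have : (fun h : C(X, ℝ) => (⟨f, hf.continuous⟩ : C(ℝ, ℝ)).comp (w + h)
      - (⟨f, hf.continuous⟩ : C(ℝ, ℝ)).comp w
      - ContinuousLinearMap.mul ℝ C(X, ℝ) ((⟨deriv f, hf'⟩ : C(ℝ, ℝ)).comp w) h)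
      =O[𝓝 0] fun h => ‖h‖ ^ 2 := by
    apply Asymptotics.IsBigO.of_bound C
    filter_upwards [Metric.ball_mem_nhds (0 : C(X, ℝ)) one_pos] with h hh
    have hh : ‖h‖ ≤ 1 := by simpa using (mem_ball_zero_iff.1 hh).le
    rw [ContinuousMap.norm_le _ (by positivity)]
    intro x
    have h1 := key (w x) (h x) (w.norm_coe_le_norm x) ((h.norm_coe_le_norm x).trans hh)
    have h2 : (h x) ^ 2 ≤ ‖h‖ ^ 2 := sq_le_sq' (by
      have := abs_le.1 (h.norm_coe_le_norm x); linarith [this.1]) ((le_abs_self _).trans (h.norm_coe_le_norm x))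
    simp only [norm_pow, norm_norm]; exact h1.trans (mul_le_mul_of_nonneg_left h2 hC0)
  exact this.trans_isLittleO (Asymptotics.isLittleO_norm_pow_id one_lt_two)

lemma contDiff_superposition {X : Type*} [TopologicalSpace X] [CompactSpace X] (n : ℕ) :
    ∀ (f : ℝ → ℝ) (hf : ContDiff ℝ ∞ f),
      ContDiff ℝ n (fun w : C(X, ℝ) => (⟨f, hf.continuous⟩ : C(ℝ, ℝ)).comp w) := by
  induction n with
  | zero =>
    intro f hf
    have hf' : Continuous (deriv f) := (contDiff_infty_iff_deriv.1 hf).2.continuous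
    exact contDiff_zero.2 (continuous_iff_continuousAt.2 fun w =>
      (hasFDerivAt_superposition hf hf' w).continuousAt)
  | succ n ih =>
    intro f hf
    have hf' : ContDiff ℝ ∞ (deriv f) := (contDiff_infty_iff_deriv.1 hf).2
    rw [show ((n + 1 : ℕ) : WithTop ℕ∞) = (n : WithTop ℕ∞) + 1 from rfl,
      contDiff_succ_iff_hasFDerivAt]
    have hmul : ContDiff ℝ n (fun g : C(X, ℝ) => ContinuousLinearMap.mul ℝ C(X, ℝ) g) := by fun_prop
    exact ⟨fun w => ContinuousLinearMap.mul ℝ C(X, ℝ)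
      ((⟨deriv f, hf'.continuous⟩ : C(ℝ, ℝ)).comp w), hmul.comp (ih _ hf'),
      fun w => hasFDerivAt_superposition hf hf'.continuous w⟩

/-- The primitive vanishing at `0`, as a bounded operator on `C([0, L], ℝ)`. -/
def primitive {L : ℝ} (hL : 0 ≤ L) : C(Icc 0 L, ℝ) →L[ℝ] C(Icc 0 L, ℝ) := LinearMap.mkContinuous
    { toFun := fun f => ⟨fun s => ∫ τ in 0..s, IccExtend hL f τ,
        (intervalIntegral.continuous_primitive
          (fun _ _ => (f.continuous.Icc_extend' (h := hL)).intervalIntegrable _ _) 0).comp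
          continuous_subtype_val⟩
      map_add' := fun f g => by
        ext s; simp only [ContinuousMap.coe_mk, ContinuousMap.add_apply]
        rw [← intervalIntegral.integral_add
          ((f.continuous.Icc_extend' (h := hL)).intervalIntegrable _ _)
          ((g.continuous.Icc_extend' (h := hL)).intervalIntegrable _ _)]
        rfl
      map_smul' := fun c f => by
        ext s
        simp only [ContinuousMap.coe_mk, ContinuousMap.smul_apply, RingHom.id_apply, smul_eq_mul]
        rw [← intervalIntegral.integral_const_mul]
        rfl } L (by
    intro f; rw [ContinuousMap.norm_le _ (by positivity)]
    intro s
    have := intervalIntegral.norm_integral_le_of_norm_le_const (a := 0) (b := (s : ℝ))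
      (f := IccExtend hL f) (C := ‖f‖) (fun x _ => f.norm_coe_le_norm _)
    refine this.trans ?_
    rw [sub_zero, abs_of_nonneg s.2.1, mul_comm]
    exact mul_le_mul_of_nonneg_right s.2.2 (norm_nonneg _))

lemma primitive_apply {L : ℝ} (hL : 0 ≤ L) (f : C(Icc 0 L, ℝ)) (s : Icc 0 L) :
    primitive hL f s = ∫ τ in 0..s, IccExtend hL f τ := rfl

lemma abs_primitive_le {L : ℝ} (hL : 0 ≤ L) (f : C(Icc 0 L, ℝ)) {C : ℝ} {n : ℕ}
    (h : ∀ s : Icc 0 L, |f s| ≤ C * (s : ℝ) ^ n) (s : Icc 0 L) :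
    |primitive hL f s| ≤ C * (s : ℝ) ^ (n + 1) / (n + 1) := by
  rw [primitive_apply]
  have h1 : ‖∫ τ in 0..s, IccExtend hL f τ‖ ≤ ∫ τ in 0..s, C * τ ^ n := by
    apply intervalIntegral.norm_integral_le_of_norm_le s.2.1
    · refine Eventually.of_forall fun τ hτ => ?_
      have hm : τ ∈ Icc 0 L := ⟨hτ.1.le, hτ.2.trans s.2.2⟩
      rw [IccExtend_of_mem hL f hm]; exact h ⟨τ, hm⟩
    · exact (by fun_prop : Continuous fun τ : ℝ => C * τ ^ n).intervalIntegrable _ _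
  refine h1.trans (le_of_eq ?_)
  rw [intervalIntegral.integral_const_mul, integral_pow]; simp; ring

/-- A Volterra operator is quasinilpotent, hence `1 - K` is invertible. -/
lemma isUnit_one_sub_volterra {L : ℝ} (hL : 0 ≤ L) (a : C(Icc 0 L, ℝ)) :
    IsUnit (1 - (primitive hL * primitive hL * ContinuousLinearMap.mul ℝ C(Icc 0 L, ℝ) a :
      C(Icc 0 L, ℝ) →L[ℝ] C(Icc 0 L, ℝ))) := by
  set T : C(Icc 0 L, ℝ) →L[ℝ] C(Icc 0 L, ℝ) :=
    primitive hL * primitive hL * ContinuousLinearMap.mul ℝ C(Icc 0 L, ℝ) a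
  set M := ‖a‖ * L with hM
  have hM0 : 0 ≤ M := by positivity
  have hpt : ∀ (n : ℕ) (f : C(Icc 0 L, ℝ)) (s : Icc 0 L),
      |(T ^ n) f s| ≤ (‖f‖ * M ^ n / n.factorial) * (s : ℝ) ^ n := fun n => by
    induction n with
    | zero => intro f s; simpa using f.norm_coe_le_norm s
    | succ n ih =>
      intro f s
      have e : (T ^ (n + 1)) f = primitive hL (primitive hL (a * (T ^ n) f)) := by
        rw [pow_succ']; rfl
      rw [e]
      have h1 : ∀ s : Icc 0 L, |(a * (T ^ n) f) s| ≤
          (‖a‖ * (‖f‖ * M ^ n / n.factorial)) * (s : ℝ) ^ n := fun s => by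
        rw [ContinuousMap.mul_apply, abs_mul, mul_assoc]
        exact mul_le_mul (a.norm_coe_le_norm s) (ih f s) (abs_nonneg _) (norm_nonneg _)
      have h2 := abs_primitive_le hL _ h1
      have h3 : ∀ s : Icc 0 L, |primitive hL (a * (T ^ n) f) s| ≤
          (‖f‖ * M ^ (n + 1) / (n + 1).factorial) * (s : ℝ) ^ n := fun s => by
        refine (h2 s).trans ?_
        have : ‖a‖ * (‖f‖ * M ^ n / n.factorial) * (s : ℝ) ^ (n + 1) / (n + 1)
            = (‖f‖ * M ^ n * ‖a‖ / (n + 1).factorial) * (s : ℝ) ^ n * s := by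
          rw [Nat.factorial_succ]; push_cast; field_simp; ring
        rw [this]
        calc _ ≤ (‖f‖ * M ^ n * ‖a‖ / (n + 1).factorial) * (s : ℝ) ^ n * L :=
              mul_le_mul_of_nonneg_left s.2.2 (by have := s.2.1; positivity)
          _ = _ := by rw [hM]; ring
      have h4 := abs_primitive_le hL _ h3 s
      refine h4.trans ?_
      have hpos : 0 ≤ (‖f‖ * M ^ (n + 1) / (n + 1).factorial) * (s : ℝ) ^ (n + 1) := by
        have := s.2.1; positivity
      apply div_le_self hpos
      have : (0 : ℝ) ≤ n := Nat.cast_nonneg n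
      linarith
  have hnorm : ∀ n : ℕ, ‖T ^ n‖ ≤ (M * L) ^ n / n.factorial := fun n => by
    apply ContinuousLinearMap.opNorm_le_bound _ (by positivity)
    intro f; rw [ContinuousMap.norm_le _ (by positivity)]
    intro s
    refine (hpt n f s).trans ?_
    have h1 : (s : ℝ) ^ n ≤ L ^ n := pow_le_pow_left₀ s.2.1 s.2.2 n
    calc _ ≤ (‖f‖ * M ^ n / n.factorial) * L ^ n := mul_le_mul_of_nonneg_left h1 (by positivity)
      _ = _ := by rw [mul_pow]; ring
  obtain ⟨n, hn⟩ := ((FloorSemiring.tendsto_pow_div_factorial_atTop (M * L)).eventually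
    (gt_mem_nhds one_pos)).exists
  have hu : IsUnit (1 - T ^ n) :=
    isUnit_one_sub_of_norm_lt_one (R := C(Icc 0 L, ℝ) →L[ℝ] C(Icc 0 L, ℝ)) ((hnorm n).trans_lt hn)
  have e1 : (1 - T) * ∑ i ∈ Finset.range n, T ^ i = 1 - T ^ n := mul_neg_geom_sum T n
  have hc : Commute (1 - T) (∑ i ∈ Finset.range n, T ^ i) := by
    apply Commute.sum_right
    intro i _; exact ((Commute.one_left _).sub_left (Commute.self_pow T i))
  rw [← e1] at hu; exact (hc.isUnit_mul_iff.1 hu).1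

/-- The twofold primitive of a continuous function on `[0, L]` as a function on the real line. -/
lemma exists_twofold_primitive {L : ℝ} (hL : 0 ≤ L) (G : C(Icc 0 L, ℝ)) :
    ∃ y v : ℝ → ℝ, y 0 = 0 ∧ v 0 = 0 ∧ (∀ s, HasDerivAt y (v s) s) ∧
      (∀ s (hs : s ∈ Icc 0 L), HasDerivAt v (G ⟨s, hs⟩) s) ∧
      (∀ s : Icc 0 L, primitive hL (primitive hL G) s = y s) ∧
      (∀ s : Icc 0 L, primitive hL G s = v s) := by
  have hc : Continuous (IccExtend hL G) := G.continuous.Icc_extend'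
  set v : ℝ → ℝ := fun s => ∫ τ in 0..s, IccExtend hL G τ with hv
  have hvd : ∀ s, HasDerivAt v (IccExtend hL G s) s := fun s =>
    intervalIntegral.integral_hasDerivAt_right (hc.intervalIntegrable _ _)
      hc.aestronglyMeasurable.stronglyMeasurableAtFilter hc.continuousAt
  have hvc : Continuous v := continuous_iff_continuousAt.2 fun s => (hvd s).continuousAt
  refine ⟨fun s => ∫ τ in 0..s, v τ, v, by simp, by simp [hv], fun s => ?_, fun s hs => ?_,
    fun s => ?_, fun s => rfl⟩
  · exact intervalIntegral.integral_hasDerivAt_right (hvc.intervalIntegrable _ _)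
      hvc.aestronglyMeasurable.stronglyMeasurableAtFilter hvc.continuousAt
  · rw [← IccExtend_of_mem hL G hs]; exact hvd s
  · rw [primitive_apply]
    apply intervalIntegral.integral_congr
    intro τ hτ; rw [uIcc_of_le s.2.1] at hτ
    have hm : τ ∈ Icc 0 L := ⟨hτ.1, hτ.2.trans s.2.2⟩
    simp only [IccExtend_of_mem hL _ hm]; rfl

lemma primitive_eq_sub {L : ℝ} (hL : 0 ≤ L) (G : C(Icc 0 L, ℝ)) {f : ℝ → ℝ}
    (h : ∀ τ (hτ : τ ∈ Icc 0 L), HasDerivAt f (G ⟨τ, hτ⟩) τ) (s : Icc 0 L) :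
    primitive hL G s = f s - f 0 := by
  rw [primitive_apply]
  apply intervalIntegral.integral_eq_sub_of_hasDerivAt
  · intro τ hτ; rw [uIcc_of_le s.2.1] at hτ
    have hm : τ ∈ Icc 0 L := ⟨hτ.1, hτ.2.trans s.2.2⟩
    rw [IccExtend_of_mem hL G hm]; exact h τ hm
  · exact (G.continuous.Icc_extend' (h := hL)).intervalIntegrable _ _

/-- Solutions of `θ'' = E g₁(θ) + g₂(θ)` with fixed initial data depend smoothly on the parameter
`E`; the derivative in `E` solves the linearised equation. -/
theorem smooth_dependence {g₁ g₂ : ℝ → ℝ} (h₁ : ContDiff ℝ ∞ g₁) (h₂ : ContDiff ℝ ∞ g₂)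
    (hlip : ∀ E : ℝ, ∃ K, LipschitzWith K (fun x => E * g₁ x + g₂ x)) {L : ℝ} (hL : 0 < L)
    {θ v : ℝ → ℝ → ℝ} {θ₀ v₀ : ℝ} (hinit : ∀ E, θ E 0 = θ₀ ∧ v E 0 = v₀)
    (hsol : ∀ E, SolvesOn (fun x => E * g₁ x + g₂ x) (θ E) (v E) (Icc 0 L)) :
    ContDiff ℝ ∞ (fun E => θ E L) ∧ ContDiff ℝ ∞ (fun E => v E L) ∧
    ∀ E, ∃ y y' : ℝ → ℝ, y 0 = 0 ∧ y' 0 = 0 ∧ (∀ s ∈ Icc 0 L, HasDerivAt y (y' s) s ∧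
        HasDerivAt y' ((E * deriv g₁ (θ E s) + deriv g₂ (θ E s)) * y s + g₁ (θ E s)) s) ∧
      HasDerivAt (fun E => θ E L) (y L) E ∧ HasDerivAt (fun E => v E L) (y' L) E := by
  have h₁' : ContDiff ℝ ∞ (deriv g₁) := (contDiff_infty_iff_deriv.1 h₁).2
  have h₂' : ContDiff ℝ ∞ (deriv g₂) := (contDiff_infty_iff_deriv.1 h₂).2
  set N₁ : C(Icc 0 L, ℝ) → C(Icc 0 L, ℝ) := fun w => (⟨g₁, h₁.continuous⟩ : C(ℝ, ℝ)).comp w with hN₁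
  set N₂ : C(Icc 0 L, ℝ) → C(Icc 0 L, ℝ) := fun w => (⟨g₂, h₂.continuous⟩ : C(ℝ, ℝ)).comp w
  set D₁ : C(Icc 0 L, ℝ) → C(Icc 0 L, ℝ) :=
    fun w => (⟨deriv g₁, h₁'.continuous⟩ : C(ℝ, ℝ)).comp w with hD₁
  set D₂ : C(Icc 0 L, ℝ) → C(Icc 0 L, ℝ) :=
    fun w => (⟨deriv g₂, h₂'.continuous⟩ : C(ℝ, ℝ)).comp w with hD₂
  set J := primitive hL.le with hJ
  set c : C(Icc 0 L, ℝ) := ⟨fun s => θ₀ + v₀ * s, by fun_prop⟩ with hc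
  set W : ℝ → C(Icc 0 L, ℝ) := fun E => ⟨fun s => θ E s, continuous_iff_continuousAt.2 fun s =>
      ContinuousAt.comp (f := Subtype.val) ((hsol E s s.2).1.continuousAt)
        continuous_subtype_val.continuousAt⟩ with hW
  set F : ℝ × C(Icc 0 L, ℝ) → C(Icc 0 L, ℝ) :=
    fun p => p.2 - c - J (J (p.1 • N₁ p.2 + N₂ p.2)) with hF
  have hN₁c : ContDiff ℝ ∞ N₁ := contDiff_infty.2 fun n => contDiff_superposition n g₁ h₁
  have hN₂c : ContDiff ℝ ∞ N₂ := contDiff_infty.2 fun n => contDiff_superposition n g₂ h₂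
  have hinner : ContDiff ℝ ∞ (fun p : ℝ × C(Icc 0 L, ℝ) => p.1 • N₁ p.2 + N₂ p.2) :=
    (contDiff_fst.smul (hN₁c.comp contDiff_snd)).add (hN₂c.comp contDiff_snd)
  have hFc : ContDiff ℝ ∞ F :=
    (contDiff_snd.sub contDiff_const).sub (J.contDiff.comp (J.contDiff.comp hinner))
  -- the first integrals of the solution
  have hvW : ∀ E (s : Icc 0 L), J (E • N₁ (W E) + N₂ (W E)) s = v E s - v₀ := fun E s => by
    rw [hJ, primitive_eq_sub hL.le _ (f := v E) (fun τ hτ => (hsol E τ hτ).2), (hinit E).2]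
  have hFW : ∀ E, F (E, W E) = 0 := fun E => by
    ext s
    have : J (J (E • N₁ (W E) + N₂ (W E))) s = θ E s - θ₀ - v₀ * s := by
      conv_lhs => rw [hJ]
      rw [primitive_eq_sub hL.le _ (f := fun τ => θ E τ - v₀ * τ), (hinit E).1]
      · ring
      · intro τ hτ
        have h1 := hvW E ⟨τ, hτ⟩
        rw [hJ] at h1; rw [h1]
        simpa using (hsol E τ hτ).1.fun_sub ((hasDerivAt_id τ).const_mul v₀)
    simp only [hF, ContinuousMap.sub_apply, this, ContinuousMap.zero_apply]
    simp only [hW, hc, ContinuousMap.coe_mk]; ring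
  have huniq : ∀ E w, F (E, w) = 0 → w = W E := fun E w hw => by
    obtain ⟨K, hK⟩ := hlip E
    obtain ⟨y, z, hy0, hz0, hy, hz, hJJ, hJ1⟩ := exists_twofold_primitive hL.le (E • N₁ w + N₂ w)
    have hwy : ∀ s : Icc 0 L, w s = θ₀ + v₀ * s + y s := fun s => by
      have := congrArg (fun f : C(Icc 0 L, ℝ) => f s) hw
      simp only [hF, ContinuousMap.sub_apply, ContinuousMap.zero_apply] at this
      rw [hJJ s] at this; simp only [hc, ContinuousMap.coe_mk] at this; linarith
    have hd1 : ∀ t, HasDerivAt (fun t => θ₀ + v₀ * t + y t) (v₀ + z t) t := fun t => by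
      simpa using (((hasDerivAt_id t).const_mul v₀).const_add θ₀).fun_add (hy t)
    have hd2 : ∀ t ∈ Icc 0 L, HasDerivAt (fun t => v₀ + z t)
        (E * g₁ (θ₀ + v₀ * t + y t) + g₂ (θ₀ + v₀ * t + y t)) t := fun t ht => by
      have := (hz t ht).const_add v₀
      have e : (E • N₁ w + N₂ w) ⟨t, ht⟩ = E * g₁ (w ⟨t, ht⟩) + g₂ (w ⟨t, ht⟩) := rfl
      rwa [e, hwy ⟨t, ht⟩] at this
    have heq := ODE_solution_unique (v := fun _ p => (p.2, E * g₁ p.1 + g₂ p.1))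
      (f := fun t => (θ₀ + v₀ * t + y t, v₀ + z t)) (g := fun t => (θ E t, v E t)) (a := 0) (b := L)
      (fun _ => lipschitz_firstOrder hK)
      (fun t ht => ((hd1 t).prodMk (hd2 t ht)).continuousAt.continuousWithinAt)
      (fun t ht => ((hd1 t).prodMk (hd2 t (Ico_subset_Icc_self ht))).hasDerivWithinAt)
      (fun t ht => ((hsol E t ht).1.prodMk (hsol E t ht).2).continuousAt.continuousWithinAt)
      (fun t ht => ((hsol E t (Ico_subset_Icc_self ht)).1.prodMk
        (hsol E t (Ico_subset_Icc_self ht)).2).hasDerivWithinAt)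
      (by simp [hy0, hz0, (hinit E).1, (hinit E).2])
    ext s; rw [hwy s]; exact congrArg Prod.fst (heq s.2)
  -- smoothness of the solution as an element of the Banach space
  have hder : ∀ (p : ℝ × C(Icc 0 L, ℝ)), HasFDerivAt (fun w => F (p.1, w))
      (1 - J * J * ContinuousLinearMap.mul ℝ C(Icc 0 L, ℝ) (p.1 • D₁ p.2 + D₂ p.2)) p.2 := fun p => by
    have ha := ((hasFDerivAt_superposition h₁ h₁'.continuous p.2).const_smul p.1).add
      (hasFDerivAt_superposition h₂ h₂'.continuous p.2)
    have hb := ((hasFDerivAt_id p.2).sub_const c).sub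
      (J.hasFDerivAt.comp p.2 (J.hasFDerivAt.comp p.2 ha))
    refine hb.congr_fderiv ?_
    ext h s; simp [hD₁, hD₂]
  have hWc : ∀ E, ContDiffAt ℝ ∞ W E := fun E => by
    have hcd : ContDiffAt ℝ ∞ F (E, W E) := hFc.contDiffAt
    have hn : (∞ : WithTop ℕ∞) ≠ 0 := by simp
    have hinr : fderiv ℝ F (E, W E) ∘L .inr ℝ ℝ C(Icc 0 L, ℝ) =
        1 - J * J * ContinuousLinearMap.mul ℝ C(Icc 0 L, ℝ) (E • D₁ (W E) + D₂ (W E)) := by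
      have h1 : HasFDerivAt (fun w => F (E, w))
          (fderiv ℝ F (E, W E) ∘L .inr ℝ ℝ C(Icc 0 L, ℝ)) (W E) :=
        HasFDerivAt.comp (W E) (hcd.differentiableAt hn).hasFDerivAt (hasFDerivAt_prodMk_right E (W E))
      exact h1.unique (hder (E, W E))
    have hinv : (fderiv ℝ F (E, W E) ∘L .inr ℝ ℝ C(Icc 0 L, ℝ)).IsInvertible := by
      rw [hinr]
      obtain ⟨u, hu⟩ := isUnit_one_sub_volterra hL.le (E • D₁ (W E) + D₂ (W E))
      exact ⟨ContinuousLinearEquiv.unitsEquiv ℝ _ u, by rw [← hu]; rfl⟩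
    refine (hcd.contDiffAt_implicitFunction hn hinv).congr_of_eventuallyEq ?_
    filter_upwards [hcd.eventually_apply_implicitFunction hn hinv] with E' hE'
    exact (huniq E' _ (by rw [hE', hFW])).symm
  have hWs : ContDiff ℝ ∞ W := contDiff_iff_contDiffAt.2 hWc
  have hLm : L ∈ Icc 0 L := ⟨hL.le, le_rfl⟩
  set ev : C(Icc 0 L, ℝ) →L[ℝ] ℝ := ContinuousMap.evalCLM ℝ ⟨L, hLm⟩ with hev
  have hθ : (fun E => θ E L) = fun E => ev (W E) := rfl
  have hv : (fun E => v E L) = fun E => v₀ + ev (J (E • N₁ (W E) + N₂ (W E))) := by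
    funext E
    have := hvW E ⟨L, hLm⟩
    simp only [hev, ContinuousMap.evalCLM_apply, this]; ring
  have hGs : ContDiff ℝ ∞ (fun E => E • N₁ (W E) + N₂ (W E)) := hinner.comp (contDiff_id.prodMk hWs)
  refine ⟨?_, ?_, fun E => ?_⟩
  · rw [hθ]; exact ev.contDiff.comp hWs
  · rw [hv]; exact contDiff_const.add (ev.contDiff.comp (J.contDiff.comp hGs))
  · set W' := deriv W E
    have hWd : HasDerivAt W W' E := (hWs.differentiable (by simp)).differentiableAt.hasDerivAt
    set G' : C(Icc 0 L, ℝ) := (E • D₁ (W E) + D₂ (W E)) * W' + N₁ (W E) with hG'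
    have hGd : HasDerivAt (fun E => E • N₁ (W E) + N₂ (W E)) G' E := by
      have ha := (hasFDerivAt_superposition h₁ h₁'.continuous (W E)).comp_hasDerivAt E hWd
      have hb := (hasFDerivAt_superposition h₂ h₂'.continuous (W E)).comp_hasDerivAt E hWd
      have := ((hasDerivAt_id E).smul ha).add hb
      refine this.congr_deriv ?_
      ext s; simp [hG', hD₁, hD₂, hN₁]; ring
    have hW'eq : W' = J (J G') := by
      have h1 : W = fun E => c + J (J (E • N₁ (W E) + N₂ (W E))) := by
        funext E'
        have := hFW E'
        simp only [hF] at this; rwa [sub_sub, sub_eq_zero] at this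
      have h2 : HasDerivAt (fun E => c + J (J (E • N₁ (W E) + N₂ (W E)))) (J (J G')) E :=
        (J.hasFDerivAt.comp_hasDerivAt E (J.hasFDerivAt.comp_hasDerivAt E hGd)).const_add c
      rw [← h1] at h2; exact hWd.unique h2
    obtain ⟨y, y', hy0, hy'0, hy, hy', hJJ, hJ1⟩ := exists_twofold_primitive hL.le G'
    have hWy : ∀ s : Icc 0 L, W' s = y s := fun s => by rw [hW'eq]; exact hJJ s
    refine ⟨y, y', hy0, hy'0, fun s hs => ⟨hy s, ?_⟩, ?_, ?_⟩
    · have := hy' s hs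
      have e : G' ⟨s, hs⟩ = (E * deriv g₁ (θ E s) + deriv g₂ (θ E s)) * W' ⟨s, hs⟩
          + g₁ (θ E s) := rfl
      rwa [e, hWy ⟨s, hs⟩] at this
    · rw [hθ]
      have := ev.hasFDerivAt.comp_hasDerivAt E hWd
      have e : ev W' = y L := hWy ⟨L, hLm⟩
      rwa [e] at this
    · rw [hv]
      have := (ev.hasFDerivAt.comp_hasDerivAt E (J.hasFDerivAt.comp_hasDerivAt E hGd)).const_add v₀
      have e : ev (J G') = y' L := hJ1 ⟨L, hLm⟩
      rwa [e] at this

/-! ### The profile equation in the angle variable -/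

/-- The coefficient of the energy in the force of the angle equation. -/
def force₁ (x : ℝ) : ℝ := -4 * cos x ^ 3 * sin x

/-- The part of the force of the angle equation that does not depend on the energy. -/
def force₂ (x : ℝ) : ℝ := -(sin x * cos x ^ 3) + 2 * sin x ^ 3 * cos x

/-- The force of the angle equation `θ'' = force E θ`.  If `φ = tan θ` and `E` is the energy
`φ' ^ 2 / 2 + φ ^ 2 / 2 - φ ^ 4 / 4`, this is the equation `φ'' = φ ^ 3 - φ`; it has global
solutions, and the poles of `φ` are the times at which `cos θ = 0`. -/
def force (E x : ℝ) : ℝ := E * force₁ x + force₂ x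

/-- The value of `θ' ^ 2` at the angle `x` for the energy `E`. -/
def speedSq (E x : ℝ) : ℝ := 2 * E * cos x ^ 4 - sin x ^ 2 * cos x ^ 2 + sin x ^ 4 / 2

lemma contDiff_force₁ : ContDiff ℝ ∞ force₁ := by unfold force₁; fun_prop

lemma contDiff_force₂ : ContDiff ℝ ∞ force₂ := by unfold force₂; fun_prop

lemma hasDerivAt_force₁ (x : ℝ) : HasDerivAt force₁
    (12 * cos x ^ 2 * sin x ^ 2 - 4 * cos x ^ 4) x := by
  have := (((hasDerivAt_cos x).fun_pow 3).const_mul (-4)).fun_mul (hasDerivAt_sin x)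
  refine this.congr_deriv ?_
  ring

lemma hasDerivAt_force₂ (x : ℝ) : HasDerivAt force₂
    (9 * sin x ^ 2 * cos x ^ 2 - cos x ^ 4 - 2 * sin x ^ 4) x := by
  have := ((hasDerivAt_sin x).fun_mul ((hasDerivAt_cos x).fun_pow 3)).fun_neg.fun_add
    ((((hasDerivAt_sin x).fun_pow 3).const_mul 2).fun_mul (hasDerivAt_cos x))
  refine this.congr_deriv ?_
  ring

lemma hasDerivAt_speedSq (E x : ℝ) : HasDerivAt (speedSq E) (2 * force E x) x := by
  have := ((((hasDerivAt_cos x).fun_pow 4).const_mul (2 * E)).fun_sub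
    (((hasDerivAt_sin x).fun_pow 2).fun_mul ((hasDerivAt_cos x).fun_pow 2))).fun_add
    (((hasDerivAt_sin x).fun_pow 4).div_const 2)
  refine this.congr_deriv ?_
  simp only [Nat.cast_ofNat, Nat.reduceSub, force, force₁, force₂]; ring

lemma lipschitz_force (E : ℝ) : ∃ K, LipschitzWith K (force E) := by
  refine ⟨⟨|E| * 16 + 12, by positivity⟩, lipschitzWith_of_nnnorm_deriv_le ?_ ?_⟩
  · exact fun x => (((hasDerivAt_force₁ x).const_mul E).fun_add (hasDerivAt_force₂ x)).differentiableAt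
  · intro x
    have h := (((hasDerivAt_force₁ x).const_mul E).fun_add (hasDerivAt_force₂ x)).deriv
    change ‖deriv (fun x => E * force₁ x + force₂ x) x‖ ≤ |E| * 16 + 12
    rw [h]
    have hs := sin_sq_add_cos_sq x
    have h1 : 0 ≤ sin x ^ 2 := sq_nonneg _
    have h2 : 0 ≤ cos x ^ 2 := sq_nonneg _
    set S := sin x ^ 2 with hS
    set C := cos x ^ 2 with hC
    have e1 : sin x ^ 4 = S ^ 2 := by rw [hS]; ring
    have e2 : cos x ^ 4 = C ^ 2 := by rw [hC]; ring
    rw [e1, e2]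
    have hC1 : C ≤ 1 := by linarith
    have hS1 : S ≤ 1 := by linarith
    have b1 : |12 * C * S - 4 * C ^ 2| ≤ 16 := by
      rw [abs_le]; constructor <;> nlinarith [mul_nonneg h1 h2]
    have b2 : |9 * S * C - C ^ 2 - 2 * S ^ 2| ≤ 12 := by
      rw [abs_le]; constructor <;> nlinarith [mul_nonneg h1 h2]
    rw [norm_eq_abs]
    refine (abs_add_le _ _).trans (add_le_add ?_ b2)
    rw [abs_mul]; exact mul_le_mul_of_nonneg_left b1 (abs_nonneg _)

lemma abs_force_le (E x : ℝ) : |force E x| ≤ |E| * 4 + 3 := by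
  have hs : |sin x| ≤ 1 := abs_sin_le_one x
  have hc : |cos x| ≤ 1 := abs_cos_le_one x
  have b1 : |force₁ x| ≤ 4 := by
    rw [force₁, abs_mul, abs_mul, abs_pow]
    have h1 : |cos x| ^ 3 ≤ 1 := pow_le_one₀ (abs_nonneg _) hc
    have : |(-4 : ℝ)| = 4 := by norm_num
    rw [this]; nlinarith [mul_le_one₀ h1 (abs_nonneg _) hs]
  have b2 : |force₂ x| ≤ 3 := by
    rw [force₂]
    refine (abs_add_le _ _).trans ?_
    rw [abs_neg, abs_mul, abs_mul, abs_mul, abs_pow, abs_pow]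
    have h1 : |cos x| ^ 3 ≤ 1 := pow_le_one₀ (abs_nonneg _) hc
    have h2 : |sin x| ^ 3 ≤ 1 := pow_le_one₀ (abs_nonneg _) hs
    have : |(2 : ℝ)| = 2 := by norm_num
    rw [this]
    nlinarith [mul_le_one₀ hs (pow_nonneg (abs_nonneg (cos x)) 3) h1,
      mul_le_one₀ h2 (abs_nonneg _) hc]
  refine (abs_add_le _ _).trans (add_le_add ?_ b2)
  rw [abs_mul]; exact mul_le_mul_of_nonneg_left b1 (abs_nonneg _)

/-- A solution of the angle equation with energy `E`.  The time interval `(-10, 10)` contains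
`[-π, π]`, which is all that is used. -/
structure AngleSolution (E : ℝ) (θ v : ℝ → ℝ) : Prop where
  solves : SolvesOn (force E) θ v (Ioo (-10) 10)
  speed : ∀ t ∈ Ioo (-10) 10, v t ^ 2 = speedSq E (θ t)

lemma exists_angleSolution (E θ₀ v₀ : ℝ) (h : v₀ ^ 2 = speedSq E θ₀) :
    ∃ θ v : ℝ → ℝ, θ 0 = θ₀ ∧ v 0 = v₀ ∧ AngleSolution E θ v := by
  obtain ⟨K, hK⟩ := lipschitz_force E
  obtain ⟨θ, v, h1, h2, h3⟩ := exists_solvesOn hK (abs_force_le E) θ₀ v₀ 10 (by norm_num)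
  refine ⟨θ, v, h1, h2, h3, fun t ht => ?_⟩
  have hd : ∀ x ∈ Ioo (-10) 10, HasDerivAt (fun t => v t ^ 2 - speedSq E (θ t)) 0 x := fun x hx => by
    have := ((h3 x hx).2.fun_pow 2).fun_sub ((hasDerivAt_speedSq E (θ x)).comp x (h3 x hx).1)
    refine this.congr_deriv ?_
    ring
  have hc := (convex_Ioo (-10) 10).is_const_of_fderivWithin_eq_zero (𝕜 := ℝ)
    (f := fun t => v t ^ 2 - speedSq E (θ t))
    (fun x hx => (hd x hx).differentiableAt.differentiableWithinAt)
    (fun x hx => by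
      rw [fderivWithin_of_isOpen isOpen_Ioo hx]
      have := (hd x hx).hasFDerivAt.fderiv
      rw [this]; ext; simp)
    (show (0 : ℝ) ∈ Ioo (-10) 10 by norm_num) ht
  simp only [h1, h2, h, sub_self] at hc; linarith

namespace AngleSolution

variable {E : ℝ} {θ v : ℝ → ℝ}

lemma hasDerivAt (h : AngleSolution E θ v) {t : ℝ} (ht : t ∈ Ioo (-10) 10) :
    HasDerivAt θ (v t) t := (h.solves t ht).1

lemma hasDerivAt_vel (h : AngleSolution E θ v) {t : ℝ} (ht : t ∈ Ioo (-10) 10) :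
    HasDerivAt v (force E (θ t)) t := (h.solves t ht).2

lemma continuousOn (h : AngleSolution E θ v) : ContinuousOn θ (Ioo (-10) 10) :=
  fun _ ht => (h.hasDerivAt ht).continuousAt.continuousWithinAt

lemma continuousOn_vel (h : AngleSolution E θ v) : ContinuousOn v (Ioo (-10) 10) :=
  fun _ ht => (h.hasDerivAt_vel ht).continuousAt.continuousWithinAt

lemma unique (h : AngleSolution E θ v) {θ' v' : ℝ → ℝ} (h' : SolvesOn (force E) θ' v' (Ioo (-10) 10))
    {t₀ : ℝ} (ht : t₀ ∈ Ioo (-10) 10) (h1 : θ t₀ = θ' t₀) (h2 : v t₀ = v' t₀) :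
    ∀ t ∈ Ioo (-10) 10, θ t = θ' t ∧ v t = v' t :=
  h.solves.unique (lipschitz_force E).choose_spec h' ht h1 h2

end AngleSolution

lemma Icc_pi_subset : Icc 0 π ⊆ Ioo (-10) 10 := fun t ht =>
  ⟨by linarith [ht.1], by linarith [ht.2, pi_lt_four]⟩

lemma speedSq_eq (E x : ℝ) : speedSq E x =
    (cos x ^ 2 - sin x ^ 2) ^ 2 / 2 + (2 * E - 1 / 2) * cos x ^ 4 := by
  rw [speedSq]; ring

lemma speedSq_pos {E : ℝ} (hE : 1 / 4 < E) (x : ℝ) : 0 < speedSq E x := by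
  rw [speedSq_eq]
  by_cases hc : cos x = 0
  · have hs := sin_sq_add_cos_sq x
    have : sin x ^ 2 = 1 := by rw [hc] at hs; linarith
    rw [hc, this]; norm_num
  · have : 0 < cos x ^ 4 := by positivity
    have : 0 < (2 * E - 1 / 2) * cos x ^ 4 := mul_pos (by linarith) this
    positivity

/-- A solution of the angle equation with a simple pole of `tan θ` at time `0`, from which
`tan θ` decreases for positive times. -/
structure PoleSolution (E : ℝ) (θ v : ℝ → ℝ) : Prop extends AngleSolution E θ v where
  init : θ 0 = π / 2
  init_vel : v 0 = -(√2 / 2)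

lemma sq_sqrt_two_div : (√2 / 2) ^ 2 = 1 / 2 := by rw [div_pow, sq_sqrt (by norm_num)]; norm_num

lemma exists_poleSolution (E : ℝ) : ∃ θ v : ℝ → ℝ, PoleSolution E θ v := by
  obtain ⟨θ, v, h1, h2, h3⟩ := exists_angleSolution E (π / 2) (-(√2 / 2)) (by
    rw [neg_sq, sq_sqrt_two_div, speedSq]; simp)
  exact ⟨θ, v, h3, h1, h2⟩

namespace PoleSolution

variable {E : ℝ} {θ v : ℝ → ℝ}

lemma vel_neg (h : PoleSolution E θ v) (hE : 1 / 4 < E) {t : ℝ} (ht : t ∈ Ioo (-10) 10) :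
    v t < 0 := by
  by_contra! hv
  have h0 : (0 : ℝ) ∈ Ioo (-10) 10 := by norm_num
  have hv0 : v 0 ≤ 0 := by rw [h.init_vel]; have := sqrt_nonneg 2; linarith
  obtain ⟨s, hs, hs0⟩ := isPreconnected_Ioo.intermediate_value h0 ht h.continuousOn_vel ⟨hv0, hv⟩
  have := h.speed s hs
  rw [hs0] at this
  have := speedSq_pos hE (θ s)
  simp_all

lemma pi_div_four_lt (h : PoleSolution E θ v) (hE : E ≤ 1 / 4) {t : ℝ} (ht : t ∈ Ioo (-10) 10) :
    π / 4 < θ t := by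
  by_contra! hv
  have h0 : (0 : ℝ) ∈ Ioo (-10) 10 := by norm_num
  have hp := pi_pos
  obtain ⟨s, hs, hs0⟩ := isPreconnected_Ioo.intermediate_value ht h0 h.continuousOn
    (show π / 4 ∈ Icc _ _ from ⟨hv, by rw [h.init]; linarith⟩)
  have hsp := h.speed s hs
  rw [hs0, speedSq_eq, cos_pi_div_four, sin_pi_div_four] at hsp
  have h4 : (√2 / 2) ^ 4 = 1 / 4 := by
    rw [show (√2 / 2) ^ 4 = ((√2 / 2) ^ 2) ^ 2 by ring, sq_sqrt_two_div]; norm_num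
  rw [h4] at hsp
  have hv2 : v s ^ 2 = 0 := le_antisymm (by rw [hsp]; ring_nf; linarith) (sq_nonneg _)
  have hEq : E = 1 / 4 := by rw [hv2] at hsp; linarith
  have hv0 : v s = 0 := by simpa using hv2
  have hf : force E (π / 4) = 0 := by
    rw [force, force₁, force₂, cos_pi_div_four, sin_pi_div_four, hEq]; ring
  have := (h.unique (θ' := fun _ => π / 4) (v' := fun _ => 0)
    (fun x _ => ⟨hasDerivAt_const _ _, by rw [hf]; exact hasDerivAt_const _ _⟩) hs hs0 hv0 0 h0).1
  rw [h.init] at this; linarith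

end PoleSolution

/-- For `w = cot θ` one has `w'' = 4 E w ^ 3 - w`, hence `(w' sin - w cos)' = 4 E w ^ 3 sin`. -/
lemma AngleSolution.hasDerivAt_cot_wronskian {E : ℝ} {θ v : ℝ → ℝ} (h : AngleSolution E θ v) {t : ℝ}
    (ht : t ∈ Ioo (-10) 10) (hs : sin (θ t) ≠ 0) :
    HasDerivAt (fun t => -(v t) / sin (θ t) ^ 2 * sin t - cos (θ t) / sin (θ t) * cos t)
      (4 * E * (cos (θ t) / sin (θ t)) ^ 3 * sin t) t := by
  have hθ := h.hasDerivAt ht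
  have hv := h.hasDerivAt_vel ht
  have h1 := ((hv.fun_neg).fun_div (hθ.sin.fun_pow 2) (pow_ne_zero 2 hs)).fun_mul (hasDerivAt_sin t)
  have h2 := (hθ.cos.fun_div hθ.sin hs).fun_mul (hasDerivAt_cos t)
  refine (h1.fun_sub h2).congr_deriv ?_
  have hsp := h.speed t ht
  have hsc : sin (θ t) ^ 2 = 1 - cos (θ t) ^ 2 := by linarith [sin_sq_add_cos_sq (θ t)]
  simp only [Nat.cast_ofNat, Nat.reduceSub, pow_one, force, force₁, force₂]
  have e : v t * (sin t) * v t = sin t * speedSq E (θ t) := by rw [← hsp]; ring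
  rw [speedSq] at e hsp
  set S := sin (θ t)
  set C := cos (θ t)
  field_simp
  have hC : C ^ 2 = 1 - S ^ 2 := by linarith
  have hC3 : C ^ 3 = C * (1 - S ^ 2) := by rw [← hC]; ring
  have hC4 : C ^ 4 = (1 - S ^ 2) ^ 2 := by rw [← hC]; ring
  rw [hC4, hC] at hsp; ring_nf
  simp only [hsp, hC3, hC]; ring

section

variable {a b s t : ℝ} {f : ℝ → ℝ}

lemma le_of_hasDerivAt_nonneg {f' : ℝ → ℝ} (hab : a ≤ b) (hd : ∀ t ∈ Icc a b, HasDerivAt f (f' t) t)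
    (h0 : ∀ t ∈ Ioo a b, 0 ≤ f' t) : f a ≤ f b := by
  have := monotoneOn_of_deriv_nonneg (convex_Icc a b)
    (fun t ht => (hd t ht).continuousAt.continuousWithinAt)
    (by rw [interior_Icc]; exact fun t ht =>
      (hd t (Ioo_subset_Icc_self ht)).differentiableAt.differentiableWithinAt)
    (by rw [interior_Icc]; exact fun t ht => (hd t (Ioo_subset_Icc_self ht)).deriv ▸ h0 t ht)
  exact this (left_mem_Icc.2 hab) (right_mem_Icc.2 hab) hab

lemma lt_of_hasDerivAt_pos {f' : ℝ → ℝ} (hab : a < b) (hd : ∀ t ∈ Icc a b, HasDerivAt f (f' t) t)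
    (h0 : ∀ t ∈ Ioo a b, 0 < f' t) : f a < f b := by
  have := strictMonoOn_of_deriv_pos (convex_Icc a b)
    (fun t ht => (hd t ht).continuousAt.continuousWithinAt)
    (by rw [interior_Icc]; exact fun t ht => (hd t (Ioo_subset_Icc_self ht)).deriv ▸ h0 t ht)
  exact this (left_mem_Icc.2 hab.le) (right_mem_Icc.2 hab.le) hab

/-- The first time at which a continuous function that starts below `c` reaches `c`. -/
lemma exists_first_hit {c : ℝ} (hf : ContinuousOn f (Icc a b)) (hab : a ≤ b)
    (ha : f a < c) (hb : c ≤ f b) :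
    ∃ s ∈ Ioc a b, f s = c ∧ ∀ t ∈ Ico a s, f t < c := by
  have hne : (Icc a b ∩ f ⁻¹' {c}).Nonempty := by
    obtain ⟨s, hs, h⟩ := intermediate_value_Icc hab hf ⟨ha.le, hb⟩
    exact ⟨s, hs, h⟩
  have hcl : IsCompact (Icc a b ∩ f ⁻¹' {c}) := by
    refine isCompact_Icc.of_isClosed_subset ?_ inter_subset_left
    exact hf.preimage_isClosed_of_isClosed isClosed_Icc isClosed_singleton
  obtain ⟨s, ⟨hs, hsc⟩, hmin⟩ := hcl.exists_isLeast hne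
  have hsc : f s = c := hsc
  have has : a ≠ s := by rintro rfl; exact ha.ne hsc
  refine ⟨s, ⟨lt_of_le_of_ne hs.1 has, hs.2⟩, hsc, fun t ht => ?_⟩
  by_contra! hct
  obtain ⟨r, hr, hrc⟩ := intermediate_value_Icc ht.1
    (hf.mono (Icc_subset_Icc_right (ht.2.le.trans hs.2))) ⟨ha.le, hct⟩
  have := hmin ⟨⟨hr.1, hr.2.trans (ht.2.le.trans hs.2)⟩, hrc⟩
  linarith [hr.2, ht.2]

lemma exists_lt_of_hasDerivAt_neg {f' : ℝ} (hf : HasDerivAt f f' a) (h : f' < 0) :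
    ∃ δ > 0, ∀ t ∈ Ioc a (a + δ), f t < f a := by
  have h1 := (hasDerivAt_iff_tendsto_slope.1 hf).eventually (gt_mem_nhds h)
  rw [eventually_nhdsWithin_iff, Metric.eventually_nhds_iff] at h1
  obtain ⟨δ, hδ, h2⟩ := h1
  refine ⟨δ / 2, by positivity, fun t ht => ?_⟩
  have h3 := h2 (y := t) (by rw [dist_eq, abs_of_pos (by linarith [ht.1])]; linarith [ht.2])
    (by simpa using ht.1.ne')
  rw [slope_def_field, div_neg_iff] at h3
  rcases h3 with h3 | h3 <;> linarith [ht.1]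

namespace PoleSolution

variable {E : ℝ} {θ v : ℝ → ℝ}

lemma exists_pos_lt (h : PoleSolution E θ v) : ∃ δ > 0, ∀ t ∈ Ioc 0 δ, θ t < π / 2 := by
  obtain ⟨δ, hδ, h1⟩ := exists_lt_of_hasDerivAt_neg (h.hasDerivAt (t := 0) (by norm_num)) (by
    rw [h.init_vel]; have : 0 < √2 := by positivity
    linarith)
  rw [h.init, zero_add] at h1; exact ⟨δ, hδ, h1⟩

lemma sin_pos (h : PoleSolution E θ v) (hE : E ≤ 1 / 4) (ht : t ∈ Ioo (-10) 10)
    (h2 : θ t ≤ π / 2) : 0 < sin (θ t) :=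
  sin_pos_of_pos_of_lt_pi (by linarith [h.pi_div_four_lt hE ht, pi_pos]) (by linarith [pi_pos])

/-- The derivative of the Wronskian of `cot θ` and `sin` has the sign of the energy. -/
lemma wronskian_le (h : PoleSolution E θ v) (hE0 : 0 ≤ E) (hE : E ≤ 1 / 4) (hs : s ∈ Icc 0 π)
    (hlt : ∀ t ∈ Ioo 0 s, θ t < π / 2) (hles : θ s ≤ π / 2) :
    0 ≤ -(v s) / sin (θ s) ^ 2 * sin s - cos (θ s) / sin (θ s) * cos s := by
  have hle : ∀ t ∈ Icc 0 s, θ t ≤ π / 2 := fun t ht => by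
    rcases ht.1.eq_or_lt with rfl | h0
    · exact h.init.le
    rcases ht.2.eq_or_lt with rfl | h1
    · exact hles
    · exact (hlt t ⟨h0, h1⟩).le
  have hsub : Icc 0 s ⊆ Ioo (-10) 10 := (Icc_subset_Icc_right hs.2).trans Icc_pi_subset
  have hd := fun t (ht : t ∈ Icc 0 s) =>
    h.hasDerivAt_cot_wronskian (hsub ht) (h.sin_pos hE (hsub ht) (hle t ht)).ne'
  have key := le_of_hasDerivAt_nonneg hs.1 hd (fun t ht => by
      have ht' := Ioo_subset_Icc_self ht
      have h1 := h.sin_pos hE (hsub ht') (hle t ht')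
      have h2 : 0 ≤ cos (θ t) := cos_nonneg_of_neg_pi_div_two_le_of_le
        (by linarith [h.pi_div_four_lt hE (hsub ht'), pi_pos]) (hle t ht')
      have h3 : 0 ≤ sin t := sin_nonneg_of_nonneg_of_le_pi ht'.1 (ht'.2.trans hs.2)
      positivity)
  simpa [h.init] using key

lemma lt_of_le_quarter (h : PoleSolution E θ v) (hE0 : 0 ≤ E) (hE : E ≤ 1 / 4)
    (ht : t ∈ Ioo 0 π) : θ t < π / 2 := by
  by_contra! hge
  obtain ⟨δ, hδ, hlt⟩ := h.exists_pos_lt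
  have hδt : δ < t := by
    by_contra! h1
    exact absurd (hlt t ⟨ht.1, h1⟩) (not_lt.2 hge)
  have hsub : Icc δ t ⊆ Ioo (-10) 10 := fun r hr =>
    Icc_pi_subset ⟨hδ.le.trans hr.1, hr.2.trans ht.2.le⟩
  obtain ⟨s, hs, hsc, hst⟩ := exists_first_hit (h.continuousOn.mono hsub) hδt.le
    (hlt δ (right_mem_Ioc.2 hδ)) hge
  have hs0 : 0 < s := hδ.trans hs.1
  have hsπ : s < π := hs.2.trans_lt ht.2
  have hlts : ∀ r ∈ Ioo 0 s, θ r < π / 2 := fun r hr => by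
    rcases le_or_gt r δ with h1 | h1
    · exact hlt r ⟨hr.1, h1⟩
    · exact hst r ⟨h1.le, hr.2⟩
  have hw := h.wronskian_le hE0 hE ⟨hs0.le, hsπ.le⟩ hlts hsc.le
  rw [hsc] at hw
  simp only [sin_pi_div_two, cos_pi_div_two, one_pow, div_one, zero_mul, sub_zero] at hw
  have hsin := sin_pos_of_pos_of_lt_pi hs0 hsπ
  have hv : v s ≤ 0 := by
    by_contra! h1
    nlinarith
  have hsp := h.speed s (hsub ⟨hs.1.le, hs.2⟩)
  rw [hsc, speedSq] at hsp; simp only [sin_pi_div_two, cos_pi_div_two] at hsp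
  have hv' : v s < 0 := lt_of_le_of_ne hv (by rintro h1; rw [h1] at hsp; norm_num at hsp)
  -- `θ` reaches its maximum on `[0, s]` at `s`, so its derivative there is nonnegative.
  have hneg : ∀ᶠ r in 𝓝[<] s, θ s < θ r := by
    have h1 := (hasDerivAt_iff_tendsto_slope.1 (h.hasDerivAt (hsub ⟨hs.1.le, hs.2⟩))).eventually
      (gt_mem_nhds hv')
    have h2 : ∀ᶠ r in 𝓝[<] s, slope θ s r < 0 := h1.filter_mono (nhdsWithin_mono _ (fun r hr => ne_of_lt hr))
    filter_upwards [h2, self_mem_nhdsWithin] with r hr hrs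
    rw [slope_def_field, div_neg_iff] at hr
    have hrs : r < s := hrs
    rcases hr with hr | hr <;> linarith
  obtain ⟨r, hr, hr2⟩ := (hneg.and (Ioo_mem_nhdsLT hs0)).exists
  rw [hsc] at hr; exact absurd (hlts r hr2) (not_lt.2 hr.le)

lemma le_at_pi (h : PoleSolution E θ v) (hlt : ∀ t ∈ Ioo 0 π, θ t < π / 2) : θ π ≤ π / 2 := by
  have hπ : π ∈ Ioo (-10) 10 := Icc_pi_subset (right_mem_Icc.2 pi_pos.le)
  have hc : Tendsto θ (𝓝[<] π) (𝓝 (θ π)) :=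
    (h.hasDerivAt hπ).continuousAt.tendsto.mono_left nhdsWithin_le_nhds
  refine le_of_tendsto hc ?_
  filter_upwards [Ioo_mem_nhdsLT pi_pos] with t ht using (hlt t ht).le

lemma at_pi_zero (h : PoleSolution 0 θ v) : θ π = π / 2 := by
  have hπ : π ∈ Ioo (-10) 10 := Icc_pi_subset (right_mem_Icc.2 pi_pos.le)
  have hlt := fun t ht => h.lt_of_le_quarter le_rfl (by norm_num) (t := t) ht
  have hle := h.le_at_pi hlt
  have hle' : ∀ t ∈ Icc 0 π, θ t ≤ π / 2 := fun t ht => by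
    rcases ht.1.eq_or_lt with rfl | h0
    · exact h.init.le
    rcases ht.2.eq_or_lt with rfl | h1
    · exact hle
    · exact (hlt t ⟨h0, h1⟩).le
  have hd := fun t (ht : t ∈ Icc 0 π) => (h.hasDerivAt_cot_wronskian (Icc_pi_subset ht)
      (h.sin_pos (by norm_num) (Icc_pi_subset ht) (hle' t ht)).ne').fun_neg
  have key := le_of_hasDerivAt_nonneg pi_pos.le hd (fun t ht => by simp)
  simp only [h.init, cos_pi_div_two, sin_zero, sin_pi, cos_pi,
    mul_zero, zero_div, zero_mul, sub_zero, neg_zero, zero_sub, mul_neg, mul_one, neg_neg] at key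
  have h1 := h.sin_pos (by norm_num) hπ hle
  have h2 : cos (θ π) / sin (θ π) ≤ 0 := by linarith
  rw [div_le_iff₀ h1, zero_mul] at h2
  by_contra hne
  have h3 : 0 < cos (θ π) := cos_pos_of_mem_Ioo
    ⟨by linarith [h.pi_div_four_lt (by norm_num) hπ, pi_pos], lt_of_le_of_ne hle hne⟩
  linarith

/-- For positive energy, `tan θ` has no pole in `(0, π]` at which it becomes `+∞`. -/
lemma lt_pi_div_two (h : PoleSolution E θ v) (hE0 : 0 < E) (ht : t ∈ Ioc 0 π) : θ t < π / 2 := by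
  rcases le_or_gt E (1 / 4) with hE | hE
  · rcases ht.2.eq_or_lt with rfl | htπ
    swap
    · exact h.lt_of_le_quarter hE0.le hE ⟨ht.1, htπ⟩
    have hπ : π ∈ Ioo (-10) 10 := Icc_pi_subset (right_mem_Icc.2 pi_pos.le)
    have hlt := fun t ht => h.lt_of_le_quarter hE0.le hE (t := t) ht
    have hle := h.le_at_pi hlt
    refine lt_of_le_of_ne hle fun heq => ?_
    have hle' : ∀ t ∈ Icc 0 π, θ t ≤ π / 2 := fun t ht => by
      rcases ht.1.eq_or_lt with rfl | h0
      · exact h.init.le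
      rcases ht.2.eq_or_lt with rfl | h1
      · exact hle
      · exact (hlt t ⟨h0, h1⟩).le
    have hd := fun t (ht : t ∈ Icc 0 π) => h.hasDerivAt_cot_wronskian (Icc_pi_subset ht)
        (h.sin_pos hE (Icc_pi_subset ht) (hle' t ht)).ne'
    have key := lt_of_hasDerivAt_pos pi_pos hd (fun t ht => by
        have ht' := Icc_pi_subset (Ioo_subset_Icc_self ht)
        have h1 := h.sin_pos hE ht' (hlt t ht).le
        have h2 : 0 < cos (θ t) := cos_pos_of_mem_Ioo
          ⟨by linarith [h.pi_div_four_lt hE ht', pi_pos], hlt t ht⟩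
        have h3 : 0 < sin t := sin_pos_of_pos_of_lt_pi ht.1 ht.2
        positivity)
    simp [h.init, heq] at key
  · have h2 := lt_of_hasDerivAt_pos ht.1 (f := fun t => -θ t) (f' := fun t => -v t)
      (fun r hr => (h.hasDerivAt (Icc_pi_subset ⟨hr.1, hr.2.trans ht.2⟩)).fun_neg)
      (fun r hr => by
        have := h.vel_neg hE (Icc_pi_subset ⟨hr.1.le, hr.2.le.trans ht.2⟩)
        linarith)
    simp only [h.init] at h2; linarith

/-- A solution with a pole at time `0` that stays regular on `(0, π]` has positive energy. -/
lemma energy_pos (h : PoleSolution E θ v) (hlt : ∀ t ∈ Ioc 0 π, θ t < π / 2) : 0 < E := by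
  by_contra! hE0
  have hE : E ≤ 1 / 4 := by linarith
  have hπ : π ∈ Ioo (-10) 10 := Icc_pi_subset (right_mem_Icc.2 pi_pos.le)
  have hle' : ∀ t ∈ Icc 0 π, θ t ≤ π / 2 := fun t ht => by
    rcases ht.1.eq_or_lt with rfl | h0
    · exact h.init.le
    · exact (hlt t ⟨h0, ht.2⟩).le
  have hd := fun t (ht : t ∈ Icc 0 π) => (h.hasDerivAt_cot_wronskian (Icc_pi_subset ht)
      (h.sin_pos hE (Icc_pi_subset ht) (hle' t ht)).ne').fun_neg
  have key := le_of_hasDerivAt_nonneg pi_pos.le hd (fun t ht => by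
      have ht' := Icc_pi_subset (Ioo_subset_Icc_self ht)
      have h1 := h.sin_pos hE ht' (hle' t (Ioo_subset_Icc_self ht))
      have h2 : 0 < cos (θ t) := cos_pos_of_mem_Ioo
        ⟨by linarith [h.pi_div_four_lt hE ht', pi_pos], hlt t ⟨ht.1, ht.2.le⟩⟩
      have h3 : 0 < sin t := sin_pos_of_pos_of_lt_pi ht.1 ht.2
      have h4 : 0 ≤ (-E) * (4 * (cos (θ t) / sin (θ t)) ^ 3 * sin t) :=
        mul_nonneg (by linarith) (by positivity)
      linarith)
  simp only [h.init, cos_pi_div_two, sin_zero, sin_pi, cos_pi,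
    mul_zero, zero_div, zero_mul, sub_zero, neg_zero, zero_sub, mul_neg, mul_one, neg_neg] at key
  have h1 := h.sin_pos hE hπ (hle' _ (right_mem_Icc.2 pi_pos.le))
  have h2 : cos (θ π) / sin (θ π) ≤ 0 := by linarith
  rw [div_le_iff₀ h1, zero_mul] at h2
  have h3 : 0 < cos (θ π) := cos_pos_of_mem_Ioo
    ⟨by linarith [h.pi_div_four_lt hE hπ, pi_pos], hlt _ (right_mem_Ioc.2 pi_pos)⟩
  linarith

end PoleSolution

/-! ### The derivative of the profile in the energy -/

/-- The derivative of `force E` at `x`. -/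
def forceDeriv (E x : ℝ) : ℝ := E * (12 * cos x ^ 2 * sin x ^ 2 - 4 * cos x ^ 4) +
    (9 * sin x ^ 2 * cos x ^ 2 - cos x ^ 4 - 2 * sin x ^ 4)

lemma hasDerivAt_force (E x : ℝ) : HasDerivAt (force E) (forceDeriv E x) x :=
  ((hasDerivAt_force₁ x).const_mul E).fun_add (hasDerivAt_force₂ x)

/-- `y = ∂θ/∂E` and `y' = ∂v/∂E` along a solution: the linearised equation. -/
structure Variation (E : ℝ) (θ y y' : ℝ → ℝ) : Prop where
  init : y 0 = 0
  init_deriv : y' 0 = 0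
  hasDerivAt : ∀ s ∈ Icc 0 π, HasDerivAt y (y' s) s
  hasDerivAt_deriv : ∀ s ∈ Icc 0 π, HasDerivAt y' (forceDeriv E (θ s) * y s + force₁ (θ s)) s

lemma const_of_hasDerivAt_zero (hd : ∀ t ∈ Icc a b, HasDerivAt f 0 t) : ∀ t ∈ Icc a b, f t = f a :=
  constant_of_has_deriv_right_zero (fun t ht => (hd t ht).continuousAt.continuousWithinAt)
    fun t ht => (hd t (Ico_subset_Icc_self ht)).hasDerivWithinAt

namespace PoleSolution

variable {E : ℝ} {θ v y y' : ℝ → ℝ}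

lemma wronskian (h : PoleSolution E θ v) (hy : Variation E θ y y') (hs : s ∈ Icc 0 π) :
    v s * y' s - force E (θ s) * y s = cos (θ s) ^ 4 := by
  have hd : ∀ t ∈ Icc 0 π, HasDerivAt
      (fun t => v t * y' t - force E (θ t) * y t - cos (θ t) ^ 4) 0 t := fun t ht => by
    have h1 := h.hasDerivAt (Icc_pi_subset ht)
    have h2 := h.hasDerivAt_vel (Icc_pi_subset ht)
    refine (((h2.fun_mul (hy.hasDerivAt_deriv t ht)).fun_sub
      (((hasDerivAt_force E (θ t)).comp t h1).fun_mul (hy.hasDerivAt t ht))).fun_sub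
      (h1.cos.fun_pow 4)).congr_deriv ?_
    simp only [Nat.cast_ofNat, Nat.reduceSub, Function.comp, force₁]; ring
  have := const_of_hasDerivAt_zero hd s hs
  simp only [hy.init, hy.init_deriv, h.init, cos_pi_div_two] at this; linarith

/-- `y / v` has derivative `cos⁴ θ / v²`. -/
lemma hasDerivAt_ratio (h : PoleSolution E θ v) (hy : Variation E θ y y')
    (hs : s ∈ Icc 0 π) (hv : v s ≠ 0) :
    HasDerivAt (fun t => y t / v t) (cos (θ s) ^ 4 / v s ^ 2) s := by
  refine ((hy.hasDerivAt s hs).fun_div (h.hasDerivAt_vel (Icc_pi_subset hs)) hv).congr_deriv ?_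
  rw [← h.wronskian hy hs]; ring

/-- Near the pole: the velocity is negative, the angle lies in `(0, π/2)` and decreases. -/
lemma exists_near_pole (h : PoleSolution E θ v) : ∃ δ ∈ Ioo 0 π,
    (∀ t ∈ Icc 0 δ, v t < -(1 / 2)) ∧ (∀ t ∈ Ioc 0 δ, 0 < θ t ∧ θ t < π / 2) ∧
    AntitoneOn θ (Icc 0 δ) := by
  have h0 : (0 : ℝ) ∈ Ioo (-10) 10 := by norm_num
  have e1 : ∀ᶠ t in 𝓝 (0 : ℝ), v t < -(1 / 2) :=
    (h.hasDerivAt_vel h0).continuousAt.eventually (gt_mem_nhds (by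
      rw [h.init_vel]
      have : (1 : ℝ) < √2 := by rw [lt_sqrt] <;> norm_num
      linarith))
  have e2 : ∀ᶠ t in 𝓝 (0 : ℝ), 0 < θ t :=
    (h.hasDerivAt h0).continuousAt.eventually (lt_mem_nhds (by rw [h.init]; positivity))
  obtain ⟨δ₁, hδ₁, hlt⟩ := h.exists_pos_lt
  obtain ⟨δ₂, hδ₂, hb⟩ := Metric.eventually_nhds_iff.1 (e1.and e2)
  set δ := min (min δ₁ (δ₂ / 2)) (π / 2)
  have hp := pi_pos
  have hδ0 : 0 < δ := by positivity
  have l1 : δ ≤ δ₁ := (min_le_left _ _).trans (min_le_left _ _)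
  have l2 : δ ≤ δ₂ / 2 := (min_le_left _ _).trans (min_le_right _ _)
  have l3 : δ ≤ π / 2 := min_le_right _ _
  have hmem : ∀ t ∈ Icc 0 δ, v t < -(1 / 2) ∧ 0 < θ t := fun t ht =>
    hb (by rw [dist_eq, sub_zero, abs_of_nonneg ht.1]; linarith [ht.2])
  have hsub : Icc 0 δ ⊆ Ioo (-10) 10 := fun t ht => Icc_pi_subset ⟨ht.1, by linarith [ht.2]⟩
  refine ⟨δ, ⟨hδ0, by linarith⟩, fun t ht => (hmem t ht).1,
    fun t ht => ⟨(hmem t (Ioc_subset_Icc_self ht)).2, hlt t ⟨ht.1, ht.2.trans l1⟩⟩, ?_⟩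
  refine antitoneOn_of_deriv_nonpos (convex_Icc _ _) (h.continuousOn.mono hsub) ?_ ?_
  · intro t ht; rw [interior_Icc] at ht
    exact (h.hasDerivAt (hsub (Ioo_subset_Icc_self ht))).differentiableAt.differentiableWithinAt
  · intro t ht; rw [interior_Icc] at ht
    rw [(h.hasDerivAt (hsub (Ioo_subset_Icc_self ht))).deriv]
    linarith [(hmem t (Ioo_subset_Icc_self ht)).1]

/-- Near the pole, `y / v` is positive and at most `4 s cos⁴ θ`. -/
lemma ratio_bounds (h : PoleSolution E θ v) (hy : Variation E θ y y') {δ : ℝ} (hδ : δ ∈ Ioo 0 π)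
    (hv : ∀ t ∈ Icc 0 δ, v t < -(1 / 2)) (hθ : ∀ t ∈ Ioc 0 δ, 0 < θ t ∧ θ t < π / 2)
    (hanti : AntitoneOn θ (Icc 0 δ)) (hs : s ∈ Ioc 0 δ) :
    0 < y s / v s ∧ y s / v s ≤ 4 * s * cos (θ s) ^ 4 := by
  have hsub : ∀ t ∈ Icc 0 s, t ∈ Icc 0 δ := fun t ht => ⟨ht.1, ht.2.trans hs.2⟩
  have hd : ∀ t ∈ Icc 0 s, HasDerivAt (fun t => y t / v t) (cos (θ t) ^ 4 / v t ^ 2) t :=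
    fun t ht => h.hasDerivAt_ratio hy ⟨ht.1, by linarith [(hsub t ht).2, hδ.2]⟩
      (by linarith [hv t (hsub t ht)])
  have hcos : ∀ t ∈ Ioc 0 s, 0 < cos (θ t) := fun t ht => by
    have := hθ t ⟨ht.1, ht.2.trans hs.2⟩
    exact cos_pos_of_mem_Ioo ⟨by linarith [pi_pos], this.2⟩
  constructor
  · have := lt_of_hasDerivAt_pos hs.1 hd (fun t ht => by
        have h1 := hcos t ⟨ht.1, ht.2.le⟩
        have h2 := hv t (hsub t (Ioo_subset_Icc_self ht))
        have h3 : 0 < v t ^ 2 := by nlinarith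
        positivity)
    simpa [hy.init] using this
  · have hd2 := fun t (ht : t ∈ Icc 0 s) =>
      (((hasDerivAt_id' t).const_mul (4 * cos (θ s) ^ 4)).fun_sub (hd t ht))
    have := le_of_hasDerivAt_nonneg hs.1.le hd2 (fun t ht => by
        have h1 := hcos t ⟨ht.1, ht.2.le⟩
        have h2 := hv t (hsub t (Ioo_subset_Icc_self ht))
        have h3 : 1 / 4 < v t ^ 2 := by nlinarith
        have h4 : cos (θ t) ≤ cos (θ s) := by
          refine cos_le_cos_of_nonneg_of_le_pi (hθ s hs).1.le ?_ ?_
          · linarith [(hθ t ⟨ht.1, ht.2.le.trans hs.2⟩).2, pi_pos]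
          · exact hanti (hsub t (Ioo_subset_Icc_self ht)) (Ioc_subset_Icc_self hs) ht.2.le
        have h5 : cos (θ t) ^ 4 ≤ cos (θ s) ^ 4 := pow_le_pow_left₀ h1.le h4 4
        have h6 : cos (θ t) ^ 4 / v t ^ 2 ≤ 4 * cos (θ s) ^ 4 := by
          rw [div_le_iff₀ (by linarith)]
          have : 0 < cos (θ t) ^ 4 := by positivity
          nlinarith
        linarith)
    simp only [hy.init, zero_div, mul_zero, sub_zero] at this; linarith

lemma ratio_pos (h : PoleSolution E θ v) (hy : Variation E θ y y') (hE : 1 / 4 < E)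
    (hs : s ∈ Ioc 0 π) : 0 < y s / v s := by
  obtain ⟨δ, hδ, h1, h2, h3⟩ := h.exists_near_pole
  set r := min δ s
  have hr0 : 0 < r := lt_min hδ.1 hs.1
  have hpos := (h.ratio_bounds hy hδ h1 h2 h3 (s := r) ⟨hr0, min_le_left _ _⟩).1
  have hd : ∀ t ∈ Icc r s, HasDerivAt (fun t => y t / v t) (cos (θ t) ^ 4 / v t ^ 2) t :=
    fun t ht => h.hasDerivAt_ratio hy ⟨hr0.le.trans ht.1, ht.2.trans hs.2⟩
      (h.vel_neg hE (Icc_pi_subset ⟨hr0.le.trans ht.1, ht.2.trans hs.2⟩)).ne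
  have := le_of_hasDerivAt_nonneg (min_le_right δ s) hd (fun t ht => by positivity)
  exact hpos.trans_le this

lemma variation_neg (h : PoleSolution E θ v) (hy : Variation E θ y y') (hE : 1 / 4 < E)
    (hs : s ∈ Ioc 0 π) : y s < 0 := by
  have h1 := h.ratio_pos hy hE hs
  have h2 := h.vel_neg hE (Icc_pi_subset (Ioc_subset_Icc_self hs))
  rcases div_pos_iff.1 h1 with h3 | h3
  · linarith [h3.2]
  · exact h3.1

/-- The derivative of `y / cos² θ`, the variation of `tan θ`. -/
def tanVariationDeriv (θ v y y' : ℝ → ℝ) (s : ℝ) : ℝ :=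
  y' s / cos (θ s) ^ 2 + 2 * v s * y s * sin (θ s) / cos (θ s) ^ 3

lemma hasDerivAt_tanVariation (h : PoleSolution E θ v) (hy : Variation E θ y y')
    (hs : s ∈ Icc 0 π) (hc : cos (θ s) ≠ 0) :
    HasDerivAt (fun t => y t / cos (θ t) ^ 2) (tanVariationDeriv θ v y y' s) s := by
  refine ((hy.hasDerivAt s hs).fun_div ((h.hasDerivAt (Icc_pi_subset hs)).cos.fun_pow 2)
    (pow_ne_zero 2 hc)).congr_deriv ?_
  rw [tanVariationDeriv]; simp only [Nat.cast_ofNat, Nat.reduceSub, pow_one]; field_simp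
  ring

/-- The variation of `ψ = tan θ` solves `η'' = (3 ψ² - 1) η`. -/
lemma hasDerivAt_tanVariationDeriv (h : PoleSolution E θ v) (hy : Variation E θ y y')
    (hs : s ∈ Icc 0 π) (hc : cos (θ s) ≠ 0) :
    HasDerivAt (tanVariationDeriv θ v y y')
      ((3 * tan (θ s) ^ 2 - 1) * (y s / cos (θ s) ^ 2)) s := by
  have h1 := h.hasDerivAt (Icc_pi_subset hs)
  have h2 := h.hasDerivAt_vel (Icc_pi_subset hs)
  have h3 := hy.hasDerivAt s hs
  have h4 := hy.hasDerivAt_deriv s hs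
  refine ((h4.fun_div (h1.cos.fun_pow 2) (pow_ne_zero 2 hc)).fun_add
    ((((h2.const_mul 2).fun_mul h3).fun_mul h1.sin).fun_div (h1.cos.fun_pow 3)
      (pow_ne_zero 3 hc))).congr_deriv ?_
  have hsp := h.speed s (Icc_pi_subset hs)
  have hw := h.wronskian hy hs
  rw [tan_eq_sin_div_cos]; simp only [Nat.cast_ofNat, Nat.reduceSub, pow_one]
  simp only [forceDeriv, force, force₁, force₂, speedSq] at *
  have hS : sin (θ s) ^ 2 = 1 - cos (θ s) ^ 2 := by linarith [sin_sq_add_cos_sq (θ s)]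
  set S := sin (θ s)
  set C := cos (θ s)
  have hvy : v s * y' s = C ^ 4 + (E * (-4 * C ^ 3 * S) + (-(S * C ^ 3) + 2 * S ^ 3 * C)) * y s := by
    linarith
  field_simp
  linear_combination (4 * S * C) * hvy + (2 * C ^ 2 + 6 * S ^ 2) * y s * hsp
    + y s * (3 * S ^ 2 - C ^ 2) * (S ^ 2 + C ^ 2 + 1) * hS

end PoleSolution

end

namespace PoleSolution

variable {E : ℝ} {θ v y y' : ℝ → ℝ}

/-- As long as `tan θ ≥ 1`, the variation `η` of `tan θ` satisfies `η'' = q η` with `q > 0`; it is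
negative and decreasing near the pole, hence stays so. -/
lemma variation_neg_of_pi_div_four_le (h : PoleSolution E θ v) (hy : Variation E θ y y')
    (hθ : ∀ t ∈ Ioc 0 π, π / 4 ≤ θ t ∧ θ t < π / 2) :
    y π < 0 ∧ tanVariationDeriv θ v y y' π < 0 := by
  have hp := pi_pos
  have hcos : ∀ t ∈ Ioc 0 π, 0 < cos (θ t) := fun t ht =>
    cos_pos_of_mem_Ioo ⟨by linarith [(hθ t ht).1], (hθ t ht).2⟩
  have hd1 : ∀ t ∈ Ioc 0 π, HasDerivAt (fun t => y t / cos (θ t) ^ 2)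
      (tanVariationDeriv θ v y y' t) t := fun t ht =>
    h.hasDerivAt_tanVariation hy (Ioc_subset_Icc_self ht) (hcos t ht).ne'
  have hd2 : ∀ t ∈ Ioc 0 π, HasDerivAt (tanVariationDeriv θ v y y')
      ((3 * tan (θ t) ^ 2 - 1) * (y t / cos (θ t) ^ 2)) t := fun t ht =>
    h.hasDerivAt_tanVariationDeriv hy (Ioc_subset_Icc_self ht) (hcos t ht).ne'
  have htan : ∀ t ∈ Ioc 0 π, 0 ≤ 3 * tan (θ t) ^ 2 - 1 := fun t ht => by
    have : 1 ≤ tan (θ t) := by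
      rw [← tan_pi_div_four]
      exact (strictMonoOn_tan.le_iff_le ⟨by linarith, by linarith⟩
        ⟨by linarith [(hθ t ht).1], (hθ t ht).2⟩).2 (hθ t ht).1
    nlinarith
  set η : ℝ → ℝ := fun t => y t / cos (θ t) ^ 2 with hη
  -- a time at which both `η` and its derivative are negative
  obtain ⟨s, hs, hs1, hs2⟩ : ∃ s ∈ Ioo 0 π, η s < 0 ∧ tanVariationDeriv θ v y y' s < 0 := by
    obtain ⟨δ, hδ, h1, h2, h3⟩ := h.exists_near_pole
    have hb := fun s hs => h.ratio_bounds hy hδ h1 h2 h3 (s := s) hs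
    have hδπ : ∀ t ∈ Ioc 0 δ, t ∈ Ioc 0 π := fun t ht => ⟨ht.1, ht.2.trans hδ.2.le⟩
    have hηneg : ∀ t ∈ Ioc 0 δ, η t < 0 := fun t ht => by
      have hv := h1 t (Ioc_subset_Icc_self ht)
      have hr := (hb t ht).1
      have : y t < 0 := by
        rcases div_pos_iff.1 hr with h3 | h3
        · linarith [h3.2]
        · exact h3.1
      exact div_neg_of_neg_of_pos this (pow_pos (hcos t (hδπ t ht)) 2)
    obtain ⟨M, hM⟩ := (isCompact_Icc (a := (0 : ℝ)) (b := δ)).exists_bound_of_continuousOn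
      (h.continuousOn_vel.mono fun t ht => Icc_pi_subset ⟨ht.1, ht.2.trans hδ.2.le⟩)
    have hM0 : 0 ≤ M := (norm_nonneg _).trans (hM 0 (left_mem_Icc.2 hδ.1.le))
    have hlow : ∀ t ∈ Ioc 0 δ, -(4 * M * t) ≤ η t := fun t ht => by
      have hv := h1 t (Ioc_subset_Icc_self ht)
      have hvM : -v t ≤ M := by
        have := hM t (Ioc_subset_Icc_self ht)
        rw [norm_eq_abs] at this; exact (neg_le_abs _).trans this
      have hr := (hb t ht).2
      have hc := hcos t (hδπ t ht)
      have hc1 : cos (θ t) ^ 2 ≤ 1 := by nlinarith [cos_le_one (θ t)]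
      simp only [hη]; rw [le_div_iff₀ (by positivity)]
      have e : y t = (y t / v t) * v t := by rw [div_mul_cancel₀]; linarith
      have h5 : (y t / v t) * (-v t) ≤ 4 * t * cos (θ t) ^ 4 * M :=
        mul_le_mul hr hvM (by linarith) (by have := ht.1; positivity)
      have h6 : 4 * t * cos (θ t) ^ 4 * M ≤ 4 * M * t * cos (θ t) ^ 2 := by
        have : cos (θ t) ^ 4 ≤ cos (θ t) ^ 2 := by nlinarith [sq_nonneg (cos (θ t))]
        have h7 : 0 ≤ 4 * t * M := by have := ht.1; positivity
        nlinarith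
      rw [e]; linarith
    have hδn := hηneg δ (right_mem_Ioc.2 hδ.1)
    set r := min (δ / 2) (-η δ / (8 * M + 8)) with hr
    have hr0 : 0 < r := lt_min (by linarith [hδ.1]) (div_pos (by linarith) (by linarith))
    have hrδ : r < δ := (min_le_left _ _).trans_lt (by linarith [hδ.1])
    have hηr : η δ < η r := by
      refine lt_of_lt_of_le ?_ (hlow r ⟨hr0, hrδ.le⟩)
      have h8 : r ≤ -η δ / (8 * M + 8) := min_le_right _ _
      rw [le_div_iff₀ (by linarith)] at h8; nlinarith
    obtain ⟨s, hs, hsd⟩ := exists_hasDerivAt_eq_slope η (tanVariationDeriv θ v y y') hrδ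
      (fun t ht => (hd1 t (hδπ t ⟨hr0.trans_le ht.1, ht.2⟩)).continuousAt.continuousWithinAt)
      (fun t ht => hd1 t (hδπ t ⟨hr0.trans ht.1, ht.2.le⟩))
    refine ⟨s, ⟨hr0.trans hs.1, hs.2.trans hδ.2⟩, hηneg s ⟨hr0.trans hs.1, hs.2.le⟩, ?_⟩
    rw [hsd]; exact div_neg_of_neg_of_pos (by linarith) (by linarith)
  have hsub : ∀ t ∈ Icc s π, t ∈ Ioc 0 π := fun t ht => ⟨hs.1.trans_le ht.1, ht.2⟩
  -- if `η ≤ 0` on `[s, b)` then `η' ≤ η'(s)` on `[s, b]`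
  have hder : ∀ b ∈ Icc s π, (∀ t ∈ Ico s b, η t < 0) →
      tanVariationDeriv θ v y y' b ≤ tanVariationDeriv θ v y y' s := fun b hb hneg => by
    have hd := fun t (ht : t ∈ Icc s b) => (hd2 t (hsub t ⟨ht.1, ht.2.trans hb.2⟩)).fun_neg
    have := le_of_hasDerivAt_nonneg hb.1 hd (fun t ht => by
        have h1 := hneg t ⟨ht.1.le, ht.2⟩
        have h2 := htan t (hsub t ⟨ht.1.le, ht.2.le.trans hb.2⟩)
        have : (3 * tan (θ t) ^ 2 - 1) * (y t / cos (θ t) ^ 2) ≤ 0 :=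
          mul_nonpos_of_nonneg_of_nonpos h2 h1.le
        linarith)
    linarith
  have hall : ∀ t ∈ Icc s π, η t < 0 := by
    by_contra! hcon
    obtain ⟨t, ht, htη⟩ := hcon
    obtain ⟨b, hb, hb0, hbl⟩ := exists_first_hit (f := η) (a := s) (b := t) (c := 0)
      (fun r hr => (hd1 r (hsub r ⟨hr.1, hr.2.trans ht.2⟩)).continuousAt.continuousWithinAt)
      ht.1 hs1 htη
    have hd := fun r (hr : r ∈ Icc s b) => (hd1 r (hsub r ⟨hr.1, hr.2.trans (hb.2.trans ht.2)⟩)).fun_neg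
    have := le_of_hasDerivAt_nonneg hb.1.le hd (fun r hr => by
        have := hder r ⟨hr.1.le, hr.2.le.trans (hb.2.trans ht.2)⟩
          (fun q hq => hbl q ⟨hq.1, hq.2.trans hr.2⟩)
        linarith)
    have : -η s ≤ -η b := this
    linarith
  have hπ := hall π (right_mem_Icc.2 hs.2.le)
  refine ⟨?_, (hder π (right_mem_Icc.2 hs.2.le) fun t ht => hall t (Ico_subset_Icc_self ht)).trans_lt hs2⟩
  have hc := hcos π (right_mem_Ioc.2 hp)
  by_contra! hn
  have : 0 ≤ η π := by positivity
  linarith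

/-- The variation of `ψ' = (tan θ)'`, expressed with the Wronskian. -/
lemma vel_mul_tanVariationDeriv (h : PoleSolution E θ v) (hy : Variation E θ y y') {s : ℝ}
    (hs : s ∈ Icc 0 π) (hc : cos (θ s) ≠ 0) :
    v s * tanVariationDeriv θ v y y' s = cos (θ s) ^ 2 + y s * (tan (θ s) ^ 3 - tan (θ s)) := by
  have hw := h.wronskian hy hs
  have hsp := h.speed s (Icc_pi_subset hs)
  rw [tanVariationDeriv, tan_eq_sin_div_cos]
  simp only [force, force₁, force₂, speedSq] at hw hsp
  have hS : sin (θ s) ^ 2 = 1 - cos (θ s) ^ 2 := by linarith [sin_sq_add_cos_sq (θ s)]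
  set S := sin (θ s)
  set C := cos (θ s)
  field_simp
  linear_combination C * hw + 2 * S * y s * hsp + y s * S * (S ^ 2 - C ^ 2) * hS

lemma le_neg_pi_div_two (h : PoleSolution E θ v) (hE : 51 ≤ E) : θ π ≤ -(π / 2) := by
  have hp := pi_pos
  -- `K(θ) = θ - sin(2θ)/4` decreases at speed at least one
  have hd : ∀ t ∈ Icc 0 π, HasDerivAt (fun t => -(θ t - sin (θ t) * cos (θ t) / 2) - t)
      (-(3 / 2 - cos (θ t) ^ 2) * v t - 1) t := fun t ht => by
    have h1 := h.hasDerivAt (Icc_pi_subset ht)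
    refine (((h1.fun_sub ((h1.sin.fun_mul h1.cos).div_const 2)).fun_neg).fun_sub
      (hasDerivAt_id' t)).congr_deriv ?_
    have hS : sin (θ t) ^ 2 = 1 - cos (θ t) ^ 2 := by linarith [sin_sq_add_cos_sq (θ t)]
    linear_combination -(v t / 2) * hS
  have key := le_of_hasDerivAt_nonneg hp.le hd (fun t ht => by
      have ht' := Icc_pi_subset (Ioo_subset_Icc_self ht)
      have hv := h.vel_neg (by linarith) ht'
      have hsp := h.speed t ht'
      rw [speedSq_eq] at hsp
      have hS : sin (θ t) ^ 2 = 1 - cos (θ t) ^ 2 := by linarith [sin_sq_add_cos_sq (θ t)]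
      rw [hS] at hsp
      have hw0 : 0 ≤ cos (θ t) ^ 2 := sq_nonneg _
      have hw1 : cos (θ t) ^ 2 ≤ 1 := cos_sq_le_one _
      have hw4 : cos (θ t) ^ 4 = (cos (θ t) ^ 2) ^ 2 := by ring
      rw [hw4] at hsp
      set w := cos (θ t) ^ 2
      have hv2 : (2 * w - 1) ^ 2 / 2 + 100 * w ^ 2 ≤ v t ^ 2 := by
        rw [hsp]; nlinarith [mul_nonneg (sub_nonneg.2 hE) (sq_nonneg w)]
      have h1 : 1 ≤ ((3 / 2 - w) * (-v t)) ^ 2 := by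
        have h2 : 1 ≤ ((2 * w - 1) ^ 2 / 2 + 100 * w ^ 2) * (3 / 2 - w) ^ 2 := by
          have : (1 : ℝ) / 4 ≤ (3 / 2 - w) ^ 2 := by nlinarith
          rcases le_or_gt (1 / 4) w with h3 | h3
          · nlinarith
          · have h4 : 9 / 4 - 3 * w ≤ (3 / 2 - w) ^ 2 := by nlinarith
            have h5 : 1 ≤ ((2 * w - 1) ^ 2 / 2 + 100 * w ^ 2) * (9 / 4 - 3 * w) := by
              nlinarith [sq_nonneg (w - 1 / 40), mul_nonneg hw0 (sub_nonneg.2 h3.le),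
                mul_nonneg (sq_nonneg w) (sub_nonneg.2 h3.le)]
            refine h5.trans (mul_le_mul_of_nonneg_left h4 (by positivity))
        have h3 := mul_le_mul_of_nonneg_right hv2 (sq_nonneg (3 / 2 - w))
        nlinarith
      have h3 : 0 ≤ (3 / 2 - w) * (-v t) := mul_nonneg (by linarith) (by linarith)
      nlinarith)
  simp only [h.init, sin_pi_div_two, cos_pi_div_two] at key
  have hK : sin (θ π) * cos (θ π) / 2 = sin (2 * θ π) / 4 := by rw [sin_two_mul]; ring
  rw [hK] at key
  set α := θ π
  by_contra! hα
  have h1 : |sin (2 * α + π)| ≤ |2 * α + π| := abs_sin_le_abs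
  rw [sin_add_pi, abs_neg, abs_of_pos (by linarith : 0 < 2 * α + π)] at h1
  linarith [le_abs_self (sin (2 * α))]

end PoleSolution

/-- The angle, at elapsed time `s` after the pole, of the solution with energy `E`. -/
def poleAngle (E : ℝ) : ℝ → ℝ := (exists_poleSolution E).choose

/-- The velocity of `poleAngle`. -/
def poleVel (E : ℝ) : ℝ → ℝ := (exists_poleSolution E).choose_spec.choose

lemma poleSolution (E : ℝ) : PoleSolution E (poleAngle E) (poleVel E) :=
  (exists_poleSolution E).choose_spec.choose_spec

lemma contDiff_poleAngle_and_poleVel :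
    ContDiff ℝ ∞ (fun E => poleAngle E π) ∧ ContDiff ℝ ∞ (fun E => poleVel E π) ∧
      ∀ E, ∃ y y' : ℝ → ℝ, Variation E (poleAngle E) y y' ∧
        HasDerivAt (fun E => poleAngle E π) (y π) E ∧
        HasDerivAt (fun E => poleVel E π) (y' π) E := by
  obtain ⟨h1, h2, h3⟩ := smooth_dependence contDiff_force₁ contDiff_force₂ lipschitz_force pi_pos
    (θ := poleAngle) (v := poleVel) (θ₀ := π / 2) (v₀ := -(√2 / 2))
    (fun E => ⟨(poleSolution E).init, (poleSolution E).init_vel⟩)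
    (fun E => (poleSolution E).solves.mono Icc_pi_subset)
  refine ⟨h1, h2, fun E => ?_⟩
  obtain ⟨y, y', hy, hy', hd, hd1, hd2⟩ := h3 E
  refine ⟨y, y', ⟨hy, hy', fun s hs => (hd s hs).1, fun s hs => ?_⟩, hd1, hd2⟩
  have := (hd s hs).2
  rwa [(hasDerivAt_force₁ _).deriv, (hasDerivAt_force₂ _).deriv] at this

/-! ### A lower bound for the energy of a solution with a zero -/

lemma pi_le_of_tendsto {H H' : ℝ → ℝ} {α β k : ℝ} (hαβ : α < β)
    (hd : ∀ t ∈ Ioo α β, HasDerivAt H (H' t) t) (hk : ∀ t ∈ Ioo α β, -k ≤ H' t)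
    (h1 : Tendsto H (𝓝[>] α) (𝓝 (π / 2))) (h2 : Tendsto H (𝓝[<] β) (𝓝 (-(π / 2)))) :
    π ≤ k * (β - α) := by
  have hmono : ∀ s ∈ Ioo α β, ∀ t ∈ Ioo α β, s ≤ t → H s + k * s ≤ H t + k * t := fun s hs t ht hst => by
    have hd' := fun r (hr : r ∈ Icc s t) =>
      (hd r ⟨hs.1.trans_le hr.1, hr.2.trans_lt ht.2⟩).fun_add ((hasDerivAt_id' r).const_mul k)
    exact le_of_hasDerivAt_nonneg hst hd'
      (fun r hr => by linarith [hk r ⟨hs.1.trans hr.1, hr.2.trans ht.2⟩])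
  have l1 : Tendsto (fun s => H s + k * s) (𝓝[>] α) (𝓝 (π / 2 + k * α)) :=
    h1.add ((continuous_const_mul k).continuousAt.tendsto.mono_left nhdsWithin_le_nhds)
  have l2 : Tendsto (fun s => H s + k * s) (𝓝[<] β) (𝓝 (-(π / 2) + k * β)) :=
    h2.add ((continuous_const_mul k).continuousAt.tendsto.mono_left nhdsWithin_le_nhds)
  have h3 : ∀ t ∈ Ioo α β, π / 2 + k * α ≤ H t + k * t := fun t ht => by
    refine le_of_tendsto l1 ?_
    filter_upwards [Ioo_mem_nhdsGT ht.1] with s hs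
    exact hmono s ⟨hs.1, hs.2.trans ht.2⟩ t ht hs.2.le
  have h4 : π / 2 + k * α ≤ -(π / 2) + k * β := by
    refine ge_of_tendsto l2 ?_
    filter_upwards [Ioo_mem_nhdsLT hαβ] with t ht using h3 t ht
  linarith

section Landen

variable {m : ℝ}

lemma tendsto_sub_div_atTop (m : ℝ) : Tendsto (fun t : ℝ => t - m / t) atTop atTop := by
  simp only [sub_eq_add_neg]
  exact tendsto_id.atTop_add (tendsto_const_nhds.div_atTop tendsto_id).neg

lemma tendsto_sub_div_atBot (m : ℝ) : Tendsto (fun t : ℝ => t - m / t) atBot atBot := by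
  simp only [sub_eq_add_neg]
  exact tendsto_id.atBot_add (tendsto_const_nhds.div_atBot tendsto_id).neg

lemma tendsto_sub_div_nhdsGT_zero (hm : 0 < m) :
    Tendsto (fun t : ℝ => t - m / t) (𝓝[>] 0) atBot := by
  have h1 : Tendsto (fun t : ℝ => t) (𝓝[>] 0) (𝓝 0) := nhdsWithin_le_nhds
  have h2 : Tendsto (fun t : ℝ => m * t⁻¹) (𝓝[>] 0) atTop :=
    tendsto_inv_nhdsGT_zero.const_mul_atTop hm
  simp only [sub_eq_add_neg, div_eq_mul_inv]
  exact h1.add_atBot (tendsto_neg_atTop_atBot.comp h2)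

lemma tendsto_sub_div_nhdsLT_zero (hm : 0 < m) :
    Tendsto (fun t : ℝ => t - m / t) (𝓝[<] 0) atTop := by
  have h1 : Tendsto (fun t : ℝ => t) (𝓝[<] 0) (𝓝 0) := nhdsWithin_le_nhds
  have h2 : Tendsto (fun t : ℝ => m * t⁻¹) (𝓝[<] 0) atBot :=
    tendsto_inv_nhdsLT_zero.const_mul_atBot hm
  simp only [sub_eq_add_neg, div_eq_mul_inv]
  exact h1.add_atTop (tendsto_neg_atBot_atTop.comp h2)

end Landen

namespace PoleSolution

variable {E : ℝ} {θ v y y' : ℝ → ℝ}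

lemma strictAntiOn (h : PoleSolution E θ v) (hE : 1 / 4 < E) : StrictAntiOn θ (Icc 0 π) := by
  refine strictAntiOn_of_deriv_neg (convex_Icc _ _) (h.continuousOn.mono Icc_pi_subset) ?_
  intro t ht; rw [interior_Icc] at ht
  have ht' := Icc_pi_subset (Ioo_subset_Icc_self ht)
  rw [(h.hasDerivAt ht').deriv]; exact h.vel_neg hE ht'

lemma hasDerivAt_tan (h : PoleSolution E θ v) {t : ℝ} (ht : t ∈ Icc 0 π) (hc : cos (θ t) ≠ 0) :
    HasDerivAt (fun t => tan (θ t)) (v t / cos (θ t) ^ 2) t := by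
  refine ((Real.hasDerivAt_tan hc).comp t (h.hasDerivAt (Icc_pi_subset ht))).congr_deriv ?_
  ring

lemma sq_vel_div (h : PoleSolution E θ v) {t : ℝ} (ht : t ∈ Icc 0 π) (hc : cos (θ t) ≠ 0) :
    (v t / cos (θ t) ^ 2) ^ 2 = 2 * E - tan (θ t) ^ 2 + tan (θ t) ^ 4 / 2 := by
  rw [div_pow, h.speed t (Icc_pi_subset ht), speedSq, tan_eq_sin_div_cos]; field_simp

end PoleSolution

/-- Two steps of the arithmetic-geometric mean iteration, applied to the length of the orbit: with
`t = ψ - a²/ψ` and `w = (t - m/t)/2` the equation `ψ'² = (ψ⁴ - 2ψ² + a⁴)/2` becomes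
`w'² = 2 (w² + a₁²) (w² + m) ≤ 2 (w² + r²)²`. -/
lemma abs_landen_deriv_le {a b r ψ ψ' : ℝ} (hr : 0 < r) (hb2 : b ^ 2 = 2 * a ^ 2 - 2)
    (hr2 : r ^ 2 = (4 * a ^ 2 + 12 * a * b + b ^ 2) / 8) (hψ : ψ ≠ 0) (hψa : ψ - a ^ 2 / ψ ≠ 0)
    (hψ' : ψ' ^ 2 = (ψ ^ 4 - 2 * ψ ^ 2 + a ^ 4) / 2) :
    |(1 + 2 * a * b / (ψ - a ^ 2 / ψ) ^ 2) / 2 * (ψ' * (1 + a ^ 2 / ψ ^ 2)) * r /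
      (r ^ 2 + (((ψ - a ^ 2 / ψ) - 2 * a * b / (ψ - a ^ 2 / ψ)) / 2) ^ 2)| ≤ √2 * r := by
  set t := ψ - a ^ 2 / ψ with ht
  have e1 : (ψ' * (1 + a ^ 2 / ψ ^ 2)) ^ 2 = (t ^ 2 + b ^ 2) * (t ^ 2 + 4 * a ^ 2) / 2 := by
    rw [mul_pow, hψ', hb2, ht]; field_simp; ring
  set t' := ψ' * (1 + a ^ 2 / ψ ^ 2)
  set m := 2 * a * b with hm
  set w := (t - m / t) / 2 with hw
  have e2 : ((1 + m / t ^ 2) / 2 * t') ^ 2 = 2 * (w ^ 2 + (2 * a + b) ^ 2 / 4) * (w ^ 2 + m) := by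
    rw [mul_pow, e1, hw, hm]; field_simp; ring
  set w' := (1 + m / t ^ 2) / 2 * t'
  have e3 : w' ^ 2 ≤ 2 * (r ^ 2 + w ^ 2) ^ 2 := by
    rw [e2, hr2, hm]; nlinarith [sq_nonneg ((2 * a + b) ^ 2 / 4 - 2 * a * b)]
  have hpos : 0 < r ^ 2 + w ^ 2 := by positivity
  rw [abs_div, abs_of_pos hpos, div_le_iff₀ hpos, abs_mul, abs_of_pos hr]
  have : |w'| ≤ √2 * (r ^ 2 + w ^ 2) := by
    refine abs_le_of_sq_le_sq ?_ (by positivity)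
    rw [mul_pow (√2), sq_sqrt (by norm_num)]; exact e3
  calc |w'| * r ≤ √2 * (r ^ 2 + w ^ 2) * r := by gcongr
    _ = _ := by ring

namespace PoleSolution

variable {E : ℝ} {θ v y y' : ℝ → ℝ}

/-- The time which `tan θ` needs to come from the pole to zero. -/
lemma sqrt_two_mul_pi_le (h : PoleSolution E θ v) {a b r : ℝ} (ha : 1 < a) (haE : a ^ 4 = 4 * E)
    (hb : 0 < b) (hr : 0 < r) (hb2 : b ^ 2 = 2 * a ^ 2 - 2)
    (hr2 : r ^ 2 = (4 * a ^ 2 + 12 * a * b + b ^ 2) / 8) {s₀ : ℝ} (hs₀ : s₀ ∈ Ioc 0 π)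
    (hθ : θ s₀ = 0) : 2 * π ≤ √2 * r * s₀ := by
  have hp := pi_pos
  have hE : 1 / 4 < E := by nlinarith [pow_lt_pow_left₀ ha (by norm_num) (n := 4) (by norm_num)]
  have hanti := h.strictAntiOn hE
  have h0m : (0 : ℝ) ∈ Icc 0 π := left_mem_Icc.2 hp.le
  have hs₀m := Ioc_subset_Icc_self hs₀
  -- the time at which `tan θ = a`
  obtain ⟨s₁, hs₁, hθ₁⟩ : ∃ s₁ ∈ Ioo 0 s₀, θ s₁ = arctan a := by
    have hc : ContinuousOn θ (Icc 0 s₀) := h.continuousOn.mono fun t ht =>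
      Icc_pi_subset ⟨ht.1, ht.2.trans hs₀.2⟩
    have := intermediate_value_Ioo' hs₀.1.le hc
    exact this ⟨by rw [hθ]; exact arctan_pos.2 (by linarith),
      by rw [h.init]; exact arctan_lt_pi_div_two a⟩
  have hs₁m : s₁ ∈ Icc 0 π := ⟨hs₁.1.le, hs₁.2.le.trans hs₀.2⟩
  have hrange : ∀ t ∈ Ioo 0 s₀, θ t ∈ Ioo 0 (π / 2) := fun t ht => by
    have htm : t ∈ Icc 0 π := ⟨ht.1.le, ht.2.le.trans hs₀.2⟩
    constructor
    · rw [← hθ]; exact hanti htm hs₀m ht.2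
    · rw [← h.init]; exact hanti h0m htm ht.1
  set ψ : ℝ → ℝ := fun t => tan (θ t) with hψ
  have hψpos : ∀ t ∈ Ioo 0 s₀, 0 < ψ t := fun t ht =>
    tan_pos_of_pos_of_lt_pi_div_two (hrange t ht).1 (hrange t ht).2
  have hψ₁ : ψ s₁ = a := by simp only [hψ, hθ₁, tan_arctan]
  have htan : ∀ t ∈ Ioo 0 s₀, ∀ t' ∈ Ioo 0 s₀, t < t' → ψ t' < ψ t := fun t ht t' ht' htt' => by
    refine strictMonoOn_tan ⟨by linarith [(hrange t' ht').1], (hrange t' ht').2⟩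
      ⟨by linarith [(hrange t ht).1], (hrange t ht).2⟩ (hanti ⟨ht.1.le, ht.2.le.trans hs₀.2⟩
        ⟨ht'.1.le, ht'.2.le.trans hs₀.2⟩ htt')
  set τ : ℝ → ℝ := fun t => ψ t - a ^ 2 / ψ t with hτ
  have hτpos : ∀ t ∈ Ioo 0 s₁, 0 < τ t := fun t ht => by
    have h1 := htan t ⟨ht.1, ht.2.trans hs₁.2⟩ s₁ hs₁ ht.2
    rw [hψ₁] at h1; simp only [hτ]; rw [sub_pos, div_lt_iff₀ (by linarith)]; nlinarith
  have hτneg : ∀ t ∈ Ioo s₁ s₀, τ t < 0 := fun t ht => by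
    have h1 := htan s₁ hs₁ t ⟨hs₁.1.trans ht.1, ht.2⟩ ht.1
    rw [hψ₁] at h1
    have h2 := hψpos t ⟨hs₁.1.trans ht.1, ht.2⟩
    simp only [hτ]; rw [sub_neg, lt_div_iff₀ h2]; nlinarith
  set g : ℝ → ℝ := fun t => t - 2 * a * b / t with hg
  set H : ℝ → ℝ := fun t => arctan (g (τ t) / 2 / r)
  have hm : 0 < 2 * a * b := by positivity
  have hder : ∀ t ∈ Ioo 0 s₀, τ t ≠ 0 → ∃ H', HasDerivAt H H' t ∧ -(√2 * r) ≤ H' := fun t ht ht0 => by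
    have htm : t ∈ Icc 0 π := ⟨ht.1.le, ht.2.le.trans hs₀.2⟩
    have hc : cos (θ t) ≠ 0 := (cos_pos_of_mem_Ioo
      ⟨by linarith [(hrange t ht).1], (hrange t ht).2⟩).ne'
    have hψd := h.hasDerivAt_tan htm hc
    have hψs := h.sq_vel_div htm hc
    set ψ' := v t / cos (θ t) ^ 2
    have hψ0 := (hψpos t ht).ne'
    have hτd : HasDerivAt τ (ψ' * (1 + a ^ 2 / ψ t ^ 2)) t := by
      refine (hψd.fun_sub ((hasDerivAt_const t (a ^ 2)).fun_div hψd hψ0)).congr_deriv ?_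
      simp only [hψ] at *; field_simp; ring
    have hgd : HasDerivAt (fun t => g (τ t))
        ((1 + 2 * a * b / τ t ^ 2) * (ψ' * (1 + a ^ 2 / ψ t ^ 2))) t := by
      refine (hτd.fun_sub ((hasDerivAt_const t (2 * a * b)).fun_div hτd ht0)).congr_deriv ?_
      field_simp; ring
    refine ⟨_, ((hgd.div_const 2).div_const r).arctan, ?_⟩
    have hb' := abs_landen_deriv_le hr hb2 hr2 hψ0 ht0 (ψ' := ψ')
      (by rw [hψs, show E = a ^ 4 / 4 by linarith]; ring)
    refine (neg_le_neg hb').trans ((neg_abs_le _).trans (le_of_eq ?_))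
    simp only [hg, hτ]; field_simp
  choose! H' hH' using hder
  have hcτ : ∀ t ∈ Ioo 0 s₀, ContinuousAt τ t := fun t ht => by
    have hc : cos (θ t) ≠ 0 := (cos_pos_of_mem_Ioo
      ⟨by linarith [(hrange t ht).1], (hrange t ht).2⟩).ne'
    have hψd := (h.hasDerivAt_tan ⟨ht.1.le, ht.2.le.trans hs₀.2⟩ hc).continuousAt
    exact hψd.sub (continuousAt_const.div hψd (hψpos t ht).ne')
  have hτ₁ : τ s₁ = 0 := by simp only [hτ, hψ₁]; field_simp; ring
  have hatTop : Tendsto H (Filter.map g (Filter.map τ (𝓝[>] 0))) (Filter.map H (Filter.map g (Filter.map τ (𝓝[>] 0)))) := tendsto_map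
  have arcTop : Tendsto (fun x => arctan (x / 2 / r)) atTop (𝓝 (π / 2)) :=
    (tendsto_arctan_atTop.mono_right nhdsWithin_le_nhds).comp
      ((tendsto_id.atTop_div_const two_pos).atTop_div_const hr)
  have arcBot : Tendsto (fun x => arctan (x / 2 / r)) atBot (𝓝 (-(π / 2))) :=
    (tendsto_arctan_atBot.mono_right nhdsWithin_le_nhds).comp
      ((tendsto_id.atBot_div_const two_pos).atBot_div_const hr)
  have hψtop : Tendsto ψ (𝓝[>] 0) atTop := by
    refine tendsto_tan_pi_div_two.comp (tendsto_nhdsWithin_iff.2 ⟨?_, ?_⟩)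
    · rw [← h.init]
      exact (h.hasDerivAt (t := 0) (by norm_num)).continuousAt.tendsto.mono_left nhdsWithin_le_nhds
    · filter_upwards [Ioo_mem_nhdsGT hs₀.1] with t ht using (hrange t ht).2
  have hψzero : Tendsto ψ (𝓝[<] s₀) (𝓝[>] 0) := by
    refine tendsto_nhdsWithin_iff.2 ⟨?_, ?_⟩
    · have h1 : ContinuousAt ψ s₀ := (h.hasDerivAt_tan hs₀m (by rw [hθ]; simp)).continuousAt
      have h2 : ψ s₀ = 0 := by simp [hψ, hθ]
      rw [← h2]; exact h1.tendsto.mono_left nhdsWithin_le_nhds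
    · filter_upwards [Ioo_mem_nhdsLT hs₀.1] with t ht using hψpos t ht
  have l1 : Tendsto H (𝓝[>] 0) (𝓝 (π / 2)) :=
    arcTop.comp ((tendsto_sub_div_atTop _).comp ((tendsto_sub_div_atTop _).comp hψtop))
  have l2 : Tendsto H (𝓝[<] s₁) (𝓝 (-(π / 2))) := by
    refine arcBot.comp ((tendsto_sub_div_nhdsGT_zero hm).comp (tendsto_nhdsWithin_iff.2 ⟨?_, ?_⟩))
    · rw [← hτ₁]; exact (hcτ s₁ hs₁).tendsto.mono_left nhdsWithin_le_nhds
    · filter_upwards [Ioo_mem_nhdsLT hs₁.1] with t ht using hτpos t ht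
  have l3 : Tendsto H (𝓝[>] s₁) (𝓝 (π / 2)) := by
    refine arcTop.comp ((tendsto_sub_div_nhdsLT_zero hm).comp (tendsto_nhdsWithin_iff.2 ⟨?_, ?_⟩))
    · rw [← hτ₁]; exact (hcτ s₁ hs₁).tendsto.mono_left nhdsWithin_le_nhds
    · filter_upwards [Ioo_mem_nhdsGT hs₁.2] with t ht using hτneg t ht
  have l4 : Tendsto H (𝓝[<] s₀) (𝓝 (-(π / 2))) := arcBot.comp ((tendsto_sub_div_atBot _).comp
      ((tendsto_sub_div_nhdsGT_zero (by positivity)).comp hψzero))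
  have b1 := pi_le_of_tendsto hs₁.1 (H := H) (H' := H') (k := √2 * r)
    (fun t ht => (hH' t ⟨ht.1, ht.2.trans hs₁.2⟩ (hτpos t ht).ne').1)
    (fun t ht => (hH' t ⟨ht.1, ht.2.trans hs₁.2⟩ (hτpos t ht).ne').2) l1 l2
  have b2 := pi_le_of_tendsto hs₁.2 (H := H) (H' := H') (k := √2 * r)
    (fun t ht => (hH' t ⟨hs₁.1.trans ht.1, ht.2⟩ (hτneg t ht).ne).1)
    (fun t ht => (hH' t ⟨hs₁.1.trans ht.1, ht.2⟩ (hτneg t ht).ne).2) l3 l4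
  nlinarith

/-- Comparison of `y / v` with an explicit function of `θ` and `v`, up to the first zero of
`tan θ`. -/
lemma ratio_le_at_zero (h : PoleSolution E θ v) (hy : Variation E θ y y') {a : ℝ} (ha : 1 < a)
    (haE : a ^ 4 = 4 * E) {s₀ : ℝ} (hs₀ : s₀ ∈ Ioc 0 π) (hθ : θ s₀ = 0) :
    y s₀ / v s₀ ≤ s₀ / a ^ 4 + √2 / (a ^ 5 * (a ^ 2 - 1)) := by
  have hp := pi_pos
  have hE : 1 / 4 < E := by nlinarith [pow_lt_pow_left₀ ha (by norm_num) (n := 4) (by norm_num)]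
  have hanti := h.strictAntiOn hE
  have hs₀m := Ioc_subset_Icc_self hs₀
  have ha0 : 0 < a := by linarith
  have ha2 : 0 < a ^ 2 - 1 := by nlinarith
  set κ := 1 / (2 * a * (a ^ 2 - 1)) with hκ
  have hE' : E = a ^ 4 / 4 := by linarith
  set n : ℝ → ℝ := fun t => sin (θ t) * cos (θ t) +
    κ * (sin (θ t) ^ 2 - a ^ 2 * cos (θ t) ^ 2) with hn
  have hd : ∀ t ∈ Icc 0 s₀, HasDerivAt (fun t => t / a ^ 4 + n t / (a ^ 4 * v t) - y t / v t)
      (sin (θ t) * cos (θ t) * (sin (θ t) - a * cos (θ t)) ^ 2 /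
        (2 * a * a ^ 4 * v t ^ 2)) t := fun t ht => by
    have htm : t ∈ Icc 0 π := ⟨ht.1, ht.2.trans hs₀.2⟩
    have hv := (h.vel_neg hE (Icc_pi_subset htm)).ne
    have h1 := h.hasDerivAt (Icc_pi_subset htm)
    have h2 := h.hasDerivAt_vel (Icc_pi_subset htm)
    have hnd : HasDerivAt n ((cos (θ t) ^ 2 - sin (θ t) ^ 2 +
        2 * κ * (1 + a ^ 2) * (sin (θ t) * cos (θ t))) * v t) t := by
      refine ((h1.sin.fun_mul h1.cos).fun_add (((h1.sin.fun_pow 2).fun_sub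
        ((h1.cos.fun_pow 2).const_mul (a ^ 2))).const_mul κ)).congr_deriv ?_
      simp only [Nat.cast_ofNat, Nat.reduceSub, pow_one]; ring
    refine ((((hasDerivAt_id' t).div_const (a ^ 4)).fun_add (hnd.fun_div (h2.const_mul (a ^ 4))
      (by positivity))).fun_sub (h.hasDerivAt_ratio hy htm hv)).congr_deriv ?_
    have hsp := h.speed t (Icc_pi_subset htm)
    simp only [force, force₁, force₂, speedSq, hn, hκ, hE'] at hsp ⊢
    have hS : sin (θ t) ^ 2 = 1 - cos (θ t) ^ 2 := by linarith [sin_sq_add_cos_sq (θ t)]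
    set S := sin (θ t)
    set C := cos (θ t)
    have key : (1 + (C ^ 2 - S ^ 2 + 2 * (1 / (2 * a * (a ^ 2 - 1))) * (1 + a ^ 2) * (S * C))) * v t ^ 2 -
        (S * C + 1 / (2 * a * (a ^ 2 - 1)) * (S ^ 2 - a ^ 2 * C ^ 2)) *
          (a ^ 4 / 4 * (-4 * C ^ 3 * S) + (-(S * C ^ 3) + 2 * S ^ 3 * C)) - a ^ 4 * C ^ 4 =
        S * C * (S - a * C) ^ 2 / (2 * a) := by
      rw [hsp]; field_simp
      linear_combination (-8 * a * (a ^ 2 - 1) *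
        (2 * (a ^ 4 / 4) * C ^ 4 - S ^ 2 * C ^ 2 + S ^ 4 / 2 - a ^ 4 * C ^ 4) +
        4 * (a ^ 2 - 1) * S * C * (S - a * C) ^ 2) * hS
    rw [show S * C * (S - a * C) ^ 2 / (2 * a * a ^ 4 * v t ^ 2) =
      S * C * (S - a * C) ^ 2 / (2 * a) / (a ^ 4 * v t ^ 2) by field_simp, ← key]
    field_simp; ring
  have key := le_of_hasDerivAt_nonneg hs₀.1.le hd (fun t ht => by
      have htm : t ∈ Icc 0 π := ⟨ht.1.le, ht.2.le.trans hs₀.2⟩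
      have r1 : 0 < θ t := by rw [← hθ]; exact hanti htm hs₀m ht.2
      have r2 : θ t < π / 2 := by rw [← h.init]; exact hanti (left_mem_Icc.2 hp.le) htm ht.1
      have h1 : 0 < sin (θ t) := sin_pos_of_pos_of_lt_pi r1 (by linarith)
      have h2 : 0 < cos (θ t) := cos_pos_of_mem_Ioo ⟨by linarith, r2⟩
      positivity)
  have hv := h.vel_neg hE (Icc_pi_subset hs₀m)
  have hvs : v s₀ = -(a ^ 2 * (√2 / 2)) := by
    have hsp := h.speed s₀ (Icc_pi_subset hs₀m)
    rw [hθ, speedSq, sin_zero, cos_zero] at hsp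
    have h1 : (-v s₀) ^ 2 = (a ^ 2 * (√2 / 2)) ^ 2 := by
      rw [neg_sq, hsp, mul_pow, sq_sqrt_two_div, hE']; ring
    have := (pow_left_inj₀ (by linarith) (by positivity) two_ne_zero).1 h1
    linarith
  simp only [hn, hθ, h.init, hy.init, sin_pi_div_two, cos_pi_div_two, sin_zero,
    cos_zero, h.init_vel] at key
  have hs2 : √2 ^ 2 = 2 := sq_sqrt (by norm_num)
  have e1 : (0 * 1 + κ * (0 ^ 2 - a ^ 2 * 1 ^ 2)) / (a ^ 4 * v s₀) = κ * √2 / a ^ 4 := by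
    rw [hvs]; field_simp; rw [hs2]; ring
  have e2 : 0 / a ^ 4 + (1 * 0 + κ * (1 ^ 2 - a ^ 2 * 0 ^ 2)) / (a ^ 4 * -(√2 / 2)) -
      0 / -(√2 / 2) = -(κ * √2 / a ^ 4) := by
    field_simp; rw [hs2]; ring
  rw [e1, e2] at key
  have e3 : √2 / (a ^ 5 * (a ^ 2 - 1)) = 2 * (κ * √2 / a ^ 4) := by rw [hκ]; field_simp
  rw [e3]; linarith

/-- The bounds on the last part of the orbit, where `tan θ` runs from `0` to `-x`. -/
lemma exists_zero_and_bounds (h : PoleSolution E θ v) (hy : Variation E θ y y') (hE : 1 / 4 < E)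
    {x : ℝ} (hx : x ∈ Ioo 0 1) (hθ : θ π = -arctan x) :
    ∃ s₀ ∈ Ioo 0 π, ∃ V > 0, V = -v π / cos (θ π) ^ 2 ∧
      V ^ 2 = 2 * E - x ^ 2 + x ^ 4 / 2 ∧ θ s₀ = 0 ∧
      x ≤ √(2 * E) * (π - s₀) ∧ V * (π - s₀) ≤ x ∧
      y π / v π ≤ y s₀ / v s₀ + (π - s₀) / V ^ 2 := by
  have hp := pi_pos
  have hanti := h.strictAntiOn hE
  have hx0 := hx.1
  have hx1 := hx.2
  have hat : 0 < arctan x := arctan_pos.2 hx.1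
  obtain ⟨s₀, hs₀, hθ₀⟩ : ∃ s₀ ∈ Ioo 0 π, θ s₀ = 0 :=
    intermediate_value_Ioo' hp.le (h.continuousOn.mono Icc_pi_subset)
      ⟨by rw [hθ]; linarith, by rw [h.init]; positivity⟩
  have hπm : π ∈ Icc 0 π := right_mem_Icc.2 hp.le
  have hs₀m := Ioo_subset_Icc_self hs₀
  have hrange : ∀ t ∈ Icc s₀ π, θ t ∈ Icc (-arctan x) 0 := fun t ht => by
    have htm : t ∈ Icc 0 π := ⟨hs₀.1.le.trans ht.1, ht.2⟩
    constructor
    · rw [← hθ]; exact hanti.antitoneOn htm hπm ht.2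
    · rw [← hθ₀]; exact hanti.antitoneOn hs₀m htm ht.1
  have hat2 := arctan_lt_pi_div_two x
  have hcos : ∀ t ∈ Icc s₀ π, 0 < cos (θ t) := fun t ht =>
    cos_pos_of_mem_Ioo ⟨by linarith [(hrange t ht).1], by linarith [(hrange t ht).2]⟩
  have hψ : ∀ t ∈ Icc s₀ π, tan (θ t) ^ 2 ≤ x ^ 2 := fun t ht => by
    have h1 : tan (-arctan x) ≤ tan (θ t) := (strictMonoOn_tan.le_iff_le ⟨by linarith, by linarith⟩
        ⟨by linarith [(hrange t ht).1], by linarith [(hrange t ht).2]⟩).2 (hrange t ht).1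
    have h2 : tan (θ t) ≤ tan 0 :=
      (strictMonoOn_tan.le_iff_le ⟨by linarith [(hrange t ht).1], by linarith [(hrange t ht).2]⟩
        ⟨by linarith, by linarith⟩).2 (hrange t ht).2
    rw [tan_neg, tan_arctan] at h1; rw [tan_zero] at h2; nlinarith
  have hmem : ∀ t ∈ Icc s₀ π, t ∈ Icc 0 π := fun t ht => ⟨hs₀.1.le.trans ht.1, ht.2⟩
  set V := -v π / cos (θ π) ^ 2 with hV
  have hπs : π ∈ Icc s₀ π := right_mem_Icc.2 hs₀.2.le
  have hV0 : 0 < V := div_pos (by linarith [h.vel_neg hE (Icc_pi_subset hπm)])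
    (pow_pos (hcos _ hπs) 2)
  have hV2 : V ^ 2 = 2 * E - x ^ 2 + x ^ 4 / 2 := by
    have := h.sq_vel_div hπm (hcos _ hπs).ne'
    rw [hV, neg_div, neg_sq, this, hθ, tan_neg, tan_arctan]; ring
  have hspeed : ∀ t ∈ Icc s₀ π, V ≤ -(v t / cos (θ t) ^ 2) ∧
      -(v t / cos (θ t) ^ 2) ≤ √(2 * E) := fun t ht => by
    have h1 := h.sq_vel_div (hmem t ht) (hcos t ht).ne'
    have h2 := hψ t ht
    have h3 : 0 < -(v t / cos (θ t) ^ 2) := by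
      rw [← neg_div]
      exact div_pos (by linarith [h.vel_neg hE (Icc_pi_subset (hmem t ht))]) (pow_pos (hcos t ht) 2)
    rw [← neg_sq] at h1
    have h4 : 0 ≤ tan (θ t) ^ 2 := sq_nonneg _
    have h5 : tan (θ t) ^ 4 = (tan (θ t) ^ 2) ^ 2 := by ring
    have h6 : x ^ 4 = (x ^ 2) ^ 2 := by ring
    have h7 : x ^ 2 < 1 := by nlinarith
    rw [h5] at h1; rw [h6] at hV2
    constructor
    · refine le_of_sq_le_sq ?_ h3.le
      rw [h1, hV2]; nlinarith
    · refine le_sqrt_of_sq_le ?_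
      rw [h1]; nlinarith
  refine ⟨s₀, hs₀, V, hV0, rfl, hV2, hθ₀, ?_, ?_, ?_⟩
  · have hd := fun t (ht : t ∈ Icc s₀ π) =>
      (h.hasDerivAt_tan (hmem t ht) (hcos t ht).ne').fun_add ((hasDerivAt_id' t).const_mul (√(2 * E)))
    have := le_of_hasDerivAt_nonneg hs₀.2.le hd
      (fun t ht => by linarith [(hspeed t (Ioo_subset_Icc_self ht)).2])
    simp only [hθ, hθ₀, tan_zero, tan_neg, tan_arctan] at this; linarith
  · have hd := fun t (ht : t ∈ Icc s₀ π) => ((h.hasDerivAt_tan (hmem t ht) (hcos t ht).ne').fun_add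
        ((hasDerivAt_id' t).const_mul V)).fun_neg
    have := le_of_hasDerivAt_nonneg hs₀.2.le hd
      (fun t ht => by linarith [(hspeed t (Ioo_subset_Icc_self ht)).1])
    simp only [hθ, hθ₀, tan_zero, tan_neg, tan_arctan] at this; linarith
  · have hd := fun t (ht : t ∈ Icc s₀ π) =>
      ((hasDerivAt_id' t).div_const (V ^ 2)).fun_sub (h.hasDerivAt_ratio hy (hmem t ht)
        (h.vel_neg hE (Icc_pi_subset (hmem t ht))).ne)
    have := le_of_hasDerivAt_nonneg hs₀.2.le hd (fun t ht => by
        have ht' := Ioo_subset_Icc_self ht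
        have h1 := (hspeed t ht').1
        have h2 := h.vel_neg hE (Icc_pi_subset (hmem t ht'))
        have e : cos (θ t) ^ 4 / v t ^ 2 = 1 / (-(v t / cos (θ t) ^ 2)) ^ 2 := by
          have := hcos t ht'
          field_simp
        rw [e, sub_nonneg]
        exact one_div_le_one_div_of_le (by positivity) (pow_le_pow_left₀ hV0.le h1 2))
    have e : (π - s₀) / V ^ 2 = π / V ^ 2 - s₀ / V ^ 2 := by ring
    rw [e]; linarith

end PoleSolution

/-! ### Monotonicity of the threshold for `-1 < X < 0` -/

/-- The polynomial inequality behind `threshold_rational_bound`; it is read off from the Bernstein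
coefficients on each half of the unit interval. -/
lemma threshold_polynomial_bound {x L D : ℝ} (hx : x ∈ Icc 0 1) (hL : L = 5 / 4 + x / 2)
    (hD : D = x ^ 2 - x ^ 4 / 2) :
    (x - x ^ 3) * ((L ^ 2 - D) * (L ^ 2 / 2 - D) * (20 / 9 * ((L - 1) * (111 / 100 + x / 5)) + 1) +
        x * (L ^ 2 / 2 + D) * (L * ((L - 1) * (111 / 100 + x / 5)))) <
      L ^ 3 * ((L - 1) * (111 / 100 + x / 5)) * (L ^ 2 / 2 - D) := by
  rw [← sub_pos]
  have h0 := hx.1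
  rcases le_or_gt x (1 / 2) with h | h
  · obtain ⟨y, hy⟩ : ∃ y, y = 1 / 2 - x := ⟨_, rfl⟩
    have h1 : 0 ≤ y := by linarith
    have hpos : 0 < x ∨ 0 < y := by by_contra! h2; linarith
    calc 0 < (3121875 * y ^ 13 + 39834375 * x * y ^ 12 + 229095875 * x ^ 2 * y ^ 11 +
        784096525 * x ^ 3 * y ^ 10 + 1775219965 * x ^ 4 * y ^ 9 + 2793364603 * x ^ 5 * y ^ 8 +
        3119990177 * x ^ 6 * y ^ 7 + 2476533936 * x ^ 7 * y ^ 6 + 1371262248 * x ^ 8 * y ^ 5 +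
        505641956 * x ^ 9 * y ^ 4 + 112368128 * x ^ 10 * y ^ 3 + 11737176 * x ^ 11 * y ^ 2 +
        175423 * x ^ 12 * y + 25170 * x ^ 13) / 900 :=
          by rcases hpos with h2 | h2 <;> positivity
      _ = _ := by rw [hL, hD, hy]; ring
  · obtain ⟨y, hy⟩ : ∃ y, y = x - 1 / 2 := ⟨_, rfl⟩
    obtain ⟨z, hz⟩ : ∃ z, z = 1 - x := ⟨_, rfl⟩
    have h1 : 0 ≤ z := by linarith [hx.2]
    have h2 : 0 < y := by linarith
    calc 0 < (25170 * z ^ 13 + 478997 * y * z ^ 12 + 15380064 * y ^ 2 * z ^ 11 +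
        157127032 * y ^ 3 * z ^ 10 + 819658436 * y ^ 4 * z ^ 9 + 2644353360 * y ^ 5 * z ^ 8 +
        5766015600 * y ^ 6 * z ^ 7 + 8881733119 * y ^ 7 * z ^ 6 + 9848393263 * y ^ 8 * z ^ 5 +
        7858471317 * y ^ 9 * z ^ 4 + 4422312125 * y ^ 10 * z ^ 3 + 1671729747 * y ^ 11 * z ^ 2 +
        382144167 * y ^ 12 * z + 40035303 * y ^ 13) / 900 := by positivity
      _ = _ := by rw [hL, hD, hy, hz]; ring

lemma sub_div_cube_anti {L L₀ D : ℝ} (hL₀ : 5 / 4 ≤ L₀) (hL : L₀ ≤ L) (hD1 : D ≤ 1 / 2) :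
    (L ^ 2 - D) / L ^ 3 ≤ (L₀ ^ 2 - D) / L₀ ^ 3 := by
  have hL₀pos : 0 < L₀ := by linarith
  have hLpos : 0 < L := by linarith
  rw [div_le_div_iff₀ (by positivity) (by positivity)]
  have h1 : D * (L ^ 2 + L * L₀ + L₀ ^ 2) ≤ L ^ 2 * L₀ ^ 2 := by
    have h2 : L ^ 2 + L * L₀ + L₀ ^ 2 ≤ 3 * L ^ 2 := by nlinarith
    have h3 : D * (L ^ 2 + L * L₀ + L₀ ^ 2) ≤ 1 / 2 * (3 * L ^ 2) :=
      mul_le_mul hD1 h2 (by positivity) (by norm_num)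
    have h4 : 25 / 16 ≤ L₀ ^ 2 := by nlinarith
    have h5 := mul_le_mul_of_nonneg_left h4 (sq_nonneg L)
    nlinarith [sq_nonneg L]
  have h2 := mul_nonneg (sub_nonneg.2 hL) (sub_nonneg.2 h1)
  linarith

lemma inv_sub_inv_anti {L L₀ D V : ℝ} (hL₀ : 5 / 4 ≤ L₀) (hL : L₀ ≤ L) (hD0 : 0 ≤ D)
    (hD1 : D ≤ 1 / 2) (hV : V = L ^ 2 / 2 - D) :
    1 / V - 1 / L ^ 2 ≤ (L₀ ^ 2 / 2 + D) / ((L₀ ^ 2 / 2 - D) * L₀ ^ 2) := by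
  have h3 : L₀ ^ 2 ≤ L ^ 2 := by nlinarith
  have h4 : 25 / 16 ≤ L₀ ^ 2 := by nlinarith
  have p1 : 0 < L ^ 2 / 2 - D := by linarith
  have p2 : 0 < L₀ ^ 2 / 2 - D := by linarith
  have p3 : L ≠ 0 := by linarith
  have e : 1 / V - 1 / L ^ 2 = (L ^ 2 / 2 + D) / (L ^ 2 / 2 - D) / L ^ 2 := by
    rw [hV, div_div, div_sub_div _ _ p1.ne' (by positivity)]
    congr 1; ring
  rw [e, ← div_div]
  refine div_le_div₀ (div_nonneg (by linarith) p2.le) ?_ (by linarith) h3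
  rw [div_le_div_iff₀ p1 p2]; nlinarith

lemma threshold_rational_bound {x L V : ℝ} (hx : x ∈ Ioo (0 : ℝ) 1) (hL : 5 / 4 + x / 2 ≤ L)
    (hV : 0 < V) (hV2 : V ^ 2 = L ^ 2 / 2 - x ^ 2 + x ^ 4 / 2) :
    (x - x ^ 3) * (V * (π / L ^ 2 + √2 / (√L * L ^ 2 * (L - 1))) +
      x * (1 / V ^ 2 - 1 / L ^ 2)) < 1 := by
  have hx0 := hx.1
  have hx1 := hx.2
  set D := x ^ 2 - x ^ 4 / 2 with hD
  have hD0 : 0 ≤ D := by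
    have e : D = x ^ 2 * (1 - x * x / 2) := by rw [hD]; ring
    rw [e]; exact mul_nonneg (sq_nonneg x) (by nlinarith)
  have hD1 : D ≤ 1 / 2 := by rw [hD]; nlinarith [sq_nonneg (x ^ 2 - 1)]
  set L₀ := 5 / 4 + x / 2 with hL₀
  have hL₀' : 5 / 4 ≤ L₀ := by linarith
  have hL' : 5 / 4 ≤ L := by linarith
  have hLpos : 0 < L := by linarith
  have hL₀pos : 0 < L₀ := by linarith
  have hL2 : 25 / 16 ≤ L ^ 2 := by nlinarith
  have hL₀2 : 25 / 16 ≤ L₀ ^ 2 := by nlinarith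
  have hs0 : (0 : ℝ) < √2 := by positivity
  have hs2 : √2 ^ 2 = 2 := sq_sqrt (by norm_num)
  have hd : 0 < x - x ^ 3 := by nlinarith [mul_pos hx0 hx0]
  have hVD : V * √2 ≤ L - D / L := by
    have h1 : 0 ≤ L - D / L := by rw [sub_nonneg, div_le_iff₀ hLpos]; nlinarith
    refine le_of_sq_le_sq ?_ h1
    rw [mul_pow, hs2, hV2]
    have : (L - D / L) ^ 2 = L ^ 2 - 2 * D + (D / L) ^ 2 := by field_simp; ring
    rw [this, hD]; nlinarith [sq_nonneg ((x ^ 2 - x ^ 4 / 2) / L)]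
  have hsq : 111 / 100 + x / 5 ≤ √L := by
    refine le_sqrt_of_sq_le (le_trans ?_ hL)
    nlinarith
  have hsq0 : 0 < 111 / 100 + x / 5 := by linarith
  have hA := sub_div_cube_anti hL₀' hL hD1
  have hA0 : 0 < (L ^ 2 - D) / L ^ 3 := div_pos (by linarith) (by positivity)
  have hB : 1 / (√L * (L - 1)) ≤ 1 / ((L₀ - 1) * (111 / 100 + x / 5)) := by
    refine one_div_le_one_div_of_le (mul_pos (by linarith) hsq0) ?_
    rw [mul_comm]; exact mul_le_mul hsq (by linarith) (by linarith) (sqrt_nonneg _)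
  have hC : 1 / V ^ 2 - 1 / L ^ 2 ≤ (L₀ ^ 2 / 2 + D) / ((L₀ ^ 2 / 2 - D) * L₀ ^ 2) :=
    inv_sub_inv_anti hL₀' hL hD0 hD1 (V := V ^ 2) (by rw [hV2, hD]; ring)
  have hπ : π ≤ 20 / 9 * √2 := by
    have h1 : (1.4142 : ℝ) ≤ √2 := le_sqrt_of_sq_le (by norm_num)
    have h2 := pi_lt_d4
    nlinarith
  have hmain : V * (π / L ^ 2 + √2 / (√L * L ^ 2 * (L - 1))) ≤
      (L₀ ^ 2 - D) / L₀ ^ 3 * (20 / 9 + 1 / ((L₀ - 1) * (111 / 100 + x / 5))) := by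
    have hsqL : 0 < √L := sqrt_pos.2 hLpos
    have hA0' : 0 ≤ (L₀ ^ 2 - D) / L₀ ^ 3 := hA0.le.trans hA
    have hL1 : 0 < L - 1 := by linarith
    calc V * (π / L ^ 2 + √2 / (√L * L ^ 2 * (L - 1)))
        ≤ V * (20 / 9 * √2 / L ^ 2 + √2 / (√L * L ^ 2 * (L - 1))) := by gcongr
      _ = (V * √2) / L ^ 2 * (20 / 9 + 1 / (√L * (L - 1))) := by field_simp
      _ ≤ (L - D / L) / L ^ 2 * (20 / 9 + 1 / (√L * (L - 1))) := by gcongr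
      _ = (L ^ 2 - D) / L ^ 3 * (20 / 9 + 1 / (√L * (L - 1))) := by congr 1; field_simp
      _ ≤ _ := by gcongr
  refine lt_of_le_of_lt (mul_le_mul_of_nonneg_left (add_le_add hmain
    (mul_le_mul_of_nonneg_left hC hx0.le)) hd.le) ?_
  have p2 : 0 < L₀ ^ 2 / 2 - D := by linarith
  have p3 : 0 < L₀ - 1 := by linarith
  refine lt_of_eq_of_lt ?_ ((div_lt_one (by positivity)).2
    (threshold_polynomial_bound (x := x) (L := L₀) (D := D) ⟨hx0.le, hx1.le⟩ rfl rfl))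
  clear_value D L₀
  generalize 111 / 100 + x / 5 = q at *
  generalize hg : L₀ ^ 2 / 2 - D = g at *
  generalize hm : L₀ - 1 = m at *
  generalize x - x ^ 3 = k
  generalize L₀ ^ 2 / 2 + D = j
  generalize L₀ ^ 2 - D = i
  field_simp

/-- The bound on the time from the pole to the zero of `tan θ` bounds the energy `L²/4` from
below. -/
lemma five_quarters_le {x L : ℝ} (hx : x ∈ Ioo (0 : ℝ) 1) (hL : 1 < L) (h : 2 * π ≤ √2 *
      √((4 * L + 12 * √(2 * L * (L - 1)) + (2 * L - 2)) / 8) *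
        (π - √2 * x / L)) : 5 / 4 + x / 2 ≤ L := by
  by_contra! hlt
  have hx0 := hx.1
  have hx1 := hx.2
  have hp := pi_pos
  have hs0 : (0 : ℝ) < √2 := by positivity
  have hs2 : √2 ^ 2 = 2 := sq_sqrt (by norm_num)
  set L₀ := 5 / 4 + x / 2 with hL₀
  have hsq : √(2 * L * (L - 1)) ≤ 1.628 * L - 1.217 := by
    refine sqrt_le_iff.2 ⟨by linarith, ?_⟩
    nlinarith [sq_nonneg (L - 1.5)]
  set R := (4 * L + 12 * √(2 * L * (L - 1)) + (2 * L - 2)) / 8 with hR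
  have hR1 : R ≤ 3.192 * L₀ - 2.0755 := by rw [hR]; linarith
  have hR0 : 0 ≤ R := by rw [hR]; have := sqrt_nonneg (2 * L * (L - 1)); linarith
  -- `√2 / π ≥ 9/20`
  have h1 : π - √2 * x / L ≤ π * (1 - 9 / 20 * x / L₀) := by
    have h2 : (1.4142 : ℝ) ≤ √2 := le_sqrt_of_sq_le (by norm_num)
    have h3 := pi_lt_d4
    have h4 : π * (9 / 20) ≤ √2 := by linarith
    have h5 : π * (9 / 20) * x / L₀ ≤ √2 * x / L := by gcongr
    have h6 : π * (1 - 9 / 20 * x / L₀) = π - π * (9 / 20) * x / L₀ := by ring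
    linarith
  have h7 : 2 ≤ √2 * √R * (1 - 9 / 20 * x / L₀) := by
    have := h.trans (mul_le_mul_of_nonneg_left h1 (by positivity))
    nlinarith
  have hq0 : 0 < 1 - 9 / 20 * x / L₀ := by rw [sub_pos, div_lt_one (by linarith)]; linarith
  have h8 : 4 ≤ 2 * R * (1 - 9 / 20 * x / L₀) ^ 2 := by
    have := pow_le_pow_left₀ (by norm_num) h7 2
    rw [mul_pow, mul_pow, hs2, sq_sqrt hR0] at this; linarith
  have h9 : 2 ≤ (3.192 * L₀ - 2.0755) * (1 - 9 / 20 * x / L₀) ^ 2 := by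
    have := mul_le_mul_of_nonneg_right hR1 (sq_nonneg (1 - 9 / 20 * x / L₀))
    linarith
  have e : (1 - 9 / 20 * x / L₀) ^ 2 = (L₀ - 9 / 20 * x) ^ 2 / L₀ ^ 2 := by
    have : L₀ ≠ 0 := by linarith
    field_simp
  rw [e, mul_div_assoc', le_div_iff₀ (by positivity)] at h9; rw [hL₀] at h9
  nlinarith [mul_pos hx0 hx0, mul_pos (mul_pos hx0 hx0) hx0, sq_nonneg (x - 1 / 2)]

namespace PoleSolution

variable {E : ℝ} {θ v y y' : ℝ → ℝ}

lemma slope_bound (h : PoleSolution E θ v) (hy : Variation E θ y y') (hE : 1 / 4 < E)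
    {x : ℝ} (hx : x ∈ Ioo 0 1) (hθ : θ π = -arctan x) :
    (x - x ^ 3) * (-v π / cos (θ π) ^ 2) * (y π / v π) < 1 := by
  obtain ⟨s₀, hs₀, V, hV, hVd, hV2, hθ₀, hT1, hT2, hρ⟩ := h.exists_zero_and_bounds hy hE hx hθ
  have hx0 := hx.1
  have hx1 := hx.2
  have hp := pi_pos
  have hs0 : (0 : ℝ) < √2 := by positivity
  have hs2 : √2 ^ 2 = 2 := sq_sqrt (by norm_num)
  set L := √(4 * E)
  have hL2 : L ^ 2 = 4 * E := sq_sqrt (by linarith)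
  have hL1 : 1 < L := lt_sqrt_of_sq_lt (by linarith)
  set a := √L
  have ha2 : a ^ 2 = L := sq_sqrt (by linarith)
  have ha1 : 1 < a := lt_sqrt_of_sq_lt (by linarith)
  have ha4 : a ^ 4 = 4 * E := by rw [← hL2, ← ha2]; ring
  have hsE : √(2 * E) = L * √2 / 2 := by
    rw [sqrt_eq_iff_mul_self_eq (by linarith) (by positivity), ← pow_two, div_pow, mul_pow, hs2, hL2]; ring
  have hT0 : √2 * x / L ≤ π - s₀ := by
    rw [hsE] at hT1; rw [div_le_iff₀ (by linarith)]; nlinarith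
  have hLow : 5 / 4 + x / 2 ≤ L := by
    refine five_quarters_le hx hL1 ?_
    have hb : 0 < √(2 * a ^ 2 - 2) := sqrt_pos.2 (by rw [ha2]; linarith)
    have hb2 := sq_sqrt (show 0 ≤ 2 * a ^ 2 - 2 by rw [ha2]; linarith)
    have hab : a * √(2 * a ^ 2 - 2) = √(2 * L * (L - 1)) := by
      rw [eq_comm, sqrt_eq_iff_mul_self_eq (by nlinarith) (by positivity), ← pow_two, mul_pow, hb2, ha2]; ring
    have hr0 : 0 < (4 * L + 12 * √(2 * L * (L - 1)) + (2 * L - 2)) / 8 := by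
      have := sqrt_nonneg (2 * L * (L - 1)); linarith
    have := h.sqrt_two_mul_pi_le ha1 ha4 hb (sqrt_pos.2 hr0) hb2
      (by rw [sq_sqrt hr0.le, hb2, ← hab, ← ha2]; ring) (Ioo_subset_Ioc_self hs₀) hθ₀
    refine this.trans (mul_le_mul_of_nonneg_left (by linarith) (by positivity))
  have hρ₀ := h.ratio_le_at_zero hy ha1 ha4 (Ioo_subset_Ioc_self hs₀) hθ₀
  have hd : 0 < x - x ^ 3 := by nlinarith [mul_pos hx0 hx0]
  have hV2' : V ^ 2 = L ^ 2 / 2 - x ^ 2 + x ^ 4 / 2 := by rw [hV2, hL2]; ring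
  have hfin := threshold_rational_bound hx hLow hV hV2'
  have hVL : V ^ 2 ≤ L ^ 2 := by rw [hV2']; nlinarith [mul_pos hx0 hx0, mul_pos (mul_pos hx0 hx0) (mul_pos hx0 hx0)]
  have hgap : 0 ≤ 1 / V ^ 2 - 1 / L ^ 2 := sub_nonneg.2 (one_div_le_one_div_of_le (by positivity) hVL)
  rw [← hVd]
  have e5 : a ^ 5 * (a ^ 2 - 1) = a * L ^ 2 * (L - 1) := by rw [← ha2]; ring
  have e4 : a ^ 4 = L ^ 2 := by rw [← ha2]; ring
  rw [e5, e4] at hρ₀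
  have h1 : V * (y π / v π) ≤
      V * (π / L ^ 2 + √2 / (a * L ^ 2 * (L - 1))) + x * (1 / V ^ 2 - 1 / L ^ 2) := by
    have h2 : y π / v π ≤ π / L ^ 2 + √2 / (a * L ^ 2 * (L - 1)) +
        (π - s₀) * (1 / V ^ 2 - 1 / L ^ 2) := by
      have e : (π - s₀) * (1 / V ^ 2 - 1 / L ^ 2) =
        (π - s₀) / V ^ 2 - π / L ^ 2 + s₀ / L ^ 2 := by ring
      rw [e]; linarith
    have h3 := mul_le_mul_of_nonneg_left h2 hV.le
    have h4 := mul_le_mul_of_nonneg_right hT2 hgap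
    linarith
  calc (x - x ^ 3) * V * (y π / v π) = (x - x ^ 3) * (V * (y π / v π)) := by ring
    _ ≤ _ := mul_le_mul_of_nonneg_left h1 hd.le
    _ < 1 := hfin

/-- `∂/∂E` of `θ(π)` and of `(tan θ)'(π)` are negative. -/
lemma variation_at_pi_neg (h : PoleSolution E θ v) (hy : Variation E θ y y') (hE : 0 < E) :
    y π < 0 ∧ (-(π / 2) < θ π → tanVariationDeriv θ v y y' π < 0) := by
  have hp := pi_pos
  have hπm : π ∈ Icc 0 π := right_mem_Icc.2 hp.le
  rcases le_or_gt E (1 / 4) with hE4 | hE4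
  · have := h.variation_neg_of_pi_div_four_le hy fun t ht =>
      ⟨(h.pi_div_four_lt hE4 (Icc_pi_subset (Ioc_subset_Icc_self ht))).le, h.lt_pi_div_two hE ht⟩
    exact ⟨this.1, fun _ => this.2⟩
  have hyπ := h.variation_neg hy hE4 (right_mem_Ioc.2 hp)
  refine ⟨hyπ, fun hlow => ?_⟩
  have hup := h.lt_pi_div_two hE (right_mem_Ioc.2 hp)
  rcases le_or_gt (π / 4) (θ π) with h4 | h4
  · exact (h.variation_neg_of_pi_div_four_le hy fun t ht =>
      ⟨h4.trans ((h.strictAntiOn hE4).antitoneOn (Ioc_subset_Icc_self ht) hπm ht.2),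
        h.lt_pi_div_two hE ht⟩).2
  have hcos : 0 < cos (θ π) := cos_pos_of_mem_Ioo ⟨hlow, hup⟩
  have hv := h.vel_neg hE4 (Icc_pi_subset hπm)
  have hid := h.vel_mul_tanVariationDeriv hy hπm hcos.ne'
  suffices 0 < v π * tanVariationDeriv θ v y y' π by
    by_contra! hcon
    nlinarith
  rw [hid]
  set X := tan (θ π) with hX
  have hX1 : X < 1 := by
    rw [hX, ← tan_pi_div_four]
    exact strictMonoOn_tan ⟨hlow, hup⟩ ⟨by linarith, by linarith⟩ h4
  rcases le_or_gt (X ^ 3 - X) 0 with hs | hs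
  · have := mul_nonneg_of_nonpos_of_nonpos hyπ.le hs
    positivity
  -- here `X = -x` with `0 < x < 1`
  have hX0 : X < 0 := by
    by_contra! h0
    nlinarith [mul_nonneg (mul_nonneg h0 (sub_nonneg.2 hX1.le)) (by linarith : 0 ≤ 1 + X)]
  have hx : -X ∈ Ioo (0 : ℝ) 1 := ⟨by linarith, by
    by_contra! h1
    nlinarith [mul_nonneg (mul_nonneg (neg_nonneg.2 hX0.le) (sub_nonneg.2 h1)) (by linarith : 0 ≤ 1 - X)]⟩
  have hθ : θ π = -arctan (-X) := by rw [arctan_neg, neg_neg, hX, arctan_tan hlow hup]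
  have key := h.slope_bound hy hE4 hx hθ
  have e : (-X - (-X) ^ 3) * (-v π / cos (θ π) ^ 2) * (y π / v π) =
      -(y π * (X ^ 3 - X)) / cos (θ π) ^ 2 := by
    have := hv.ne
    field_simp; ring
  rw [e, div_lt_one (by positivity)] at key; linarith

end PoleSolution

/-! ### The threshold function -/

section

variable {E X t : ℝ} {v θ : ℝ → ℝ}

lemma hasDerivAt_poleAngle_neg (hE : 0 < E) : ∃ d < 0, HasDerivAt (fun E => poleAngle E π) d E := by
  obtain ⟨y, y', hy, h1, -⟩ := contDiff_poleAngle_and_poleVel.2.2 E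
  exact ⟨_, ((poleSolution E).variation_at_pi_neg hy hE).1, h1⟩

lemma strictAntiOn_poleAngle : StrictAntiOn (fun E => poleAngle E π) (Ici 0) := by
  refine strictAntiOn_of_deriv_neg (convex_Ici 0)
    contDiff_poleAngle_and_poleVel.1.continuous.continuousOn fun E hE => ?_
  rw [interior_Ici] at hE
  obtain ⟨d, hd, h⟩ := hasDerivAt_poleAngle_neg hE
  rwa [h.deriv]

lemma exists_energy (X : ℝ) : ∃ E, 0 < E ∧ poleAngle E π = arctan X := by
  have h1 := (poleSolution 0).at_pi_zero
  have h2 := (poleSolution 51).le_neg_pi_div_two le_rfl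
  obtain ⟨E, hE, h⟩ := intermediate_value_Ioo' (show (0 : ℝ) ≤ 51 by norm_num)
    contDiff_poleAngle_and_poleVel.1.continuous.continuousOn
    (show arctan X ∈ Ioo _ _ from ⟨h2.trans_lt (neg_pi_div_two_lt_arctan X),
      (arctan_lt_pi_div_two X).trans_eq h1.symm⟩)
  exact ⟨E, hE.1, h⟩

/-- The energy of the solution with a pole at time `π` and the initial position `X`. -/
def thresholdEnergy (X : ℝ) : ℝ := (exists_energy X).choose

lemma thresholdEnergy_pos (X : ℝ) : 0 < thresholdEnergy X := (exists_energy X).choose_spec.1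

lemma poleAngle_thresholdEnergy (X : ℝ) : poleAngle (thresholdEnergy X) π = arctan X :=
  (exists_energy X).choose_spec.2

lemma eq_thresholdEnergy (hE : 0 < E) (h : poleAngle E π = arctan X) : E = thresholdEnergy X :=
  strictAntiOn_poleAngle.injOn hE.le (thresholdEnergy_pos X).le
    (h.trans (poleAngle_thresholdEnergy X).symm)

/-- The velocity `Y = β(X)` for which the solution with initial position `X` has its first pole at
time `π`, and becomes `+∞` there. -/
def threshold (X : ℝ) : ℝ := -poleVel (thresholdEnergy X) π * (1 + X ^ 2)

lemma contDiff_thresholdEnergy : ContDiff ℝ ∞ thresholdEnergy := by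
  rw [contDiff_iff_contDiffAt]
  intro X
  obtain ⟨d, hd, hder⟩ := hasDerivAt_poleAngle_neg (thresholdEnergy_pos X)
  have hcd : ContDiffAt ℝ ∞ (fun E => poleAngle E π) (thresholdEnergy X) :=
    contDiff_poleAngle_and_poleVel.1.contDiffAt
  have hne : (∞ : WithTop ℕ∞) ≠ 0 := by simp
  set Θ : ℝ → ℝ := fun E => poleAngle E π
  set f' : ℝ ≃L[ℝ] ℝ := ContinuousLinearEquiv.unitsEquivAut ℝ (Units.mk0 d hd.ne) with hf'
  have hf : HasFDerivAt Θ (f' : ℝ →L[ℝ] ℝ) (thresholdEnergy X) := by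
    refine hder.hasFDerivAt.congr_fderiv ?_
    ext
    simp [hf']
  have hinv := hcd.to_localInverse hf hne
  have hcont := hinv.continuousAt
  have hself := hcd.localInverse_apply_image hf hne
  have hright := (hcd.hasStrictFDerivAt' hf hne).eventually_right_inverse
  have hΘX : Θ (thresholdEnergy X) = arctan X := poleAngle_thresholdEnergy X
  have hloc : ∀ᶠ x in 𝓝 X, thresholdEnergy x = hcd.localInverse hf hne (arctan x) := by
    have hat : Tendsto arctan (𝓝 X) (𝓝 (Θ (thresholdEnergy X))) := by
      rw [hΘX]; exact continuous_arctan.continuousAt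
    have e1 := hat.eventually hright
    have e2 : ∀ᶠ x in 𝓝 X, 0 < hcd.localInverse hf hne (arctan x) := by
      have : Tendsto (hcd.localInverse hf hne) (𝓝 (Θ (thresholdEnergy X))) (𝓝 (thresholdEnergy X)) := by
        have h := hcont.tendsto
        rwa [hself] at h
      exact (this.comp hat).eventually (lt_mem_nhds (thresholdEnergy_pos X))
    filter_upwards [e1, e2] with x h1 h2
    exact (eq_thresholdEnergy h2 h1).symm
  refine ContDiffAt.congr_of_eventuallyEq ?_ hloc
  refine ContDiffAt.comp X ?_ contDiff_arctan.contDiffAt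
  rw [← hΘX]; exact hinv

lemma contDiff_threshold : ContDiff ℝ ∞ threshold := by
  have h1 := contDiff_poleAngle_and_poleVel.2.1.comp contDiff_thresholdEnergy
  have : ContDiff ℝ ∞ fun X => -poleVel (thresholdEnergy X) π * (1 + X ^ 2) :=
    (ContDiff.neg h1).mul (by fun_prop)
  exact this

lemma strictAnti_threshold : StrictAnti threshold := by
  refine strictAnti_of_deriv_neg fun X => ?_
  have hp := pi_pos
  set e := thresholdEnergy X
  have he0 : 0 < e := thresholdEnergy_pos X
  obtain ⟨y, y', hy, h1, h2⟩ := contDiff_poleAngle_and_poleVel.2.2 e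
  have hΘ : poleAngle e π = arctan X := poleAngle_thresholdEnergy X
  have hneg := (poleSolution e).variation_at_pi_neg hy he0
  have hcos : 0 < cos (poleAngle e π) := by rw [hΘ]; exact cos_arctan_pos X
  have hed : HasDerivAt thresholdEnergy (deriv thresholdEnergy X) X :=
    (contDiff_thresholdEnergy.differentiable (by simp) X).hasDerivAt
  set e' := deriv thresholdEnergy X
  have he' : e' < 0 := by
    have c1 : HasDerivAt (fun x => poleAngle (thresholdEnergy x) π) (y π * e') X :=
      HasDerivAt.comp (h₂ := fun E => poleAngle E π) X h1 hed
    have c2 : HasDerivAt (fun x => poleAngle (thresholdEnergy x) π) (1 / (1 + X ^ 2)) X := by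
      simp only [poleAngle_thresholdEnergy]; exact hasDerivAt_arctan X
    have := c1.unique c2
    have h3 : 0 < y π * e' := by rw [this]; positivity
    by_contra! hcon
    have := mul_nonpos_of_nonpos_of_nonneg hneg.1.le hcon
    linarith
  have hd : HasDerivAt (fun E => -poleVel E π / cos (poleAngle E π) ^ 2)
      (-PoleSolution.tanVariationDeriv (poleAngle e) (poleVel e) y y' π) e := by
    refine (h2.fun_neg.fun_div (h1.cos.fun_pow 2) (pow_ne_zero 2 hcos.ne')).congr_deriv ?_
    rw [PoleSolution.tanVariationDeriv]
    simp only [Nat.cast_ofNat, Nat.reduceSub, pow_one]; field_simp; ring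
  have hβ : threshold = fun x => (fun E => -poleVel E π / cos (poleAngle E π) ^ 2)
      (thresholdEnergy x) := by
    ext x; simp only [threshold, poleAngle_thresholdEnergy, cos_sq_arctan]; field_simp
  have hβd : HasDerivAt threshold (-PoleSolution.tanVariationDeriv (poleAngle e) (poleVel e) y y' π * e') X := by
    rw [hβ]
    exact HasDerivAt.comp (h₂ := fun E => -poleVel E π / cos (poleAngle E π) ^ 2) X hd hed
  rw [hβd.deriv]
  have := hneg.2 (by rw [hΘ]; exact neg_pi_div_two_lt_arctan X)
  exact mul_neg_of_pos_of_neg (by linarith) he'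

lemma speedSq_arctan (E X : ℝ) :
    speedSq E (arctan X) = (2 * E - X ^ 2 + X ^ 4 / 2) / (1 + X ^ 2) ^ 2 := by
  have h1 : cos (arctan X) ^ 2 = 1 / (1 + X ^ 2) := cos_sq_arctan X
  have h2 : sin (arctan X) ^ 2 = X ^ 2 / (1 + X ^ 2) := by
    have := sin_sq_add_cos_sq (arctan X)
    rw [h1] at this
    have h3 : (1 + X ^ 2) ≠ 0 := by positivity
    field_simp at this ⊢; linarith
  have h4 : cos (arctan X) ^ 4 = (1 / (1 + X ^ 2)) ^ 2 := by rw [← h1]; ring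
  have h5 : sin (arctan X) ^ 4 = (X ^ 2 / (1 + X ^ 2)) ^ 2 := by rw [← h2]; ring
  rw [speedSq, h1, h2, h4, h5]; field_simp

lemma threshold_sq (X : ℝ) : threshold X ^ 2 = 2 * thresholdEnergy X - X ^ 2 + X ^ 4 / 2 := by
  have := (poleSolution (thresholdEnergy X)).speed π (Icc_pi_subset (right_mem_Icc.2 pi_pos.le))
  rw [poleAngle_thresholdEnergy, speedSq_arctan] at this
  rw [threshold, mul_pow, neg_sq, this]; field_simp

lemma tendsto_threshold_sq {l : Filter ℝ} (hl : Tendsto (fun X : ℝ => |X|) l atTop) :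
    Tendsto (fun X => |threshold X|) l atTop := by
  refine tendsto_atTop_mono' l ?_ hl
  filter_upwards [hl.eventually_ge_atTop 2] with X hX
  refine sq_le_sq.1 ?_
  rw [threshold_sq]
  have h1 : 4 ≤ X ^ 2 := by rw [← sq_abs]; nlinarith
  nlinarith [thresholdEnergy_pos X]

lemma tendsto_threshold_atTop : Tendsto threshold atTop atBot := by
  have h := tendsto_threshold_sq tendsto_abs_atTop_atTop
  rw [tendsto_atBot]
  intro b
  filter_upwards [h.eventually_gt_atTop (max |threshold 0| (-b)), eventually_ge_atTop 0] with X hX hX0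
  have h1 := strictAnti_threshold.antitone hX0
  have h2 := (le_max_left _ _).trans_lt hX
  have h3 := (le_max_right |threshold 0| (-b)).trans_lt hX
  rcases abs_cases (threshold X) with h4 | h4
  · rw [h4.1] at h2; linarith [le_abs_self (threshold 0)]
  · linarith

lemma tendsto_threshold_atBot : Tendsto threshold atBot atTop := by
  have h := tendsto_threshold_sq tendsto_abs_atBot_atTop
  rw [tendsto_atTop]
  intro b
  filter_upwards [h.eventually_gt_atTop (max |threshold 0| b), eventually_le_atBot 0] with X hX hX0
  have h1 := strictAnti_threshold.antitone hX0
  have h2 := (le_max_left _ _).trans_lt hX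
  have h3 := (le_max_right |threshold 0| b).trans_lt hX
  rcases abs_cases (threshold X) with h4 | h4
  · linarith
  · rw [h4.1] at h2; linarith [neg_le_abs (threshold 0)]

/-! ### Classification of the profiles by their first pole -/

/-- The angle solution with `tan θ(0) = X` and `(tan θ)'(0) = Y`. -/
structure DataSolution (X Y : ℝ) (E : ℝ) (θ v : ℝ → ℝ) : Prop extends AngleSolution E θ v where
  init : θ 0 = arctan X
  init_vel : v 0 = Y / (1 + X ^ 2)

/-- The angle is regular at time `t`, that is, `tan θ` has had no pole. -/
def Regular (θ : ℝ → ℝ) (s : Set ℝ) : Prop := ∀ t ∈ s, θ t ∈ Ioo (-(π / 2)) (π / 2)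

lemma exists_dataSolution (X Y : ℝ) : ∃ E θ v, DataSolution X Y E θ v := by
  obtain ⟨θ, v, h1, h2, h3⟩ := exists_angleSolution ((Y ^ 2 + X ^ 2 - X ^ 4 / 2) / 2) (arctan X)
    (Y / (1 + X ^ 2)) (by rw [speedSq_arctan, div_pow]; congr 1; ring)
  exact ⟨_, θ, v, h3, h1, h2⟩

lemma AngleSolution.hasDerivAt_tan (h : AngleSolution E θ v)
    (ht : t ∈ Ioo (-10) 10) (hc : cos (θ t) ≠ 0) :
    HasDerivAt (fun t => tan (θ t)) (v t / cos (θ t) ^ 2) t := by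
  refine ((Real.hasDerivAt_tan hc).comp t (h.hasDerivAt ht)).congr_deriv ?_
  ring

/-- `φ = tan θ` solves `φ'' = φ³ - φ`. -/
lemma AngleSolution.hasDerivAt_tan_deriv (h : AngleSolution E θ v)
    (ht : t ∈ Ioo (-10) 10) (hc : cos (θ t) ≠ 0) :
    HasDerivAt (fun t => v t / cos (θ t) ^ 2) (tan (θ t) ^ 3 - tan (θ t)) t := by
  have h1 := h.hasDerivAt ht
  refine ((h.hasDerivAt_vel ht).fun_div (h1.cos.fun_pow 2) (pow_ne_zero 2 hc)).congr_deriv ?_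
  have hsp := h.speed t ht
  rw [tan_eq_sin_div_cos]
  simp only [Nat.cast_ofNat, Nat.reduceSub, pow_one, force, force₁, force₂, speedSq] at *
  have hS : sin (θ t) ^ 2 = 1 - cos (θ t) ^ 2 := by linarith [sin_sq_add_cos_sq (θ t)]
  set S := sin (θ t)
  set C := cos (θ t)
  field_simp; linear_combination 2 * S * hsp + S * (S ^ 2 - C ^ 2) * hS

lemma Regular.cos_pos {s : Set ℝ} (h : Regular θ s) (ht : t ∈ s) :
    0 < cos (θ t) := cos_pos_of_mem_Ioo (h t ht)

/-- Sturm comparison of `η'' = (q - 1) η`, `q ≥ 0`, with `sin`. -/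
lemma nonneg_of_sturm {η η' q : ℝ → ℝ} {s : ℝ} (hs : s < π)
    (h1 : ∀ t ∈ Icc 0 s, HasDerivAt η (η' t) t)
    (h2 : ∀ t ∈ Icc 0 s, HasDerivAt η' ((q t - 1) * η t) t) (hq : ∀ t ∈ Icc 0 s, 0 ≤ q t)
    (h0 : η 0 = 0) (h0' : 0 < η' 0) : ∀ t ∈ Icc 0 s, 0 ≤ η t := fun t ht => by
  by_contra! hneg
  have ht0 : 0 < t := by
    rcases ht.1.eq_or_lt with rfl | h
    · linarith
    · exact h
  obtain ⟨δ, hδ, hlt⟩ := exists_lt_of_hasDerivAt_neg (h1 0 (left_mem_Icc.2 (ht.1.trans ht.2))).fun_neg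
    (by linarith)
  simp only [h0, neg_zero, zero_add] at hlt
  have hδt : δ < t := by
    by_contra! hcon
    have := hlt t ⟨ht0, hcon⟩
    linarith
  have hsub : ∀ r ∈ Icc 0 t, r ∈ Icc 0 s := fun r hr => ⟨hr.1, hr.2.trans ht.2⟩
  obtain ⟨b, hb, hb0, hbl⟩ := exists_first_hit (f := fun r => -η r) (a := δ) (b := t) (c := 0)
    (fun r hr => (h1 r (hsub r ⟨hδ.le.trans hr.1, hr.2⟩)).continuousAt.neg.continuousWithinAt)
    hδt.le (hlt δ ⟨hδ, le_rfl⟩) (by linarith)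
  have hpos : ∀ r ∈ Ioo 0 b, 0 < η r := fun r hr => by
    rcases le_or_gt r δ with h | h
    · linarith [hlt r ⟨hr.1, h⟩]
    · linarith [hbl r ⟨h.le, hr.2⟩]
  have hbt : ∀ r ∈ Icc 0 b, r ∈ Icc 0 s := fun r hr => hsub r ⟨hr.1, hr.2.trans hb.2⟩
  have hsin : ∀ r ∈ Ioc 0 b, 0 < sin r := fun r hr =>
    sin_pos_of_pos_of_lt_pi hr.1 ((hr.2.trans (hb.2.trans ht.2)).trans_lt hs)
  -- the Wronskian of `η` and `sin` is nonnegative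
  have hw : ∀ r ∈ Icc 0 b, 0 ≤ η' r * sin r - η r * cos r := fun r hr => by
    have hd := fun x (hx : x ∈ Icc 0 r) =>
      ((h2 x (hbt x ⟨hx.1, hx.2.trans hr.2⟩)).fun_mul (hasDerivAt_sin x)).fun_sub
        ((h1 x (hbt x ⟨hx.1, hx.2.trans hr.2⟩)).fun_mul (hasDerivAt_cos x))
    have := le_of_hasDerivAt_nonneg hr.1 hd (fun x hx => by
        have e1 := hpos x ⟨hx.1, hx.2.trans_le hr.2⟩
        have e2 := hsin x ⟨hx.1, hx.2.le.trans hr.2⟩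
        have e3 := hq x (hbt x ⟨hx.1.le, hx.2.le.trans hr.2⟩)
        have e4 : 0 ≤ q x * η x * sin x := by positivity
        linarith)
    simpa [h0] using this
  have hδb : 0 < δ / 2 ∧ δ / 2 < b := ⟨by positivity, by linarith [hb.1]⟩
  have hd := fun x (hx : x ∈ Icc (δ / 2) b) =>
    (h1 x (hbt x ⟨hδb.1.le.trans hx.1, hx.2⟩)).fun_div (hasDerivAt_sin x)
      (hsin x ⟨hδb.1.trans_le hx.1, hx.2⟩).ne'
  have := le_of_hasDerivAt_nonneg hδb.2.le hd (fun x hx =>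
      div_nonneg (hw x ⟨(hδb.1.trans hx.1).le, hx.2.le⟩) (sq_nonneg _))
  have hb0' : η b = 0 := by linarith
  simp only [hb0', zero_div] at this
  have h3 := div_pos (hpos _ hδb) (hsin _ ⟨hδb.1, hδb.2.le⟩)
  linarith

lemma DataSolution.le {Y₁ Y₂ E₁ E₂ : ℝ} {θ₁ v₁ θ₂ v₂ : ℝ → ℝ} (h₁ : DataSolution X Y₁ E₁ θ₁ v₁)
    (h₂ : DataSolution X Y₂ E₂ θ₂ v₂) (hY : Y₁ < Y₂) {s : ℝ} (hs : s < π)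
    (hr₁ : Regular θ₁ (Icc 0 s)) (hr₂ : Regular θ₂ (Icc 0 s)) :
    ∀ t ∈ Icc 0 s, θ₁ t ≤ θ₂ t := fun t ht => by
  have hsub : ∀ t ∈ Icc 0 s, t ∈ Ioo (-10) 10 := fun t ht => Icc_pi_subset ⟨ht.1, ht.2.trans hs.le⟩
  have key := nonneg_of_sturm hs (η := fun t => tan (θ₂ t) - tan (θ₁ t))
    (q := fun t => tan (θ₂ t) ^ 2 + tan (θ₂ t) * tan (θ₁ t) + tan (θ₁ t) ^ 2)
    (fun t ht => (h₂.hasDerivAt_tan (hsub t ht) (hr₂.cos_pos ht).ne').fun_sub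
      (h₁.hasDerivAt_tan (hsub t ht) (hr₁.cos_pos ht).ne'))
    (fun t ht => ((h₂.hasDerivAt_tan_deriv (hsub t ht) (hr₂.cos_pos ht).ne').fun_sub
      (h₁.hasDerivAt_tan_deriv (hsub t ht) (hr₁.cos_pos ht).ne')).congr_deriv (by ring))
    (fun t _ => by nlinarith [sq_nonneg (tan (θ₂ t) + tan (θ₁ t))])
    (by simp only [h₁.init, h₂.init, sub_self])
    (by
      simp only [h₁.init, h₂.init, h₁.init_vel, h₂.init_vel, cos_sq_arctan]
      have : 0 < 1 + X ^ 2 := by positivity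
      field_simp
      linarith) t ht
  exact (strictMonoOn_tan.le_iff_le (hr₁ t ht) (hr₂ t ht)).1 (by linarith)

lemma PoleSolution.reverse (h : PoleSolution E θ v) :
    SolvesOn (force E) (fun t => θ (π - t)) (fun t => -v (π - t)) (Ioo (-6) 10) := fun t ht => by
  have ht' : π - t ∈ Ioo (-10) 10 := ⟨by linarith [ht.2, pi_pos], by linarith [ht.1, pi_lt_four]⟩
  refine ⟨HasDerivAt.comp_const_sub _ _ (h.hasDerivAt ht'), ?_⟩
  simpa using (HasDerivAt.comp_const_sub _ _ (h.hasDerivAt_vel ht')).fun_neg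

/-- Reversal of time turns the first pole at time `π` into the initial time. -/
lemma DataSolution.reverse {Y : ℝ} (h : DataSolution X Y E θ v)
    (hreg : Regular θ (Ico 0 π)) (hπ : θ π = π / 2) :
    Y = threshold X := by
  have hp := pi_pos
  have hπm : π ∈ Icc 0 π := right_mem_Icc.2 hp.le
  have hvπ : 0 ≤ v π := by
    by_contra! hneg
    obtain ⟨δ, hδ, hlt⟩ := exists_lt_of_hasDerivAt_neg (f := fun s => -θ (π - s)) (a := 0)
      (f' := v π) (by
        have h1 := h.hasDerivAt (Icc_pi_subset hπm)
        have h2 : HasDerivAt (fun s => π - s) (-1) (0 : ℝ) := by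
          simpa using (hasDerivAt_id' (0 : ℝ)).const_sub π
        have h1' : HasDerivAt θ (v π) ((fun s => π - s) 0) := by simpa using h1
        simpa using (h1'.comp (0 : ℝ) h2).fun_neg) hneg
    have h3 := hlt (min δ π) ⟨lt_min hδ hp, by simp⟩
    have h4 := hreg (π - min δ π) ⟨by simp, by linarith [lt_min hδ hp]⟩
    simp only [sub_zero, hπ] at h3; linarith [h4.2]
  have hsp := h.speed _ (Icc_pi_subset hπm)
  have hv : v π = √2 / 2 := by
    refine (pow_left_inj₀ hvπ (by positivity) two_ne_zero).1 ?_
    rw [hsp, hπ, sq_sqrt_two_div, speedSq]; simp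
  have hP := poleSolution E
  have hsub : Ioo (-6 : ℝ) 10 ⊆ Ioo (-10) 10 := Ioo_subset_Ioo_left (by norm_num)
  have hIcc : Icc 0 π ⊆ Ioo (-6 : ℝ) 10 := fun t ht =>
    ⟨by linarith [ht.1], by linarith [ht.2, pi_lt_four]⟩
  have huniq := (h.solves.mono hsub).unique (lipschitz_force E).choose_spec hP.reverse (hIcc hπm)
    (by simp [hπ, hP.init]) (by simp [hv, hP.init_vel])
  have h0 := huniq 0 (hIcc (left_mem_Icc.2 hp.le))
  simp only [sub_zero, h.init, h.init_vel] at h0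
  have hE : 0 < E := by
    refine hP.energy_pos fun t ht => ?_
    have := (huniq (π - t) (hIcc ⟨by linarith [ht.2], by linarith [ht.1]⟩)).1
    simp only [sub_sub_cancel] at this; rw [← this]
    exact (hreg _ ⟨by linarith [ht.2], by linarith [ht.1]⟩).2
  have := eq_thresholdEnergy hE h0.1.symm
  rw [threshold, ← this, ← h0.2]; field_simp

lemma DataSolution.of_threshold (h : DataSolution X (threshold X) E θ v) :
    Regular θ (Ico 0 π) ∧ θ π = π / 2 := by
  have hp := pi_pos
  set e := thresholdEnergy X
  have he0 : 0 < e := thresholdEnergy_pos X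
  have hP := poleSolution e
  have hXe : poleAngle e π = arctan X := poleAngle_thresholdEnergy X
  have hπm : π ∈ Icc 0 π := right_mem_Icc.2 hp.le
  have hv0 : v 0 = -poleVel e π := by rw [h.init_vel, threshold]; field_simp; rfl
  have hEe : E = e := by
    have h1 := h.speed 0 (by norm_num)
    have h2 := hP.speed π (Icc_pi_subset hπm)
    rw [hv0, neg_sq, h2, h.init, hXe, speedSq_arctan, speedSq_arctan] at h1
    have : (1 + X ^ 2) ≠ 0 := by positivity
    field_simp at h1; linarith
  rw [hEe] at h
  have hsub : Ioo (-6 : ℝ) 10 ⊆ Ioo (-10) 10 := Ioo_subset_Ioo_left (by norm_num)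
  have hIcc : Icc 0 π ⊆ Ioo (-6 : ℝ) 10 := fun t ht =>
    ⟨by linarith [ht.1], by linarith [ht.2, pi_lt_four]⟩
  have huniq := (h.solves.mono hsub).unique (lipschitz_force e).choose_spec hP.reverse
    (hIcc (left_mem_Icc.2 hp.le)) (by simp [h.init, hXe]) (by simp [hv0])
  constructor
  · intro t ht
    have h1 := (huniq t (hIcc (Ico_subset_Icc_self ht))).1
    have hm : π - t ∈ Ioc 0 π := ⟨by linarith [ht.2], by linarith [ht.1]⟩
    rw [h1]
    refine ⟨?_, hP.lt_pi_div_two he0 hm⟩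
    rcases le_or_gt e (1 / 4) with h4 | h4
    · linarith [hP.pi_div_four_lt h4 (Icc_pi_subset (Ioc_subset_Icc_self hm))]
    · have := (hP.strictAntiOn h4).antitoneOn (Ioc_subset_Icc_self hm) hπm hm.2
      rw [hXe] at this; exact (neg_pi_div_two_lt_arctan X).trans_le this
  · have := (huniq π (hIcc hπm)).1
    simpa [hP.init] using this

end

section

variable {v θ : ℝ → ℝ} {E X Y : ℝ} {s : Set ℝ}

lemma force_neg (E x : ℝ) : force E (-x) = -force E x := by
  simp only [force, force₁, force₂, sin_neg, cos_neg]; ring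

lemma speedSq_neg (E x : ℝ) : speedSq E (-x) = speedSq E x := by
  simp only [speedSq, sin_neg, cos_neg]; ring

lemma DataSolution.neg (h : DataSolution X Y E θ v) :
    DataSolution (-X) (-Y) E (fun t => -θ t) (fun t => -v t) where
  solves t ht := ⟨(h.hasDerivAt ht).fun_neg, by rw [force_neg]; exact (h.hasDerivAt_vel ht).fun_neg⟩
  speed t ht := by rw [neg_sq, speedSq_neg]; exact h.speed t ht
  init := by rw [h.init, arctan_neg]
  init_vel := by rw [h.init_vel, neg_sq, neg_div]

lemma regular_iff_abs : Regular θ s ↔ ∀ t ∈ s, |θ t| < π / 2 := by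
  simp only [Regular, mem_Ioo, abs_lt]

lemma Regular.neg (h : Regular θ s) : Regular (fun t => -θ t) s := by
  rw [regular_iff_abs] at *; simpa using h

lemma Regular.mono {s' : Set ℝ} (h : Regular θ s) (hs : s' ⊆ s) : Regular θ s' :=
  fun t ht => h t (hs ht)

lemma DataSolution.abs_init_lt (h : DataSolution X Y E θ v) :
    |θ 0| < π / 2 := by
  rw [h.init, abs_lt]; exact ⟨neg_pi_div_two_lt_arctan X, arctan_lt_pi_div_two X⟩

lemma DataSolution.regular_or_exists (h : DataSolution X Y E θ v) :
    Regular θ (Icc 0 π) ∨ ∃ B ∈ Ioc 0 π, Regular θ (Ico 0 B) ∧ |θ B| = π / 2 := by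
  by_contra! hcon
  refine hcon.1 (regular_iff_abs.2 fun t ht => ?_)
  by_contra! hge
  obtain ⟨B, hB, h1, h2⟩ := exists_first_hit (f := fun t => |θ t|) (a := 0) (b := t)
    ((h.continuousOn.mono fun r hr => Icc_pi_subset ⟨hr.1, hr.2.trans ht.2⟩).abs) ht.1
    h.abs_init_lt hge
  exact hcon.2 B ⟨hB.1, hB.2.trans ht.2⟩ (regular_iff_abs.2 h2) h1

lemma DataSolution.le_of_le {Y₁ Y₂ E₁ E₂ : ℝ} {θ₁ v₁ θ₂ v₂ : ℝ → ℝ}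
    (h₁ : DataSolution X Y₁ E₁ θ₁ v₁) (h₂ : DataSolution X Y₂ E₂ θ₂ v₂) (hY : Y₁ < Y₂) {B : ℝ}
    (hB : B ∈ Ioc 0 π) (hr₁ : Regular θ₁ (Ico 0 B)) (hr₂ : Regular θ₂ (Ico 0 B)) :
    θ₁ B ≤ θ₂ B := by
  have hBm := Icc_pi_subset (Ioc_subset_Icc_self hB)
  refine le_of_tendsto_of_tendsto
    ((h₁.hasDerivAt hBm).continuousAt.tendsto.mono_left (nhdsWithin_le_nhds (s := Iio B)))
    ((h₂.hasDerivAt hBm).continuousAt.tendsto.mono_left nhdsWithin_le_nhds) ?_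
  filter_upwards [Ioo_mem_nhdsLT hB.1] with t ht
  have hsub : Icc 0 t ⊆ Ico 0 B := fun r hr => ⟨hr.1, hr.2.trans_lt ht.2⟩
  exact h₁.le h₂ hY (ht.2.trans_le hB.2) (hr₁.mono hsub) (hr₂.mono hsub) t (right_mem_Icc.2 ht.1.le)

lemma DataSolution.of_neg_threshold (h : DataSolution X (-threshold (-X)) E θ v) :
    Regular θ (Ico 0 π) ∧ θ π = -(π / 2) := by
  have h' := h.neg
  rw [neg_neg] at h'
  obtain ⟨h1, h2⟩ := h'.of_threshold
  refine ⟨by simpa using h1.neg, by linarith⟩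

lemma DataSolution.eq_threshold (h : DataSolution X Y E θ v)
    (hreg : Regular θ (Ico 0 π)) (hπ : |θ π| = π / 2) :
    Y = threshold X ∨ Y = -threshold (-X) := by
  rcases eq_or_eq_neg_of_abs_eq hπ with h1 | h1
  · exact Or.inl (h.reverse hreg h1)
  · right
    have := h.neg.reverse hreg.neg (by rw [h1, neg_neg])
    linarith

lemma neg_threshold_neg_lt (X : ℝ) : -threshold (-X) < threshold X := by
  obtain ⟨E₁, θ₁, v₁, h₁⟩ := exists_dataSolution X (threshold X)
  obtain ⟨E₂, θ₂, v₂, h₂⟩ := exists_dataSolution X (-threshold (-X))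
  obtain ⟨r₁, e₁⟩ := h₁.of_threshold
  obtain ⟨r₂, e₂⟩ := h₂.of_neg_threshold
  have hp := pi_pos
  rcases lt_trichotomy (threshold X) (-threshold (-X)) with h | h | h
  · have := h₁.le_of_le h₂ h (right_mem_Ioc.2 hp) r₁ r₂
    linarith
  · rw [← h] at h₂; rw [h₂.of_threshold.2] at e₂; linarith
  · exact h

/-- Above the threshold the profile has a pole before time `π`. -/
lemma DataSolution.exists_pole_of_gt (h : DataSolution X Y E θ v)
    (hY : threshold X < Y) : ∃ B ∈ Ioo 0 π, Regular θ (Ico 0 B) ∧ |θ B| = π / 2 := by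
  have hp := pi_pos
  obtain ⟨E₁, θ₁, v₁, h₁⟩ := exists_dataSolution X (threshold X)
  obtain ⟨r₁, e₁⟩ := h₁.of_threshold
  have hne : ¬(Regular θ (Ico 0 π) ∧ |θ π| = π / 2) := by
    rintro ⟨hr, hπ⟩
    rcases h.eq_threshold hr hπ with h2 | h2
    · exact hY.ne' h2
    · linarith [neg_threshold_neg_lt X]
  rcases h.regular_or_exists with hr | ⟨B, hB, hr, hθ⟩
  · have := h₁.le_of_le h hY (right_mem_Ioc.2 hp) r₁ (hr.mono Ico_subset_Icc_self)
    linarith [(hr π (right_mem_Icc.2 hp.le)).2]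
  · rcases hB.2.eq_or_lt with rfl | hlt
    · exact absurd ⟨hr, hθ⟩ hne
    · exact ⟨B, ⟨hB.1, hlt⟩, hr, hθ⟩

lemma DataSolution.exists_pole (h : DataSolution X Y E θ v)
    (hY : threshold X < Y ∨ Y < -threshold (-X)) :
    ∃ B ∈ Ioo 0 π, Regular θ (Ico 0 B) ∧ |θ B| = π / 2 := by
  rcases hY with hY | hY
  · exact h.exists_pole_of_gt hY
  · obtain ⟨B, hB, h1, h2⟩ := h.neg.exists_pole_of_gt (by linarith)
    exact ⟨B, hB, by simpa using h1.neg, by simpa using h2⟩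

/-- Strictly between the thresholds the profile has no pole up to time `π`. -/
lemma DataSolution.regular (h : DataSolution X Y E θ v)
    (hY₁ : -threshold (-X) < Y) (hY₂ : Y < threshold X) : Regular θ (Icc 0 π) := by
  obtain ⟨E₁, θ₁, v₁, h₁⟩ := exists_dataSolution X (threshold X)
  obtain ⟨E₂, θ₂, v₂, h₂⟩ := exists_dataSolution X (-threshold (-X))
  obtain ⟨r₁, e₁⟩ := h₁.of_threshold
  obtain ⟨r₂, e₂⟩ := h₂.of_neg_threshold
  rcases h.regular_or_exists with hr | ⟨B, hB, hr, hθ⟩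
  · exact hr
  exfalso
  rcases hB.2.eq_or_lt with rfl | hlt
  · rcases h.eq_threshold hr hθ with h2 | h2 <;> linarith
  · have hsub : Ico 0 B ⊆ Ico 0 π := Ico_subset_Ico_right hB.2
    have l1 := h.le_of_le h₁ hY₂ hB hr (r₁.mono hsub)
    have l2 := h₂.le_of_le h hY₁ hB (r₂.mono hsub) hr
    have m1 := (r₁ B ⟨hB.1.le, hlt⟩).2
    have m2 := (r₂ B ⟨hB.1.le, hlt⟩).1
    have : |θ B| < π / 2 := abs_lt.2 ⟨by linarith, by linarith⟩
    linarith

lemma DataSolution.pole_at_pi (h : DataSolution X Y E θ v)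
    (hY : Y = threshold X ∨ Y = -threshold (-X)) :
    Regular θ (Ico 0 π) ∧ |θ π| = π / 2 := by
  have hp := pi_pos
  rcases hY with rfl | rfl
  · obtain ⟨r, e⟩ := h.of_threshold
    exact ⟨r, by rw [e, abs_of_pos (by positivity)]⟩
  · obtain ⟨r, e⟩ := h.of_neg_threshold
    exact ⟨r, by rw [e, abs_neg, abs_of_pos (by positivity)]⟩

/-- Reversal of time. -/
lemma DataSolution.backward (h : DataSolution X Y E θ v) :
    DataSolution X (-Y) E (fun t => θ (-t)) (fun t => -v (-t)) where
  solves t ht := by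
    have ht' : -t ∈ Ioo (-10) 10 := ⟨by linarith [ht.2], by linarith [ht.1]⟩
    have h1 := HasDerivAt.comp_const_sub (0 : ℝ) t (f := θ) (f' := v (-t))
      (by rw [zero_sub]; exact h.hasDerivAt ht')
    have h2 := (HasDerivAt.comp_const_sub (0 : ℝ) t (f := v) (f' := force E (θ (-t)))
      (by rw [zero_sub]; exact h.hasDerivAt_vel ht')).fun_neg
    simp only [zero_sub, neg_neg] at h1 h2; exact ⟨h1, h2⟩
  speed t ht := by rw [neg_sq]; exact h.speed (-t) ⟨by linarith [ht.2], by linarith [ht.1]⟩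
  init := by simpa using h.init
  init_vel := by simp [h.init_vel, neg_div]

end

/-! ### Fourier transforms of square integrable functions -/

section

variable {g g₁ g₂ : Space → ℂ} {f : Space → ℝ} {F : Fin 3 → Space → ℝ} {l : ℝ}

open scoped LineDeriv

/-- The unit vectors of the coordinate axes. -/
def unitVec (j : Fin 3) : Space := EuclideanSpace.single j 1

lemma exists_schwartz_of_compactSupport (g : Space → ℝ) (hg : ContDiff ℝ ∞ g)
    (hc : HasCompactSupport g) : ∃ φ : 𝓢(Space, ℂ), ∀ x, φ x = (g x : ℂ) :=
  ⟨(hc.comp_left (g := fun r : ℝ => (r : ℂ)) Complex.ofReal_zero).toSchwartzMap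
    (ofRealCLM.contDiff.comp hg), fun _ => rfl⟩

lemma locallyIntegrable_of_schwartz
    (h : ∀ φ : 𝓢(Space, ℂ), Integrable (fun ξ => φ ξ * g ξ)) : LocallyIntegrable g := fun x => by
  let b : ContDiffBump (0 : Space) := ⟨‖x‖ + 1, ‖x‖ + 2, by positivity, by linarith⟩
  obtain ⟨φ, hφ⟩ := exists_schwartz_of_compactSupport b b.contDiff b.hasCompactSupport
  refine ⟨ball 0 (‖x‖ + 1), Metric.isOpen_ball.mem_nhds (by simp), ?_⟩
  refine (integrableOn_congr_fun (fun ξ hξ => ?_) measurableSet_ball).1 (h φ).integrableOn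
  simp [hφ, b.one_of_mem_closedBall (Metric.ball_subset_closedBall hξ)]

lemma ae_eq_of_schwartz (h₁ : ∀ φ : 𝓢(Space, ℂ), Integrable (fun ξ => φ ξ * g₁ ξ))
    (h₂ : ∀ φ : 𝓢(Space, ℂ), Integrable (fun ξ => φ ξ * g₂ ξ))
    (h : ∀ φ : 𝓢(Space, ℂ), ∫ ξ, φ ξ * g₁ ξ = ∫ ξ, φ ξ * g₂ ξ) : g₁ =ᵐ[volume] g₂ := by
  refine ae_eq_of_integral_contDiff_smul_eq (locallyIntegrable_of_schwartz h₁)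
    (locallyIntegrable_of_schwartz h₂) fun g hg hc => ?_
  obtain ⟨φ, hφ⟩ := exists_schwartz_of_compactSupport g hg hc
  have := h φ
  simpa [hφ, Complex.real_smul] using this

lemma IsFourierTransformOf.ae_eq
    (h₁ : IsFourierTransformOf f g₁) (h₂ : IsFourierTransformOf f g₂) : g₁ =ᵐ[volume] g₂ :=
  ae_eq_of_schwartz h₁.2.1 h₂.2.1 fun φ => (h₁.2.2 φ).symm.trans (h₂.2.2 φ)

lemma integrable_schwartz_mul (hg : MemLp g 2) (φ : 𝓢(Space, ℂ)) :
    Integrable (fun ξ => φ ξ * g ξ) :=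
  (φ.memLp 2).integrable_mul hg

lemma exists_isFourierTransformOf (hf : MemLp f 2) :
    ∃ g : Space → ℂ, MemLp g 2 ∧ IsFourierTransformOf f g ∧ eLpNorm g 2 = eLpNorm f 2 := by
  have hf' : MemLp (fun x => (f x : ℂ)) 2 := hf.ofReal
  set F := hf'.toLp
  refine ⟨(𝓕 F : Lp ℂ 2 (volume : Measure Space)), Lp.memLp _,
    ⟨integrable_schwartz_mul hf', integrable_schwartz_mul (Lp.memLp _), fun φ => ?_⟩, ?_⟩
  · have h := congrArg (fun T => T φ) (Lp.fourier_toTemperedDistribution_eq F)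
    simp only [TemperedDistribution.fourier_apply, Lp.toTemperedDistribution_apply, smul_eq_mul] at h
    rw [← h]
    refine integral_congr_ae ?_
    filter_upwards [hf'.coeFn_toLp] with x hx
    rw [hx]
  · have h := Lp.norm_fourier_eq F
    rw [Lp.norm_def, Lp.norm_def, ENNReal.toReal_eq_toReal_iff' (Lp.memLp _).2.ne (Lp.memLp _).2.ne] at h
    rw [h, eLpNorm_congr_ae hf'.coeFn_toLp]
    refine eLpNorm_congr_norm_ae (Eventually.of_forall fun x => ?_)
    simp

lemma hasTemperateGrowth_inner_left (m : Space) :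
    Function.HasTemperateGrowth (fun x : Space => inner ℝ x m) := by fun_prop

/-- If `f` is the divergence of the vector field `F` in the sense of distributions, and both are
square integrable, then the Fourier transform of `f` is `∑ 2πi ξⱼ F̂ⱼ`. -/
lemma ae_eq_of_weak_divergence
    {G : Fin 3 → Space → ℂ} (hg : IsFourierTransformOf f g)
    (hG : ∀ j, IsFourierTransformOf (F j) (G j))
    (hw : ∀ φ : 𝓢(Space, ℂ), ∫ x, φ x * (f x : ℂ) = -∑ j, ∫ x, (∂_{unitVec j} φ) x * (F j x : ℂ)) :
    g =ᵐ[volume] fun ξ => ∑ j, (2 * π * I * (ξ j : ℂ)) * G j ξ := by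
  set M : Fin 3 → 𝓢(Space, ℂ) → 𝓢(Space, ℂ) := fun j φ =>
    -(2 * π * I) • SchwartzMap.smulLeftCLM ℂ (inner ℝ · (unitVec j)) φ with hM
  have hMapp : ∀ j φ ξ, M j φ ξ = -(2 * π * I * (ξ j : ℂ)) * φ ξ := fun j φ ξ => by
    have h1 := SchwartzMap.smulLeftCLM_apply_apply (F := ℂ)
      (hasTemperateGrowth_inner_left (unitVec j)) φ ξ
    have h2 : inner ℝ ξ (unitVec j) = ξ j := by simp [unitVec, EuclideanSpace.inner_single_right]
    rw [h2, Complex.real_smul] at h1; simp only [hM, smul_apply, h1, smul_eq_mul]; ring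
  have hint : ∀ j (φ : 𝓢(Space, ℂ)),
      Integrable (fun ξ => φ ξ * ((2 * π * I * (ξ j : ℂ)) * G j ξ)) := fun j φ => by
    refine ((hG j).2.1 (M j φ)).neg.congr (Eventually.of_forall fun ξ => ?_)
    simp only [Pi.neg_apply, hMapp]; ring
  refine ae_eq_of_schwartz hg.2.1 (fun φ => ?_) fun φ => ?_
  · simp only [mul_sum]; exact integrable_finsetSum _ fun j _ => hint j φ
  · rw [← hg.2.2 φ, hw]; simp only [mul_sum]
    rw [integral_finsetSum _ fun j _ => hint j φ, ← sum_neg_distrib]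
    refine sum_congr rfl fun j _ => ?_
    rw [SchwartzMap.lineDerivOp_fourier_eq]
    have := (hG j).2.2 (M j φ)
    simp only [hM] at this; rw [this, ← integral_neg]
    refine integral_congr_ae (Eventually.of_forall fun ξ => ?_)
    have h2 := hMapp j φ ξ
    simp only [hM] at h2; simp only [h2]; ring

lemma sobolevNorm_le (h : IsFourierTransformOf f g) (s : ℝ) :
    sobolevNorm s f ≤ eLpNorm (fun ξ => ((2 * π * ‖ξ‖) ^ s : ℝ) • g ξ) 2 volume :=
  iInf₂_le g h

lemma sobolevNorm_eq (h : IsFourierTransformOf f g) (s : ℝ) :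
    sobolevNorm s f = eLpNorm (fun ξ => ((2 * π * ‖ξ‖) ^ s : ℝ) • g ξ) 2 volume := by
  refine le_antisymm (sobolevNorm_le h s) (le_iInf₂ fun g' h' => le_of_eq ?_)
  refine eLpNorm_congr_ae ?_
  filter_upwards [h.ae_eq h'] with ξ hξ
  rw [hξ]

lemma eLpNorm_two_sq {E : Type*} [NormedAddCommGroup E] (g : Space → E) :
    eLpNorm g 2 volume ^ 2 = ∫⁻ ξ, ‖g ξ‖ₑ ^ 2 := by
  rw [eLpNorm_eq_lintegral_rpow_enorm_toReal (by norm_num) (by norm_num), ← ENNReal.rpow_natCast,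
    ← ENNReal.rpow_mul]
  norm_num

lemma lintegral_enorm_mul_le {h : Space → ℂ} (hg : AEStronglyMeasurable g)
    (hh : AEStronglyMeasurable h) :
    ∫⁻ ξ, ‖g ξ‖ₑ * ‖h ξ‖ₑ ≤ eLpNorm g 2 volume * eLpNorm h 2 volume := by
  have := ENNReal.lintegral_mul_le_Lp_mul_Lq (volume : Measure Space) HolderConjugate.two_two
    hg.enorm hh.enorm
  rw [eLpNorm_eq_lintegral_rpow_enorm_toReal (by norm_num) (by norm_num),
    eLpNorm_eq_lintegral_rpow_enorm_toReal (by norm_num) (by norm_num)]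
  simpa using this

/-- If a weighted Fourier transform is dominated by `∑ |Gⱼ|` in the sense that
`|w g|² ≤ |g| ∑ |Gⱼ|`, this bounds the Sobolev norm by interpolation. -/
lemma sobolevNorm_sq_le {G : Fin 3 → Space → ℂ} {s : ℝ}
    (h : IsFourierTransformOf f g) (hg : MemLp g 2) (hG : ∀ j, MemLp (G j) 2)
    (hle : ∀ᵐ ξ, ((2 * π * ‖ξ‖) ^ s) ^ 2 * ‖g ξ‖ ≤ ∑ j, ‖G j ξ‖) :
    sobolevNorm s f ^ 2 ≤ eLpNorm g 2 volume * ∑ j, eLpNorm (G j) 2 volume := by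
  rw [sobolevNorm_eq h, eLpNorm_two_sq]
  calc ∫⁻ ξ, ‖((2 * π * ‖ξ‖) ^ s : ℝ) • g ξ‖ₑ ^ 2 ≤ ∫⁻ ξ, ∑ j, ‖g ξ‖ₑ * ‖G j ξ‖ₑ := by
        refine lintegral_mono_ae ?_
        filter_upwards [hle] with ξ hξ
        have h0 : 0 ≤ (2 * π * ‖ξ‖) ^ s := by positivity
        have e1 : ‖((2 * π * ‖ξ‖) ^ s : ℝ) • g ξ‖ₑ ^ 2 =
            ofReal (((2 * π * ‖ξ‖) ^ s) ^ 2 * ‖g ξ‖ * ‖g ξ‖) := by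
          rw [← ofReal_norm, norm_smul, norm_of_nonneg h0, ← ofReal_pow (by positivity)]
          congr 1; ring
        have e2 : ∑ j, ‖g ξ‖ₑ * ‖G j ξ‖ₑ = ofReal ((∑ j, ‖G j ξ‖) * ‖g ξ‖) := by
          rw [sum_mul, ofReal_sum_of_nonneg (fun j _ => by positivity)]
          refine sum_congr rfl fun j _ => ?_
          rw [← ofReal_norm, ← ofReal_norm, ← ofReal_mul (norm_nonneg _), mul_comm]
        rw [e1, e2]
        exact ofReal_le_ofReal (mul_le_mul_of_nonneg_right hξ (norm_nonneg _))
    _ = ∑ j, ∫⁻ ξ, ‖g ξ‖ₑ * ‖G j ξ‖ₑ := by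
        rw [lintegral_finsetSum']; exact fun j _ => hg.1.enorm.mul (hG j).1.enorm
    _ ≤ ∑ j, eLpNorm g 2 volume * eLpNorm (G j) 2 volume :=
        sum_le_sum fun j _ => lintegral_enorm_mul_le hg.1 (hG j).1
    _ = _ := by rw [mul_sum]

lemma norm_le_sum_abs (ξ : Space) : ‖ξ‖ ≤ ∑ j, |ξ j| := by
  rw [EuclideanSpace.norm_eq, sqrt_le_iff]; simp only [norm_eq_abs, Fin.sum_univ_three]
  refine ⟨by positivity, ?_⟩
  nlinarith [mul_nonneg (abs_nonneg (ξ 0)) (abs_nonneg (ξ 1)),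
    mul_nonneg (abs_nonneg (ξ 0)) (abs_nonneg (ξ 2)), mul_nonneg (abs_nonneg (ξ 1)) (abs_nonneg (ξ 2))]

lemma abs_apply_le_norm (ξ : Space) (j : Fin 3) : |ξ j| ≤ ‖ξ‖ := by
  simpa using PiLp.norm_apply_le ξ j

/-- The Fourier transform of a weak partial derivative. -/
lemma ae_eq_of_weak_deriv {F : Space → ℝ} {G : Space → ℂ} (j : Fin 3)
    (hg : IsFourierTransformOf f g) (hG : IsFourierTransformOf F G)
    (hw : ∀ φ : 𝓢(Space, ℂ), ∫ x, φ x * (F x : ℂ) = -∫ x, (∂_{unitVec j} φ) x * (f x : ℂ)) :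
    G =ᵐ[volume] fun ξ => (2 * π * I * (ξ j : ℂ)) * g ξ := by
  have hzero : IsFourierTransformOf (fun _ => 0) (fun _ => 0) := by
    refine ⟨fun φ => ?_, fun φ => ?_, fun φ => ?_⟩ <;> simp
  have := ae_eq_of_weak_divergence (f := F) (F := fun i => if i = j then f else fun _ => 0)
    (G := fun i => if i = j then g else fun _ => 0) hG
    (fun i => by by_cases hij : i = j <;> simp [hij, hg, hzero])
    (fun φ => by
      rw [hw φ, Finset.sum_eq_single j]
      · simp
      · intro i _ hij; simp [hij]
      · simp)
  refine this.trans (Eventually.of_forall fun ξ => ?_)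
  simp only
  rw [Finset.sum_eq_single j]
  · simp
  · intro i _ hij; simp [hij]
  · simp

/-- Interpolation of `Ḣ^{1/2}` between `L²` and `Ḣ¹`. -/
lemma sobolevNorm_half_sq_le (hf : MemLp f 2) (hF : ∀ j, MemLp (F j) 2)
    (hw : ∀ j (φ : 𝓢(Space, ℂ)), ∫ x, φ x * (F j x : ℂ) = -∫ x, (∂_{unitVec j} φ) x * (f x : ℂ)) :
    sobolevNorm (1 / 2) f ^ 2 ≤ eLpNorm f 2 volume * ∑ j, eLpNorm (F j) 2 volume := by
  obtain ⟨g, hg, hfg, hn⟩ := exists_isFourierTransformOf hf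
  choose G hG hFG hnG using fun j => exists_isFourierTransformOf (hF j)
  have hall : ∀ᵐ ξ, ∀ j, G j ξ = (2 * π * I * (ξ j : ℂ)) * g ξ :=
    ae_all_iff.2 fun j => ae_eq_of_weak_deriv j hfg (hFG j) (hw j)
  have key := sobolevNorm_sq_le (s := 1 / 2) hfg hg hG (by
    filter_upwards [hall] with ξ hξ
    simp only [hξ, norm_mul, norm_real, Complex.norm_I, Complex.norm_ofNat, norm_eq_abs,
      abs_of_pos pi_pos, mul_one]
    rw [← sum_mul]
    refine mul_le_mul_of_nonneg_right ?_ (norm_nonneg _)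
    rw [← mul_sum, ← sqrt_eq_rpow, sq_sqrt (by positivity)]
    exact mul_le_mul_of_nonneg_left (norm_le_sum_abs ξ) (by positivity))
  simpa only [hn, hnG] using key

/-- A divergence of a square integrable vector field lies in `Ḣ^{-1/2}`. -/
lemma sobolevNorm_neg_half_sq_le (hf : MemLp f 2) (hF : ∀ j, MemLp (F j) 2)
    (hw : ∀ φ : 𝓢(Space, ℂ), ∫ x, φ x * (f x : ℂ) = -∑ j, ∫ x, (∂_{unitVec j} φ) x * (F j x : ℂ)) :
    sobolevNorm (-1 / 2) f ^ 2 ≤ eLpNorm f 2 volume * ∑ j, eLpNorm (F j) 2 volume := by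
  obtain ⟨g, hg, hfg, hn⟩ := exists_isFourierTransformOf hf
  choose G hG hFG hnG using fun j => exists_isFourierTransformOf (hF j)
  have hae := ae_eq_of_weak_divergence hfg hFG hw
  have key := sobolevNorm_sq_le (s := -1 / 2) hfg hg hG (by
    filter_upwards [hae] with ξ hξ
    rcases eq_or_ne ξ 0 with rfl | h0
    · simp only [norm_zero, mul_zero]; rw [zero_rpow (by norm_num)]
      simp only [ne_eq, OfNat.ofNat_ne_zero, not_false_eq_true, zero_pow, zero_mul]
      positivity
    · have hpos : 0 < 2 * π * ‖ξ‖ := by positivity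
      rw [← rpow_natCast, ← rpow_mul hpos.le]; norm_num only [Nat.cast_ofNat]
      rw [rpow_neg_one, inv_mul_le_iff₀ hpos, hξ]
      refine (norm_sum_le _ _).trans ?_
      rw [mul_sum]
      refine sum_le_sum fun j _ => ?_
      rw [norm_mul]
      refine mul_le_mul_of_nonneg_right ?_ (norm_nonneg _)
      simp only [norm_mul, norm_real, Complex.norm_I, Complex.norm_ofNat, norm_eq_abs,
        abs_of_pos pi_pos, mul_one]
      exact mul_le_mul_of_nonneg_left (abs_apply_le_norm ξ j) (by positivity))
  simpa only [hn, hnG] using key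

/-! ### The triangle inequality and duality -/

lemma IsFourierTransformOf.aestronglyMeasurable
    (h : IsFourierTransformOf f g) : AEStronglyMeasurable g :=
  (locallyIntegrable_of_schwartz h.2.1).aestronglyMeasurable

lemma IsFourierTransformOf.add {f₁ f₂ : Space → ℝ}
    (h₁ : IsFourierTransformOf f₁ g₁) (h₂ : IsFourierTransformOf f₂ g₂) :
    IsFourierTransformOf (f₁ + f₂) (g₁ + g₂) := by
  refine ⟨fun φ => ?_, fun φ => ?_, fun φ => ?_⟩
  · exact ((h₁.1 φ).add (h₂.1 φ)).congr (Eventually.of_forall fun x => by simp [mul_add])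
  · exact ((h₁.2.1 φ).add (h₂.2.1 φ)).congr (Eventually.of_forall fun x => by simp [mul_add])
  · simp only [Pi.add_apply, Complex.ofReal_add, mul_add]
    rw [integral_add (h₁.1 (𝓕 φ)) (h₂.1 (𝓕 φ)), integral_add (h₁.2.1 φ) (h₂.2.1 φ), h₁.2.2, h₂.2.2]

lemma aestronglyMeasurable_weight (s : ℝ) (hg : AEStronglyMeasurable g) :
    AEStronglyMeasurable (fun ξ : Space => ((2 * π * ‖ξ‖) ^ s : ℝ) • g ξ) :=
  (by fun_prop : Measurable fun ξ : Space => ((2 * π * ‖ξ‖) ^ s : ℝ)).aestronglyMeasurable.smul hg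

lemma sobolevNorm_add_le (s : ℝ) (f₁ f₂ : Space → ℝ) :
    sobolevNorm s (f₁ + f₂) ≤ sobolevNorm s f₁ + sobolevNorm s f₂ := by
  by_cases h₁ : ∃ g₁, IsFourierTransformOf f₁ g₁
  swap
  · have : sobolevNorm s f₁ = ⊤ := by
      simp only [sobolevNorm, iInf_eq_top]; exact fun g hg => absurd ⟨g, hg⟩ h₁
    simp [this]
  by_cases h₂ : ∃ g₂, IsFourierTransformOf f₂ g₂
  swap
  · have : sobolevNorm s f₂ = ⊤ := by
      simp only [sobolevNorm, iInf_eq_top]; exact fun g hg => absurd ⟨g, hg⟩ h₂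
    simp [this]
  obtain ⟨g₁, h₁⟩ := h₁
  obtain ⟨g₂, h₂⟩ := h₂
  rw [sobolevNorm_eq h₁, sobolevNorm_eq h₂]
  refine (sobolevNorm_le (h₁.add h₂) s).trans ?_
  simp only [Pi.add_apply, smul_add]
  exact eLpNorm_add_le (aestronglyMeasurable_weight s h₁.aestronglyMeasurable)
    (aestronglyMeasurable_weight s h₂.aestronglyMeasurable) (by norm_num)

lemma sobolevNorm_le_pairNorm (s : ℝ) (f h : Space → ℝ) : sobolevNorm s f ≤ pairNorm s f h := by
  rw [pairNorm]
  calc sobolevNorm s f = (sobolevNorm s f ^ 2) ^ (1 / 2 : ℝ) := by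
        rw [← ENNReal.rpow_natCast, ← ENNReal.rpow_mul]; norm_num
    _ ≤ _ := ENNReal.rpow_le_rpow le_self_add (by norm_num)

lemma pairNorm_le (s : ℝ) (f h : Space → ℝ) :
    pairNorm s f h ≤ sobolevNorm s f + sobolevNorm (s - 1) h := by
  rw [pairNorm]
  calc _ ≤ ((sobolevNorm s f + sobolevNorm (s - 1) h) ^ 2) ^ (1 / 2 : ℝ) := by
        refine ENNReal.rpow_le_rpow ?_ (by norm_num)
        rw [add_sq]
        calc _ ≤ sobolevNorm s f ^ 2 + 2 * sobolevNorm s f * sobolevNorm (s - 1) h +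
              sobolevNorm (s - 1) h ^ 2 := by gcongr; exact le_self_add
          _ = _ := rfl
    _ = _ := by rw [← ENNReal.rpow_natCast, ← ENNReal.rpow_mul]; norm_num

lemma sobolevNorm_le_pairNorm_right (s : ℝ) (f h : Space → ℝ) :
    sobolevNorm (s - 1) h ≤ pairNorm s f h := by
  rw [pairNorm]
  calc sobolevNorm (s - 1) h = (sobolevNorm (s - 1) h ^ 2) ^ (1 / 2 : ℝ) := by
        rw [← ENNReal.rpow_natCast, ← ENNReal.rpow_mul]; norm_num
    _ ≤ _ := ENNReal.rpow_le_rpow le_add_self (by norm_num)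

/-- Dilation of a Schwartz function. -/
def dilate (l : ℝ) (hl : l ≠ 0) (φ : 𝓢(Space, ℂ)) : 𝓢(Space, ℂ) :=
  SchwartzMap.compCLMOfContinuousLinearEquiv ℂ
    (ContinuousLinearEquiv.smulLeft (Units.mk0 l hl) : Space ≃L[ℝ] Space) φ

lemma dilate_apply (l : ℝ) (hl : l ≠ 0) (φ : 𝓢(Space, ℂ)) (ξ : Space) :
    dilate l hl φ ξ = φ (l • ξ) := rfl

lemma fourier_dilate (hl : 0 < l) (φ : 𝓢(Space, ℂ)) (x : Space) :
    (𝓕 (dilate l hl.ne' φ)) x = ((l ^ 3)⁻¹ : ℝ) • (𝓕 φ) (l⁻¹ • x) := by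
  rw [SchwartzMap.fourier_coe, SchwartzMap.fourier_coe, fourier_eq', fourier_eq']
  have := Measure.integral_comp_smul (volume : Measure Space)
    (fun v => Complex.exp (↑(-2 * π * inner ℝ v (l⁻¹ • x)) * I) • φ v) l
  rw [finrank_euclideanSpace, Fintype.card_fin, abs_of_pos (by positivity)] at this
  rw [← this]
  refine integral_congr_ae (Eventually.of_forall fun v => ?_)
  simp only [dilate_apply, inner_smul_left, inner_smul_right]
  congr 3
  simp only [conj_trivial]; field_simp

lemma eLpNorm_weight_dilate (hl : 0 < l) (s : ℝ) (φ : 𝓢(Space, ℂ)) :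
    eLpNorm (fun ξ : Space => ((2 * π * ‖ξ‖) ^ (-s) : ℝ) • φ (l • ξ)) 2 volume =
      ofReal (l ^ (s - 3 / 2)) *
        eLpNorm (fun ξ : Space => ((2 * π * ‖ξ‖) ^ (-s) : ℝ) • φ ξ) 2 volume := by
  set w : Space → ℂ := fun ξ => ((2 * π * ‖ξ‖) ^ (-s) : ℝ) • φ ξ with hw
  have hwm : AEStronglyMeasurable w (Measure.map (l • ·) (volume : Measure Space)) := by
    refine (StronglyMeasurable.aestronglyMeasurable ?_)
    exact (by fun_prop : Measurable fun ξ : Space => ((2 * π * ‖ξ‖) ^ (-s) : ℝ)).stronglyMeasurable.smul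
      φ.continuous.stronglyMeasurable
  have e1 : (fun ξ : Space => ((2 * π * ‖ξ‖) ^ (-s) : ℝ) • φ (l • ξ)) =
      (l ^ s : ℝ) • (w ∘ (l • ·)) := by
    ext ξ
    simp only [hw, Pi.smul_apply, Function.comp, norm_smul, norm_of_nonneg hl.le, smul_smul]
    congr 1
    rw [show 2 * π * (l * ‖ξ‖) = l * (2 * π * ‖ξ‖) by ring,
      mul_rpow hl.le (by positivity), ← mul_assoc, ← rpow_add hl]
    simp
  rw [e1, eLpNorm_const_smul, ← eLpNorm_map_measure hwm (by fun_prop),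
    Measure.map_addHaar_smul _ hl.ne', eLpNorm_smul_measure_of_ne_top (by norm_num),
    smul_eq_mul, ← mul_assoc, finrank_euclideanSpace, Fintype.card_fin]
  congr 1
  rw [← ofReal_norm, norm_of_nonneg (by positivity), abs_of_pos (by positivity),
    ENNReal.ofReal_rpow_of_nonneg (by positivity) (by norm_num), ← ofReal_mul (by positivity)]
  congr 1; rw [← rpow_natCast, ← rpow_neg hl.le, ← rpow_mul hl.le, ← rpow_add hl]
  norm_num; ring_nf

/-- Duality: pairings of `f(l ·)` with Schwartz functions bound the Sobolev norms of `f` from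
below. -/
lemma div_le_sobolevNorm (hl : 0 < l) (s : ℝ) (f : Space → ℝ) (φ : 𝓢(Space, ℂ)) :
    ‖∫ x, (𝓕 φ) x * (f (l • x) : ℂ)‖ₑ / (ofReal (l ^ (s - 3 / 2)) *
        eLpNorm (fun ξ : Space => ((2 * π * ‖ξ‖) ^ (-s) : ℝ) • φ ξ) 2 volume) ≤
      sobolevNorm s f := by
  refine le_iInf₂ fun g hg => ENNReal.div_le_of_le_mul ?_
  rw [← eLpNorm_weight_dilate hl]
  have e1 : ∫ x, (𝓕 φ) x * (f (l • x) : ℂ) = ∫ ξ, dilate l hl.ne' φ ξ * g ξ := by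
    rw [← hg.2.2]; simp only [fourier_dilate hl]
    have := Measure.integral_comp_smul (volume : Measure Space)
      (fun x => (𝓕 φ) (l⁻¹ • x) * (f x : ℂ)) l
    rw [finrank_euclideanSpace, Fintype.card_fin, abs_of_pos (by positivity)] at this
    simp only [smul_smul, inv_mul_cancel₀ hl.ne', one_smul] at this
    rw [this, ← integral_smul]; simp only [smul_mul_assoc]
  rw [e1]
  refine (enorm_integral_le_lintegral_enorm _).trans ?_
  rw [mul_comm]
  refine le_trans ?_ (lintegral_enorm_mul_le ?_ ?_)
  · refine lintegral_mono_ae ?_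
    filter_upwards [Measure.ae_ne volume (0 : Space)] with ξ hξ
    have hpos : 0 < 2 * π * ‖ξ‖ := by positivity
    rw [enorm_mul, enorm_smul, enorm_smul, dilate_apply, mul_mul_mul_comm,
      ← enorm_mul ((2 * π * ‖ξ‖) ^ (-s)) _, ← rpow_add hpos, neg_add_cancel, rpow_zero, enorm_one, one_mul]
  · exact aestronglyMeasurable_weight _ (dilate l hl.ne' φ).continuous.aestronglyMeasurable
  · exact aestronglyMeasurable_weight _ hg.aestronglyMeasurable

end

/-! ### Solutions from the Penrose compactification -/

/-- The square of the denominator of the conformal factor, in terms of time and the squared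
radius. -/
def conformalSq (t ρ : ℝ) : ℝ := (1 - t ^ 2 + ρ) ^ 2 + 4 * t ^ 2

/-- The time coordinate `arctan (t + r) + arctan (t - r)` of the Penrose compactification as a
function of time and the squared radius `ρ = r²`; in this form it is smooth up to `r = 0`. -/
def conformalTime (t ρ : ℝ) : ℝ := arg (⟨1 - t ^ 2 + ρ, 2 * t⟩ : ℂ)

/-- The solution with profile `φ` on the Einstein cylinder, as a function of time and of the squared
radius. -/
def radialSol (φ : ℝ → ℝ) (t ρ : ℝ) : ℝ := 2 * (√(conformalSq t ρ))⁻¹ * φ (conformalTime t ρ)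

/-- The solution with profile `φ` on the Einstein cylinder. -/
def sol (φ : ℝ → ℝ) (t : ℝ) (x : Space) : ℝ := radialSol φ t (‖x‖ ^ 2)

lemma mem_slitPlane {t ρ : ℝ} (hρ : -1 < ρ) : (⟨1 - t ^ 2 + ρ, 2 * t⟩ : ℂ) ∈ slitPlane := by
  rw [Complex.mem_slitPlane_iff]
  rcases eq_or_ne t 0 with rfl | ht
  · left; simp; linarith
  · right; simpa using ht

lemma conformalSq_pos {t ρ : ℝ} (hρ : -1 < ρ) : 0 < conformalSq t ρ := by
  rw [conformalSq]
  rcases eq_or_ne t 0 with rfl | ht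
  · have : 0 < 1 + ρ := by linarith
    simp; positivity
  · positivity

lemma div_im_eq (a b c d : ℝ) : ((⟨a, b⟩ : ℂ) / ⟨c, d⟩).im = (b * c - a * d) / (c ^ 2 + d ^ 2) := by
  rw [Complex.div_im, Complex.normSq_mk]; ring

lemma hasDerivAt_complex_mk {a b : ℝ → ℝ} {a' b' t : ℝ} (ha : HasDerivAt a a' t)
    (hb : HasDerivAt b b' t) : HasDerivAt (fun t => (⟨a t, b t⟩ : ℂ)) ⟨a', b'⟩ t := by
  have h := ha.ofReal_comp.fun_add (hb.ofReal_comp.mul_const I)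
  simpa only [← Complex.mk_eq_add_mul_I] using h

lemma hasDerivAt_conformalTime_left {t ρ : ℝ} (hρ : -1 < ρ) :
    HasDerivAt (fun t => conformalTime t ρ) (2 * (1 + t ^ 2 + ρ) * (√(conformalSq t ρ))⁻¹ ^ 2) t := by
  have h1 : HasDerivAt (fun t : ℝ => 1 - t ^ 2 + ρ) (-(2 * t)) t := by
    simpa using ((hasDerivAt_pow 2 t).const_sub 1).add_const ρ
  have h2 : HasDerivAt (fun t : ℝ => 2 * t) 2 t := by simpa using (hasDerivAt_id t).const_mul 2
  have h := imCLM.hasFDerivAt.comp_hasDerivAt t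
    ((hasDerivAt_complex_mk h1 h2).clog_real (mem_slitPlane hρ))
  refine (h.congr_of_eventuallyEq (Eventually.of_forall fun _ => (Complex.log_im _).symm)).congr_deriv ?_
  rw [inv_pow, sq_sqrt (conformalSq_pos hρ).le]; simp only [Complex.imCLM_apply]
  rw [div_im_eq, conformalSq, div_eq_mul_inv]
  congr 1
  · ring
  · congr 1; ring

lemma hasDerivAt_conformalTime_right {t ρ : ℝ} (hρ : -1 < ρ) :
    HasDerivAt (fun ρ => conformalTime t ρ) (-(2 * t) * (√(conformalSq t ρ))⁻¹ ^ 2) ρ := by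
  have h1 : HasDerivAt (fun ρ : ℝ => 1 - t ^ 2 + ρ) 1 ρ := by
    simpa using (hasDerivAt_id ρ).const_add (1 - t ^ 2)
  have h := imCLM.hasFDerivAt.comp_hasDerivAt ρ
    ((hasDerivAt_complex_mk h1 (hasDerivAt_const ρ (2 * t))).clog_real (mem_slitPlane hρ))
  refine (h.congr_of_eventuallyEq (Eventually.of_forall fun _ => (Complex.log_im _).symm)).congr_deriv ?_
  rw [inv_pow, sq_sqrt (conformalSq_pos hρ).le]; simp only [Complex.imCLM_apply]
  rw [div_im_eq, conformalSq, div_eq_mul_inv]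
  congr 1
  · ring
  · congr 1; ring

lemma hasDerivAt_inv_sqrt {n : ℝ → ℝ} {n' t : ℝ} (hn : HasDerivAt n n' t) (h0 : 0 < n t) :
    HasDerivAt (fun t => (√(n t))⁻¹) (-(n' / 2) * (√(n t))⁻¹ ^ 3) t := by
  have h1 : √(n t) ≠ 0 := (sqrt_pos.2 h0).ne'
  refine ((hn.sqrt h0.ne').fun_inv h1).congr_deriv ?_
  field_simp

lemma hasDerivAt_conformalSq_left (t ρ : ℝ) :
    HasDerivAt (fun t => conformalSq t ρ) (4 * t * (1 + t ^ 2 - ρ)) t := by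
  have h1 : HasDerivAt (fun t : ℝ => 1 - t ^ 2 + ρ) (-(2 * t)) t := by
    simpa using ((hasDerivAt_pow 2 t).const_sub 1).add_const ρ
  refine ((h1.fun_pow 2).fun_add ((hasDerivAt_pow 2 t).const_mul 4)).congr_deriv ?_
  ring

lemma hasDerivAt_conformalSq_right (t ρ : ℝ) :
    HasDerivAt (fun ρ => conformalSq t ρ) (2 * (1 - t ^ 2 + ρ)) ρ := by
  have h1 : HasDerivAt (fun ρ : ℝ => 1 - t ^ 2 + ρ) 1 ρ := by
    simpa using (hasDerivAt_id ρ).const_add (1 - t ^ 2)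
  refine ((h1.fun_pow 2).add_const (4 * t ^ 2)).congr_deriv ?_
  ring

section Derivatives

variable {φ ψ : ℝ → ℝ} {s : Set ℝ} {t ρ : ℝ}

/-- The time derivative of `radialSol φ`, where `ψ` is the derivative of `φ`. -/
def radialSolTime (φ ψ : ℝ → ℝ) (t ρ : ℝ) : ℝ :=
  (√(conformalSq t ρ))⁻¹ ^ 3 * (-(4 * t * (1 + t ^ 2 - ρ)) * φ (conformalTime t ρ) +
    4 * (1 + t ^ 2 + ρ) * ψ (conformalTime t ρ))

/-- The derivative of `radialSol φ` in the squared radius, where `ψ` is the derivative of `φ`. -/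
def radialSolSpace (φ ψ : ℝ → ℝ) (t ρ : ℝ) : ℝ :=
  -(√(conformalSq t ρ))⁻¹ ^ 3 * (2 * (1 - t ^ 2 + ρ) * φ (conformalTime t ρ) +
    4 * t * ψ (conformalTime t ρ))

lemma hasDerivAt_radialSol_left (hφ : SolvesOn (fun x => x ^ 3 - x) φ ψ s) (hρ : -1 < ρ)
    (ht : conformalTime t ρ ∈ s) :
    HasDerivAt (fun t => radialSol φ t ρ) (radialSolTime φ ψ t ρ) t := by
  have h1 := hasDerivAt_inv_sqrt (hasDerivAt_conformalSq_left t ρ) (conformalSq_pos hρ)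
  have h2 := (hφ _ ht).1.comp t (hasDerivAt_conformalTime_left hρ)
  refine ((h1.const_mul 2).fun_mul h2).congr_deriv ?_
  simp only [radialSolTime, Function.comp_apply]; ring

lemma hasDerivAt_radialSol_right (hφ : SolvesOn (fun x => x ^ 3 - x) φ ψ s) (hρ : -1 < ρ)
    (ht : conformalTime t ρ ∈ s) :
    HasDerivAt (fun ρ => radialSol φ t ρ) (radialSolSpace φ ψ t ρ) ρ := by
  have h1 := hasDerivAt_inv_sqrt (hasDerivAt_conformalSq_right t ρ) (conformalSq_pos hρ)
  have h2 := (hφ _ ht).1.comp ρ (hasDerivAt_conformalTime_right hρ)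
  refine ((h1.const_mul 2).fun_mul h2).congr_deriv ?_
  simp only [radialSolSpace, Function.comp_apply]; ring

/-- The wave equation in the coordinates `t` and `ρ = r²`. -/
lemma radialSol_wave (hφ : SolvesOn (fun x => x ^ 3 - x) φ ψ s) (hρ : -1 < ρ)
    (ht : conformalTime t ρ ∈ s) :
    ∃ htt hρρ : ℝ, HasDerivAt (fun t => radialSolTime φ ψ t ρ) htt t ∧
      HasDerivAt (fun ρ => radialSolSpace φ ψ t ρ) hρρ ρ ∧
      htt - (4 * ρ * hρρ + 6 * radialSolSpace φ ψ t ρ) = radialSol φ t ρ ^ 3 := by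
  have hN := conformalSq_pos (t := t) hρ
  have a1 := hasDerivAt_inv_sqrt (hasDerivAt_conformalSq_left t ρ) hN
  have a2 := (hφ _ ht).1.comp t (hasDerivAt_conformalTime_left hρ)
  have a3 := (hφ _ ht).2.comp t (hasDerivAt_conformalTime_left hρ)
  have b1 := hasDerivAt_inv_sqrt (hasDerivAt_conformalSq_right t ρ) hN
  have b2 := (hφ _ ht).1.comp ρ (hasDerivAt_conformalTime_right hρ)
  have b3 := (hφ _ ht).2.comp ρ (hasDerivAt_conformalTime_right hρ)
  have p1 : HasDerivAt (fun t : ℝ => -(4 * t * (1 + t ^ 2 - ρ))) (-(4 + 12 * t ^ 2 - 4 * ρ)) t := by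
    have := (((hasDerivAt_id t).const_mul 4).fun_mul
      (((hasDerivAt_pow 2 t).const_add 1).sub_const ρ)).fun_neg
    refine this.congr_deriv ?_
    simp only [Nat.cast_ofNat, Nat.reduceSub, id]; ring
  have p2 : HasDerivAt (fun t : ℝ => 4 * (1 + t ^ 2 + ρ)) (8 * t) t := by
    refine ((((hasDerivAt_pow 2 t).const_add 1).add_const ρ).const_mul 4).congr_deriv ?_
    ring
  have q1 : HasDerivAt (fun ρ : ℝ => 2 * (1 - t ^ 2 + ρ)) 2 ρ := by
    simpa using ((hasDerivAt_id ρ).const_add (1 - t ^ 2)).const_mul 2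
  refine ⟨_, _, (a1.fun_pow 3).fun_mul ((p1.fun_mul a2).fun_add (p2.fun_mul a3)),
    ((b1.fun_pow 3).fun_neg).fun_mul ((q1.fun_mul b2).fun_add (b3.const_mul (4 * t))), ?_⟩
  simp only [radialSol, radialSolSpace, Function.comp_apply, Nat.cast_ofNat, Nat.reduceSub]
  set W := (√(conformalSq t ρ))⁻¹ with hW
  have hWN : W ^ 2 * ((1 - t ^ 2 + ρ) ^ 2 + 4 * t ^ 2) = 1 := by
    rw [hW, inv_pow, sq_sqrt hN.le, conformalSq] at *; exact inv_mul_cancel₀ hN.ne'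
  set f := φ (conformalTime t ρ)
  set f' := ψ (conformalTime t ρ)
  linear_combination (8 * W ^ 3 * (f ^ 3 - f) -
    W ^ 3 * (32 * t * f' - 24 * t ^ 2 * f + 24 * ρ * f)) * hWN

end Derivatives

/-! ### Laplacians of radial functions -/

lemma laplacian_eq_sum {f : Space → ℝ} {f' : Space → Space →L[ℝ] ℝ}
    {f'' : Space →L[ℝ] Space →L[ℝ] ℝ} {x : Space} (h1 : ∀ᶠ y in 𝓝 x, HasFDerivAt f (f' y) y)
    (h2 : HasFDerivAt f' f'' x) :
    Laplacian.laplacian f x = ∑ j, f'' (unitVec j) (unitVec j) := by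
  have := congrFun (InnerProductSpace.laplacian_eq_iteratedFDeriv_orthonormalBasis f
    (EuclideanSpace.basisFun (Fin 3) ℝ)) x
  rw [this]
  have h3 : fderiv ℝ f =ᶠ[𝓝 x] f' := by filter_upwards [h1] with y hy using hy.fderiv
  refine sum_congr rfl fun j _ => ?_
  rw [iteratedFDeriv_two_apply, h3.fderiv_eq, h2.fderiv]; simp [unitVec]

lemma hasFDerivAt_norm_sq (x : Space) :
    HasFDerivAt (fun x : Space => ‖x‖ ^ 2) ((2 : ℝ) • innerSL ℝ x) x := by
  refine (hasStrictFDerivAt_norm_sq x).hasFDerivAt.congr_fderiv ?_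
  ext; simp

lemma hasFDerivAt_comp_norm_sq {g : ℝ → ℝ} {g' : ℝ} {x : Space} (h : HasDerivAt g g' (‖x‖ ^ 2)) :
    HasFDerivAt (fun x : Space => g (‖x‖ ^ 2)) ((2 * g') • innerSL ℝ x) x := by
  refine (h.comp_hasFDerivAt x (hasFDerivAt_norm_sq x)).congr_fderiv ?_
  rw [smul_smul, mul_comm]

lemma sum_apply_sq (x : Space) : ∑ j, x j * x j = ‖x‖ ^ 2 := by
  rw [EuclideanSpace.norm_sq_eq]; simp [sq]

lemma laplacian_comp_norm_sq {g g' : ℝ → ℝ} {g'' : ℝ} {x : Space}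
    (h1 : ∀ᶠ ρ in 𝓝 (‖x‖ ^ 2), HasDerivAt g (g' ρ) ρ) (h2 : HasDerivAt g' g'' (‖x‖ ^ 2)) :
    Laplacian.laplacian (fun x : Space => g (‖x‖ ^ 2)) x =
      4 * ‖x‖ ^ 2 * g'' + 6 * g' (‖x‖ ^ 2) := by
  have hc : Tendsto (fun y : Space => ‖y‖ ^ 2) (𝓝 x) (𝓝 (‖x‖ ^ 2)) :=
    (by fun_prop : Continuous fun y : Space => ‖y‖ ^ 2).tendsto x
  obtain ⟨L, hL⟩ : ∃ L : Space →L[ℝ] Space →L[ℝ] ℝ, ∀ y, L y = innerSL ℝ y := ⟨innerSL ℝ, fun _ => rfl⟩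
  have h3 : HasFDerivAt (fun y : Space => (2 * g' (‖y‖ ^ 2)) • L y) _ x :=
    ((hasFDerivAt_comp_norm_sq h2).const_mul 2).smul L.hasFDerivAt
  rw [laplacian_eq_sum ((hc.eventually h1).mono fun y hy =>
    (hasFDerivAt_comp_norm_sq hy).congr_fderiv (by rw [hL])) h3]
  have hx : ∀ j, innerSL ℝ x (unitVec j) = x j := fun j => by
    simp [unitVec, EuclideanSpace.inner_single_right]
  have hu : ∀ j, innerSL ℝ (unitVec j) (unitVec j) = 1 := fun j => by simp [unitVec]
  simp only [add_apply, smul_apply, ContinuousLinearMap.smulRight_apply, hL, hx, hu, smul_eq_mul]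
  rw [sum_add_distrib, ← sum_apply_sq x]; simp only [Fin.sum_univ_three]; ring

/-! ### The solution with a given profile -/

lemma SolvesOn.contDiffOn {g θ v : ℝ → ℝ} {s : Set ℝ} (hs : IsOpen s) (hg : ContDiff ℝ ∞ g)
    (h : SolvesOn g θ v s) : ContDiffOn ℝ ∞ θ s ∧ ContDiffOn ℝ ∞ v s := by
  have key : ∀ n : ℕ, ContDiffOn ℝ n θ s ∧ ContDiffOn ℝ n v s := fun n => by
    induction n with
    | zero =>
      simp only [Nat.cast_zero, contDiffOn_zero]
      exact ⟨fun t ht => (h t ht).1.continuousAt.continuousWithinAt,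
        fun t ht => (h t ht).2.continuousAt.continuousWithinAt⟩
    | succ n ih =>
      push_cast
      rw [contDiffOn_succ_iff_deriv_of_isOpen hs, contDiffOn_succ_iff_deriv_of_isOpen hs]
      refine ⟨⟨fun t ht => (h t ht).1.differentiableAt.differentiableWithinAt, by simp, ?_⟩,
        ⟨fun t ht => (h t ht).2.differentiableAt.differentiableWithinAt, by simp, ?_⟩⟩
      · exact ih.2.congr fun t ht => (h t ht).1.deriv
      · exact ((hg.of_le (by exact_mod_cast le_top)).comp_contDiffOn ih.1).congr
          fun t ht => (h t ht).2.deriv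
  exact ⟨contDiffOn_infty.2 fun n => (key n).1, contDiffOn_infty.2 fun n => (key n).2⟩

lemma conformalSq_sq (t r : ℝ) : conformalSq t (r ^ 2) = (1 + (t + r) ^ 2) * (1 + (t - r) ^ 2) := by
  rw [conformalSq]; ring

lemma inv_sqrt_conformalSq (t r : ℝ) : (√(conformalSq t (r ^ 2)))⁻¹ =
    cos (arctan (t + r)) * cos (arctan (t - r)) := by
  rw [conformalSq_sq, sqrt_mul (by positivity), cos_arctan, cos_arctan, mul_inv]; simp

lemma conformalTime_sq (t r : ℝ) : conformalTime t (r ^ 2) = arctan (t + r) + arctan (t - r) := by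
  set a := arctan (t + r) with ha
  set b := arctan (t - r) with hb
  have hca : 0 < cos a := cos_arctan_pos _
  have hcb : 0 < cos b := cos_arctan_pos _
  have hsa : sin a = (t + r) * cos a := by rw [← tan_mul_cos hca.ne', ha, tan_arctan]
  have hsb : sin b = (t - r) * cos b := by rw [← tan_mul_cos hcb.ne', hb, tan_arctan]
  have h1 := Complex.arg_mul_cos_add_sin_mul_I (r := (cos a * cos b)⁻¹) (θ := a + b)
    (by positivity) ⟨by linarith [neg_pi_div_two_lt_arctan (t + r), neg_pi_div_two_lt_arctan (t - r)],
      by linarith [arctan_lt_pi_div_two (t + r), arctan_lt_pi_div_two (t - r)]⟩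
  rw [← h1, conformalTime]
  congr 1; rw [← Complex.ofReal_cos, ← Complex.ofReal_sin, cos_add, sin_add, hsa, hsb]
  rw [Complex.mk_eq_add_mul_I, mul_add, ← Complex.ofReal_mul, ← mul_assoc _ _ I,
    ← Complex.ofReal_mul]
  congr 3
  · field_simp; ring
  · field_simp; ring

lemma conformalTime_neg (t : ℝ) {ρ : ℝ} (hρ : 0 ≤ ρ) : conformalTime (-t) ρ = -conformalTime t ρ := by
  rw [← sq_sqrt hρ, conformalTime_sq, conformalTime_sq, ← neg_inj, neg_add, ← arctan_neg,
    ← arctan_neg]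
  ring_nf

lemma conformalTime_zero_right (t : ℝ) : conformalTime t 0 = 2 * arctan t := by
  have := conformalTime_sq t 0
  simp only [ne_eq, OfNat.ofNat_ne_zero, not_false_eq_true, zero_pow, add_zero, sub_zero] at this
  rw [this]; ring

lemma conformalTime_zero_left {ρ : ℝ} (hρ : 0 ≤ ρ) : conformalTime 0 ρ = 0 := by
  have := conformalTime_neg 0 hρ
  rw [neg_zero] at this; linarith

lemma conformalTime_mem_Icc {t ρ : ℝ} (ht : 0 ≤ t) (hρ : 0 ≤ ρ) :
    conformalTime t ρ ∈ Icc 0 (2 * arctan t) := by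
  refine ⟨Complex.arg_nonneg_iff.2 (by simpa using ht), ?_⟩
  rw [← conformalTime_zero_right]
  have hd : ∀ x ∈ Ici (0 : ℝ), HasDerivAt (fun ρ => conformalTime t ρ) _ x := fun x hx =>
    hasDerivAt_conformalTime_right (t := t) (lt_of_lt_of_le (by norm_num) (show (0 : ℝ) ≤ x from hx))
  refine antitoneOn_of_deriv_nonpos (convex_Ici (0 : ℝ))
    (fun x hx => (hd x hx).continuousAt.continuousWithinAt)
    (fun x hx => (hd x (interior_subset hx)).differentiableAt.differentiableWithinAt)
    (fun x hx => ?_) self_mem_Ici hρ hρ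
  rw [(hd x (interior_subset hx)).deriv]
  have : 0 ≤ t * (√(conformalSq t x))⁻¹ ^ 2 := by positivity
  linarith

lemma conformalTime_mem_Ioo {A B t ρ : ℝ} (hA : 0 < A) (hB : 0 < B) (h1 : -A < 2 * arctan t)
    (h2 : 2 * arctan t < B) (hρ : 0 ≤ ρ) : conformalTime t ρ ∈ Ioo (-A) B := by
  rcases le_total 0 t with ht | ht
  · have := conformalTime_mem_Icc ht hρ
    exact ⟨by linarith [this.1], by linarith [this.2]⟩
  · have := conformalTime_mem_Icc (neg_nonneg.2 ht) hρ
    rw [conformalTime_neg _ hρ, arctan_neg] at this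
    exact ⟨by linarith [this.2], by linarith [this.1]⟩

/-- The time at the spatial origin at which the solution reaches time `B` on the Einstein cylinder;
it is infinite when `B = π`. -/
def lifespan (B : ℝ) : EReal := if B = π then ⊤ else (tan (B / 2) : EReal)

lemma lt_lifespan_iff {B : ℝ} (hB : B ∈ Ioc 0 π) (t : ℝ) :
    (t : EReal) < lifespan B ↔ 2 * arctan t < B := by
  rw [lifespan]
  split_ifs with h
  · simp only [EReal.coe_lt_top, true_iff]; linarith [arctan_lt_pi_div_two t]
  · rw [EReal.coe_lt_coe_iff]
    have h2 : B < π := lt_of_le_of_ne hB.2 h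
    have h3 : arctan (tan (B / 2)) = B / 2 := arctan_tan (by linarith [hB.1, pi_pos]) (by linarith)
    rw [← arctan_strictMono.lt_iff_lt, h3]
    constructor <;> intro <;> linarith

lemma neg_lifespan_lt_iff {A : ℝ} (hA : A ∈ Ioc 0 π) (t : ℝ) :
    -lifespan A < (t : EReal) ↔ -A < 2 * arctan t := by
  rw [EReal.neg_lt_comm, ← EReal.coe_neg, lt_lifespan_iff hA, arctan_neg]
  constructor <;> intro <;> linarith

lemma contDiffAt_conformalTime {p : ℝ × ℝ} (hp : -1 < p.2) :
    ContDiffAt ℝ ∞ (fun p : ℝ × ℝ => conformalTime p.1 p.2) p := by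
  have h1 : ContDiff ℝ ∞ fun p : ℝ × ℝ =>
      ((1 - p.1 ^ 2 + p.2 : ℝ) : ℂ) + ((2 * p.1 : ℝ) : ℂ) * I := by
    have h1 : ContDiff ℝ ∞ fun p : ℝ × ℝ => ((1 - p.1 ^ 2 + p.2 : ℝ) : ℂ) := ofRealCLM.contDiff.comp
        (by fun_prop : ContDiff ℝ ∞ fun p : ℝ × ℝ => 1 - p.1 ^ 2 + p.2)
    have h2 : ContDiff ℝ ∞ fun p : ℝ × ℝ => ((2 * p.1 : ℝ) : ℂ) :=
      ofRealCLM.contDiff.comp (by fun_prop : ContDiff ℝ ∞ fun p : ℝ × ℝ => 2 * p.1)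
    exact h1.add (h2.mul contDiff_const)
  simp only [← Complex.mk_eq_add_mul_I] at h1
  have h2 : ContDiffAt ℝ ∞ Complex.log ⟨1 - p.1 ^ 2 + p.2, 2 * p.1⟩ :=
    (Complex.contDiffAt_log (mem_slitPlane hp)).restrict_scalars ℝ
  have h3 := imCLM.contDiff.contDiffAt.comp p (h2.comp p h1.contDiffAt)
  refine h3.congr_of_eventuallyEq (Eventually.of_forall fun q => ?_)
  simp [conformalTime, Complex.log_im]

lemma contDiff_conformalSq : ContDiff ℝ ∞ (fun p : ℝ × ℝ => conformalSq p.1 p.2) := by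
  unfold conformalSq; fun_prop

section Solution

variable {φ ψ : ℝ → ℝ} {A B X Y : ℝ}

/-- A smooth solution `φ` of `φ'' = φ³ - φ` with derivative `ψ` on an interval `(-A, B)`. -/
structure Profile (X Y A B : ℝ) (φ ψ : ℝ → ℝ) : Prop where
  neg : A ∈ Ioc 0 π
  pos : B ∈ Ioc 0 π
  solves : SolvesOn (fun x => x ^ 3 - x) φ ψ (Ioo (-A) B)
  init : φ 0 = X
  init_deriv : ψ 0 = Y

namespace Profile

lemma contDiffOn (h : Profile X Y A B φ ψ) :
    ContDiffOn ℝ ∞ φ (Ioo (-A) B) ∧ ContDiffOn ℝ ∞ ψ (Ioo (-A) B) :=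
  h.solves.contDiffOn isOpen_Ioo (by fun_prop)

lemma mem (h : Profile X Y A B φ ψ) {t : ℝ} (h1 : -lifespan A < (t : EReal))
    (h2 : (t : EReal) < lifespan B) {ρ : ℝ} (hρ : 0 ≤ ρ) : conformalTime t ρ ∈ Ioo (-A) B :=
  conformalTime_mem_Ioo h.neg.1 h.pos.1 ((neg_lifespan_lt_iff h.neg t).1 h1)
    ((lt_lifespan_iff h.pos t).1 h2) hρ

lemma lifespan_pos (h : Profile X Y A B φ ψ) : 0 < lifespan B := by
  have := (lt_lifespan_iff h.pos 0).2 (by simpa using h.pos.1)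
  simpa using this

lemma neg_lifespan_neg (h : Profile X Y A B φ ψ) : -lifespan A < 0 := by
  have := (neg_lifespan_lt_iff h.neg 0).2 (by simpa using h.neg.1)
  simpa using this

lemma contDiffAt_radialSol (h : Profile X Y A B φ ψ) {p : ℝ × ℝ} (hp : -1 < p.2)
    (hm : conformalTime p.1 p.2 ∈ Ioo (-A) B) :
    ContDiffAt ℝ ∞ (fun p : ℝ × ℝ => radialSol φ p.1 p.2) p := by
  unfold radialSol
  have h1 := contDiff_conformalSq.contDiffAt (x := p)
  have hN := conformalSq_pos (t := p.1) hp
  have h2 : ContDiffAt ℝ ∞ φ (conformalTime p.1 p.2) :=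
    h.contDiffOn.1.contDiffAt (isOpen_Ioo.mem_nhds hm)
  exact (contDiffAt_const.mul ((h1.sqrt hN.ne').inv (sqrt_pos.2 hN).ne')).mul
    (h2.comp p (contDiffAt_conformalTime hp))

lemma contDiffAt_sol (h : Profile X Y A B φ ψ) {p : ℝ × Space} (h1 : -lifespan A < (p.1 : EReal))
    (h2 : (p.1 : EReal) < lifespan B) :
    ContDiffAt ℝ ∞ (fun p : ℝ × Space => sol φ p.1 p.2) p := by
  have h3 : ContDiff ℝ ∞ fun p : ℝ × Space => (p.1, ‖p.2‖ ^ 2) :=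
    contDiff_fst.prodMk (contDiff_snd.norm_sq ℝ)
  have hm := h.mem h1 h2 (sq_nonneg ‖p.2‖)
  exact (h.contDiffAt_radialSol (p := (p.1, ‖p.2‖ ^ 2)) (by simp only; nlinarith [sq_nonneg ‖p.2‖]) hm).comp p
    h3.contDiffAt

lemma hasDerivAt_sol (h : Profile X Y A B φ ψ) {t : ℝ} (h1 : -lifespan A < (t : EReal))
    (h2 : (t : EReal) < lifespan B) (x : Space) :
    HasDerivAt (fun τ => sol φ τ x) (radialSolTime φ ψ t (‖x‖ ^ 2)) t :=
  hasDerivAt_radialSol_left h.solves (by nlinarith [sq_nonneg ‖x‖]) (h.mem h1 h2 (sq_nonneg _))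

lemma timeDeriv_sol (h : Profile X Y A B φ ψ) {t : ℝ} (h1 : -lifespan A < (t : EReal))
    (h2 : (t : EReal) < lifespan B) (x : Space) :
    timeDeriv (sol φ) t x = radialSolTime φ ψ t (‖x‖ ^ 2) := (h.hasDerivAt_sol h1 h2 x).deriv

lemma isSolution (h : Profile X Y A B φ ψ) : IsSolution X Y (-lifespan A) (lifespan B) (sol φ) where
  zero_mem := ⟨h.neg_lifespan_neg, h.lifespan_pos⟩
  smooth := fun p hp => (h.contDiffAt_sol hp.1 hp.2).contDiffWithinAt
  eqn := fun t h1 h2 x => by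
    have hρ : -1 < ‖x‖ ^ 2 := by nlinarith [sq_nonneg ‖x‖]
    have hm := h.mem h1 h2 (sq_nonneg ‖x‖)
    obtain ⟨htt, hρρ, e1, e2, e3⟩ := radialSol_wave h.solves hρ hm
    have ev1 : ∀ᶠ τ in 𝓝 t, conformalTime τ (‖x‖ ^ 2) ∈ Ioo (-A) B :=
      (hasDerivAt_conformalTime_left hρ).continuousAt.eventually_mem (isOpen_Ioo.mem_nhds hm)
    have ev2 : ∀ᶠ ρ in 𝓝 (‖x‖ ^ 2), conformalTime t ρ ∈ Ioo (-A) B :=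
      (hasDerivAt_conformalTime_right hρ).continuousAt.eventually_mem (isOpen_Ioo.mem_nhds hm)
    have hL := laplacian_comp_norm_sq (g := fun ρ => radialSol φ t ρ)
      (g' := fun ρ => radialSolSpace φ ψ t ρ) (x := x) (by
        filter_upwards [ev2, lt_mem_nhds hρ] with ρ k1 k2 using
          hasDerivAt_radialSol_right h.solves k2 k1) e2
    have hT : iteratedDeriv 2 (fun τ => sol φ τ x) t = htt := by
      rw [iteratedDeriv_succ, iteratedDeriv_one]
      have : deriv (fun τ => sol φ τ x) =ᶠ[𝓝 t] fun τ => radialSolTime φ ψ τ (‖x‖ ^ 2) := by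
        filter_upwards [ev1] with τ k1 using (hasDerivAt_radialSol_left h.solves hρ k1).deriv
      rw [this.deriv_eq, e1.deriv]
    rw [waveOp, hT, show sol φ t = fun x : Space => radialSol φ t (‖x‖ ^ 2) from rfl, hL, e3]
  init := fun x => by
    have : (1 : ℝ) + ‖x‖ ^ 2 ≠ 0 := by positivity
    rw [sol, radialSol, conformalTime_zero_left (sq_nonneg _), h.init, conformalSq]
    rw [show (1 - (0 : ℝ) ^ 2 + ‖x‖ ^ 2) ^ 2 + 4 * 0 ^ 2 = (1 + ‖x‖ ^ 2) ^ 2 by ring,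
      sqrt_sq (by positivity)]
    field_simp
  init_deriv := fun x => by
    have : (1 : ℝ) + ‖x‖ ^ 2 ≠ 0 := by positivity
    rw [h.timeDeriv_sol (by simpa using h.neg_lifespan_neg) (by simpa using h.lifespan_pos),
      radialSolTime, conformalTime_zero_left (sq_nonneg _), h.init_deriv, conformalSq]
    rw [show (1 - (0 : ℝ) ^ 2 + ‖x‖ ^ 2) ^ 2 + 4 * 0 ^ 2 = (1 + ‖x‖ ^ 2) ^ 2 by ring,
      sqrt_sq (by positivity)]
    field_simp; ring

end Profile

end Solution

/-! ### Finiteness of the Sobolev norms -/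

section

variable {f : Space → ℝ} {C s : ℝ}

open scoped LineDeriv

/-- Integration by parts against a Schwartz function. -/
lemma integral_schwartz_mul_fderiv {f' : Space → Space →L[ℝ] ℝ} {e : Space}
    (hf : ∀ x, HasFDerivAt f (f' x) x) (h : MemLp f 2) (h' : MemLp (fun x => f' x e) 2)
    (φ : 𝓢(Space, ℂ)) :
    ∫ x, φ x * (f' x e : ℂ) = -∫ x, (∂_{e} φ) x * (f x : ℂ) := by
  have hd : ∀ x, HasFDerivAt (fun x => (f x : ℂ)) (ofRealCLM.comp (f' x)) x := fun x =>
    ofRealCLM.hasFDerivAt.comp x (hf x)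
  have h1 : (fun x => φ x * (f' x e : ℂ)) = fun x => φ x * fderiv ℝ (fun x => (f x : ℂ)) x e := by
    ext x; rw [(hd x).fderiv]; rfl
  have h2 : (fun x => (∂_{e} φ) x * (f x : ℂ)) = fun x => fderiv ℝ φ x e * (f x : ℂ) := by
    ext x; rw [SchwartzMap.lineDerivOp_apply_eq_fderiv]
  rw [h1, h2]
  refine integral_mul_fderiv_eq_neg_fderiv_mul_of_integrable ?_ ?_ ?_
    (fun x _ => φ.differentiable x) (fun x _ => (hd x).differentiableAt)
  · rw [← h2]; exact integrable_schwartz_mul h.ofReal _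
  · rw [← h1]; exact integrable_schwartz_mul h'.ofReal _
  · exact integrable_schwartz_mul h.ofReal _

/-- The weight `1 / (1 + |x|²)`. -/
def weight (x : Space) : ℝ := (1 + ‖x‖ ^ 2)⁻¹

lemma weight_pos (x : Space) : 0 < weight x := by unfold weight; positivity

lemma weight_le_one (x : Space) : weight x ≤ 1 := by
  unfold weight; exact inv_le_one_of_one_le₀ (by nlinarith [sq_nonneg ‖x‖])

lemma weight_mem (x : Space) : weight x ∈ Icc 0 1 := ⟨(weight_pos x).le, weight_le_one x⟩

lemma continuous_weight : Continuous weight := by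
  unfold weight; exact Continuous.inv₀ (by fun_prop) fun x => by positivity

lemma weight_mul_sq (x : Space) : weight x * ‖x‖ ^ 2 = 1 - weight x := by
  unfold weight; field_simp; ring

lemma abs_apply_sq_le (x : Space) (j : Fin 3) : x j ^ 2 ≤ ‖x‖ ^ 2 := by
  rw [← sq_abs]; exact pow_le_pow_left₀ (abs_nonneg _) (abs_apply_le_norm x j) 2

lemma weight_mul_apply_sq_le (x : Space) (j : Fin 3) : weight x * x j ^ 2 ≤ 1 := by
  have := mul_le_mul_of_nonneg_left (abs_apply_sq_le x j) (weight_pos x).le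
  rw [weight_mul_sq] at this; linarith [weight_pos x]

lemma weight_mul_abs_apply_le (x : Space) (j : Fin 3) : weight x * |x j| ≤ 1 := by
  have h1 := weight_mul_apply_sq_le x j
  have h2 := weight_pos x
  have h3 := weight_le_one x
  refine abs_le_of_sq_le_sq' ?_ zero_le_one |>.2
  rw [mul_pow, sq_abs]; nlinarith [sq_nonneg (x j), mul_nonneg h2.le (sq_nonneg (x j))]

lemma integrable_weight_sq : Integrable (fun x => weight x ^ 2) := by
  have := integrable_rpow_neg_one_add_norm_sq (E := Space) (μ := volume) (r := 4)
    (by rw [finrank_euclideanSpace, Fintype.card_fin]; norm_num)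
  refine this.congr (Eventually.of_forall fun x => ?_)
  simp only [weight]
  rw [show (-4 / 2 : ℝ) = -((2 : ℕ) : ℝ) by norm_num, rpow_neg (by positivity),
    rpow_natCast, inv_pow]

lemma memLp_weight : MemLp weight 2 :=
  (memLp_two_iff_integrable_sq continuous_weight.aestronglyMeasurable).2 integrable_weight_sq

lemma memLp_of_le_weight (hf : Continuous f) (h : ∀ x, |f x| ≤ C * weight x) : MemLp f 2 :=
  memLp_weight.of_le_mul hf.aestronglyMeasurable (c := C) (Eventually.of_forall fun x => by
    rw [norm_eq_abs, norm_of_nonneg (weight_pos x).le]; exact h x)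

lemma hasFDerivAt_weight (x : Space) :
    HasFDerivAt weight ((-2 * weight x ^ 2) • innerSL ℝ x) x := by
  have h1 : HasDerivAt (fun ρ : ℝ => (1 + ρ)⁻¹) (-(1 + ‖x‖ ^ 2)⁻¹ ^ 2) (‖x‖ ^ 2) := by
    refine (((hasDerivAt_id (‖x‖ ^ 2)).const_add 1).fun_inv (by simp only [id]; positivity)).congr_deriv ?_
    simp only [id, inv_pow]; ring
  refine (hasFDerivAt_comp_norm_sq h1).congr_fderiv ?_
  rw [weight]; congr 1; ring

section Compactified

variable {U : Set ℝ} {K : ℝ → ℝ}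

lemma hasFDerivAt_comp_weight {K' : ℝ} {x : Space} (h : HasDerivAt K K' (weight x)) :
    HasFDerivAt (fun x => K (weight x)) ((-2 * weight x ^ 2 * K') • innerSL ℝ x) x := by
  refine (h.comp_hasFDerivAt x (hasFDerivAt_weight x)).congr_fderiv ?_
  rw [smul_smul]; congr 1; ring

lemma exists_abs_le_of_contDiffOn (hU : Icc 0 1 ⊆ U) (hK : ContinuousOn K U) :
    ∃ C, 0 ≤ C ∧ ∀ x : Space, |K (weight x)| ≤ C := by
  obtain ⟨C, hC⟩ := isCompact_Icc.exists_bound_of_continuousOn (hK.mono hU)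
  exact ⟨C, (norm_nonneg _).trans (hC 0 (by norm_num)), fun x => hC _ (weight_mem x)⟩

lemma continuous_comp_weight (hU : Icc 0 1 ⊆ U) (hK : ContinuousOn K U) :
    Continuous fun x => K (weight x) :=
  hK.comp_continuous continuous_weight fun x => hU (weight_mem x)

/-- In terms of `w = 1 / (1 + |x|²)`, the Laplacian of `K(w)`. -/
def weightLaplacian (K : ℝ → ℝ) (w : ℝ) : ℝ :=
  3 * (-2 * w ^ 2 * deriv K w) - 2 * (1 - w) * w * deriv (fun w => -2 * w ^ 2 * deriv K w) w

lemma contDiffOn_weightLaplacian (hU : IsOpen U) (hK : ContDiffOn ℝ ∞ K U) :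
    ContDiffOn ℝ ∞ (weightLaplacian K) U := by
  have h1 : ContDiffOn ℝ ∞ (fun w => -2 * w ^ 2 * deriv K w) U :=
    (by fun_prop : ContDiff ℝ ∞ fun w : ℝ => -2 * w ^ 2).contDiffOn.mul
      (hK.deriv_of_isOpen hU (by simp))
  exact (contDiffOn_const.mul h1).sub
    ((by fun_prop : ContDiff ℝ ∞ fun w : ℝ => 2 * (1 - w) * w).contDiffOn.mul
      (h1.deriv_of_isOpen hU (by simp)))

lemma weightLaplacian_eq (K : ℝ → ℝ) (w : ℝ) :
    weightLaplacian K w = w * (-6 * w * deriv K w - 2 * (1 - w) *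
      deriv (fun w => -2 * w ^ 2 * deriv K w) w) := by
  rw [weightLaplacian]; ring

/-- The Laplacian of `K(w)` multiplies the Fourier transform by `-|2πξ|²`. -/
lemma ae_eq_weightLaplacian (hU : IsOpen U) (hU' : Icc 0 1 ⊆ U) (hK : ContDiffOn ℝ ∞ K U)
    (hC : ∀ w ∈ Icc 0 1, |K w| ≤ C * w) {g h : Space → ℂ}
    (hg : IsFourierTransformOf (fun x => K (weight x)) g)
    (hh : IsFourierTransformOf (fun x => weightLaplacian K (weight x)) h) :
    h =ᵐ[volume] fun ξ => -(((2 * π * ‖ξ‖) ^ 2 : ℝ) : ℂ) * g ξ := by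
  set Q : ℝ → ℝ := fun w => -2 * w ^ 2 * deriv K w with hQ
  have hK' : ContDiffOn ℝ ∞ (deriv K) U := hK.deriv_of_isOpen hU (by simp)
  have hQs : ContDiffOn ℝ ∞ Q U :=
    (by fun_prop : ContDiff ℝ ∞ fun w : ℝ => -2 * w ^ 2).contDiffOn.mul hK'
  have hQ' : ContDiffOn ℝ ∞ (deriv Q) U := hQs.deriv_of_isOpen hU (by simp)
  have hdK : ∀ x : Space, HasFDerivAt (fun x => K (weight x)) (Q (weight x) • innerSL ℝ x) x :=
    fun x => hasFDerivAt_comp_weight ((hK.differentiableOn (by simp)).differentiableAt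
      (hU.mem_nhds (hU' (weight_mem x)))).hasDerivAt
  have hdQ : ∀ x : Space, HasFDerivAt (fun x => Q (weight x))
      ((-2 * weight x ^ 2 * deriv Q (weight x)) • innerSL ℝ x) x :=
    fun x => hasFDerivAt_comp_weight ((hQs.differentiableOn (by simp)).differentiableAt
      (hU.mem_nhds (hU' (weight_mem x)))).hasDerivAt
  obtain ⟨C₁, hC₁, hb₁⟩ := exists_abs_le_of_contDiffOn hU' hK'.continuousOn
  obtain ⟨C₂, hC₂, hb₂⟩ := exists_abs_le_of_contDiffOn hU' hQ'.continuousOn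
  have hcQ := continuous_comp_weight hU' hQs.continuousOn
  have hcQ' := continuous_comp_weight hU' hQ'.continuousOn
  have hinner : ∀ (x : Space) j, innerSL ℝ x (unitVec j) = x j := fun x j => by
    simp [unitVec, EuclideanSpace.inner_single_right]
  have hcoord : ∀ j : Fin 3, Continuous fun x : Space => x j := fun j => by fun_prop
  have hbQ : ∀ x, |Q (weight x)| ≤ 2 * C₁ * weight x ^ 2 := fun x => by
    have h1 : Q (weight x) = -(2 * weight x ^ 2 * deriv K (weight x)) := by rw [hQ]; ring
    rw [h1, abs_neg, abs_mul, abs_of_nonneg (by positivity)]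
    nlinarith [hb₁ x, sq_nonneg (weight x)]
  have hwL : MemLp (fun x => K (weight x)) 2 :=
    memLp_of_le_weight (continuous_comp_weight hU' hK.continuousOn) fun x => hC _ (weight_mem x)
  have hFL : ∀ j : Fin 3, MemLp (fun x : Space => x j * Q (weight x)) 2 := fun j => by
    refine memLp_of_le_weight ((hcoord j).mul hcQ) (C := 2 * C₁) fun x => ?_
    rw [abs_mul]
    calc |x j| * |Q (weight x)| ≤ |x j| * (2 * C₁ * weight x ^ 2) := by gcongr; exact hbQ x
      _ = 2 * C₁ * weight x * (weight x * |x j|) := by ring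
      _ ≤ 2 * C₁ * weight x * 1 := by
        have := weight_pos x
        gcongr; exact weight_mul_abs_apply_le x j
      _ = _ := by ring
  have hF'L : ∀ j : Fin 3, MemLp (fun x : Space => Q (weight x) +
      x j ^ 2 * (-2 * weight x ^ 2 * deriv Q (weight x))) 2 := fun j => by
    refine memLp_of_le_weight (hcQ.add (((hcoord j).pow 2).mul
      ((continuous_const.mul (continuous_weight.pow 2)).mul hcQ'))) (C := 2 * C₁ + 2 * C₂) fun x => ?_
    have hw := weight_pos x
    have hw1 := weight_le_one x
    refine (abs_add_le _ _).trans ?_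
    rw [add_mul]
    refine add_le_add ((hbQ x).trans ?_) ?_
    · have : weight x ^ 2 ≤ weight x := by nlinarith
      gcongr
    · have e : x j ^ 2 * (-2 * weight x ^ 2 * deriv Q (weight x)) =
          -(2 * weight x * (weight x * x j ^ 2) * deriv Q (weight x)) := by ring
      have hp : 0 ≤ weight x * x j ^ 2 := by positivity
      rw [e, abs_neg, abs_mul, abs_of_nonneg (by positivity)]
      calc 2 * weight x * (weight x * x j ^ 2) * |deriv Q (weight x)|
          ≤ 2 * weight x * 1 * C₂ := by gcongr; exacts [weight_mul_apply_sq_le x j, hb₂ x]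
        _ = _ := by ring
  have hdF : ∀ (j : Fin 3) (x : Space), HasFDerivAt (fun x : Space => x j * Q (weight x)) (x j •
      ((-2 * weight x ^ 2 * deriv Q (weight x)) • innerSL ℝ x) +
        Q (weight x) • (EuclideanSpace.proj j : Space →L[ℝ] ℝ)) x := fun j x =>
    (EuclideanSpace.proj j : Space →L[ℝ] ℝ).hasFDerivAt.mul (hdQ x)
  have hdFe : ∀ (j : Fin 3) (x : Space), (x j •
      ((-2 * weight x ^ 2 * deriv Q (weight x)) • innerSL ℝ x) +
        Q (weight x) • (EuclideanSpace.proj j : Space →L[ℝ] ℝ)) (unitVec j) =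
      Q (weight x) + x j ^ 2 * (-2 * weight x ^ 2 * deriv Q (weight x)) := fun j x => by
    simp only [add_apply, smul_apply, hinner, smul_eq_mul]; simp [unitVec]; ring
  have hsum : ∀ x : Space, weightLaplacian K (weight x) =
      ∑ j, (Q (weight x) + x j ^ 2 * (-2 * weight x ^ 2 * deriv Q (weight x))) := fun x => by
    have h1 := EuclideanSpace.real_norm_sq_eq x
    simp only [Fin.sum_univ_three] at h1 ⊢
    have h2 : weightLaplacian K (weight x) =
        3 * Q (weight x) - 2 * (1 - weight x) * weight x * deriv Q (weight x) := rfl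
    rw [h2]
    linear_combination (2 * weight x * deriv Q (weight x)) * weight_mul_sq x -
      (2 * weight x ^ 2 * deriv Q (weight x)) * h1
  choose G hG hFG hnG using fun j => exists_isFourierTransformOf (hFL j)
  have h1 := ae_eq_of_weak_divergence hh hFG fun φ => by
    have : ∀ x, φ x * ((weightLaplacian K (weight x) : ℝ) : ℂ) = ∑ j, φ x * ((Q (weight x) +
        x j ^ 2 * (-2 * weight x ^ 2 * deriv Q (weight x)) : ℝ) : ℂ) := fun x => by
      rw [hsum, Complex.ofReal_sum, mul_sum]
    simp only [this]
    have hi : ∀ j, Integrable (fun x => φ x * ((Q (weight x) +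
        x j ^ 2 * (-2 * weight x ^ 2 * deriv Q (weight x)) : ℝ) : ℂ)) :=
      fun j => integrable_schwartz_mul (hF'L j).ofReal φ
    rw [integral_finsetSum _ fun j _ => hi j, ← sum_neg_distrib]
    refine sum_congr rfl fun j _ => ?_
    have := integral_schwartz_mul_fderiv (hdF j) (hFL j) (e := unitVec j)
      (by simpa only [hdFe] using hF'L j) φ
    simpa only [hdFe] using this
  have h2 : ∀ j, G j =ᵐ[volume] fun ξ => (2 * π * I * (ξ j : ℂ)) * g ξ := fun j => by
    have e : ∀ x : Space, (Q (weight x) • innerSL ℝ x) (unitVec j) = x j * Q (weight x) := fun x => by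
      rw [smul_apply, hinner, smul_eq_mul, mul_comm]
    refine ae_eq_of_weak_deriv j hg (hFG j) fun φ => ?_
    have := integral_schwartz_mul_fderiv hdK hwL (e := unitVec j) (by simpa only [e] using hFL j) φ
    simpa only [e] using this
  filter_upwards [h1, ae_all_iff.2 h2] with ξ k1 k2
  rw [k1]; simp only [k2]
  have e : ∀ j, 2 * π * I * (ξ j : ℂ) * (2 * π * I * (ξ j : ℂ) * g ξ) =
      -(4 * π ^ 2 * ((ξ j ^ 2 : ℝ) : ℂ)) * g ξ := fun j => by
    push_cast; linear_combination (4 * π ^ 2 * (ξ j : ℂ) ^ 2 * g ξ) * Complex.I_sq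
  simp only [e]
  rw [← sum_mul, sum_neg_distrib, ← mul_sum, ← Complex.ofReal_sum, ← EuclideanSpace.real_norm_sq_eq]
  push_cast; ring

lemma exists_weightLaplacian_le (hU : IsOpen U) (hU' : Icc 0 1 ⊆ U) (hK : ContDiffOn ℝ ∞ K U) :
    ∃ C, ∀ w ∈ Icc 0 1, |weightLaplacian K w| ≤ C * w := by
  have hK' : ContDiffOn ℝ ∞ (deriv K) U := hK.deriv_of_isOpen hU (by simp)
  have hQ : ContDiffOn ℝ ∞ (deriv fun w => -2 * w ^ 2 * deriv K w) U :=
    ((by fun_prop : ContDiff ℝ ∞ fun w : ℝ => -2 * w ^ 2).contDiffOn.mul hK').deriv_of_isOpen hU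
      (by simp)
  have h : ContinuousOn (fun w => -6 * w * deriv K w - 2 * (1 - w) *
      deriv (fun w => -2 * w ^ 2 * deriv K w) w) U :=
    ((by fun_prop : Continuous fun w : ℝ => -6 * w).continuousOn.mul hK'.continuousOn).sub
      ((by fun_prop : Continuous fun w : ℝ => 2 * (1 - w)).continuousOn.mul hQ.continuousOn)
  obtain ⟨C, hC⟩ := isCompact_Icc.exists_bound_of_continuousOn (h.mono hU')
  refine ⟨C, fun w hw => ?_⟩
  rw [weightLaplacian_eq, abs_mul, abs_of_nonneg hw.1, mul_comm]
  exact mul_le_mul_of_nonneg_right (hC w hw) hw.1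

lemma memLp_pow_smul (hU : IsOpen U) (hU' : Icc 0 1 ⊆ U) (k : ℕ) :
    ∀ {K : ℝ → ℝ}, ContDiffOn ℝ ∞ K U → (∃ C, ∀ w ∈ Icc 0 1, |K w| ≤ C * w) →
      ∀ g, IsFourierTransformOf (fun x => K (weight x)) g →
        MemLp (fun ξ => (((2 * π * ‖ξ‖) ^ (2 * k) : ℝ) : ℂ) * g ξ) 2 := by
  have hLp : ∀ {K : ℝ → ℝ}, ContDiffOn ℝ ∞ K U → (∃ C, ∀ w ∈ Icc 0 1, |K w| ≤ C * w) →
      MemLp (fun x => K (weight x)) 2 := fun hK hC => by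
    obtain ⟨C, hC⟩ := hC
    exact memLp_of_le_weight (continuous_comp_weight hU' hK.continuousOn) fun x => hC _ (weight_mem x)
  induction k with
  | zero =>
    intro K hK hC g hg
    obtain ⟨g', h1, h2, -⟩ := exists_isFourierTransformOf (hLp hK hC)
    simpa using h1.ae_eq (h2.ae_eq hg)
  | succ k ih =>
    intro K hK hC g hg
    have hK₂ := contDiffOn_weightLaplacian hU hK
    have hC₂ := exists_weightLaplacian_le hU hU' hK
    obtain ⟨h, -, hh, -⟩ := exists_isFourierTransformOf (hLp hK₂ hC₂)
    obtain ⟨C, hC⟩ := hC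
    refine (ih hK₂ hC₂ h hh).neg.ae_eq ?_
    filter_upwards [ae_eq_weightLaplacian hU hU' hK hC hg hh] with ξ hξ
    rw [Pi.neg_apply, hξ]; push_cast; ring

/-- Functions of `1 / (1 + |x|²)` which are smooth and vanish at infinity have finite Sobolev
norms of all nonnegative orders. -/
lemma sobolevNorm_lt_top_of_nonneg (hU : IsOpen U) (hU' : Icc 0 1 ⊆ U) (hK : ContDiffOn ℝ ∞ K U)
    (hC : ∀ w ∈ Icc 0 1, |K w| ≤ C * w) (hs : 0 ≤ s) :
    sobolevNorm s (fun x => K (weight x)) < ⊤ := by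
  obtain ⟨g, hg, hfg, -⟩ := exists_isFourierTransformOf
    (memLp_of_le_weight (continuous_comp_weight hU' hK.continuousOn) fun x => hC _ (weight_mem x))
  obtain ⟨k, hk⟩ := exists_nat_ge s
  have h2 := memLp_pow_smul hU hU' k hK ⟨C, hC⟩ g hfg
  refine (sobolevNorm_le hfg s).trans_lt ?_
  refine ((hg.norm.add h2.norm).of_le (aestronglyMeasurable_weight s hg.1)
    (Eventually.of_forall fun ξ => ?_)).2
  rw [norm_smul, Pi.add_apply, norm_of_nonneg (by positivity), norm_mul, norm_real,
    norm_of_nonneg (by positivity), norm_of_nonneg (by positivity), ← one_add_mul]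
  refine mul_le_mul_of_nonneg_right ?_ (norm_nonneg _)
  set y := 2 * π * ‖ξ‖
  have hy : 0 ≤ y := by positivity
  rcases le_total y 1 with h | h
  · exact (rpow_le_one hy h hs).trans (by linarith [pow_nonneg hy (2 * k)])
  · have : y ^ s ≤ y ^ ((2 * k : ℕ) : ℝ) := by
      refine rpow_le_rpow_of_exponent_le h ?_
      push_cast; linarith [Nat.cast_nonneg (α := ℝ) k]
    rw [rpow_natCast] at this; linarith

lemma exists_bounded_isFourierTransformOf (hf : Integrable f) :
    ∃ (g : Space → ℂ) (C : ℝ), IsFourierTransformOf f g ∧ ∀ ξ, ‖g ξ‖ ≤ C := by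
  have hL : Continuous fun p : Space × Space => (innerₗ Space) p.1 p.2 := continuous_inner
  have hf' : Integrable (fun x => (f x : ℂ)) := hf.ofReal
  set g := VectorFourier.fourierIntegral fourierChar volume (innerₗ Space).flip
    fun x => (f x : ℂ)
  have hgc : Continuous g := VectorFourier.fourierIntegral_continuous continuous_fourierChar
    (by exact hL.comp (continuous_snd.prodMk continuous_fst)) hf'
  have hgb : ∀ ξ, ‖g ξ‖ ≤ ∫ x, ‖(f x : ℂ)‖ := fun ξ =>
    VectorFourier.norm_fourierIntegral_le_integral_norm _ _ _ _ _
  refine ⟨g, _, ⟨fun φ => ?_, fun φ => ?_, fun φ => ?_⟩, hgb⟩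
  · exact hf'.bdd_mul φ.continuous.aestronglyMeasurable
      (Eventually.of_forall fun x => φ.toBoundedContinuousFunction.norm_coe_le_norm x)
  · exact (φ.integrable.mul_bdd hgc.aestronglyMeasurable (Eventually.of_forall hgb))
  · have := VectorFourier.integral_fourierIntegral_smul_eq_flip (μ := volume) (ν := volume)
      continuous_fourierChar hL φ.integrable hf'
    simpa only [smul_eq_mul] using! this

/-- Integrable functions have finite Sobolev norms of negative order above the critical one. -/
lemma sobolevNorm_lt_top_of_neg (hf : Integrable f) (hf' : MemLp f 2)
    (hs : -3 / 2 < s) (hs' : s < 0) : sobolevNorm s f < ⊤ := by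
  obtain ⟨g, hg, hfg, -⟩ := exists_isFourierTransformOf hf'
  obtain ⟨g₀, C, hfg₀, hC⟩ := exists_bounded_isFourierTransformOf hf
  have hgC : ∀ᵐ ξ, ‖g ξ‖ ≤ C := by
    filter_upwards [hfg.ae_eq hfg₀] with ξ h
    rw [h]; exact hC ξ
  refine (sobolevNorm_le hfg s).trans_lt ?_
  have hm := aestronglyMeasurable_weight s hg.1
  have hC0 : 0 ≤ C := (norm_nonneg _).trans (hC 0)
  have hpi := pi_gt_three
  have hin : Integrable (fun ξ : Space => ‖((2 * π * ‖ξ‖) ^ s : ℝ) • g ξ‖ ^ 2) := by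
    rw [← integrableOn_univ, ← Set.union_compl_self (ball (0 : Space) 1)]
    refine IntegrableOn.union ?_ ?_
    · refine integrableOn_ball_of_norm_le_rpow (C := (2 * π) ^ (2 * s) * C ^ 2) (α := -(2 * s))
        (by simp) (by simp; linarith) (ae_restrict_of_ae ?_) (hm.norm.pow 2)
      filter_upwards [hgC] with ξ h
      rw [norm_of_nonneg (by positivity), norm_smul, norm_of_nonneg (by positivity), mul_pow,
        neg_neg, mul_rpow (by positivity) (norm_nonneg _), mul_pow, ← rpow_natCast,
        ← rpow_natCast (‖ξ‖ ^ s), ← rpow_mul (by positivity),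
        ← rpow_mul (by positivity)]
      rw [show s * ((2 : ℕ) : ℝ) = 2 * s by push_cast; ring]
      calc (2 * π) ^ (2 * s) * ‖ξ‖ ^ (2 * s) * ‖g ξ‖ ^ 2 ≤
            (2 * π) ^ (2 * s) * ‖ξ‖ ^ (2 * s) * C ^ 2 := by gcongr
        _ = _ := by ring
    · refine ((hg.norm.integrable_sq).integrableOn (s := (ball 0 1)ᶜ)).mono'
        (hm.norm.pow 2).restrict ?_
      refine (ae_restrict_iff' measurableSet_ball.compl).2 (Eventually.of_forall fun ξ hξ => ?_)
      have h1 : 1 ≤ ‖ξ‖ := by simpa using hξ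
      rw [norm_of_nonneg (by positivity), norm_smul, norm_of_nonneg (by positivity), mul_pow]
      have : (2 * π * ‖ξ‖) ^ s ≤ 1 := rpow_le_one_of_one_le_of_nonpos (by nlinarith) hs'.le
      have h0 : 0 ≤ (2 * π * ‖ξ‖) ^ s := by positivity
      exact mul_le_of_le_one_left (by positivity) (pow_le_one₀ h0 this)
  exact ((memLp_two_iff_integrable_sq_norm hm).2 hin).2

lemma sobolevNorm_lt_top_of_weight_sq (hU : IsOpen U) (hU' : Icc 0 1 ⊆ U) (hK : ContDiffOn ℝ ∞ K U)
    (hC : ∀ w ∈ Icc 0 1, |K w| ≤ C * w ^ 2) (hs : -3 / 2 < s) :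
    sobolevNorm s (fun x => K (weight x)) < ⊤ := by
  have hC' : ∀ w ∈ Icc 0 1, |K w| ≤ C * w := fun w hw => by
    have hC0 : 0 ≤ C := by simpa using (abs_nonneg _).trans (hC 1 (by norm_num))
    refine (hC w hw).trans (mul_le_mul_of_nonneg_left ?_ hC0)
    nlinarith [hw.1, hw.2]
  rcases le_or_gt 0 s with h | h
  · exact sobolevNorm_lt_top_of_nonneg hU hU' hK hC' h
  · have hc := continuous_comp_weight hU' hK.continuousOn
    refine sobolevNorm_lt_top_of_neg ?_ (memLp_of_le_weight hc fun x => hC' _ (weight_mem x)) hs h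
    exact (integrable_weight_sq.const_mul C).mono' hc.aestronglyMeasurable
      (Eventually.of_forall fun x => hC _ (weight_mem x))

end Compactified

end

section Compactification

variable {φ ψ : ℝ → ℝ} {A B X Y t : ℝ}

/-- `w (1 - t² + r² + 2 i t)` as a function of `w = 1 / (1 + r²)`. -/
def compactPoint (t w : ℝ) : ℂ := ⟨1 - w * t ^ 2, 2 * (w * t)⟩

lemma contDiff_compactPoint (t : ℝ) : ContDiff ℝ ∞ (compactPoint t) := by
  have h1 : ContDiff ℝ ∞ fun w : ℝ => ((1 - w * t ^ 2 : ℝ) : ℂ) := ofRealCLM.contDiff.comp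
      (by fun_prop : ContDiff ℝ ∞ fun w : ℝ => 1 - w * t ^ 2)
  have h2 : ContDiff ℝ ∞ fun w : ℝ => ((2 * (w * t) : ℝ) : ℂ) :=
    ofRealCLM.contDiff.comp (by fun_prop : ContDiff ℝ ∞ fun w : ℝ => 2 * (w * t))
  have := h1.add (h2.mul (contDiff_const (c := I)))
  simpa only [← Complex.mk_eq_add_mul_I] using! this

lemma compactPoint_inv (t : ℝ) {ρ : ℝ} (hρ : 0 ≤ ρ) :
    compactPoint t (1 + ρ)⁻¹ = ((1 + ρ)⁻¹ : ℝ) * (⟨1 - t ^ 2 + ρ, 2 * t⟩ : ℂ) := by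
  have h : 1 + ρ ≠ 0 := by positivity
  apply Complex.ext
  · rw [Complex.re_ofReal_mul, compactPoint]; simp only; field_simp; ring
  · rw [Complex.im_ofReal_mul, compactPoint]; simp only; ring

lemma arg_compactPoint_inv (t : ℝ) {ρ : ℝ} (hρ : 0 ≤ ρ) :
    arg (compactPoint t (1 + ρ)⁻¹) = conformalTime t ρ := by
  rw [compactPoint_inv t hρ, Complex.arg_real_mul _ (by positivity), conformalTime]

lemma compactPoint_inv_mem_slitPlane (t : ℝ) {ρ : ℝ} (hρ : 0 ≤ ρ) :
    compactPoint t (1 + ρ)⁻¹ ∈ slitPlane := by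
  have h := mem_slitPlane (t := t) (ρ := ρ) (by linarith)
  rw [Complex.mem_slitPlane_iff_arg] at h ⊢; rw [arg_compactPoint_inv t hρ]
  refine ⟨h.1, ?_⟩
  rw [compactPoint_inv t hρ]
  exact mul_ne_zero (by exact_mod_cast (by positivity : (1 + ρ)⁻¹ ≠ 0)) h.2

lemma normSq_compactPoint_inv (t : ℝ) {ρ : ℝ} (hρ : 0 ≤ ρ) :
    (√(normSq (compactPoint t (1 + ρ)⁻¹)))⁻¹ = (1 + ρ) * (√(conformalSq t ρ))⁻¹ := by
  rw [compactPoint_inv t hρ, map_mul, Complex.normSq_ofReal, Complex.normSq_mk, sqrt_mul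
    (by positivity), sqrt_mul_self (by positivity), mul_inv, inv_inv]
  congr 3
  rw [conformalSq]; ring

/-- The values of `w` at which the compactified solution is regular at time `t`. -/
def compactDomain (A B t : ℝ) : Set ℝ := (compactPoint t ⁻¹' slitPlane) ∩
    (fun w => arg (compactPoint t w)) ⁻¹' Ioo (-A) B

lemma contDiffOn_arg_compactPoint (t : ℝ) :
    ContDiffOn ℝ ∞ (fun w => arg (compactPoint t w)) (compactPoint t ⁻¹' slitPlane) := fun w hw => by
  have h2 : ContDiffAt ℝ ∞ Complex.log (compactPoint t w) :=
    (Complex.contDiffAt_log hw).restrict_scalars ℝ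
  have h3 := imCLM.contDiff.contDiffAt.comp w (h2.comp w (contDiff_compactPoint t).contDiffAt)
  refine (h3.congr_of_eventuallyEq (Eventually.of_forall fun q => ?_)).contDiffWithinAt
  simp [Complex.log_im]

lemma isOpen_compactDomain (A B t : ℝ) : IsOpen (compactDomain A B t) :=
  (contDiffOn_arg_compactPoint t).continuousOn.isOpen_inter_preimage
    (Complex.isOpen_slitPlane.preimage (contDiff_compactPoint t).continuous) isOpen_Ioo

namespace Profile

lemma Icc_subset_compactDomain (h : Profile X Y A B φ ψ) (h1 : -lifespan A < (t : EReal))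
    (h2 : (t : EReal) < lifespan B) : Icc 0 1 ⊆ compactDomain A B t := fun w hw => by
  rcases hw.1.eq_or_lt with rfl | h0
  · have e : compactPoint t 0 = 1 := by apply Complex.ext <;> simp [compactPoint]
    refine ⟨?_, ?_⟩
    · rw [Set.mem_preimage, e]; exact Complex.one_mem_slitPlane
    · rw [Set.mem_preimage, e, Complex.arg_one]; exact ⟨by linarith [h.neg.1], h.pos.1⟩
  · obtain ⟨ρ, hρ, rfl⟩ : ∃ ρ : ℝ, 0 ≤ ρ ∧ w = (1 + ρ)⁻¹ :=
      ⟨w⁻¹ - 1, by linarith [one_le_inv₀ h0 |>.2 hw.2], by simp⟩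
    refine ⟨compactPoint_inv_mem_slitPlane t hρ, ?_⟩
    rw [Set.mem_preimage, arg_compactPoint_inv t hρ]; exact h.mem h1 h2 hρ

lemma pairNorm_sol_lt_top (h : Profile X Y A B φ ψ) (h1 : -lifespan A < (t : EReal))
    (h2 : (t : EReal) < lifespan B) {s : ℝ} (hs : 1 / 2 ≤ s) :
    pairNorm s (sol φ t) (timeDeriv (sol φ) t) < ⊤ := by
  have hU := isOpen_compactDomain A B t
  have hU' := h.Icc_subset_compactDomain h1 h2
  set U := compactDomain A B t
  set τ : ℝ → ℝ := fun w => arg (compactPoint t w) with hτ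
  set M : ℝ → ℝ := fun w => (√(normSq (compactPoint t w)))⁻¹ with hM
  have hτs : ContDiffOn ℝ ∞ τ U := (contDiffOn_arg_compactPoint t).mono inter_subset_left
  have hMs : ContDiffOn ℝ ∞ M U := fun w hw => by
    have h0 : 0 < normSq (compactPoint t w) := Complex.normSq_pos.2 (Complex.slitPlane_ne_zero hw.1)
    have hn : ContDiff ℝ ∞ fun w => normSq (compactPoint t w) := by
      simp only [Complex.normSq_apply, compactPoint]
      fun_prop
    exact ((hn.contDiffAt.sqrt h0.ne').inv (sqrt_pos.2 h0).ne').contDiffWithinAt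
  have hφ : ContDiffOn ℝ ∞ (fun w => φ (τ w)) U := h.contDiffOn.1.comp hτs fun w hw => hw.2
  have hψ : ContDiffOn ℝ ∞ (fun w => ψ (τ w)) U := h.contDiffOn.2.comp hτs fun w hw => hw.2
  have hP : ContDiffOn ℝ ∞ (fun w => 2 * M w * φ (τ w)) U := (contDiffOn_const.mul hMs).mul hφ
  have hQ : ContDiffOn ℝ ∞ (fun w => M w ^ 3 * (-(4 * t * (w * (2 + t ^ 2) - 1)) * φ (τ w) +
      4 * (1 + w * t ^ 2) * ψ (τ w))) U :=
    (hMs.pow 3).mul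
      (((by fun_prop : ContDiff ℝ ∞ fun w : ℝ => -(4 * t * (w * (2 + t ^ 2) - 1))).contDiffOn.mul hφ).add
        ((by fun_prop : ContDiff ℝ ∞ fun w : ℝ => 4 * (1 + w * t ^ 2)).contDiffOn.mul hψ))
  obtain ⟨C₁, hC₁⟩ := isCompact_Icc.exists_bound_of_continuousOn (hP.continuousOn.mono hU')
  obtain ⟨C₂, hC₂⟩ := isCompact_Icc.exists_bound_of_continuousOn (hQ.continuousOn.mono hU')
  have e1 : sol φ t = fun x => weight x * (2 * M (weight x) * φ (τ (weight x))) := by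
    ext x
    have hx : (1 : ℝ) + ‖x‖ ^ 2 ≠ 0 := by positivity
    simp only [hM, hτ, weight, arg_compactPoint_inv t (sq_nonneg ‖x‖),
      normSq_compactPoint_inv t (sq_nonneg ‖x‖)]
    rw [sol, radialSol]; field_simp
  have e2 : timeDeriv (sol φ) t = fun x => weight x ^ 2 * (M (weight x) ^ 3 *
      (-(4 * t * (weight x * (2 + t ^ 2) - 1)) * φ (τ (weight x)) +
      4 * (1 + weight x * t ^ 2) * ψ (τ (weight x)))) := by
    ext x
    have hx : (1 : ℝ) + ‖x‖ ^ 2 ≠ 0 := by positivity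
    rw [h.timeDeriv_sol h1 h2]
    simp only [hM, hτ, weight, arg_compactPoint_inv t (sq_nonneg ‖x‖),
      normSq_compactPoint_inv t (sq_nonneg ‖x‖)]
    rw [radialSolTime]; field_simp; ring
  refine (pairNorm_le s _ _).trans_lt (ENNReal.add_lt_top.2 ⟨?_, ?_⟩)
  · rw [e1]
    exact sobolevNorm_lt_top_of_nonneg (K := fun w => w * (2 * M w * φ (τ w))) hU hU'
      (contDiffOn_id.mul hP) (C := C₁)
      (fun w hw => by
        rw [abs_mul, abs_of_nonneg hw.1, mul_comm]
        exact mul_le_mul_of_nonneg_right (hC₁ w hw) hw.1) (by linarith)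
  · rw [e2]
    exact sobolevNorm_lt_top_of_weight_sq (K := fun w => w ^ 2 * (M w ^ 3 *
      (-(4 * t * (w * (2 + t ^ 2) - 1)) * φ (τ w) + 4 * (1 + w * t ^ 2) * ψ (τ w)))) hU hU'
      ((contDiffOn_id.pow 2).mul hQ) (C := C₂)
      (fun w hw => by
        rw [abs_mul, abs_of_nonneg (sq_nonneg w), mul_comm]
        exact mul_le_mul_of_nonneg_right (hC₂ w hw) (sq_nonneg w)) (by linarith)

end Profile

end Compactification

/-! ### Uniqueness of smooth solutions -/

/-- The time direction in space-time. -/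
def timeVec : ℝ × Space := (1, 0)

/-- The spatial directions in space-time. -/
def spaceVec (j : Fin 3) : ℝ × Space := (0, unitVec j)

section Derivatives

variable {D : ℝ × Space → ℝ} {S : Set (ℝ × Space)} {p : ℝ × Space}

lemma contDiffOn_fderiv_apply (hS : IsOpen S) (hD : ContDiffOn ℝ ∞ D S) (v : ℝ × Space) :
    ContDiffOn ℝ ∞ (fun p => fderiv ℝ D p v) S :=
  (hD.fderiv_of_isOpen hS (by simp)).clm_apply contDiffOn_const

lemma hasFDerivAt_of_contDiffOn (hS : IsOpen S) (hD : ContDiffOn ℝ ∞ D S) (hp : p ∈ S) :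
    HasFDerivAt D (fderiv ℝ D p) p :=
  ((hD.differentiableOn (by simp)).differentiableAt (hS.mem_nhds hp)).hasFDerivAt

lemma hasFDerivAt_fderiv_of_contDiffOn (hS : IsOpen S) (hD : ContDiffOn ℝ ∞ D S) (hp : p ∈ S) :
    HasFDerivAt (fderiv ℝ D) (fderiv ℝ (fderiv ℝ D) p) p :=
  (((hD.fderiv_of_isOpen (m := ∞) hS (by simp)).differentiableOn (by simp)).differentiableAt
    (hS.mem_nhds hp)).hasFDerivAt

lemma fderiv_fderiv_apply (hS : IsOpen S) (hD : ContDiffOn ℝ ∞ D S) (hp : p ∈ S) (v w : ℝ × Space) :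
    fderiv ℝ (fun p => fderiv ℝ D p v) p w = fderiv ℝ (fderiv ℝ D) p w v := by
  have h := (hasFDerivAt_fderiv_of_contDiffOn hS hD hp).clm_apply (hasFDerivAt_const v p)
  rw [h.fderiv]; simp

lemma fderiv_fderiv_comm (hS : IsOpen S) (hD : ContDiffOn ℝ ∞ D S) (hp : p ∈ S) (v w : ℝ × Space) :
    fderiv ℝ (fun p => fderiv ℝ D p v) p w = fderiv ℝ (fun p => fderiv ℝ D p w) p v := by
  rw [fderiv_fderiv_apply hS hD hp, fderiv_fderiv_apply hS hD hp]
  exact ((hD.contDiffAt (hS.mem_nhds hp)).isSymmSndFDerivAt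
    (by simp only [minSmoothness_of_isRCLikeNormedField]; exact WithTop.coe_le_coe.2 (le_top (a := (2 : ℕ∞))))) w v

lemma hasDerivAt_time (hS : IsOpen S) (hD : ContDiffOn ℝ ∞ D S) {t : ℝ} {x : Space}
    (hp : (t, x) ∈ S) : HasDerivAt (fun τ => D (τ, x)) (fderiv ℝ D (t, x) timeVec) t :=
  (hasFDerivAt_of_contDiffOn hS hD hp).comp_hasDerivAt t
    ((hasDerivAt_id t).prodMk (hasDerivAt_const t x))

lemma hasFDerivAt_space (hS : IsOpen S) (hD : ContDiffOn ℝ ∞ D S) {t : ℝ} {x : Space}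
    (hp : (t, x) ∈ S) : HasFDerivAt (fun y => D (t, y))
      ((fderiv ℝ D (t, x)).comp (ContinuousLinearMap.inr ℝ ℝ Space)) x :=
  (hasFDerivAt_of_contDiffOn hS hD hp).comp x ((hasFDerivAt_const t x).prodMk (hasFDerivAt_id x))

lemma waveOp_eq (hS : IsOpen S) (hD : ContDiffOn ℝ ∞ D S) {t : ℝ} {x : Space}
    (hp : (t, x) ∈ S) : waveOp (fun t x => D (t, x)) t x =
      fderiv ℝ (fun p => fderiv ℝ D p timeVec) (t, x) timeVec -
        ∑ j, fderiv ℝ (fun p => fderiv ℝ D p (spaceVec j)) (t, x) (spaceVec j) := by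
  rw [waveOp]
  congr 1
  · rw [iteratedDeriv_succ, iteratedDeriv_one]
    have hev : ∀ᶠ τ in 𝓝 t, (τ, x) ∈ S :=
      (Continuous.prodMk_left x).continuousAt.eventually_mem (hS.mem_nhds hp)
    have : deriv (fun τ => D (τ, x)) =ᶠ[𝓝 t] fun τ => fderiv ℝ D (τ, x) timeVec := by
      filter_upwards [hev] with τ hτ using (hasDerivAt_time hS hD hτ).deriv
    rw [this.deriv_eq]
    exact (hasDerivAt_time hS (contDiffOn_fderiv_apply hS hD timeVec) hp).deriv
  · have hev : ∀ᶠ y in 𝓝 x, (t, y) ∈ S :=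
      (Continuous.prodMk_right t).continuousAt.eventually_mem (hS.mem_nhds hp)
    have h2 : HasFDerivAt (fun y => (fderiv ℝ D (t, y)).comp (ContinuousLinearMap.inr ℝ ℝ Space))
        _ x :=
      (((hasFDerivAt_fderiv_of_contDiffOn hS hD hp).comp x
        ((hasFDerivAt_const t x).prodMk (hasFDerivAt_id x))).clm_comp
          (hasFDerivAt_const (ContinuousLinearMap.inr ℝ ℝ Space) x))
    rw [laplacian_eq_sum (hev.mono fun y hy => hasFDerivAt_space hS hD hy) h2]
    refine sum_congr rfl fun j _ => ?_
    rw [fderiv_fderiv_apply hS hD hp]; simp [spaceVec]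

end Derivatives

/-- Differentiation under the integral sign for functions supported in a fixed compact set. -/
lemma hasDerivAt_integral_of_isCompact {F F' : ℝ → Space → ℝ} {a b t : ℝ} {K : Set Space}
    (hK : IsCompact K) (ht : t ∈ Ioo a b) (hF : ∀ τ ∈ Ioo a b, Continuous (F τ))
    (hF' : ContinuousOn (fun p : ℝ × Space => F' p.1 p.2) (Prod.fst ⁻¹' Ioo a b))
    (hd : ∀ τ ∈ Ioo a b, ∀ x, HasDerivAt (fun τ => F τ x) (F' τ x) τ)
    (h0 : ∀ τ ∈ Ioo a b, ∀ x ∉ K, F τ x = 0) (h0' : ∀ τ ∈ Ioo a b, ∀ x ∉ K, F' τ x = 0) :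
    HasDerivAt (fun τ => ∫ x, F τ x) (∫ x, F' t x) t := by
  obtain ⟨ε, hε, hsub⟩ := Metric.isOpen_iff.1 isOpen_Ioo t ht
  have hcl : closedBall t (ε / 2) ⊆ Ioo a b :=
    (Metric.closedBall_subset_ball (by linarith)).trans hsub
  obtain ⟨C, hC⟩ := ((isCompact_closedBall t (ε / 2)).prod hK).exists_bound_of_continuousOn
    (hF'.mono fun p hp => hcl hp.1)
  have hcont' : ∀ τ ∈ Ioo a b, Continuous (F' τ) := fun τ hτ =>
    hF'.comp_continuous (Continuous.prodMk_right τ) fun _ => hτ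
  refine (hasDerivAt_integral_of_dominated_loc_of_deriv_le (F := F) (F' := F')
    (bound := K.indicator fun _ => C) (Metric.ball_mem_nhds t (half_pos hε)) ?_ ?_
    (hcont' t ht).aestronglyMeasurable ?_ ?_ ?_).2
  · filter_upwards [isOpen_Ioo.mem_nhds ht] with τ hτ using (hF τ hτ).aestronglyMeasurable
  · exact (hF t ht).integrable_of_hasCompactSupport (HasCompactSupport.intro hK fun x hx => h0 t ht x hx)
  · refine Eventually.of_forall fun x τ hτ => ?_
    have hτ' := Metric.ball_subset_closedBall hτ
    by_cases hx : x ∈ K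
    · rw [indicator_of_mem hx]; exact hC (τ, x) ⟨hτ', hx⟩
    · rw [indicator_of_notMem hx, h0' τ (hcl hτ') x hx, norm_zero]
  · exact (integrable_indicator_iff hK.measurableSet).2 (integrableOn_const (hK.measure_lt_top.ne))
  · exact Eventually.of_forall fun x τ hτ => hd τ (hcl (Metric.ball_subset_closedBall hτ)) x

lemma integral_fderiv_apply_eq_zero {J : Space → ℝ} (hJ : ContDiff ℝ 1 J) (hc : HasCompactSupport J)
    (e : Space) : ∫ x, fderiv ℝ J x e = 0 := by
  have h1 : Continuous fun x => fderiv ℝ J x e := (hJ.continuous_fderiv (by simp)).clm_apply continuous_const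
  have h2 : HasCompactSupport fun x => fderiv ℝ J x e := hc.fderiv_apply (𝕜 := ℝ) e
  have := integral_mul_fderiv_eq_neg_fderiv_mul_of_integrable (μ := (volume : Measure Space)) (𝕜 := ℝ)
    (f := fun _ => (1 : ℝ)) (g := J) (v := e) (by simp)
    (by simpa using h1.integrable_of_hasCompactSupport h2)
    (by simpa using hJ.continuous.integrable_of_hasCompactSupport hc)
    (fun x _ => differentiableAt_const _) (fun x _ => (hJ.differentiable (by simp)) x)
  simpa using this

/-- The smooth cutoff to a backward light cone with vertex near `x₁`. -/
def coneCutoff (M : ℝ) (x₁ : Space) (p : ℝ × Space) : ℝ :=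
  expNegInvGlue (M - p.1 - √(1 + ‖p.2 - x₁‖ ^ 2))

lemma contDiff_coneCutoff (M : ℝ) (x₁ : Space) : ContDiff ℝ ∞ (coneCutoff M x₁) := by
  unfold coneCutoff
  have h1 : ContDiff ℝ ∞ fun p : ℝ × Space => 1 + ‖p.2 - x₁‖ ^ 2 :=
    contDiff_const.add ((contDiff_snd.sub contDiff_const).norm_sq ℝ)
  exact (expNegInvGlue.contDiff (n := ⊤)).comp
    ((contDiff_const.sub contDiff_fst).sub (h1.sqrt fun p => by positivity))

lemma exists_fderiv_coneCutoff (M : ℝ) (x₁ : Space) (p : ℝ × Space) :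
    ∃ c : ℝ, 0 ≤ c ∧ ∃ o : Fin 3 → ℝ, (∑ j, o j ^ 2 ≤ 1) ∧
      fderiv ℝ (coneCutoff M x₁) p timeVec = -c ∧
      ∀ j, fderiv ℝ (coneCutoff M x₁) p (spaceVec j) = -(c * o j) := by
  have h0 : 0 < 1 + ‖p.2 - x₁‖ ^ 2 := by positivity
  have hE : HasDerivAt expNegInvGlue (deriv expNegInvGlue (M - p.1 - √(1 + ‖p.2 - x₁‖ ^ 2)))
      (M - p.1 - √(1 + ‖p.2 - x₁‖ ^ 2)) :=
    (((expNegInvGlue.contDiff (n := ⊤)).differentiable (by simp)) _).hasDerivAt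
  have h1 : HasFDerivAt (fun p : ℝ × Space => p.2 - x₁) (ContinuousLinearMap.snd ℝ ℝ Space) p :=
    hasFDerivAt_snd.sub_const x₁
  have h2 := ((hasFDerivAt_norm_sq (p.2 - x₁)).comp p h1).const_add 1
  have h3 : HasFDerivAt (fun p : ℝ × Space => √(1 + ‖p.2 - x₁‖ ^ 2)) _ p := h2.sqrt h0.ne'
  have h4 : HasFDerivAt (coneCutoff M x₁) _ p :=
    hE.comp_hasFDerivAt p ((hasFDerivAt_fst.const_sub M).sub h3)
  refine ⟨_, expNegInvGlue.monotone.deriv_nonneg (x := M - p.1 - √(1 + ‖p.2 - x₁‖ ^ 2)),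
    fun j => (√(1 + ‖p.2 - x₁‖ ^ 2))⁻¹ * (p.2 - x₁) j, ?_, ?_, fun j => ?_⟩
  · simp only [mul_pow]
    rw [← mul_sum, ← EuclideanSpace.real_norm_sq_eq, inv_pow, sq_sqrt h0.le, inv_mul_le_iff₀ h0]
    linarith
  · rw [h4.fderiv]; simp [timeVec]
  · rw [h4.fderiv]; simp [spaceVec, unitVec, EuclideanSpace.inner_single_right]
    left
    ring

lemma coneCutoff_eq_zero {M : ℝ} {x₁ : Space} {p : ℝ × Space} (h : M - p.1 ≤ ‖p.2 - x₁‖) :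
    coneCutoff M x₁ p = 0 := by
  refine expNegInvGlue.zero_of_nonpos ?_
  have : ‖p.2 - x₁‖ ≤ √(1 + ‖p.2 - x₁‖ ^ 2) := le_sqrt_of_sq_le (by linarith)
  linarith

/-- The energy identity in divergence form, for the energy density multiplied by a cutoff `X`. -/
lemma energy_density_le {D X : ℝ × Space → ℝ} {S : Set (ℝ × Space)} (hS : IsOpen S)
    (hD : ContDiffOn ℝ ∞ D S) (hX : ContDiff ℝ ∞ X) {V C : ℝ} {p : ℝ × Space} (hp : p ∈ S)
    (heq : fderiv ℝ (fun p => fderiv ℝ D p timeVec) p timeVec -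
      ∑ j, fderiv ℝ (fun p => fderiv ℝ D p (spaceVec j)) p (spaceVec j) = V * D p)
    (hX0 : 0 ≤ X p) (hC : X p ≠ 0 → |V| + 1 ≤ C)
    (hX' : ∃ c : ℝ, 0 ≤ c ∧ ∃ o : Fin 3 → ℝ, (∑ j, o j ^ 2 ≤ 1) ∧
      fderiv ℝ X p timeVec = -c ∧ ∀ j, fderiv ℝ X p (spaceVec j) = -(c * o j)) :
    fderiv ℝ (fun p => X p * ((fderiv ℝ D p timeVec ^ 2 + ∑ j, fderiv ℝ D p (spaceVec j) ^ 2 +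
        D p ^ 2) * (1 / 2))) p timeVec -
      ∑ j, fderiv ℝ (fun p => X p * (fderiv ℝ D p timeVec * fderiv ℝ D p (spaceVec j))) p (spaceVec j) ≤
    C * (X p * ((fderiv ℝ D p timeVec ^ 2 + ∑ j, fderiv ℝ D p (spaceVec j) ^ 2 + D p ^ 2) * (1 / 2))) := by
  obtain ⟨c, hc, o, ho, hXt, hXj⟩ := hX'
  have hX1 : HasFDerivAt X (fderiv ℝ X p) p := (hX.differentiable (by simp) p).hasFDerivAt
  have hD1 := hasFDerivAt_of_contDiffOn hS hD hp
  have ht := hasFDerivAt_of_contDiffOn hS (contDiffOn_fderiv_apply hS hD timeVec) hp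
  have hj := fun j => hasFDerivAt_of_contDiffOn hS (contDiffOn_fderiv_apply hS hD (spaceVec j)) hp
  have hsym := fun j => fderiv_fderiv_comm hS hD hp timeVec (spaceVec j)
  have hJ : ∀ j, fderiv ℝ (fun p => X p * (fderiv ℝ D p timeVec * fderiv ℝ D p (spaceVec j))) p
      (spaceVec j) = _ := fun j => by rw [(hX1.fun_mul (ht.fun_mul (hj j))).fderiv]
  simp only [Fin.sum_univ_three] at *
  have hW : HasFDerivAt (fun p => X p * ((fderiv ℝ D p timeVec ^ 2 + (fderiv ℝ D p (spaceVec 0) ^ 2 +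
      fderiv ℝ D p (spaceVec 1) ^ 2 + fderiv ℝ D p (spaceVec 2) ^ 2) + D p ^ 2) * (1 / 2))) _ p :=
    hX1.fun_mul ((((ht.pow 2).fun_add ((((hj 0).pow 2).fun_add ((hj 1).pow 2)).fun_add
      ((hj 2).pow 2))).fun_add (hD1.pow 2)).mul_const (1 / 2))
  rw [hW.fderiv, hJ, hJ, hJ]
  simp only [add_apply, smul_apply, smul_eq_mul, Nat.reduceSub, pow_one, hXt, hXj, ← hsym]
  set a := fderiv ℝ D p timeVec
  set d := D p
  set b₀ := fderiv ℝ D p (spaceVec 0)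
  set b₁ := fderiv ℝ D p (spaceVec 1)
  set b₂ := fderiv ℝ D p (spaceVec 2)
  set e := (a ^ 2 + (b₀ ^ 2 + b₁ ^ 2 + b₂ ^ 2) + d ^ 2) * (1 / 2) with he
  have h1 : a * (o 0 * b₀ + o 1 * b₁ + o 2 * b₂) ≤ e := by
    have k1 : (o 0 * b₀ + o 1 * b₁ + o 2 * b₂) ^ 2 ≤ b₀ ^ 2 + b₁ ^ 2 + b₂ ^ 2 := by
      have : (o 0 * b₀ + o 1 * b₁ + o 2 * b₂) ^ 2 ≤
          (o 0 ^ 2 + o 1 ^ 2 + o 2 ^ 2) * (b₀ ^ 2 + b₁ ^ 2 + b₂ ^ 2) := by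
        nlinarith [sq_nonneg (o 0 * b₁ - o 1 * b₀), sq_nonneg (o 0 * b₂ - o 2 * b₀),
          sq_nonneg (o 1 * b₂ - o 2 * b₁)]
      refine this.trans (mul_le_of_le_one_left (by positivity) ho)
    nlinarith [sq_nonneg (a - (o 0 * b₀ + o 1 * b₁ + o 2 * b₂)), sq_nonneg d]
  have h2 : X p * ((V + 1) * (d * a)) ≤ C * (X p * e) := by
    rcases eq_or_ne (X p) 0 with h0 | h0
    · simp [h0]
    · have k1 := hC h0
      have k2 : |d * a| ≤ e := by
        rw [abs_le]
        constructor <;> nlinarith [sq_nonneg (d - a), sq_nonneg (d + a), sq_nonneg b₀, sq_nonneg b₁,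
          sq_nonneg b₂]
      have k3 : (V + 1) * (d * a) ≤ C * e := by
        refine (le_abs_self _).trans ?_
        rw [abs_mul]
        refine mul_le_mul ((abs_add_le V 1).trans (by simpa using k1)) k2 (abs_nonneg _) ?_
        linarith [abs_nonneg V]
      calc X p * ((V + 1) * (d * a)) ≤ X p * (C * e) := mul_le_mul_of_nonneg_left k3 hX0
        _ = _ := by ring
  have h3 := mul_le_mul_of_nonneg_left h1 hc
  have h4 : X p * ((V + 1) * (d * a)) - (c * e - c * (a * (o 0 * b₀ + o 1 * b₁ + o 2 * b₂))) ≤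
      C * (X p * e) := by linarith
  refine le_trans (le_of_eq ?_) h4
  rw [sub_eq_iff_eq_add] at heq; rw [heq, he]; simp only [nsmul_eq_mul, Nat.cast_ofNat]
  ring

/-- Uniqueness forward in time for linear wave equations with a potential. -/
lemma eq_zero_of_wave {D V : ℝ × Space → ℝ} {a b : ℝ} (ha : a < 0)
    (hD : ContDiffOn ℝ ∞ D (Prod.fst ⁻¹' Ioo a b)) (hV : ContinuousOn V (Prod.fst ⁻¹' Ioo a b))
    (heq : ∀ p ∈ Prod.fst ⁻¹' Ioo a b, fderiv ℝ (fun p => fderiv ℝ D p timeVec) p timeVec -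
      ∑ j, fderiv ℝ (fun p => fderiv ℝ D p (spaceVec j)) p (spaceVec j) = V p * D p)
    (h0 : ∀ x, D (0, x) = 0) (h0' : ∀ x, fderiv ℝ D (0, x) timeVec = 0) {t₁ : ℝ} (ht₁ : 0 ≤ t₁)
    (ht₁' : t₁ < b) (x₁ : Space) : D (t₁, x₁) = 0 := by
  rcases ht₁.eq_or_lt with rfl | ht₁0
  · exact h0 x₁
  set S : Set (ℝ × Space) := Prod.fst ⁻¹' Ioo a b
  have hS : IsOpen S := isOpen_Ioo.preimage continuous_fst
  set X := coneCutoff (t₁ + 2) x₁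
  have hX : ContDiff ℝ ∞ X := contDiff_coneCutoff _ _
  have hX0 : ∀ p, 0 ≤ X p := fun p => expNegInvGlue.nonneg _
  set K := closedBall x₁ (t₁ + 2 - a) with hKdef
  have hK : IsCompact K := isCompact_closedBall _ _
  have hXK : ∀ τ ∈ Ioo a b, ∀ x ∉ K, X (τ, x) = 0 := fun τ hτ x hx => by
    refine coneCutoff_eq_zero ?_
    rw [hKdef, Metric.mem_closedBall, not_le, dist_eq_norm] at hx; simp only
    linarith [hτ.1]
  set e : ℝ × Space → ℝ := fun p => (fderiv ℝ D p timeVec ^ 2 +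
    ∑ j, fderiv ℝ D p (spaceVec j) ^ 2 + D p ^ 2) * (1 / 2) with hedef
  have he : ContDiffOn ℝ ∞ e S := ((((contDiffOn_fderiv_apply hS hD timeVec).pow 2).add
      (ContDiffOn.sum fun j _ => (contDiffOn_fderiv_apply hS hD (spaceVec j)).pow 2)).add
        (hD.pow 2)).mul contDiffOn_const
  have he0 : ∀ p, 0 ≤ e p := fun p => by simp only [hedef]; positivity
  set W : ℝ × Space → ℝ := fun p => X p * e p with hWdef
  have hW : ContDiffOn ℝ ∞ W S := hX.contDiffOn.mul he
  set J : Fin 3 → ℝ × Space → ℝ := fun j p =>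
    X p * (fderiv ℝ D p timeVec * fderiv ℝ D p (spaceVec j)) with hJdef
  have hJ : ∀ j, ContDiffOn ℝ ∞ (J j) S := fun j => hX.contDiffOn.mul
    ((contDiffOn_fderiv_apply hS hD timeVec).mul (contDiffOn_fderiv_apply hS hD (spaceVec j)))
  have hslice : ∀ {G : ℝ × Space → ℝ}, ContDiffOn ℝ ∞ G S → ∀ τ ∈ Ioo a b,
      ContDiff ℝ ∞ fun x => G (τ, x) := fun hG τ hτ =>
    hG.comp_contDiff (contDiff_const.prodMk contDiff_id) fun x => hτ
  have hcs : ∀ {G : Space → ℝ}, (∀ x ∉ K, G x = 0) → HasCompactSupport G := fun h =>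
    HasCompactSupport.intro hK fun x hx => h x hx
  have hW' : ContinuousOn (fun p => fderiv ℝ W p timeVec) S :=
    (contDiffOn_fderiv_apply hS hW timeVec).continuousOn
  have hWK : ∀ τ ∈ Ioo a b, ∀ x ∉ K, W (τ, x) = 0 := fun τ hτ x hx => by
    simp only [hWdef, hXK τ hτ x hx, zero_mul]
  have hWK' : ∀ τ ∈ Ioo a b, ∀ x ∉ K, fderiv ℝ W (τ, x) timeVec = 0 := fun τ hτ x hx => by
    refine (hasDerivAt_time hS hW (show (τ, x) ∈ S from hτ)).unique ?_
    refine (hasDerivAt_const τ (0 : ℝ)).congr_of_eventuallyEq ?_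
    filter_upwards [isOpen_Ioo.mem_nhds hτ] with σ hσ using hWK σ hσ x hx
  have hE : ∀ τ ∈ Ioo a b, HasDerivAt (fun τ => ∫ x, W (τ, x)) (∫ x, fderiv ℝ W (τ, x) timeVec) τ :=
    fun τ hτ => hasDerivAt_integral_of_isCompact (F := fun τ x => W (τ, x)) hK hτ
      (fun σ hσ => (hslice hW σ hσ).continuous) hW'
      (fun σ hσ x => hasDerivAt_time hS hW (show (σ, x) ∈ S from hσ)) hWK hWK'
  have hJint : ∀ τ ∈ Ioo a b, ∀ j, Integrable (fun x => fderiv ℝ (J j) (τ, x) (spaceVec j)) ∧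
      ∫ x, fderiv ℝ (J j) (τ, x) (spaceVec j) = 0 := fun τ hτ j => by
    have h1 : (fun x => fderiv ℝ (J j) (τ, x) (spaceVec j)) =
        fun x => fderiv ℝ (fun y => J j (τ, y)) x (unitVec j) := by
      ext x; rw [(hasFDerivAt_space hS (hJ j) (show (τ, x) ∈ S from hτ)).fderiv]
      simp [spaceVec]
    have h2 : ContDiff ℝ 1 fun x => J j (τ, x) := (hslice (hJ j) τ hτ).of_le (by simp)
    have h3 : HasCompactSupport fun x => J j (τ, x) :=
      hcs fun x hx => by simp only [hJdef, hXK τ hτ x hx, zero_mul]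
    rw [h1]
    exact ⟨((h2.continuous_fderiv (by simp)).clm_apply continuous_const).integrable_of_hasCompactSupport
      (h3.fderiv_apply (𝕜 := ℝ) _), integral_fderiv_apply_eq_zero h2 h3 _⟩
  obtain ⟨C₀, hC₀⟩ := ((isCompact_Icc (a := (0 : ℝ)) (b := t₁)).prod hK).exists_bound_of_continuousOn
    (hV.mono fun p hp => ⟨ha.trans_le hp.1.1, hp.1.2.trans_lt ht₁'⟩)
  set C := C₀ + 1
  have hmem : ∀ τ ∈ Icc 0 t₁, τ ∈ Ioo a b := fun τ hτ => ⟨ha.trans_le hτ.1, hτ.2.trans_lt ht₁'⟩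
  have hEle : ∀ τ ∈ Icc 0 t₁, ∫ x, fderiv ℝ W (τ, x) timeVec ≤ C * ∫ x, W (τ, x) := fun τ hτ => by
    have hτ' := hmem τ hτ
    have hi1 : Integrable fun x => fderiv ℝ W (τ, x) timeVec :=
      (hW'.comp_continuous (Continuous.prodMk_right τ) fun x => hτ').integrable_of_hasCompactSupport
        (hcs fun x hx => hWK' τ hτ' x hx)
    have hi2 : Integrable fun x => ∑ j, fderiv ℝ (J j) (τ, x) (spaceVec j) :=
      integrable_finsetSum _ fun j _ => (hJint τ hτ' j).1
    have hi3 : Integrable fun x => W (τ, x) :=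
      (hslice hW τ hτ').continuous.integrable_of_hasCompactSupport (hcs fun x hx => hWK τ hτ' x hx)
    have e1 : ∫ x, fderiv ℝ W (τ, x) timeVec =
        ∫ x, (fderiv ℝ W (τ, x) timeVec - ∑ j, fderiv ℝ (J j) (τ, x) (spaceVec j)) := by
      rw [integral_sub hi1 hi2, integral_finsetSum _ fun j _ => (hJint τ hτ' j).1,
        Finset.sum_eq_zero fun j _ => (hJint τ hτ' j).2, sub_zero]
    rw [e1, ← integral_const_mul]
    refine integral_mono (hi1.sub hi2) (hi3.const_mul C) fun x => ?_
    refine energy_density_le hS hD hX (p := (τ, x)) hτ' (heq _ hτ') (hX0 _) (fun hne => ?_)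
      (exists_fderiv_coneCutoff _ _ _)
    have hx : x ∈ K := by
      by_contra hx
      exact hne (hXK τ hτ' x hx)
    have := hC₀ (τ, x) ⟨hτ, hx⟩
    rw [norm_eq_abs] at this; linarith
  have hgr : ∀ τ ∈ Icc 0 t₁, HasDerivAt (fun τ => -(exp (-C * τ) * ∫ x, W (τ, x)))
      (exp (-C * τ) * (C * (∫ x, W (τ, x)) - ∫ x, fderiv ℝ W (τ, x) timeVec)) τ := fun τ hτ => by
    refine ((((hasDerivAt_id τ).const_mul (-C)).exp).fun_mul (hE τ (hmem τ hτ))).fun_neg.congr_deriv ?_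
    simp only [id]; ring
  have hfin := le_of_hasDerivAt_nonneg ht₁ hgr fun τ hτ =>
      mul_nonneg (exp_nonneg _) (sub_nonneg.2 (hEle τ (Ioo_subset_Icc_self hτ)))
  have hW0 : ∀ x, W (0, x) = 0 := fun x => by
    have hg : ∀ j, fderiv ℝ D (0, x) (spaceVec j) = 0 := fun j => by
      have h1 := (hasFDerivAt_space hS hD (show ((0 : ℝ), x) ∈ S from hmem 0 ⟨le_rfl, ht₁⟩))
      simp only [h0] at h1
      have := congrArg (fun L => L (unitVec j)) (h1.unique (hasFDerivAt_const (0 : ℝ) x))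
      simpa [spaceVec] using this
    simp [hWdef, hedef, hg, h0, h0']
  simp only [hW0, integral_zero, mul_zero, neg_zero, Left.nonneg_neg_iff] at hfin
  have hle : ∫ x, W (t₁, x) ≤ 0 := by
    have := exp_pos (-C * t₁)
    by_contra! h
    nlinarith [mul_pos this h]
  have hmt := hmem t₁ ⟨ht₁, le_rfl⟩
  have hWz : W (t₁, x₁) = 0 := by
    by_contra hne
    have := (hslice hW t₁ hmt).continuous.integral_pos_of_hasCompactSupport_nonneg_nonzero
      (μ := volume) (hcs fun x hx => hWK t₁ hmt x hx) (fun x => mul_nonneg (hX0 _) (he0 _)) (x := x₁) hne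
    linarith
  have hXp : 0 < X (t₁, x₁) := by
    refine expNegInvGlue.pos_of_pos ?_
    simp
  have hez : e (t₁, x₁) = 0 := (mul_eq_zero.1 hWz).resolve_left hXp.ne'
  simp only [hedef, Fin.sum_univ_three] at hez
  nlinarith [sq_nonneg (fderiv ℝ D (t₁, x₁) timeVec), sq_nonneg (fderiv ℝ D (t₁, x₁) (spaceVec 0)),
    sq_nonneg (fderiv ℝ D (t₁, x₁) (spaceVec 1)), sq_nonneg (fderiv ℝ D (t₁, x₁) (spaceVec 2)),
    sq_nonneg (D (t₁, x₁))]

/-! ### The maximal solution -/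

section Uniqueness

variable {X Y t : ℝ} {a b a' b' : EReal} {u w : ℝ → Space → ℝ}

lemma waveOp_sub {S : Set (ℝ × Space)} (hS : IsOpen S)
    (hu : ContDiffOn ℝ ∞ (fun p : ℝ × Space => u p.1 p.2) S)
    (hw : ContDiffOn ℝ ∞ (fun p : ℝ × Space => w p.1 p.2) S) {x : Space} (hp : (t, x) ∈ S) :
    waveOp (fun t x => u t x - w t x) t x = waveOp u t x - waveOp w t x := by
  have h1 : ∀ {u : ℝ → Space → ℝ}, ContDiffOn ℝ ∞ (fun p : ℝ × Space => u p.1 p.2) S →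
      ContDiffAt ℝ 2 (fun τ => u τ x) t ∧ ContDiffAt ℝ 2 (u t) x := fun hu => by
    have h := (hu.contDiffAt (hS.mem_nhds hp)).of_le
      (m := 2) (WithTop.coe_le_coe.2 (le_top (a := (2 : ℕ∞))))
    exact ⟨h.comp t (contDiffAt_id.prodMk contDiffAt_const),
      h.comp x (contDiffAt_const.prodMk contDiffAt_id)⟩
  have e1 := iteratedDeriv_fun_sub (n := 2) (h1 hu).1 (h1 hw).1
  have e2 := (h1 hu).2.laplacian_sub (h1 hw).2
  rw [waveOp, waveOp, waveOp, e1, show (fun x => u t x - w t x) = u t - w t from rfl, e2]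
  ring

lemma IsSolution.eq_of_nonneg (hu : IsSolution X Y a b u) (hw : IsSolution X Y a' b' w) (ht : 0 ≤ t)
    (h1 : (t : EReal) < b) (h2 : (t : EReal) < b') (x : Space) : u t x = w t x := by
  obtain ⟨α, hα, hα0⟩ := EReal.lt_iff_exists_real_btwn.1 (max_lt hu.zero_mem.1 hw.zero_mem.1)
  obtain ⟨β, hβt, hβ⟩ := EReal.lt_iff_exists_real_btwn.1 (lt_min h1 h2)
  have hα0' : α < 0 := by exact_mod_cast hα0
  have hβt' : t < β := by exact_mod_cast hβt
  rw [max_lt_iff] at hα; rw [lt_min_iff] at hβ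
  have hI : ∀ τ ∈ Ioo α β, a < (τ : EReal) ∧ (τ : EReal) < b ∧ a' < (τ : EReal) ∧ (τ : EReal) < b' :=
    fun τ hτ => by
      have k1 : (α : EReal) < τ := by exact_mod_cast hτ.1
      have k2 : (τ : EReal) < β := by exact_mod_cast hτ.2
      exact ⟨hα.1.trans k1, k2.trans hβ.1, hα.2.trans k1, k2.trans hβ.2⟩
  set S : Set (ℝ × Space) := Prod.fst ⁻¹' Ioo α β
  have hS : IsOpen S := isOpen_Ioo.preimage continuous_fst
  have hus : ContDiffOn ℝ ∞ (fun p : ℝ × Space => u p.1 p.2) S :=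
    hu.smooth.mono fun p hp => ⟨(hI _ hp).1, (hI _ hp).2.1⟩
  have hws : ContDiffOn ℝ ∞ (fun p : ℝ × Space => w p.1 p.2) S :=
    hw.smooth.mono fun p hp => ⟨(hI _ hp).2.2.1, (hI _ hp).2.2.2⟩
  have hD : ContDiffOn ℝ ∞ (fun p : ℝ × Space => u p.1 p.2 - w p.1 p.2) S := hus.sub hws
  have h0S : ∀ x : Space, ((0 : ℝ), x) ∈ S := fun x => ⟨hα0', ht.trans_lt hβt'⟩
  have key := eq_zero_of_wave (V := fun p => u p.1 p.2 ^ 2 + u p.1 p.2 * w p.1 p.2 + w p.1 p.2 ^ 2)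
    hα0' hD (((hus.continuousOn.pow 2).add (hus.continuousOn.mul hws.continuousOn)).add
      (hws.continuousOn.pow 2)) (fun p hp => ?_) (fun x => ?_) (fun x => ?_) ht hβt' x
  · exact sub_eq_zero.1 key
  · have hp' := hI _ hp
    have e := waveOp_eq hS hD (t := p.1) (x := p.2) hp
    rw [waveOp_sub hS hus hws hp, hu.eqn _ hp'.1 hp'.2.1, hw.eqn _ hp'.2.2.1 hp'.2.2.2] at e
    rw [← e]; ring
  · simp only [hu.init, hw.init, sub_self]
  · have e := hasDerivAt_time hS hD (h0S x)
    have e1 := hu.init_deriv x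
    have e2 := hw.init_deriv x
    rw [timeDeriv] at e1 e2; rw [← e.deriv]
    have d1 := (hasDerivAt_time hS hus (h0S x)).differentiableAt
    have d2 := (hasDerivAt_time hS hws (h0S x)).differentiableAt
    have := deriv_fun_sub d1 d2
    rw [this, e1, e2, sub_self]

lemma IsSolution.reverse (hu : IsSolution X Y a b u) :
    IsSolution X (-Y) (-b) (-a) (fun t => u (-t)) where
  zero_mem := ⟨by simpa using hu.zero_mem.2, by simpa using hu.zero_mem.1⟩
  smooth := by
    have h1 : ContDiff ℝ ∞ fun p : ℝ × Space => (-p.1, p.2) := by fun_prop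
    refine hu.smooth.comp h1.contDiffOn fun p hp => ?_
    simp only [mem_ofPred_eq, EReal.coe_neg] at hp ⊢
    exact ⟨EReal.lt_neg_comm.1 hp.2, EReal.neg_lt_comm.1 hp.1⟩
  eqn := fun t h1 h2 x => by
    have := hu.eqn (-t) (by rw [EReal.coe_neg]; exact EReal.lt_neg_comm.1 h2)
      (by rw [EReal.coe_neg]; exact EReal.neg_lt_comm.1 h1) x
    rw [← this, waveOp, waveOp]
    congr 1
    have := iteratedDeriv_comp_neg 2 (fun τ => u τ x) t
    simpa using this
  init := by simpa using hu.init
  init_deriv := fun x => by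
    have h1 := hu.init_deriv x
    rw [timeDeriv] at h1 ⊢
    have := deriv_comp_neg (fun τ => u τ x) 0
    rw [neg_zero, h1] at this; rw [this]; ring

lemma IsSolution.eq (hu : IsSolution X Y a b u) (hw : IsSolution X Y a' b' w)
    (h1 : a < t) (h2 : (t : EReal) < b) (h3 : a' < t) (h4 : (t : EReal) < b') (x : Space) :
    u t x = w t x := by
  rcases le_total 0 t with ht | ht
  · exact hu.eq_of_nonneg hw ht h2 h4 x
  · have := hu.reverse.eq_of_nonneg hw.reverse (t := -t) (by linarith)
      (by rw [EReal.coe_neg]; exact EReal.neg_lt_neg_iff.2 h1)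
      (by rw [EReal.coe_neg]; exact EReal.neg_lt_neg_iff.2 h3) x
    simpa using this

end Uniqueness

section Maximality

variable {φ ψ : ℝ → ℝ} {A B X Y t : ℝ}

lemma sol_zero_right (φ : ℝ → ℝ) (t : ℝ) : sol φ t 0 = 2 / (1 + t ^ 2) * φ (2 * arctan t) := by
  rw [sol, radialSol, norm_zero, zero_pow two_ne_zero, conformalTime_zero_right, conformalSq,
    show (1 - t ^ 2 + 0) ^ 2 + 4 * t ^ 2 = (1 + t ^ 2) ^ 2 by ring, sqrt_sq (by positivity)]
  rfl

lemma Profile.reverse (h : Profile X Y A B φ ψ) :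
    Profile X (-Y) B A (fun s => φ (-s)) (fun s => -ψ (-s)) where
  neg := h.pos
  pos := h.neg
  solves := fun t ht => by
    have hm : -t ∈ Ioo (-A) B := ⟨by linarith [ht.2], by linarith [ht.1]⟩
    have h1 := (h.solves _ hm).1.comp t (hasDerivAt_neg t)
    have h2 := ((h.solves _ hm).2.comp t (hasDerivAt_neg t)).fun_neg
    exact ⟨h1.congr_deriv (by ring), h2.congr_deriv (by ring)⟩
  init := by simpa using h.init
  init_deriv := by simpa using h.init_deriv

lemma Profile.le_lifespan (h : Profile X Y A B φ ψ)
    (hB : B < π → Tendsto (fun s => |φ s|) (𝓝[<] B) atTop) {a b : EReal}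
    {w : ℝ → Space → ℝ} (hw : IsSolution X Y a b w) : b ≤ lifespan B := by
  by_contra! hlt
  have hBπ : B ≠ π := fun hB => by simp [lifespan, hB] at hlt
  have hBlt : B < π := lt_of_le_of_ne h.pos.2 hBπ
  set T := tan (B / 2) with hT
  have hTl : lifespan B = (T : EReal) := by rw [lifespan, if_neg hBπ]
  rw [hTl] at hlt
  have hT0 : 0 < T := tan_pos_of_pos_of_lt_pi_div_two (by linarith [h.pos.1]) (by linarith)
  have hat : 2 * arctan T = B := by
    rw [hT, arctan_tan (by linarith [h.pos.1, pi_pos]) (by linarith)]; ring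
  -- `w` is continuous at `(T, 0)`, whereas the solution with profile `φ` is unbounded there
  have haT : a < (T : EReal) := hw.zero_mem.1.trans (by exact_mod_cast hT0)
  have hcont : ContinuousAt (fun τ => w τ 0) T := by
    have hopen : IsOpen {p : ℝ × Space | a < (p.1 : EReal) ∧ (p.1 : EReal) < b} :=
      (isOpen_lt continuous_const (continuous_coe_real_ereal.comp continuous_fst)).inter
        (isOpen_lt (continuous_coe_real_ereal.comp continuous_fst) continuous_const)
    have h1 := (hw.smooth.contDiffAt (x := (T, (0 : Space))) (hopen.mem_nhds ⟨haT, hlt⟩)).continuousAt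
    exact ContinuousAt.comp (f := fun τ : ℝ => (τ, (0 : Space))) (x := T) h1
      (Continuous.prodMk_left (0 : Space)).continuousAt
  have h1 : Tendsto (fun τ => |w τ 0| * (1 + τ ^ 2) / 2) (𝓝[<] T) (𝓝 (|w T 0| * (1 + T ^ 2) / 2)) :=
    ((hcont.abs.mul (by fun_prop)).div_const 2).tendsto.mono_left nhdsWithin_le_nhds
  have h2 : Tendsto (fun τ => |φ (2 * arctan τ)|) (𝓝[<] T) atTop := by
    refine (hB hBlt).comp (tendsto_nhdsWithin_iff.2 ⟨?_, ?_⟩)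
    · rw [← hat]
      exact (by fun_prop : Continuous fun τ => 2 * arctan τ).tendsto T |>.mono_left
        nhdsWithin_le_nhds
    · filter_upwards [self_mem_nhdsWithin] with τ hτ
      rw [mem_Iio, ← hat]; linarith [arctan_strictMono (show τ < T from hτ)]
  refine not_tendsto_nhds_of_tendsto_atTop h2 _ (h1.congr' ?_)
  filter_upwards [Ioo_mem_nhdsLT hT0] with τ hτ
  have e := h.isSolution.eq_of_nonneg hw hτ.1.le (by rw [hTl]; exact_mod_cast hτ.2)
    (lt_trans (by exact_mod_cast hτ.2) hlt) 0
  rw [← e, sol_zero_right, abs_mul, abs_of_pos (by positivity)]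
  have : (1 : ℝ) + τ ^ 2 ≠ 0 := by positivity
  field_simp

lemma Profile.isMaximalSolution (h : Profile X Y A B φ ψ)
    (hB : B < π → Tendsto (fun s => |φ s|) (𝓝[<] B) atTop)
    (hA : A < π → Tendsto (fun s => |φ (-s)|) (𝓝[<] A) atTop) :
    IsMaximalSolution X Y (-lifespan A) (lifespan B) (sol φ) where
  isSolution := h.isSolution
  maximal := fun a b w hw => by
    have h1 := h.le_lifespan hB hw
    have h2 := h.reverse.le_lifespan hA hw.reverse
    have h3 : -lifespan A ≤ a := EReal.neg_le.1 h2
    exact ⟨h3, h1, fun t k1 k2 x => hw.eq h.isSolution k1 k2 (h3.trans_lt k1) (k2.trans_le h1) x⟩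

end Maximality

/-! ### Blow-up of the norms -/

lemma eLpNorm_weight_lt_top_of_support {φ : 𝓢(Space, ℂ)} (s : ℝ)
    (h : ∀ ξ, φ ξ ≠ 0 → 1 ≤ ‖ξ‖ ∧ ‖ξ‖ ≤ 3) :
    eLpNorm (fun ξ : Space => ((2 * π * ‖ξ‖) ^ (-s) : ℝ) • φ ξ) 2 volume < ⊤ := by
  have hm := aestronglyMeasurable_weight (-s) φ.continuous.aestronglyMeasurable
  have hL : MemLp (fun ξ => φ ξ) 2 volume := φ.memLp 2
  refine (hL.of_le_mul (c := (2 * π * 3) ^ |s|) hm (Eventually.of_forall fun ξ => ?_)).2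
  rw [norm_smul, norm_of_nonneg (by positivity)]
  rcases eq_or_ne (φ ξ) 0 with h0 | h0
  · simp [h0]
  obtain ⟨h1, h3⟩ := h ξ h0
  refine mul_le_mul_of_nonneg_right ?_ (norm_nonneg _)
  have hpi := pi_gt_three
  calc (2 * π * ‖ξ‖) ^ (-s) ≤ (2 * π * ‖ξ‖) ^ |s| :=
        rpow_le_rpow_of_exponent_le (by nlinarith) (neg_le_abs s)
    _ ≤ _ := rpow_le_rpow (by positivity) (by gcongr) (abs_nonneg s)

/-- A test function whose pairing with Gaussians, and hence with their superpositions, is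
positive, and which vanishes near the zero frequency. -/
lemma exists_test_function : ∃ (φ : 𝓢(Space, ℂ)) (g : Space → ℝ), Continuous g ∧ HasCompactSupport g ∧
    (∀ ξ, 0 ≤ g ξ) ∧ (∃ ξ, g ξ ≠ 0) ∧ (∀ ξ, φ ξ = (g ξ : ℂ)) ∧
    ∀ s : ℝ, eLpNorm (fun ξ : Space => ((2 * π * ‖ξ‖) ^ (-s) : ℝ) • φ ξ) 2 volume < ⊤ := by
  obtain ⟨c, hcn⟩ : ∃ c : Space, ‖c‖ = 2 := ⟨(2 : ℝ) • unitVec 0, by simp [unitVec, norm_smul]⟩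
  let b : ContDiffBump c := ⟨1 / 2, 1, by norm_num, by norm_num⟩
  obtain ⟨φ, hφ⟩ := exists_schwartz_of_compactSupport b b.contDiff b.hasCompactSupport
  refine ⟨φ, b, b.continuous, b.hasCompactSupport, fun ξ => b.nonneg, ⟨c, ?_⟩, hφ,
    fun s => eLpNorm_weight_lt_top_of_support s fun ξ h0 => ?_⟩
  · rw [b.one_of_mem_closedBall (Metric.mem_closedBall_self (by norm_num))]
    exact one_ne_zero
  · have hmem : ξ ∈ ball c 1 := by
      rw [← b.support_eq]
      intro h; exact h0 (by rw [hφ, h, Complex.ofReal_zero])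
    rw [mem_ball, dist_eq_norm] at hmem
    have h1 := norm_sub_norm_le c ξ
    have h2 := norm_sub_norm_le ξ c
    rw [norm_sub_rev, hcn] at h1; rw [hcn] at h2
    constructor <;> linarith

lemma integral_fourier_mul_gaussian {φ : 𝓢(Space, ℂ)} {g : Space → ℝ} (hg : Continuous g)
    (hgc : HasCompactSupport g) (hg0 : ∀ ξ, 0 ≤ g ξ) (hg1 : ∃ ξ, g ξ ≠ 0)
    (hφ : ∀ ξ, φ ξ = (g ξ : ℂ)) {b : ℝ} (hb : 0 < b) :
    ∃ r : ℝ, 0 < r ∧ ∫ y, (𝓕 φ) y * ((exp (-b * ‖y‖ ^ 2) : ℝ) : ℂ) = r := by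
  have hL : Continuous fun p : Space × Space => (innerₗ Space) p.1 p.2 := continuous_inner
  set G : Space → ℂ := fun v => Complex.exp (-(b : ℂ) * ‖v‖ ^ 2) with hG
  have hGint : Integrable G := by
    have := GaussianFourier.integrable_cexp_neg_mul_sq_norm_add (V := Space) (b := (b : ℂ))
      (by simpa using hb) 0 0
    refine this.congr (Eventually.of_forall fun v => ?_)
    simp [hG]
  have h1 := VectorFourier.integral_fourierIntegral_smul_eq_flip (μ := volume) (ν := volume)
      continuous_fourierChar hL φ.integrable hGint
  have h2 : ∀ ξ, VectorFourier.fourierIntegral fourierChar volume (innerₗ Space).flip G ξ =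
      (((π / b) ^ (3 / 2 : ℝ) * exp (-π ^ 2 * ‖ξ‖ ^ 2 / b) : ℝ) : ℂ) := fun ξ => by
    have e := fourier_gaussian_innerProductSpace (V := Space) (b := (b : ℂ)) (by simpa using hb) ξ
    have e2 : VectorFourier.fourierIntegral fourierChar volume (innerₗ Space).flip G ξ = 𝓕 G ξ := by
      rw [flip_innerₗ]; rfl
    rw [e2, hG, e, finrank_euclideanSpace, Fintype.card_fin, Complex.ofReal_mul,
      Complex.ofReal_cpow (by positivity)]
    push_cast; rfl
  refine ⟨∫ ξ, g ξ * ((π / b) ^ (3 / 2 : ℝ) * exp (-π ^ 2 * ‖ξ‖ ^ 2 / b)), ?_, ?_⟩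
  · obtain ⟨ξ, hξ⟩ := hg1
    refine Continuous.integral_pos_of_hasCompactSupport_nonneg_nonzero (x := ξ) (by fun_prop)
      hgc.mul_right (fun ξ => mul_nonneg (hg0 ξ) (by positivity)) (mul_ne_zero hξ (by positivity))
  · rw [← integral_complex_ofReal]; simp only [h2, hφ, smul_eq_mul] at h1
    convert h1 using 1
    · refine integral_congr_ae (Eventually.of_forall fun y => ?_)
      simp only [hG]; push_cast; rfl
    · refine integral_congr_ae (Eventually.of_forall fun y => ?_)
      push_cast; rfl

lemma integral_fourier_mul_inv_ne_zero {φ : 𝓢(Space, ℂ)} {g : Space → ℝ} (hg : Continuous g)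
    (hgc : HasCompactSupport g) (hg0 : ∀ ξ, 0 ≤ g ξ) (hg1 : ∃ ξ, g ξ ≠ 0)
    (hφ : ∀ ξ, φ ξ = (g ξ : ℂ)) {α κ : ℝ} (hα : 0 < α) (hκ : 0 < κ) :
    ∫ y, (𝓕 φ) y * (((α + κ * ‖y‖ ^ 2)⁻¹ : ℝ) : ℂ) ≠ 0 := by
  set F : Space → ℝ → ℂ := fun y τ => (𝓕 φ) y * ((exp (-(α + κ * ‖y‖ ^ 2) * τ) : ℝ) : ℂ) with hF
  have hFc : Continuous (Function.uncurry F) := by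
    have h1 : Continuous fun p : Space × ℝ => exp (-(α + κ * ‖p.1‖ ^ 2) * p.2) := by fun_prop
    exact ((𝓕 φ).continuous.comp continuous_fst).mul (Complex.continuous_ofReal.comp h1)
  have hexp : IntegrableOn (fun τ => exp (-α * τ)) (Ioi 0) := exp_neg_integrableOn_Ioi 0 hα
  have hFint : Integrable (Function.uncurry F) (volume.prod (volume.restrict (Ioi 0))) := by
    refine (((𝓕 φ).integrable.norm).mul_prod hexp).mono' hFc.aestronglyMeasurable ?_
    have : ∀ᵐ p : Space × ℝ ∂(volume.prod (volume.restrict (Ioi 0))), p.2 ∈ Ioi 0 :=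
      Measure.quasiMeasurePreserving_snd.ae (ae_restrict_mem measurableSet_Ioi)
    filter_upwards [this] with p hp
    have hp : 0 < p.2 := hp
    simp only [Function.uncurry, hF, norm_mul, norm_real, norm_eq_abs, abs_exp]
    refine mul_le_mul_of_nonneg_left (exp_le_exp.2 ?_) (norm_nonneg _)
    have : 0 ≤ κ * ‖p.1‖ ^ 2 * p.2 := by positivity
    linarith
  have e1 : ∀ y : Space, (𝓕 φ) y * (((α + κ * ‖y‖ ^ 2)⁻¹ : ℝ) : ℂ) = ∫ τ in Ioi 0, F y τ :=
    fun y => by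
      have h0 : -(α + κ * ‖y‖ ^ 2) < 0 := neg_neg_of_pos (by positivity)
      simp only [hF]
      rw [integral_const_mul, integral_complex_ofReal, integral_exp_mul_Ioi h0]
      congr 2
      rw [mul_zero, exp_zero, neg_div_neg_eq, one_div]
  have e2 : ∀ τ ∈ Ioi 0, ∃ r : ℝ, 0 < r ∧ ∫ y, F y τ = r := fun τ hτ => by
    have hτ : 0 < τ := hτ
    obtain ⟨r, hr, h⟩ := integral_fourier_mul_gaussian hg hgc hg0 hg1 hφ (mul_pos hκ hτ)
    refine ⟨exp (-α * τ) * r, by positivity, ?_⟩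
    rw [Complex.ofReal_mul, ← h, ← integral_const_mul]
    refine integral_congr_ae (Eventually.of_forall fun y => ?_)
    simp only [hF]
    rw [show -(α + κ * ‖y‖ ^ 2) * τ = -α * τ + -(κ * τ) * ‖y‖ ^ 2 by ring, exp_add,
      Complex.ofReal_mul]
    ring
  simp only [e1]; rw [integral_integral_swap hFint]
  have hint : IntegrableOn (fun τ => ∫ y, F y τ) (Ioi 0) := hFint.integral_prod_right
  intro h0
  have h1 : ∫ τ in Ioi 0, (∫ y, F y τ).re = 0 := by
    have := Complex.reCLM.integral_comp_comm hint
    simp only [Complex.reCLM_apply] at this; rw [this, h0, Complex.zero_re]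
  have hpos : ∀ τ ∈ Ioi 0, 0 < (∫ y, F y τ).re := fun τ hτ => by
    obtain ⟨r, hr, h⟩ := e2 τ hτ
    rw [h]; simpa using hr
  have h2 : 0 < ∫ τ in Ioi 0, (∫ y, F y τ).re := by
    rw [setIntegral_pos_iff_support_of_nonneg_ae]
    · have : Function.support (fun τ => (∫ y, F y τ).re) ∩ Ioi 0 = Ioi 0 :=
        inter_eq_right.2 fun τ hτ => (hpos τ hτ).ne'
      rw [this]; simp
    · exact (ae_restrict_iff' measurableSet_Ioi).2 (Eventually.of_forall fun τ hτ => (hpos τ hτ).le)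
    · exact hint.re
  exact h2.ne' h1

/-- A family of functions whose rescalings pair with a test function more strongly than scaling
invariance permits is unbounded in the Sobolev norm. -/
lemma tendsto_sobolevNorm_top {ι : Type*} {l : Filter ι} {f : ι → Space → ℝ} {lam : ι → ℝ} {s : ℝ}
    {φ : 𝓢(Space, ℂ)} (hlam : ∀ᶠ i in l, 0 < lam i)
    (hφ : eLpNorm (fun ξ : Space => ((2 * π * ‖ξ‖) ^ (-s) : ℝ) • φ ξ) 2 volume < ⊤)
    (h : Tendsto (fun i => ‖∫ x, (𝓕 φ) x * (f i (lam i • x) : ℂ)‖ * lam i ^ (3 / 2 - s)) l atTop) :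
    Tendsto (fun i => sobolevNorm s (f i)) l (𝓝 ⊤) := by
  set N := eLpNorm (fun ξ : Space => ((2 * π * ‖ξ‖) ^ (-s) : ℝ) • φ ξ) 2 volume with hN
  have hN0 : 0 < N.toReal + 1 := by positivity
  have hNle : N ≤ ofReal (N.toReal + 1) := by
    rw [ENNReal.le_ofReal_iff_toReal_le hφ.ne hN0.le]; linarith
  refine tendsto_nhds_top_mono (ENNReal.tendsto_ofReal_atTop.comp (h.atTop_div_const hN0)) ?_
  filter_upwards [hlam] with i hi
  refine le_trans ?_ (div_le_sobolevNorm hi s (f i) φ)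
  rw [← hN]
  refine le_trans ?_ (ENNReal.div_le_div_left (mul_le_mul_right hNle _) _)
  rw [← ofReal_mul (by positivity), ← ofReal_norm, ← ENNReal.ofReal_div_of_pos (by positivity)]
  refine ofReal_le_ofReal (le_of_eq ?_)
  simp only
  rw [show 3 / 2 - s = -(s - 3 / 2) by ring, rpow_neg hi.le]; field_simp

section BlowUp

variable {φ ψ : ℝ → ℝ} {A B X Y T c : ℝ}

lemma arctan_sub_ge {t T : ℝ} (ht : 0 ≤ t) (htT : t ≤ T) :
    (T - t) / (1 + T ^ 2) ≤ arctan T - arctan t := by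
  have h := le_of_hasDerivAt_nonneg (f := fun x => arctan x - x / (1 + T ^ 2))
    (f' := fun x => 1 / (1 + x ^ 2) - 1 / (1 + T ^ 2)) htT
    (fun x _ => (hasDerivAt_arctan x).fun_sub ((hasDerivAt_id x).div_const _))
    (fun x hx => by
      have : 0 < x := ht.trans_lt hx.1
      have h2 : x < T := hx.2
      rw [sub_nonneg]
      exact one_div_le_one_div_of_le (by positivity) (by nlinarith))
  rw [sub_div]; linarith

/-- Towards the blow-up time, self-similarly, the compactified time approaches its final value at a
rate depending on the self-similar variable. -/
lemma hasDerivAt_conformalTime_selfSimilar (T ρ : ℝ) :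
    HasDerivAt (fun t => conformalTime t ((T - t) * ρ))
      (2 / (1 + T ^ 2) + 2 * T / (1 + T ^ 2) ^ 2 * ρ) T := by
  have h0 : (-1 : ℝ) < ((T, (0 : ℝ)) : ℝ × ℝ).2 := by norm_num
  have hd := ((contDiffAt_conformalTime h0).differentiableAt (by simp)).hasFDerivAt
  set L := fderiv ℝ (fun p : ℝ × ℝ => conformalTime p.1 p.2) (T, 0)
  have hN : (√(conformalSq T 0))⁻¹ ^ 2 = 1 / (1 + T ^ 2) ^ 2 := by
    rw [inv_pow, sq_sqrt (conformalSq_pos (by norm_num)).le, conformalSq]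
    rw [one_div]; congr 1; ring
  have hne : (1 : ℝ) + T ^ 2 ≠ 0 := by positivity
  have h1 : L (1, 0) = 2 / (1 + T ^ 2) := by
    have e1 := hd.comp_hasDerivAt T ((hasDerivAt_id T).prodMk (hasDerivAt_const T (0 : ℝ)))
    have e2 := hasDerivAt_conformalTime_left (t := T) (ρ := 0) (by norm_num)
    rw [hN] at e2; rw [e1.unique e2]; field_simp; ring
  have h2 : L (0, 1) = -(2 * T / (1 + T ^ 2) ^ 2) := by
    have e1 := hd.comp_hasDerivAt (0 : ℝ) ((hasDerivAt_const (0 : ℝ) T).prodMk (hasDerivAt_id (0 : ℝ)))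
    have e2 := hasDerivAt_conformalTime_right (t := T) (ρ := 0) (by norm_num)
    rw [hN] at e2; rw [e1.unique e2]; ring
  have hc : HasDerivAt (fun t : ℝ => (T - t) * ρ) (-ρ) T := by
    simpa using ((hasDerivAt_id T).const_sub T).mul_const ρ
  have hd' : HasFDerivAt (fun p : ℝ × ℝ => conformalTime p.1 p.2) L (id T, (T - T) * ρ) := by
    simpa using hd
  have h3 := hd'.comp_hasDerivAt T ((hasDerivAt_id T).prodMk hc)
  refine h3.congr_deriv ?_
  have e : ((1, -ρ) : ℝ × ℝ) = (1, 0) + (-ρ) • (0, 1) := by ext <;> simp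
  rw [e, map_add, map_smul, h1, h2, smul_eq_mul]; ring

lemma Profile.exists_abs_le (h : Profile X Y A B φ ψ)
    (hc : Tendsto (fun s => (B - s) * φ s) (𝓝[<] B) (𝓝 c)) :
    ∃ C, 0 ≤ C ∧ ∀ s ∈ Ico 0 B, |(B - s) * φ s| ≤ C := by
  have h1 : ∀ᶠ s in 𝓝[<] B, |(B - s) * φ s| < |c| + 1 := hc.abs.eventually_lt_const (by linarith)
  obtain ⟨δ, hδ, h2⟩ := (mem_nhdsLT_iff_exists_Ioo_subset' h.pos.1).1 h1
  have hδB : δ < B := hδ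
  have hcont : ContinuousOn (fun s => (B - s) * φ s) (Icc 0 δ) := by
    refine ContinuousOn.mul (by fun_prop) (h.contDiffOn.1.continuousOn.mono fun s hs => ?_)
    exact ⟨by linarith [hs.1, h.neg.1], by linarith [hs.2]⟩
  obtain ⟨C, hC⟩ := isCompact_Icc.exists_bound_of_continuousOn hcont
  refine ⟨max C (|c| + 1), le_max_of_le_right (by positivity), fun s hs => ?_⟩
  rcases le_or_gt s δ with hsδ | hsδ
  · exact (hC s ⟨hs.1, hsδ⟩).trans (le_max_left _ _)
  · exact (h2 ⟨hsδ, hs.2⟩ : |(B - s) * φ s| < |c| + 1).le.trans (le_max_right _ _)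

/-- The self-similar blow-up profile. -/
lemma Profile.tendsto_rescaled (hT : 0 < T) (hTB : 2 * arctan T = B)
    (hc : Tendsto (fun s => (B - s) * φ s) (𝓝[<] B) (𝓝 c)) (y : Space) :
    Tendsto (fun t => (T - t) * sol φ t (√(T - t) • y)) (𝓝[<] T)
      (𝓝 (2 / (1 + T ^ 2) * c * (2 / (1 + T ^ 2) + 2 * T / (1 + T ^ 2) ^ 2 * ‖y‖ ^ 2)⁻¹)) := by
  set τ : ℝ → ℝ := fun t => conformalTime t ((T - t) * ‖y‖ ^ 2) with hτ
  have hd := hasDerivAt_conformalTime_selfSimilar T (‖y‖ ^ 2)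
  set a := 2 / (1 + T ^ 2) + 2 * T / (1 + T ^ 2) ^ 2 * ‖y‖ ^ 2
  have ha0 : a ≠ 0 := by positivity
  have hτT : τ T = B := by simp only [hτ, sub_self, zero_mul, conformalTime_zero_right, hTB]
  have hlt : ∀ t ∈ Ioo 0 T, τ t < B := fun t ht => by
    have := (conformalTime_mem_Icc ht.1.le (mul_nonneg (by linarith [ht.2]) (sq_nonneg ‖y‖)) :
      τ t ∈ _).2
    linarith [arctan_strictMono ht.2]
  have hslope : Tendsto (fun t => (B - τ t) / (T - t)) (𝓝[<] T) (𝓝 a) := by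
    have := (hasDerivAt_iff_tendsto_slope.1 hd).mono_left
      (nhdsWithin_mono T fun x (hx : x < T) => hx.ne)
    refine this.congr' ?_
    filter_upwards [self_mem_nhdsWithin] with t ht
    rw [slope_def_field, ← hτT, ← neg_sub (τ T), ← neg_sub T, neg_div_neg_eq]
  have hτt : Tendsto τ (𝓝[<] T) (𝓝[<] B) := by
    refine tendsto_nhdsWithin_iff.2 ⟨?_, ?_⟩
    · rw [← hτT]; exact hd.continuousAt.tendsto.mono_left nhdsWithin_le_nhds
    · filter_upwards [Ioo_mem_nhdsLT hT] with t ht using hlt t ht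
  have hN : Tendsto (fun t => 2 * (√(conformalSq t ((T - t) * ‖y‖ ^ 2)))⁻¹) (𝓝[<] T)
      (𝓝 (2 / (1 + T ^ 2))) := by
    have h1 : Tendsto (fun t => conformalSq t ((T - t) * ‖y‖ ^ 2)) (𝓝 T)
        (𝓝 (conformalSq T ((T - T) * ‖y‖ ^ 2))) :=
      (by unfold conformalSq; fun_prop : Continuous fun t => conformalSq t ((T - t) * ‖y‖ ^ 2)).tendsto T
    have h2 : conformalSq T ((T - T) * ‖y‖ ^ 2) = (1 + T ^ 2) ^ 2 := by rw [conformalSq]; ring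
    rw [h2] at h1
    have h3 := ((continuous_sqrt.tendsto _).comp h1).inv₀
      (by rw [sqrt_sq (by positivity)]; positivity)
    rw [sqrt_sq (by positivity)] at h3
    simpa [div_eq_mul_inv] using! (h3.const_mul 2).mono_left nhdsWithin_le_nhds
  refine ((hN.mul (hc.comp hτt)).mul (hslope.inv₀ ha0)).congr' ?_
  filter_upwards [Ioo_mem_nhdsLT hT] with t ht
  have h1 : T - t ≠ 0 := by linarith [ht.2]
  have h2 : B - τ t ≠ 0 := by linarith [hlt t ht]
  have h3 : ‖√(T - t) • y‖ ^ 2 = (T - t) * ‖y‖ ^ 2 := by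
    rw [norm_smul, mul_pow, norm_of_nonneg (sqrt_nonneg _), sq_sqrt (by linarith [ht.2])]
  rw [sol, radialSol, h3]; simp only [Function.comp_apply]
  rw [show conformalTime t ((T - t) * ‖y‖ ^ 2) = τ t from rfl]; field_simp

lemma Profile.exists_rescaled_le (h : Profile X Y A B φ ψ) (hT : 0 < T) (hTB : 2 * arctan T = B)
    (hc : Tendsto (fun s => (B - s) * φ s) (𝓝[<] B) (𝓝 c)) :
    ∃ C, ∀ t ∈ Ioo (T / 2) T, ∀ x, |(T - t) * sol φ t x| ≤ C := by
  obtain ⟨C, hC0, hC⟩ := h.exists_abs_le hc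
  refine ⟨2 * T⁻¹ * ((1 + T ^ 2) / 2 * C), fun t ht x => ?_⟩
  have ht0 : 0 < t := by linarith [ht.1]
  have htT : 0 < T - t := by linarith [ht.2]
  have hm := conformalTime_mem_Icc ht0.le (sq_nonneg ‖x‖)
  set τ := conformalTime t (‖x‖ ^ 2)
  have h1 := arctan_sub_ge ht0.le ht.2.le
  have h2 : (T - t) ≤ (1 + T ^ 2) / 2 * (B - τ) := by
    rw [div_le_iff₀ (by positivity)] at h1
    have h3 := hm.2
    have h4 : 0 < 1 + T ^ 2 := by positivity
    nlinarith
  have h5 : 0 < B - τ := by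
    by_contra! h6
    have : (1 + T ^ 2) / 2 * (B - τ) ≤ 0 := mul_nonpos_of_nonneg_of_nonpos (by positivity) h6
    linarith
  have h6 : |φ τ| * (T - t) ≤ (1 + T ^ 2) / 2 * C := by
    have := hC τ ⟨hm.1, by linarith⟩
    rw [abs_mul, abs_of_pos h5] at this
    calc |φ τ| * (T - t) ≤ |φ τ| * ((1 + T ^ 2) / 2 * (B - τ)) := by gcongr
      _ = (1 + T ^ 2) / 2 * ((B - τ) * |φ τ|) := by ring
      _ ≤ _ := by gcongr
  have h7 : (√(conformalSq t (‖x‖ ^ 2)))⁻¹ ≤ T⁻¹ := by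
    refine inv_anti₀ hT (le_sqrt_of_sq_le ?_)
    rw [conformalSq]; nlinarith [sq_nonneg (1 - t ^ 2 + ‖x‖ ^ 2), ht.1]
  rw [sol, radialSol, abs_mul, abs_mul, abs_of_pos htT, abs_mul, abs_of_nonneg (inv_nonneg.2 (sqrt_nonneg _))]
  calc (T - t) * (|2| * (√(conformalSq t (‖x‖ ^ 2)))⁻¹ * |φ τ|)
      = 2 * (√(conformalSq t (‖x‖ ^ 2)))⁻¹ * (|φ τ| * (T - t)) := by rw [abs_two]; ring
    _ ≤ _ := by gcongr

/-- At a pole of the profile before time `π` all Sobolev norms blow up. -/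
lemma Profile.blowsUp (h : Profile X Y A B φ ψ) (hB : B < π) (hc0 : c ≠ 0)
    (hc : Tendsto (fun s => (B - s) * φ s) (𝓝[<] B) (𝓝 c)) : BlowsUp (lifespan B) (sol φ) := by
  set T := tan (B / 2) with hTd
  have hT : 0 < T := tan_pos_of_pos_of_lt_pi_div_two (by linarith [h.pos.1]) (by linarith)
  have hTB : 2 * arctan T = B := by
    rw [hTd, arctan_tan (by linarith [h.pos.1, pi_pos]) (by linarith)]; ring
  refine ⟨T, by rw [lifespan, if_neg hB.ne], fun s hs => ?_⟩
  refine tendsto_nhds_top_mono' ?_ fun t => sobolevNorm_le_pairNorm s _ _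
  obtain ⟨χ, g, hg, hgc, hg0, hg1, hχ, hχs⟩ := exists_test_function
  have hlam : ∀ᶠ t in 𝓝[<] T, 0 < √(T - t) := by
    filter_upwards [self_mem_nhdsWithin] with t ht
    exact sqrt_pos.2 (sub_pos.2 ht)
  have hcont : ∀ t ∈ Ioo (T / 2) T, Continuous (sol φ t) := fun t ht => by
    have h1 : -lifespan A < (t : EReal) := h.neg_lifespan_neg.trans
      (by exact_mod_cast (by linarith [ht.1] : 0 < t))
    have h2 : (t : EReal) < lifespan B := by rw [lifespan, if_neg hB.ne]; exact_mod_cast ht.2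
    refine continuous_iff_continuousAt.2 fun x => ?_
    exact ContinuousAt.comp (f := fun x : Space => (t, x)) (x := x)
      (h.contDiffAt_sol (p := (t, x)) h1 h2).continuousAt (Continuous.prodMk_right t).continuousAt
  obtain ⟨C, hC⟩ := h.exists_rescaled_le hT hTB hc
  have hIoo : Ioo (T / 2) T ∈ 𝓝[<] T := Ioo_mem_nhdsLT (by linarith)
  have hlim : Tendsto (fun t => ∫ y, (𝓕 χ) y * (((T - t) * sol φ t (√(T - t) • y) : ℝ) : ℂ)) (𝓝[<] T)
      (𝓝 (∫ y, (𝓕 χ) y * ((2 / (1 + T ^ 2) * c *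
        (2 / (1 + T ^ 2) + 2 * T / (1 + T ^ 2) ^ 2 * ‖y‖ ^ 2)⁻¹ : ℝ) : ℂ))) := by
    refine tendsto_integral_filter_of_dominated_convergence (fun y => ‖(𝓕 χ) y‖ * C) ?_ ?_
      ((𝓕 χ).integrable.norm.mul_const C) ?_
    · filter_upwards [hIoo] with t ht
      have h1 : Continuous fun y : Space => (T - t) * sol φ t (√(T - t) • y) :=
        continuous_const.mul ((hcont t ht).comp (by fun_prop))
      exact ((𝓕 χ).continuous.mul (Complex.continuous_ofReal.comp h1)).aestronglyMeasurable
    · filter_upwards [hIoo] with t ht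
      refine Eventually.of_forall fun y => ?_
      rw [norm_mul, norm_real, norm_eq_abs]
      exact mul_le_mul_of_nonneg_left (hC t ht _) (norm_nonneg _)
    · refine Eventually.of_forall fun y => ?_
      exact ((Complex.continuous_ofReal.tendsto _).comp
        (Profile.tendsto_rescaled hT hTB hc y)).const_mul _
  have hne : ∫ y, (𝓕 χ) y * ((2 / (1 + T ^ 2) * c *
      (2 / (1 + T ^ 2) + 2 * T / (1 + T ^ 2) ^ 2 * ‖y‖ ^ 2)⁻¹ : ℝ) : ℂ) ≠ 0 := by
    have h1 := integral_fourier_mul_inv_ne_zero hg hgc hg0 hg1 hχ (α := 2 / (1 + T ^ 2))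
      (κ := 2 * T / (1 + T ^ 2) ^ 2) (by positivity) (by positivity)
    have h2 : ∀ y : Space, (𝓕 χ) y * ((2 / (1 + T ^ 2) * c *
        (2 / (1 + T ^ 2) + 2 * T / (1 + T ^ 2) ^ 2 * ‖y‖ ^ 2)⁻¹ : ℝ) : ℂ) =
        ((2 / (1 + T ^ 2) * c : ℝ) : ℂ) * ((𝓕 χ) y *
          (((2 / (1 + T ^ 2) + 2 * T / (1 + T ^ 2) ^ 2 * ‖y‖ ^ 2)⁻¹ : ℝ) : ℂ)) := fun y => by
      rw [Complex.ofReal_mul]; ring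
    simp only [h2]; rw [integral_const_mul]
    refine mul_ne_zero ?_ h1
    rw [Complex.ofReal_ne_zero]; positivity
  refine tendsto_sobolevNorm_top (φ := χ) (lam := fun t => √(T - t)) hlam (hχs s) ?_
  have hpow : Tendsto (fun t => √(T - t) ^ (-(s + 1 / 2))) (𝓝[<] T) atTop := by
    refine (tendsto_rpow_neg_nhdsGT_zero (by linarith)).comp (tendsto_nhdsWithin_iff.2 ⟨?_, hlam⟩)
    have : Tendsto (fun t => √(T - t)) (𝓝 T) (𝓝 (√(T - T))) :=
      (by fun_prop : Continuous fun t => √(T - t)).tendsto T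
    rw [sub_self, sqrt_zero] at this; exact this.mono_left nhdsWithin_le_nhds
  refine (hlim.norm.pos_mul_atTop (norm_pos_iff.2 hne) hpow).congr' ?_
  filter_upwards [hlam, self_mem_nhdsWithin] with t ht htT
  have htT' : 0 < T - t := sub_pos.2 htT
  have e1 : ∀ y : Space, (𝓕 χ) y * (((T - t) * sol φ t (√(T - t) • y) : ℝ) : ℂ) =
      ((T - t : ℝ) : ℂ) * ((𝓕 χ) y * (sol φ t (√(T - t) • y) : ℂ)) := fun y => by
    rw [Complex.ofReal_mul]; ring
  simp only [e1]; rw [integral_const_mul, norm_mul, norm_real, norm_of_nonneg htT'.le]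
  have e2 : √(T - t) ^ (3 / 2 - s) = (T - t) * √(T - t) ^ (-(s + 1 / 2)) := by
    rw [show 3 / 2 - s = (2 : ℕ) + -(s + 1 / 2) by push_cast; ring, rpow_add ht,
      rpow_natCast, sq_sqrt htT'.le]
  rw [e2]; ring

end BlowUp

/-! ### Hardy's inequality and radial functions in critical Sobolev spaces -/

section

variable {K : ℝ} {W w : ℝ → ℝ} {f : Space → ℝ}

/-- `f` is continuous and `∫₀^∞ f² ≤ K`. -/
structure SqIntegralLe (f : ℝ → ℝ) (K : ℝ) : Prop where
  continuous : Continuous f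
  le : ∀ R, 0 ≤ R → ∫ r in 0..R, f r ^ 2 ≤ K

namespace SqIntegralLe

variable {f g : ℝ → ℝ} {K L : ℝ}

lemma nonneg (hf : SqIntegralLe f K) : 0 ≤ K := by simpa using hf.le 0 le_rfl

lemma mono (hf : SqIntegralLe f K) (hg : Continuous g) (h : ∀ r, 0 < r → |g r| ≤ |f r|) :
    SqIntegralLe g K := by
  refine ⟨hg, fun R hR => le_trans ?_ (hf.le R hR)⟩
  refine intervalIntegral.integral_mono_on_of_le_Ioo hR
    ((hg.pow 2).intervalIntegrable _ _) ((hf.continuous.pow 2).intervalIntegrable _ _) fun r hr => ?_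
  exact sq_le_sq.2 (h r hr.1)

lemma abs (hf : SqIntegralLe f K) : SqIntegralLe (fun r => |f r|) K :=
  hf.mono hf.continuous.abs fun _ _ => (abs_abs _).le

lemma const_mul (hf : SqIntegralLe f K) (c : ℝ) : SqIntegralLe (fun r => c * f r) (c ^ 2 * K) := by
  refine ⟨hf.continuous.const_mul c, fun R hR => ?_⟩
  simp only [mul_pow]; rw [intervalIntegral.integral_const_mul]
  exact mul_le_mul_of_nonneg_left (hf.le R hR) (sq_nonneg c)

lemma add (hf : SqIntegralLe f K) (hg : SqIntegralLe g L) :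
    SqIntegralLe (fun r => f r + g r) (2 * K + 2 * L) := by
  refine ⟨hf.continuous.add hg.continuous, fun R hR => ?_⟩
  have i1 : ∀ a b, IntervalIntegrable (fun r => f r ^ 2) volume a b :=
    (hf.continuous.pow 2).intervalIntegrable
  have i2 : ∀ a b, IntervalIntegrable (fun r => g r ^ 2) volume a b :=
    (hg.continuous.pow 2).intervalIntegrable
  calc ∫ r in 0..R, (f r + g r) ^ 2 ≤ ∫ r in 0..R, (2 * f r ^ 2 + 2 * g r ^ 2) := by
        refine intervalIntegral.integral_mono_on hR
          (((hf.continuous.add hg.continuous).pow 2).intervalIntegrable _ _)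
          (((i1 _ _).const_mul 2).add ((i2 _ _).const_mul 2)) fun r _ => ?_
        nlinarith [sq_nonneg (f r - g r)]
    _ = 2 * (∫ r in 0..R, f r ^ 2) + 2 * ∫ r in 0..R, g r ^ 2 := by
        rw [intervalIntegral.integral_add ((i1 _ _).const_mul 2) ((i2 _ _).const_mul 2),
          intervalIntegral.integral_const_mul, intervalIntegral.integral_const_mul]
    _ ≤ 2 * K + 2 * L := by linarith [hf.le R hR, hg.le R hR]

lemma integrableOn (hf : SqIntegralLe f K) : IntegrableOn (fun r => f r ^ 2) (Ioi 0) := by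
  refine integrableOn_Ioi_of_intervalIntegral_norm_bounded (l := atTop) (b := id) K 0
    (fun R => ((hf.continuous.pow 2).integrableOn_Icc (a := 0) (b := R)).mono_set Ioc_subset_Icc_self)
    tendsto_id ?_
  filter_upwards [eventually_ge_atTop 0] with R hR
  simpa only [norm_eq_abs, abs_pow, sq_abs, id_eq] using hf.le R hR

lemma integral_le (hf : SqIntegralLe f K) : ∫ r in Ioi 0, f r ^ 2 ≤ K := by
  refine le_of_tendsto (intervalIntegral_tendsto_integral_Ioi 0 hf.integrableOn tendsto_id) ?_
  filter_upwards [eventually_ge_atTop 0] with R hR using hf.le R hR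

end SqIntegralLe

lemma continuous_dslope_zero (hW : ∀ r, HasDerivAt W (w r) r) : Continuous (dslope W 0) :=
  continuous_iff_continuousAt.2 fun r => by
    rcases eq_or_ne r 0 with rfl | h
    · exact continuousAt_dslope_same.2 (hW 0).differentiableAt
    · exact (continuousAt_dslope_of_ne h).2 (hW r).continuousAt

lemma mul_dslope_zero (h0 : W 0 = 0) (r : ℝ) : r * dslope W 0 r = W r := by
  simpa [h0] using sub_smul_dslope W 0 r

/-- Hardy's inequality `∫ (W/r)² ≤ 4 ∫ W'²`, where `dslope W 0` is the continuous
extension of `W / r`: the difference of the two sides, less the boundary term `2 W² / R`, has the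
derivative `(2 W' - W/R)²`. -/
lemma SqIntegralLe.hardy (hw : SqIntegralLe w K)
    (hW : ∀ r, HasDerivAt W (w r) r) (h0 : W 0 = 0) : SqIntegralLe (dslope W 0) (4 * K) := by
  have hκ := continuous_dslope_zero hW
  set κ := dslope W 0
  have hWκ : ∀ r, r * κ r = W r := mul_dslope_zero h0
  have hWc : Continuous W := continuous_iff_continuousAt.2 fun r => (hW r).continuousAt
  refine ⟨hκ, fun R hR => ?_⟩
  have hd1 : ∀ r, HasDerivAt (fun R => ∫ s in 0..R, w s ^ 2) (w r ^ 2) r := fun r =>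
    (hw.continuous.pow 2).integral_hasStrictDerivAt 0 r |>.hasDerivAt
  have hd2 : ∀ r, HasDerivAt (fun R => ∫ s in 0..R, κ s ^ 2) (κ r ^ 2) r := fun r =>
    (hκ.pow 2).integral_hasStrictDerivAt 0 r |>.hasDerivAt
  have hc1 : Continuous (fun R => ∫ s in 0..R, w s ^ 2) :=
    continuous_iff_continuousAt.2 fun r => (hd1 r).continuousAt
  have hc2 : Continuous (fun R => ∫ s in 0..R, κ s ^ 2) :=
    continuous_iff_continuousAt.2 fun r => (hd2 r).continuousAt
  have hd : ∀ r ∈ interior (Icc 0 R), HasDerivAt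
      (fun R => 4 * (∫ s in 0..R, w s ^ 2) - (∫ s in 0..R, κ s ^ 2) - 2 * W R * κ R)
      ((2 * w r - κ r) ^ 2) r := fun r hr => by
    have hr0 : r ≠ 0 := (interior_Icc.subset hr).1.ne'
    have e1 : HasDerivAt (fun R => W R * κ R) (2 * w r * κ r - κ r ^ 2) r := by
      have := ((hW r).fun_pow 2).fun_div (hasDerivAt_id' r) hr0
      refine (this.congr_of_eventuallyEq ?_).congr_deriv ?_
      · filter_upwards [isOpen_ne.mem_nhds hr0] with y hy
        have hy' : y ≠ 0 := hy
        rw [← hWκ y]; field_simp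
      · simp only [Nat.cast_ofNat, Nat.reduceSub]; rw [← hWκ r]; field_simp
    have := (((hd1 r).const_mul 4).fun_sub (hd2 r)).fun_sub (e1.const_mul 2)
    simp only [← mul_assoc] at this; exact this.congr_deriv (by ring)
  have key := monotoneOn_of_deriv_nonneg (convex_Icc 0 R) (by fun_prop)
    (fun r hr => (hd r hr).differentiableAt.differentiableWithinAt)
    (fun r hr => (hd r hr).deriv ▸ sq_nonneg _) (left_mem_Icc.2 hR) (right_mem_Icc.2 hR) hR
  simp only [intervalIntegral.integral_same, h0] at key
  have h2 : 0 ≤ W R * κ R := by rw [← hWκ R]; nlinarith [mul_nonneg hR (sq_nonneg (κ R))]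
  linarith [hw.le R hR]

/-- The area of the unit sphere. -/
def sphereArea : ℝ := 3 * volume.real (ball (0 : Space) 1)

lemma sphereArea_nonneg : 0 ≤ sphereArea := by unfold sphereArea; positivity

lemma eLpNorm_le_of_radial (hw : SqIntegralLe w K) (h : ∀ x, x ≠ 0 → ‖x‖ * |f x| ≤ |w ‖x‖|) :
    eLpNorm f 2 volume ^ 2 ≤ ofReal (sphereArea * K) := by
  have hd : Module.finrank ℝ Space = 3 := by simp
  have hcong : ∀ y ∈ Ioi 0, y ^ (Module.finrank ℝ Space - 1) • (w y / y) ^ 2 = w y ^ 2 := fun y hy => by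
    have : y ≠ 0 := (mem_Ioi.1 hy).ne'
    rw [hd, smul_eq_mul]; field_simp; ring
  have hint : Integrable (fun x : Space => (w ‖x‖ / ‖x‖) ^ 2) := by
    refine (integrable_fun_norm_addHaar (volume : Measure Space) (f := fun y => (w y / y) ^ 2)).2 ?_
    exact hw.integrableOn.congr_fun (fun y hy => (hcong y hy).symm) measurableSet_Ioi
  have hval : ∫ x : Space, (w ‖x‖ / ‖x‖) ^ 2 = sphereArea * ∫ r in Ioi 0, w r ^ 2 := by
    rw [integral_fun_norm_addHaar (volume : Measure Space) (fun y => (w y / y) ^ 2),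
      setIntegral_congr_fun measurableSet_Ioi hcong, hd, sphereArea, smul_eq_mul, nsmul_eq_mul]
    norm_num; ring
  calc eLpNorm f 2 volume ^ 2 = ∫⁻ x, ‖f x‖ₑ ^ 2 := eLpNorm_two_sq f
    _ ≤ ∫⁻ x : Space, ofReal ((w ‖x‖ / ‖x‖) ^ 2) := by
        refine lintegral_mono_ae ?_
        filter_upwards [compl_mem_ae_iff.2 (measure_singleton (0 : Space))] with x hx
        have hx0 : x ≠ 0 := hx
        have hpos : 0 < ‖x‖ := norm_pos_iff.2 hx0
        rw [← ofReal_norm, ← ofReal_pow (norm_nonneg _)]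
        refine ofReal_le_ofReal ?_
        rw [norm_eq_abs, sq_abs]
        refine sq_le_sq.2 ?_
        rw [abs_div, abs_of_pos hpos, le_div_iff₀ hpos, mul_comm]; exact h x hx0
    _ = ofReal (∫ x : Space, (w ‖x‖ / ‖x‖) ^ 2) :=
        (ofReal_integral_eq_lintegral_ofReal hint (ae_of_all _ fun x => sq_nonneg _)).symm
    _ ≤ ofReal (sphereArea * K) := by
        rw [hval]
        exact ofReal_le_ofReal (mul_le_mul_of_nonneg_left hw.integral_le sphereArea_nonneg)

lemma memLp_of_radial (hf : AEStronglyMeasurable f)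
    (hw : SqIntegralLe w K) (h : ∀ x, x ≠ 0 → ‖x‖ * |f x| ≤ |w ‖x‖|) : MemLp f 2 := by
  refine ⟨hf, ?_⟩
  have := (eLpNorm_le_of_radial hw h).trans_lt ENNReal.ofReal_lt_top
  by_contra hc
  rw [not_lt, top_le_iff] at hc; simp [hc] at this

lemma ennreal_le_of_sq_le {a : ℝ≥0∞} {c : ℝ} (hc : 0 ≤ c) (h : a ^ 2 ≤ ofReal (c ^ 2)) :
    a ≤ ofReal c := by
  rw [ofReal_pow hc] at h; exact (ENNReal.pow_le_pow_left_iff two_ne_zero).1 h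

lemma hasFDerivAt_comp_norm {G : ℝ → ℝ} {G' : ℝ} {x : Space} (hx : x ≠ 0)
    (h : HasDerivAt G G' ‖x‖) :
    HasFDerivAt (fun y : Space => G ‖y‖) ((G' / ‖x‖) • innerSL ℝ x) x := by
  have hpos : 0 < ‖x‖ := norm_pos_iff.2 hx
  have h1 : HasDerivAt (fun ρ => G (√ρ)) (G' * (1 / (2 * √(‖x‖ ^ 2)))) (‖x‖ ^ 2) := by
    refine HasDerivAt.comp (h₂ := G) (‖x‖ ^ 2) ?_ (hasDerivAt_sqrt (by positivity))
    rwa [sqrt_sq hpos.le]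
  have h2 := hasFDerivAt_comp_norm_sq h1
  have e : (fun y : Space => G √(‖y‖ ^ 2)) = fun y => G ‖y‖ := by
    ext y; rw [sqrt_sq (norm_nonneg _)]
  rw [e] at h2
  refine h2.congr_fderiv ?_
  rw [sqrt_sq hpos.le]
  ext y; simp only [smul_apply, smul_eq_mul]; field_simp

/-- The critical Sobolev norm of a function `p(|x|)/|x|` on `ℝ³`. -/
lemma sobolevNorm_half_le_of_radial (hf : Differentiable ℝ f) {p p' : ℝ → ℝ}
    (hfp : ∀ x, ‖x‖ * f x = p ‖x‖) (hp : ∀ r, HasDerivAt p (p' r) r)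
    (h1 : SqIntegralLe p K) (h2 : SqIntegralLe p' K) :
    sobolevNorm (1 / 2) f ^ 2 ≤ ofReal (12 * sphereArea * K) := by
  have hK := h1.nonneg
  have hA := sphereArea_nonneg
  have h0 : p 0 = 0 := by simpa using (hfp 0).symm
  have hκ := h2.hardy hp h0
  have hfL : MemLp f 2 := memLp_of_radial hf.continuous.aestronglyMeasurable h1 fun x _ => by
    rw [← hfp x, abs_mul, abs_norm]
  have hm : ∀ j, AEStronglyMeasurable (fun x => fderiv ℝ f x (unitVec j)) := fun j =>
    (measurable_fderiv_apply_const ℝ f (unitVec j)).aestronglyMeasurable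
  have hw := h2.abs.add hκ.abs
  have hbd : ∀ j, ∀ x, x ≠ 0 → ‖x‖ * |fderiv ℝ f x (unitVec j)| ≤
      |(|p' ‖x‖| + |dslope p 0 ‖x‖|)| := fun j x hx => by
    have hpos : 0 < ‖x‖ := norm_pos_iff.2 hx
    have hd : HasFDerivAt f (((p' ‖x‖ * ‖x‖ - p ‖x‖ * 1) / ‖x‖ ^ 2 / ‖x‖) • innerSL ℝ x) x := by
      have := hasFDerivAt_comp_norm hx ((hp ‖x‖).fun_div (hasDerivAt_id' ‖x‖) hpos.ne')
      refine this.congr_of_eventuallyEq ?_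
      filter_upwards [isOpen_ne.mem_nhds hx] with y hy
      have hy' : ‖y‖ ≠ 0 := norm_ne_zero_iff.2 hy
      rw [← hfp y]; field_simp
    have hin : innerSL ℝ x (unitVec j) = x j := by simp [unitVec, EuclideanSpace.inner_single_right]
    rw [hd.fderiv, smul_apply, hin, smul_eq_mul, ← mul_dslope_zero h0 ‖x‖]
    have e : ‖x‖ * |(p' ‖x‖ * ‖x‖ - ‖x‖ * dslope p 0 ‖x‖ * 1) / ‖x‖ ^ 2 / ‖x‖ * x j| =
        |p' ‖x‖ - dslope p 0 ‖x‖| * (|x j| / ‖x‖) := by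
      have : (p' ‖x‖ * ‖x‖ - ‖x‖ * dslope p 0 ‖x‖ * 1) / ‖x‖ ^ 2 / ‖x‖ * x j =
        (p' ‖x‖ - dslope p 0 ‖x‖) * (x j / ‖x‖) / ‖x‖ := by field_simp
      rw [this, abs_div, abs_mul, abs_div, abs_norm]; field_simp
    rw [e]
    have h3 : |x j| / ‖x‖ ≤ 1 := (div_le_one hpos).2 (abs_apply_le_norm x j)
    calc _ ≤ |p' ‖x‖ - dslope p 0 ‖x‖| * 1 := mul_le_mul_of_nonneg_left h3 (abs_nonneg _)
      _ ≤ _ := by rw [mul_one]; exact (abs_sub _ _).trans (le_abs_self _)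
  have hFL : ∀ j, MemLp (fun x => fderiv ℝ f x (unitVec j)) 2 := fun j =>
    memLp_of_radial (hm j) hw (hbd j)
  have e1 : eLpNorm f 2 volume ≤ ofReal √(sphereArea * K) := by
    refine ennreal_le_of_sq_le (sqrt_nonneg _) ?_
    rw [sq_sqrt (by positivity)]
    exact eLpNorm_le_of_radial h1 fun x _ => by rw [← hfp x, abs_mul, abs_norm]
  have e2 : ∀ j, eLpNorm (fun x => fderiv ℝ f x (unitVec j)) 2 volume ≤
      ofReal (4 * √(sphereArea * K)) := fun j => by
    refine ennreal_le_of_sq_le (by positivity) ((eLpNorm_le_of_radial hw (hbd j)).trans ?_)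
    rw [mul_pow, sq_sqrt (by positivity)]
    exact ofReal_le_ofReal (by nlinarith [mul_nonneg hA hK])
  calc sobolevNorm (1 / 2) f ^ 2
      ≤ eLpNorm f 2 volume * ∑ j, eLpNorm (fun x => fderiv ℝ f x (unitVec j)) 2 volume :=
        sobolevNorm_half_sq_le hfL hFL fun j φ =>
          integral_schwartz_mul_fderiv (fun x => (hf x).hasFDerivAt) hfL (hFL j) φ
    _ ≤ ofReal √(sphereArea * K) * ∑ _j : Fin 3, ofReal (4 * √(sphereArea * K)) :=
        mul_le_mul' e1 (sum_le_sum fun j _ => e2 j)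
    _ = ofReal (12 * sphereArea * K) := by
        rw [sum_const, card_univ, Fintype.card_fin, nsmul_eq_mul, Nat.cast_ofNat,
          ← ofReal_ofNat, ← ofReal_mul (by positivity),
          ← ofReal_mul (by positivity)]
        congr 1; linear_combination 12 * mul_self_sqrt (mul_nonneg hA hK)

/-- The critical Sobolev norm of a time derivative `q(|x|)/|x|` on `ℝ³`, `q = a' + h`.  It is
the divergence of `x B(|x|)`, where `B(r) = r⁻³ ∫₀^r s q(s) ds`, and Hardy's inequality bounds
`r² B = a - r⁻¹ ∫₀^r a + r⁻¹ ∫₀^r s h` in `L²(0, ∞)`. -/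
lemma sobolevNorm_neg_half_le_of_radial {g : Space → ℝ} (hg : Continuous g) {q a a' h : ℝ → ℝ}
    (hgq : ∀ x, ‖x‖ * g x = q ‖x‖) (ha : ∀ r, HasDerivAt a (a' r) r)
    (hq : ∀ r, q r = a' r + h r) (ha' : Continuous a') (hh : Continuous h)
    (h1 : SqIntegralLe q K) (h2 : SqIntegralLe a K) (h3 : SqIntegralLe (fun r => r * h r) K) :
    sobolevNorm (-1 / 2) g ^ 2 ≤ ofReal (30 * sphereArea * K) := by
  have hK := h1.nonneg
  have hA := sphereArea_nonneg
  have hqc := h1.continuous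
  -- the primitive of `s q(s)`, and the radial profile `γ` of `g`
  set W : ℝ → ℝ := fun r => ∫ s in 0..r, s * q s with hW
  set γ : ℝ → ℝ := fun r => g (r • unitVec 0) with hγ
  have hWd : ∀ r, HasDerivAt W (r * q r) r := fun r =>
    ((continuous_id.mul hqc).integral_hasStrictDerivAt 0 r).hasDerivAt
  have hW0 : W 0 = 0 := by simp [hW]
  have hγc : Continuous γ := hg.comp (by fun_prop)
  have hnorm : ∀ r : ℝ, ‖r • unitVec 0‖ = |r| := fun r => by simp [norm_smul, unitVec]
  have hγq : ∀ r, 0 ≤ r → r * γ r = q r := fun r hr => by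
    have := hgq (r • unitVec 0)
    rwa [hnorm, abs_of_nonneg hr] at this
  have hgγ : ∀ x, g x = γ ‖x‖ := fun x => by
    rcases eq_or_ne x 0 with rfl | hx
    · simp [hγ]
    · have hpos := norm_pos_iff.2 hx
      exact mul_left_cancel₀ hpos.ne' (by rw [hgq, hγq _ hpos.le])
  set B : ℝ → ℝ := fun r => ∫ σ in 0..1, σ ^ 2 * γ (r * σ) with hB
  have hBc : Continuous B := intervalIntegral.continuous_parametric_intervalIntegral_of_continuous'
    (f := fun r σ => σ ^ 2 * γ (r * σ)) (by fun_prop) 0 1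
  have hBW : ∀ r, 0 ≤ r → r ^ 3 * B r = W r := fun r hr => by
    have e := intervalIntegral.mul_integral_comp_mul_left (f := fun s => s * q s) (a := 0) (b := 1) r
    rw [mul_zero, mul_one] at e; rw [hW]
    dsimp only; rw [← e, hB, pow_succ', mul_assoc, ← intervalIntegral.integral_const_mul]
    congr 1
    refine intervalIntegral.integral_congr fun σ hσ => ?_
    rw [uIcc_of_le zero_le_one] at hσ; rw [← hγq (r * σ) (mul_nonneg hr hσ.1)]; ring
  have hBd : ∀ r, 0 < r → HasDerivAt B ((γ r - 3 * B r) / r) r := fun r hr => by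
    have := (hWd r).fun_div (hasDerivAt_pow 3 r) (by positivity)
    refine (this.congr_of_eventuallyEq ?_).congr_deriv ?_
    · filter_upwards [isOpen_Ioi.mem_nhds hr] with s hs
      have : s ≠ 0 := (mem_Ioi.1 hs).ne'
      rw [← hBW s (mem_Ioi.1 hs).le]; field_simp
    · simp only [Nat.cast_ofNat, Nat.reduceSub]
      rw [← hBW r hr.le, ← hγq r hr.le]; field_simp
  have hB0 : γ 0 - 3 * B 0 = 0 := by
    simp only [hB, zero_mul]
    rw [intervalIntegral.integral_mul_const, integral_pow]; norm_num; ring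
  -- `r² B` in terms of Hardy averages
  have hac : Continuous a := h2.continuous
  have hA1 : ∀ r, HasDerivAt (fun r => ∫ s in 0..r, a s) (a r) r := fun r =>
    (hac.integral_hasStrictDerivAt 0 r).hasDerivAt
  have hA2 : ∀ r, HasDerivAt (fun r => ∫ s in 0..r, s * h s) (r * h r) r := fun r =>
    (h3.continuous.integral_hasStrictDerivAt 0 r).hasDerivAt
  have hA3 : ∀ r, HasDerivAt (fun r => ∫ s in 0..r, |q s|) |q r| r := fun r =>
    (h1.abs.continuous.integral_hasStrictDerivAt 0 r).hasDerivAt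
  have hy1 := h2.hardy hA1 (by simp)
  have hy2 := h3.hardy hA2 (by simp)
  have hy3 := h1.abs.hardy hA3 (by simp)
  set κ₁ := dslope (fun r => ∫ s in 0..r, a s) 0
  set κ₂ := dslope (fun r => ∫ s in 0..r, s * h s) 0
  set κ₃ := dslope (fun r => ∫ s in 0..r, |q s|) 0
  have m1 : ∀ r, r * κ₁ r = ∫ s in 0..r, a s := mul_dslope_zero (by simp)
  have m2 : ∀ r, r * κ₂ r = ∫ s in 0..r, s * h s := mul_dslope_zero (by simp)
  have m3 : ∀ r, r * κ₃ r = ∫ s in 0..r, |q s| := mul_dslope_zero (by simp)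
  have hWe : ∀ r, W r = r * a r - r * κ₁ r + r * κ₂ r := fun r => by
    have e1 : ∫ s in 0..r, (1 * a s + s * a' s) = r * a r - 0 * a 0 :=
      intervalIntegral.integral_eq_sub_of_hasDerivAt (f := fun s => s * a s)
        (fun s _ => (hasDerivAt_id' s).fun_mul (ha s)) ((by fun_prop : Continuous _).intervalIntegrable _ _)
    rw [intervalIntegral.integral_add ((by fun_prop : Continuous _).intervalIntegrable _ _)
      ((by fun_prop : Continuous _).intervalIntegrable _ _)] at e1
    simp only [one_mul, zero_mul, sub_zero] at e1
    have e2 : W r = (∫ s in 0..r, s * a' s) + ∫ s in 0..r, s * h s := by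
      rw [← intervalIntegral.integral_add ((by fun_prop : Continuous _).intervalIntegrable _ _)
        ((by fun_prop : Continuous _).intervalIntegrable _ _)]
      refine intervalIntegral.integral_congr fun s _ => ?_
      simp only [hq s]; ring
    rw [m1, m2, e2]; linear_combination e1
  have hsum := (h2.add (hy1.const_mul (-1))).add hy2
  have hBr : ∀ r, 0 < r → r ^ 2 * B r = a r + -1 * κ₁ r + κ₂ r := fun r hr => by
    refine mul_left_cancel₀ hr.ne' ?_
    have := hBW r hr.le
    rw [hWe r] at this; linear_combination this
  have hBr' : ∀ r, 0 < r → r * |B r| ≤ κ₃ r := fun r hr => by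
    have e : |W r| ≤ r * (r * κ₃ r) := by
      rw [m3, ← intervalIntegral.integral_const_mul]
      refine (intervalIntegral.abs_integral_le_integral_abs hr.le).trans ?_
      refine intervalIntegral.integral_mono_on hr.le
        ((by fun_prop : Continuous _).intervalIntegrable _ _)
        ((by fun_prop : Continuous _).intervalIntegrable _ _) fun s hs => ?_
      rw [abs_mul, abs_of_nonneg hs.1]
      exact mul_le_mul_of_nonneg_right hs.2 (abs_nonneg _)
    rw [← hBW r hr.le, abs_mul, abs_of_pos (by positivity)] at e
    have h2 : r ^ 2 * (r * |B r|) ≤ r ^ 2 * κ₃ r := by linarith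
    exact le_of_mul_le_mul_left h2 (by positivity)
  -- the vector field
  set F : Fin 3 → Space → ℝ := fun j x => x j * B ‖x‖ with hF
  have hFc : ∀ j, Continuous (F j) := fun j => by fun_prop
  have hproj : ∀ j x, HasFDerivAt (fun y : Space => y j) (EuclideanSpace.proj j : Space →L[ℝ] ℝ) x :=
    fun j x => (EuclideanSpace.proj j : Space →L[ℝ] ℝ).hasFDerivAt
  have hpu : ∀ j, (EuclideanSpace.proj j : Space →L[ℝ] ℝ) (unitVec j) = 1 := fun j => by simp [unitVec]
  have hin : ∀ (x : Space) j, innerSL ℝ x (unitVec j) = x j := fun x j => by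
    simp [unitVec, EuclideanSpace.inner_single_right]
  have hFd : ∀ j x, ∃ L : Space →L[ℝ] ℝ, HasFDerivAt (F j) L x ∧
      L (unitVec j) = B ‖x‖ + x j ^ 2 * ((γ ‖x‖ - 3 * B ‖x‖) / ‖x‖ ^ 2) := fun j x => by
    rcases eq_or_ne x 0 with rfl | hx
    · refine ⟨B 0 • (EuclideanSpace.proj j : Space →L[ℝ] ℝ), ?_, by simp [hpu]⟩
      rw [hasFDerivAt_iff_isLittleO_nhds_zero]
      have hlim : Tendsto (fun y : Space => B ‖y‖ - B 0) (𝓝 0) (𝓝 0) := by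
        have : Continuous fun y : Space => B ‖y‖ - B 0 := by fun_prop
        simpa using this.tendsto 0
      have hO : (fun y : Space => y j) =O[𝓝 0] fun y => ‖y‖ :=
        Asymptotics.isBigO_of_le _ fun y => by rw [norm_norm]; exact abs_apply_le_norm y j
      have := hO.mul_isLittleO ((Asymptotics.isLittleO_one_iff ℝ).2 hlim)
      simp only [mul_one] at this
      refine this.of_norm_right.congr_left fun y => ?_
      simp [hF]; ring
    · have hpos := norm_pos_iff.2 hx
      refine ⟨_, (hproj j x).fun_mul (hasFDerivAt_comp_norm hx (hBd _ hpos)), ?_⟩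
      simp only [add_apply, smul_apply, hin, hpu, smul_eq_mul]; field_simp; ring
  choose L hL hLe using hFd
  have hdiv : ∀ x, ∑ j, L j x (unitVec j) = g x := fun x => by
    simp only [hLe]
    rw [sum_add_distrib, ← sum_mul, sum_const, card_univ, Fintype.card_fin, nsmul_eq_mul, hgγ]
    have := sum_apply_sq x
    simp only [← sq] at this; rw [this]
    rcases eq_or_ne x 0 with rfl | hx
    · simp only [norm_zero]; push_cast; linear_combination -hB0
    · have hpos := norm_pos_iff.2 hx
      field_simp; push_cast; ring
  have hFb : ∀ j x, x ≠ 0 → ‖x‖ * |F j x| ≤ |a ‖x‖ + -1 * κ₁ ‖x‖ + κ₂ ‖x‖| := fun j x hx => by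
    have hpos := norm_pos_iff.2 hx
    rw [← hBr _ hpos, hF]; simp only [abs_mul, abs_pow, abs_norm]
    nlinarith [mul_le_mul_of_nonneg_left (abs_apply_le_norm x j)
      (mul_nonneg hpos.le (abs_nonneg (B ‖x‖)))]
  have hgb : ∀ x, x ≠ 0 → ‖x‖ * |g x| ≤ |q ‖x‖| := fun x _ => by rw [← hgq x, abs_mul, abs_norm]
  have hgL : MemLp g 2 := memLp_of_radial hg.aestronglyMeasurable h1 hgb
  have hFL : ∀ j, MemLp (F j) 2 := fun j => memLp_of_radial (hFc j).aestronglyMeasurable hsum (hFb j)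
  have hLL : ∀ j, MemLp (fun x => L j x (unitVec j)) 2 := fun j => by
    have hm : AEStronglyMeasurable (fun x => L j x (unitVec j)) := by
      have : (fun x => L j x (unitVec j)) = fun x => fderiv ℝ (F j) x (unitVec j) := by
        ext x; rw [(hL j x).fderiv]
      rw [this]
      exact (measurable_fderiv_apply_const ℝ (F j) (unitVec j)).aestronglyMeasurable
    refine memLp_of_radial hm (h1.abs.add (hy3.const_mul 4)) fun x hx => ?_
    have hpos := norm_pos_iff.2 hx
    have hb1 := hBr' _ hpos
    have hx2 : x j ^ 2 / ‖x‖ ^ 2 ≤ 1 := (div_le_one (by positivity)).2 (abs_apply_sq_le x j)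
    have hx3 : 0 ≤ x j ^ 2 / ‖x‖ ^ 2 := by positivity
    rw [hLe, ← hγq _ hpos.le]
    have e : x j ^ 2 * ((γ ‖x‖ - 3 * B ‖x‖) / ‖x‖ ^ 2) = (x j ^ 2 / ‖x‖ ^ 2) * (γ ‖x‖ - 3 * B ‖x‖) := by
      ring
    rw [e]
    have h4 : |B ‖x‖ + x j ^ 2 / ‖x‖ ^ 2 * (γ ‖x‖ - 3 * B ‖x‖)| ≤ |γ ‖x‖| + 4 * |B ‖x‖| := by
      refine (abs_add_le _ _).trans ?_
      rw [abs_mul, abs_of_nonneg hx3]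
      have h5 : |γ ‖x‖ - 3 * B ‖x‖| ≤ |γ ‖x‖| + 3 * |B ‖x‖| := by
        refine (abs_sub _ _).trans ?_
        rw [abs_mul]; norm_num
      nlinarith [mul_le_mul hx2 h5 (abs_nonneg _) zero_le_one]
    refine le_trans ?_ (le_abs_self _)
    rw [abs_mul, abs_norm]; nlinarith [mul_le_mul_of_nonneg_left h4 hpos.le]
  have e1 : eLpNorm g 2 volume ≤ ofReal √(sphereArea * K) := by
    refine ennreal_le_of_sq_le (sqrt_nonneg _) ?_
    rw [sq_sqrt (by positivity)]; exact eLpNorm_le_of_radial h1 hgb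
  have e2 : ∀ j, eLpNorm (F j) 2 volume ≤ ofReal (10 * √(sphereArea * K)) := fun j => by
    refine ennreal_le_of_sq_le (by positivity) ((eLpNorm_le_of_radial hsum (hFb j)).trans ?_)
    rw [mul_pow, sq_sqrt (by positivity)]
    exact ofReal_le_ofReal (by nlinarith [mul_nonneg hA hK])
  calc sobolevNorm (-1 / 2) g ^ 2 ≤ eLpNorm g 2 volume * ∑ j, eLpNorm (F j) 2 volume := by
        refine sobolevNorm_neg_half_sq_le hgL hFL fun φ => ?_
        rw [← sum_neg_distrib]
        simp only [← fun j => integral_schwartz_mul_fderiv (hL j) (hFL j) (hLL j) φ]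
        refine Eq.trans ?_ (integral_finsetSum (μ := volume) Finset.univ
          (f := fun j x => φ x * (L j x (unitVec j) : ℂ))
          fun j _ => integrable_schwartz_mul (hLL j).ofReal φ)
        refine integral_congr_ae (ae_of_all _ fun x => ?_)
        dsimp only; rw [← mul_sum, ← hdiv x]; push_cast; rfl
    _ ≤ ofReal √(sphereArea * K) * ∑ _j : Fin 3, ofReal (10 * √(sphereArea * K)) :=
        mul_le_mul' e1 (sum_le_sum fun j _ => e2 j)
    _ = ofReal (30 * sphereArea * K) := by
        rw [sum_const, card_univ, Fintype.card_fin, nsmul_eq_mul, Nat.cast_ofNat,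
          ← ofReal_ofNat, ← ofReal_mul (by positivity),
          ← ofReal_mul (by positivity)]
        congr 1; linear_combination 30 * mul_self_sqrt (mul_nonneg hA hK)

end

/-! ### Smooth radial solutions of the linear wave equation -/

section

variable {F G : ℝ → ℝ} {C : ℝ}

/-- The weighted mean of `F(t + σ r)` over `σ ∈ [-1, 1]`.  For `k = 0` and `F = G'` it is
`(G(t + r) - G(t - r)) / r`, which is a solution of the linear wave equation for `r = |x|`.  The
weights `(1 - σ²)^k` are there because the spatial gradient raises `k` by one. -/
def radialMean (k : ℕ) (F : ℝ → ℝ) (t r : ℝ) : ℝ :=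
  ∫ σ in (-1 : ℝ)..1, (1 - σ ^ 2) ^ k * F (t + σ * r)

lemma _root_.ContDiff.deriv_infty (hF : ContDiff ℝ ∞ F) : ContDiff ℝ ∞ (deriv F) :=
  (contDiff_infty_iff_deriv.1 hF).2

lemma _root_.ContDiff.hasDerivAt_infty (hF : ContDiff ℝ ∞ F) (x : ℝ) : HasDerivAt F (deriv F x) x :=
  ((contDiff_infty_iff_deriv.1 hF).1 x).hasDerivAt

lemma integral_deriv_mul_comp {V V' F' : ℝ → ℝ} (hV : ∀ σ, HasDerivAt V (V' σ) σ)
    (hV' : Continuous V') (h1 : V 1 = 0) (h2 : V (-1) = 0) (hF : ∀ σ, HasDerivAt F (F' σ) σ)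
    (hF' : Continuous F') (t r : ℝ) :
    ∫ σ in (-1 : ℝ)..1, V' σ * F (t + σ * r) = -(r * ∫ σ in (-1 : ℝ)..1, V σ * F' (t + σ * r)) := by
  have hd : ∀ σ, HasDerivAt (fun σ => F (t + σ * r)) (F' (t + σ * r) * r) σ := fun σ => by
    have := HasDerivAt.comp (h₂ := F) σ (hF (t + σ * r)) (((hasDerivAt_id' σ).mul_const r).const_add t)
    rwa [one_mul] at this
  have hVc : Continuous V := continuous_iff_continuousAt.2 fun s => (hV s).continuousAt
  have := intervalIntegral.integral_mul_deriv_eq_deriv_mul (a := -1) (b := 1) (u := V)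
    (fun σ _ => hV σ) (fun σ _ => hd σ) (hV'.intervalIntegrable _ _)
    ((by fun_prop : Continuous fun σ => F' (t + σ * r) * r).intervalIntegrable _ _)
  rw [h1, h2, zero_mul, zero_mul, sub_zero, zero_sub] at this
  rw [← neg_eq_iff_eq_neg, ← this, ← intervalIntegral.integral_const_mul]
  exact intervalIntegral.integral_congr fun σ _ => by ring

lemma integral_mul_radialMean (k : ℕ) (hF : ContDiff ℝ ∞ F) (t r : ℝ) :
    ∫ σ in (-1 : ℝ)..1, (1 - σ ^ 2) ^ k * σ * F (t + σ * r) =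
      r * ((2 * (k + 1 : ℝ))⁻¹ * radialMean (k + 1) (deriv F) t r) := by
  have h := integral_deriv_mul_comp (V := fun σ => -(2 * (k + 1 : ℝ))⁻¹ * (1 - σ ^ 2) ^ (k + 1))
    (V' := fun σ => (1 - σ ^ 2) ^ k * σ) (fun σ => ?_) (by fun_prop) (by simp) (by simp)
    (ContDiff.hasDerivAt_infty hF) hF.deriv_infty.continuous t r
  · rw [h, radialMean, ← mul_neg, ← intervalIntegral.integral_neg]
    congr 1; rw [← intervalIntegral.integral_const_mul]
    exact intervalIntegral.integral_congr fun σ _ => by ring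
  · have := ((((hasDerivAt_id' σ).fun_pow 2).const_sub 1).fun_pow (k + 1)).const_mul (-(2 * (k + 1 : ℝ))⁻¹)
    refine this.congr_deriv ?_
    have : (k + 1 : ℝ) ≠ 0 := by positivity
    push_cast; field_simp

lemma hasFDerivAt_radialMean (k : ℕ) (hF : ContDiff ℝ ∞ F) (p : ℝ × ℝ) :
    HasFDerivAt (fun p : ℝ × ℝ => radialMean k F p.1 p.2)
      (radialMean k (deriv F) p.1 p.2 • ContinuousLinearMap.fst ℝ ℝ ℝ +
        (p.2 * ((2 * (k + 1 : ℝ))⁻¹ * radialMean (k + 1) (deriv (deriv F)) p.1 p.2)) •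
          ContinuousLinearMap.snd ℝ ℝ ℝ) p := by
  have hFc := hF.continuous
  have hFc' := hF.deriv_infty.continuous
  set F' : ℝ × ℝ → ℝ → ℝ × ℝ →L[ℝ] ℝ := fun p σ => ((1 - σ ^ 2) ^ k * deriv F (p.1 + σ * p.2)) •
    (ContinuousLinearMap.fst ℝ ℝ ℝ + σ • ContinuousLinearMap.snd ℝ ℝ ℝ) with hF'
  have hF'c : Continuous fun z : (ℝ × ℝ) × ℝ => F' z.1 z.2 := by simp only [hF']; fun_prop
  obtain ⟨C, hC⟩ := ((isCompact_closedBall p 1).prod (isCompact_Icc (a := (-1 : ℝ)) (b := 1)))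
    |>.exists_bound_of_continuousOn hF'c.continuousOn
  have hslice : ∀ p, Continuous (F' p) := fun p => hF'c.comp (Continuous.prodMk_right p)
  have key := intervalIntegral.hasFDerivAt_integral_of_dominated_of_fderiv_le (𝕜 := ℝ) (μ := volume)
    (a := -1) (b := 1) (bound := fun _ => C) (F' := F')
    (F := fun p σ => (1 - σ ^ 2) ^ k * F (p.1 + σ * p.2))
    (Metric.closedBall_mem_nhds p one_pos)
    (Eventually.of_forall fun q => (by fun_prop : Continuous fun σ : ℝ =>
      (1 - σ ^ 2) ^ k * F (q.1 + σ * q.2)).aestronglyMeasurable)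
    ((by fun_prop : Continuous fun σ : ℝ => (1 - σ ^ 2) ^ k * F (p.1 + σ * p.2)).intervalIntegrable _ _)
    (hslice p).aestronglyMeasurable
    (ae_of_all _ fun σ hσ q hq => hC (q, σ) ⟨hq, by
      rw [uIoc_of_le (by norm_num)] at hσ; exact ⟨hσ.1.le, hσ.2⟩⟩)
    intervalIntegrable_const
    (ae_of_all _ fun σ _ q _ => by
      have h1 : HasFDerivAt (fun q : ℝ × ℝ => q.1 + σ * q.2)
          (ContinuousLinearMap.fst ℝ ℝ ℝ + σ • ContinuousLinearMap.snd ℝ ℝ ℝ) q :=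
        (ContinuousLinearMap.fst ℝ ℝ ℝ + σ • ContinuousLinearMap.snd ℝ ℝ ℝ).hasFDerivAt
      refine (((ContDiff.hasDerivAt_infty hF (q.1 + σ * q.2)).comp_hasFDerivAt q h1).const_mul
        ((1 - σ ^ 2) ^ k)).congr_fderiv ?_
      rw [smul_smul])
  refine key.congr_fderiv ?_
  refine ContinuousLinearMap.ext fun y => ?_
  rw [ContinuousLinearMap.intervalIntegral_apply ((hslice p).intervalIntegrable _ _)]
  simp only [hF', add_apply, smul_apply, smul_eq_mul, ContinuousLinearMap.coe_fst',
    ContinuousLinearMap.coe_snd']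
  rw [← integral_mul_radialMean k hF.deriv_infty, radialMean, ← intervalIntegral.integral_mul_const,
    ← intervalIntegral.integral_mul_const, ← intervalIntegral.integral_add
      ((by fun_prop : Continuous _).intervalIntegrable _ _)
      ((by fun_prop : Continuous _).intervalIntegrable _ _)]
  exact intervalIntegral.integral_congr fun σ _ => by ring

/-- At `x = 0` the map `(t, x) ↦ (t, |x|)` is not differentiable, but the mean is even in `r`, so
that its derivative in `r` vanishes there. -/
lemma hasFDerivAt_radialMean_norm (k : ℕ) (hF : ContDiff ℝ ∞ F) (p : ℝ × Space) :
    HasFDerivAt (fun p : ℝ × Space => radialMean k F p.1 ‖p.2‖)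
      (radialMean k (deriv F) p.1 ‖p.2‖ • ContinuousLinearMap.fst ℝ ℝ Space +
        ((2 * (k + 1 : ℝ))⁻¹ * radialMean (k + 1) (deriv (deriv F)) p.1 ‖p.2‖) •
          (innerSL ℝ p.2).comp (ContinuousLinearMap.snd ℝ ℝ Space)) p := by
  have hm := hasFDerivAt_radialMean k hF (p.1, ‖p.2‖)
  rcases eq_or_ne p.2 0 with h0 | h0
  · rw [h0, norm_zero] at hm ⊢; simp only [zero_mul, zero_smul, add_zero] at hm
    have e : HasFDerivAt (fun q : ℝ × ℝ => radialMean k F q.1 q.2)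
        (radialMean k (deriv F) p.1 0 • ContinuousLinearMap.fst ℝ ℝ ℝ) (p.1, 0) := hm
    rw [hasFDerivAt_iff_isLittleO_nhds_zero] at e ⊢
    have hc : Tendsto (fun h : ℝ × Space => (h.1, ‖h.2‖)) (𝓝 0) (𝓝 0) := by
      have : Continuous fun h : ℝ × Space => (h.1, ‖h.2‖) := by fun_prop
      have := this.tendsto 0
      simpa only [Prod.fst_zero, Prod.snd_zero, norm_zero, Prod.mk_zero_zero] using this
    have hO : ((fun h : ℝ × Space => (h.1, ‖h.2‖)) : ℝ × Space → ℝ × ℝ) =O[𝓝 0] fun h => h :=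
      Asymptotics.isBigO_of_le _ fun h => by simp [Prod.norm_def]
    refine ((e.comp_tendsto hc).trans_isBigO hO).congr_left fun h => ?_
    simp [h0]
  · have hn : HasFDerivAt (fun q : ℝ × Space => (q.1, ‖q.2‖))
        ((ContinuousLinearMap.fst ℝ ℝ Space).prod
          (((1 / ‖p.2‖) • innerSL ℝ p.2).comp (ContinuousLinearMap.snd ℝ ℝ Space))) p := by
      refine HasFDerivAt.prodMk hasFDerivAt_fst ?_
      exact HasFDerivAt.comp p (hasFDerivAt_comp_norm h0 (hasDerivAt_id' ‖p.2‖)) hasFDerivAt_snd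
    have hpos : ‖p.2‖ ≠ 0 := norm_ne_zero_iff.2 h0
    refine (HasFDerivAt.comp p (g := fun p : ℝ × ℝ => radialMean k F p.1 p.2) hm hn).congr_fderiv ?_
    refine ContinuousLinearMap.ext fun y => ?_
    simp only [ContinuousLinearMap.comp_apply, add_apply, smul_apply, smul_eq_mul,
      ContinuousLinearMap.coe_fst', ContinuousLinearMap.coe_snd', ContinuousLinearMap.prod_apply]
    field_simp

lemma contDiff_radialMean_norm (k : ℕ) (hF : ContDiff ℝ ∞ F) :
    ContDiff ℝ ∞ (fun p : ℝ × Space => radialMean k F p.1 ‖p.2‖) := by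
  rw [contDiff_infty]
  intro n
  induction n generalizing k F with
  | zero =>
    exact contDiff_zero.2 (continuous_iff_continuousAt.2 fun p =>
      (hasFDerivAt_radialMean_norm k hF p).continuousAt)
  | succ n ih =>
    rw [Nat.cast_succ]
    refine contDiff_succ_iff_hasFDerivAt.2 ⟨_, ?_, fun p => hasFDerivAt_radialMean_norm k hF p⟩
    refine ((ih k hF.deriv_infty).smul contDiff_const).add
      ((contDiff_const.mul (ih (k + 1) hF.deriv_infty.deriv_infty)).smul ?_)
    exact ((innerSL ℝ).contDiff.comp contDiff_snd).clm_comp contDiff_const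

lemma mul_radialMean_zero (hG : ContDiff ℝ ∞ G) (t r : ℝ) :
    r * radialMean 0 (deriv G) t r = G (t + r) - G (t - r) := by
  have := intervalIntegral.integral_eq_sub_of_hasDerivAt (a := -1) (b := 1)
    (f := fun σ => G (t + σ * r)) (f' := fun σ => deriv G (t + σ * r) * r) (fun σ _ => by
      have := HasDerivAt.comp (h₂ := G) σ (ContDiff.hasDerivAt_infty hG (t + σ * r))
        (((hasDerivAt_id' σ).mul_const r).const_add t)
      rwa [one_mul] at this)
    ((by have := hG.deriv_infty.continuous; fun_prop :
      Continuous fun σ => deriv G (t + σ * r) * r).intervalIntegrable _ _)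
  rw [intervalIntegral.integral_mul_const] at this
  simp only [radialMean, pow_zero, one_mul]; rw [mul_comm, this]; ring_nf

lemma hasDerivAt_radialMean_time (k : ℕ) (hF : ContDiff ℝ ∞ F) (t r : ℝ) :
    HasDerivAt (fun t => radialMean k F t r) (radialMean k (deriv F) t r) t := by
  have := (hasFDerivAt_radialMean k hF (t, r)).comp_hasDerivAt t
    ((hasDerivAt_id' t).prodMk (hasDerivAt_const t r))
  refine this.congr_deriv ?_
  simp

/-- The Euler-Poisson-Darboux identity for the spherical means. -/
lemma laplacian_radialMean (hF : ContDiff ℝ ∞ F) (t : ℝ) (x : Space) :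
    Laplacian.laplacian (fun x : Space => radialMean 0 F t ‖x‖) x =
      radialMean 0 (deriv (deriv F)) t ‖x‖ := by
  have hF2 := hF.deriv_infty.deriv_infty
  have hs : ∀ k {F : ℝ → ℝ}, ContDiff ℝ ∞ F → ∀ x : Space,
      HasFDerivAt (fun x : Space => radialMean k F t ‖x‖)
        (((2 * (k + 1 : ℝ))⁻¹ * radialMean (k + 1) (deriv (deriv F)) t ‖x‖) • innerSL ℝ x) x := fun k F hF x => by
    have h1 : HasFDerivAt (fun y : Space => (t, y)) ((0 : Space →L[ℝ] ℝ).prod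
        (ContinuousLinearMap.id ℝ Space)) x := (hasFDerivAt_const t x).prodMk (hasFDerivAt_id x)
    refine (HasFDerivAt.comp x (g := fun p : ℝ × Space => radialMean k F p.1 ‖p.2‖)
      (hasFDerivAt_radialMean_norm k hF (t, x)) h1).congr_fderiv ?_
    refine ContinuousLinearMap.ext fun y => ?_
    simp
  obtain ⟨L, hL⟩ : ∃ L : Space →L[ℝ] Space →L[ℝ] ℝ, ∀ y, L y = innerSL ℝ y := ⟨innerSL ℝ, fun _ => rfl⟩
  have h3 : HasFDerivAt (fun y : Space => ((2 * (((0 : ℕ) : ℝ) + 1))⁻¹ *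
      radialMean (0 + 1) (deriv (deriv F)) t ‖y‖) • L y) _ x :=
    ((hs 1 hF2 x).const_mul _).smul L.hasFDerivAt
  rw [laplacian_eq_sum (Eventually.of_forall fun y => (hs 0 hF y).congr_fderiv (by rw [hL])) h3]
  have hx : ∀ j, innerSL ℝ x (unitVec j) = x j := fun j => by
    simp [unitVec, EuclideanSpace.inner_single_right]
  have hu : ∀ j, innerSL ℝ (unitVec j) (unitVec j) = 1 := fun j => by simp [unitVec]
  simp only [add_apply, smul_apply, ContinuousLinearMap.smulRight_apply, hL, hx, hu, smul_eq_mul]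
  -- integration by parts turns the weight `(1 - σ²)²` and two derivatives into `1 - 3 σ²`
  set H := deriv (deriv F)
  have hHc := hF2.continuous
  have e1 : ‖x‖ * (‖x‖ * radialMean 2 (deriv (deriv H)) t ‖x‖) =
      -4 * ∫ σ in (-1 : ℝ)..1, (1 - 3 * σ ^ 2) * H (t + σ * ‖x‖) := by
    have a1 := integral_mul_radialMean 1 hF2.deriv_infty t ‖x‖
    have a2 := integral_deriv_mul_comp (V := fun σ => (1 - σ ^ 2) * σ) (V' := fun σ => 1 - 3 * σ ^ 2)
      (fun σ => ((((hasDerivAt_id' σ).fun_pow 2).const_sub 1).fun_mul (hasDerivAt_id' σ)).congr_deriv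
        (by simp; ring)) (by fun_prop) (by simp) (by simp) (ContDiff.hasDerivAt_infty hF2)
      hF2.deriv_infty.continuous t ‖x‖
    rw [a2]; norm_num at a1; rw [a1]; ring
  have e2 : ∫ σ in (-1 : ℝ)..1, (1 - 3 * σ ^ 2) * H (t + σ * ‖x‖) =
      3 * radialMean 1 H t ‖x‖ - 2 * radialMean 0 H t ‖x‖ := by
    simp only [radialMean]
    rw [← intervalIntegral.integral_const_mul, ← intervalIntegral.integral_const_mul,
      ← intervalIntegral.integral_sub ((by fun_prop : Continuous _).intervalIntegrable _ _)
        ((by fun_prop : Continuous _).intervalIntegrable _ _)]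
    exact intervalIntegral.integral_congr fun σ _ => by ring
  have e3 := sum_apply_sq x
  simp only [Fin.sum_univ_three] at e3 ⊢; rw [e2] at e1; norm_num
  linear_combination (1 / 8 : ℝ) * radialMean 2 (deriv (deriv H)) t ‖x‖ * e3 + (1 / 8 : ℝ) * e1

lemma waveOp_radialMean (hF : ContDiff ℝ ∞ F) (t : ℝ) (x : Space) :
    waveOp (fun t x => radialMean 0 F t ‖x‖) t x = 0 := by
  have h1 : deriv (fun τ => radialMean 0 F τ ‖x‖) = fun τ => radialMean 0 (deriv F) τ ‖x‖ :=
    funext fun τ => (hasDerivAt_radialMean_time 0 hF τ ‖x‖).deriv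
  rw [waveOp, laplacian_radialMean hF, iteratedDeriv_succ, iteratedDeriv_one, h1,
    (hasDerivAt_radialMean_time 0 hF.deriv_infty t ‖x‖).deriv, sub_self]

lemma timeDeriv_radialMean (hF : ContDiff ℝ ∞ F) (t : ℝ) :
    timeDeriv (fun t x => radialMean 0 F t ‖x‖) t = fun x => radialMean 0 (deriv F) t ‖x‖ :=
  funext fun x => (hasDerivAt_radialMean_time 0 hF t ‖x‖).deriv

lemma SqIntegralLe.of_decay (hG : Continuous G) (h : ∀ z, G z ^ 2 ≤ C * (1 / (1 + z ^ 2))) (t : ℝ) :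
    SqIntegralLe (fun r => G (t + r)) (C * π) := by
  refine ⟨by fun_prop, fun R hR => ?_⟩
  have hC : 0 ≤ C := by simpa using (sq_nonneg _).trans (h 0)
  have h1 : ∫ r in 0..R, C * (1 / (1 + (t + r) ^ 2)) = C * (arctan (t + R) - arctan t) := by
    rw [intervalIntegral.integral_const_mul, intervalIntegral.integral_comp_add_left
      (fun z => 1 / (1 + z ^ 2)), integral_one_div_one_add_sq, add_zero]
  refine (intervalIntegral.integral_mono_on hR ((by fun_prop : Continuous fun r => G (t + r) ^ 2).intervalIntegrable _ _)
    (Continuous.intervalIntegrable (u := fun r => C * (1 / (1 + (t + r) ^ 2)))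
      (continuous_const.mul (continuous_const.div (by fun_prop) fun r => by positivity)) _ _)
    fun r _ => h (t + r)).trans ?_
  rw [h1]
  refine mul_le_mul_of_nonneg_left ?_ hC
  linarith [arctan_lt_pi_div_two (t + R), neg_pi_div_two_lt_arctan t]

lemma SqIntegralLe.of_decay_sub (hG : Continuous G)
    (h : ∀ z, G z ^ 2 ≤ C * (1 / (1 + z ^ 2))) (t : ℝ) :
    SqIntegralLe (fun r => G (t - r)) (C * π) := by
  have := SqIntegralLe.of_decay (G := fun z => G (-z)) (by fun_prop) (C := C)
    (fun z => by simpa using h (-z)) (-t)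
  simpa only [neg_add, neg_neg, ← sub_eq_add_neg] using this

/-- The critical norm of `(G(t + r) - G(t - r)) / r` is bounded in time. -/
lemma pairNorm_radialMean_le (hG : ContDiff ℝ ∞ G)
    (h0 : ∀ z, G z ^ 2 ≤ C * (1 / (1 + z ^ 2))) (h1 : ∀ z, deriv G z ^ 2 ≤ C * (1 / (1 + z ^ 2))) :
    ∃ M : ℝ≥0∞, M < ⊤ ∧ ∀ t, pairNorm (1 / 2) (fun x => radialMean 0 (deriv G) t ‖x‖)
      (fun x => radialMean 0 (deriv (deriv G)) t ‖x‖) ≤ M := by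
  have hG1 := hG.deriv_infty
  have hd := ContDiff.hasDerivAt_infty hG
  set K := 2 * (C * π) + 2 * (C * π)
  have hsm : ∀ k {F : ℝ → ℝ} (_ : ContDiff ℝ ∞ F) t, ContDiff ℝ ∞ fun x : Space => radialMean k F t ‖x‖ :=
    fun k F hF t => (contDiff_radialMean_norm k hF).comp (contDiff_prodMk_right t)
  have hp1 : ∀ t r, HasDerivAt (fun r => G (t + r)) (deriv G (t + r)) r := fun t r =>
    (hd (t + r)).comp_const_add t r
  have hp2 : ∀ t r, HasDerivAt (fun r => G (t - r)) (-deriv G (t - r)) r := fun t r =>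
    (hd (t - r)).comp_const_sub t r
  have s1 : ∀ t, SqIntegralLe (fun r => G (t + r)) (C * π) := .of_decay hG.continuous h0
  have s2 : ∀ t, SqIntegralLe (fun r => G (t - r)) (C * π) := .of_decay_sub hG.continuous h0
  have s3 : ∀ t, SqIntegralLe (fun r => deriv G (t + r)) (C * π) := .of_decay hG1.continuous h1
  have s4 : ∀ t, SqIntegralLe (fun r => deriv G (t - r)) (C * π) := .of_decay_sub hG1.continuous h1
  have neg : ∀ {f : ℝ → ℝ} {L : ℝ}, SqIntegralLe f L → SqIntegralLe (fun r => -f r) L := fun h =>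
    h.mono h.continuous.neg fun r _ => (abs_neg _).le
  have hz : SqIntegralLe (fun r : ℝ => r * (0 : ℝ)) K := ⟨by fun_prop, fun R _ => by
      simpa only [mul_zero, zero_pow two_ne_zero, intervalIntegral.integral_zero] using
        ((s1 0).add (s2 0)).nonneg⟩
  have a1 : ∀ t, sobolevNorm (1 / 2) (fun x => radialMean 0 (deriv G) t ‖x‖) ^ 2 ≤
      ofReal (12 * sphereArea * K) := fun t =>
    sobolevNorm_half_le_of_radial ((hsm 0 hG1 t).differentiable (by simp))
      (p := fun r => G (t + r) + -G (t - r)) (p' := fun r => deriv G (t + r) + deriv G (t - r))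
      (fun x => by rw [mul_radialMean_zero hG, sub_eq_add_neg])
      (fun r => ((hp1 t r).fun_add (hp2 t r).fun_neg).congr_deriv (by ring))
      ((s1 t).add (neg (s2 t))) ((s3 t).add (s4 t))
  have a2 : ∀ t, sobolevNorm (-1 / 2) (fun x => radialMean 0 (deriv (deriv G)) t ‖x‖) ^ 2 ≤
      ofReal (30 * sphereArea * K) := fun t =>
    sobolevNorm_neg_half_le_of_radial (hsm 0 hG1.deriv_infty t).continuous
      (q := fun r => deriv G (t + r) + -deriv G (t - r)) (a := fun r => G (t + r) + G (t - r))
      (a' := fun r => deriv G (t + r) + -deriv G (t - r)) (h := fun _ => 0)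
      (fun x => by rw [mul_radialMean_zero hG1, sub_eq_add_neg])
      (fun r => (hp1 t r).fun_add (hp2 t r)) (fun r => (add_zero _).symm)
      (by have := hG1.continuous; fun_prop) continuous_const
      ((s3 t).add (neg (s4 t))) ((s1 t).add (s2 t)) hz
  refine ⟨(ofReal (12 * sphereArea * K) + ofReal (30 * sphereArea * K)) ^ (1 / 2 : ℝ),
    ENNReal.rpow_lt_top_of_nonneg (by norm_num) (by simp), fun t => ?_⟩
  rw [pairNorm, show (1 / 2 - 1 : ℝ) = -1 / 2 by norm_num]
  exact ENNReal.rpow_le_rpow (add_le_add (a1 t) (a2 t)) (by norm_num)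

end

/-! ### Scattering -/

section Defect

variable {φ ψ : ℝ → ℝ} {U : Set ℝ}

/-- In the coordinates `a = arctan (t + r)`, `b = arctan (t - r)`, the product of `r` with the
solution of profile `φ` is `sin (a - b) φ(a + b)`.  Its trace `-φ(π/2 + b) cos b` on null infinity
`a = π/2` determines a linear solution, and this is `r` times the difference of the two. -/
def scatteringDefect (φ : ℝ → ℝ) (a b : ℝ) : ℝ := sin (a - b) * φ (a + b) + φ (π / 2 + a) * cos a -
    φ (π / 2 + b) * cos b

/-- The derivative of `scatteringDefect φ` in its first variable, where `ψ = φ'`. -/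
def scatteringDefectLeft (φ ψ : ℝ → ℝ) (a b : ℝ) : ℝ :=
  cos (a - b) * φ (a + b) + sin (a - b) * ψ (a + b) + ψ (π / 2 + a) * cos a - φ (π / 2 + a) * sin a

/-- The derivative of `scatteringDefect φ` in its second variable, where `ψ = φ'`. -/
def scatteringDefectRight (φ ψ : ℝ → ℝ) (a b : ℝ) : ℝ :=
  -cos (a - b) * φ (a + b) + sin (a - b) * ψ (a + b) - ψ (π / 2 + b) * cos b + φ (π / 2 + b) * sin b

lemma hasDerivAt_scatteringDefect (hS : SolvesOn (fun x => x ^ 3 - x) φ ψ U) {a b : ℝ → ℝ}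
    {a' b' τ : ℝ} (ha : HasDerivAt a a' τ) (hb : HasDerivAt b b' τ) (h1 : a τ + b τ ∈ U)
    (h2 : π / 2 + a τ ∈ U) (h3 : π / 2 + b τ ∈ U) :
    HasDerivAt (fun τ => scatteringDefect φ (a τ) (b τ))
      (scatteringDefectLeft φ ψ (a τ) (b τ) * a' + scatteringDefectRight φ ψ (a τ) (b τ) * b') τ := by
  have e1 := (ha.fun_sub hb).sin.fun_mul (HasDerivAt.comp (h₂ := φ) τ (hS _ h1).1 (ha.fun_add hb))
  have e2 := (HasDerivAt.comp (h₂ := φ) τ (hS _ h2).1 (ha.const_add (π / 2))).fun_mul ha.cos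
  have e3 := (HasDerivAt.comp (h₂ := φ) τ (hS _ h3).1 (hb.const_add (π / 2))).fun_mul hb.cos
  refine ((e1.fun_add e2).fun_sub e3).congr_deriv ?_
  simp only [scatteringDefectLeft, scatteringDefectRight, Function.comp_apply]; ring

lemma hasDerivAt_scatteringDefectRight (hS : SolvesOn (fun x => x ^ 3 - x) φ ψ U) {a b : ℝ}
    (h1 : a + b ∈ U) :
    HasDerivAt (fun a => scatteringDefectRight φ ψ a b) (sin (a - b) * φ (a + b) ^ 3) a := by
  have ha := (hasDerivAt_id' a).sub_const b
  have hs := (hasDerivAt_id' a).add_const b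
  have e1 := ha.cos.fun_neg.fun_mul (HasDerivAt.comp (h₂ := φ) a (hS _ h1).1 hs)
  have e2 := ha.sin.fun_mul (HasDerivAt.comp (h₂ := ψ) a (hS _ h1).2 hs)
  refine (((e1.fun_add e2).sub_const (ψ (π / 2 + b) * cos b)).add_const
    (φ (π / 2 + b) * sin b)).congr_deriv ?_
  simp only [Function.comp_apply]; ring

lemma scatteringDefect_pi_div_two (φ : ℝ → ℝ) (b : ℝ) : scatteringDefect φ (π / 2) b = 0 := by
  simp [scatteringDefect, sin_pi_div_two_sub]; ring

lemma scatteringDefectRight_pi_div_two (φ ψ : ℝ → ℝ) (b : ℝ) :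
    scatteringDefectRight φ ψ (π / 2) b = 0 := by
  simp [scatteringDefectRight, sin_pi_div_two_sub, cos_pi_div_two_sub]; ring

variable {M : ℝ}

lemma abs_scatteringDefectLeft_le (hφ : ∀ s ∈ Icc 0 π, |φ s| ≤ M)
    (hψ : ∀ s ∈ Icc 0 π, |ψ s| ≤ M) {a b : ℝ} (ha : a ≤ π / 2) (hb : b ≤ π / 2)
    (hab : 0 ≤ a + b) : |scatteringDefectLeft φ ψ a b| ≤ 4 * M := by
  have mulle : ∀ {x y : ℝ}, |x| ≤ 1 → |y| ≤ M → |x * y| ≤ M := fun hx hy => by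
    rw [abs_mul]
    calc _ ≤ 1 * M := mul_le_mul hx hy (abs_nonneg _) zero_le_one
      _ = M := one_mul M
  have i1 : a + b ∈ Icc 0 π := ⟨hab, by linarith⟩
  have i2 : π / 2 + a ∈ Icc 0 π := ⟨by linarith, by linarith⟩
  have k1 := abs_le.1 (mulle (abs_cos_le_one (a - b)) (hφ _ i1))
  have k2 := abs_le.1 (mulle (abs_sin_le_one (a - b)) (hψ _ i1))
  have k3 := abs_le.1 (mulle (abs_cos_le_one a) (hψ _ i2))
  have k4 := abs_le.1 (mulle (abs_sin_le_one a) (hφ _ i2))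
  rw [scatteringDefectLeft, abs_le]
  constructor <;> linarith [k1.1, k1.2, k2.1, k2.2, k3.1, k3.2, k4.1, k4.2]

lemma abs_scatteringDefect_le (hS : SolvesOn (fun x => x ^ 3 - x) φ ψ U) (hI : Icc 0 π ⊆ U)
    (hφ : ∀ s ∈ Icc 0 π, |φ s| ≤ M) (hψ : ∀ s ∈ Icc 0 π, |ψ s| ≤ M) {a b : ℝ}
    (ha : a ≤ π / 2) (hb : b ≤ π / 2) (hab : 0 ≤ a + b) :
    |scatteringDefect φ a b| ≤ 4 * M * (π / 2 - a) := by
  have hd : ∀ s ∈ Icc a (π / 2), HasDerivWithinAt (fun a => scatteringDefect φ a b)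
      (scatteringDefectLeft φ ψ s b) (Icc a (π / 2)) s := fun s hs => by
    have := hasDerivAt_scatteringDefect hS (hasDerivAt_id' s) (hasDerivAt_const s b)
      (hI ⟨by linarith [hs.1], by linarith [hs.2]⟩) (hI ⟨by linarith [hs.1], by linarith [hs.2]⟩)
      (hI ⟨by linarith [hs.1], by linarith [hs.2]⟩)
    exact (this.congr_deriv (by ring)).hasDerivWithinAt
  have := (convex_Icc a (π / 2)).norm_image_sub_le_of_norm_hasDerivWithin_le hd
    (fun s hs => abs_scatteringDefectLeft_le hφ hψ hs.2 hb (by linarith [hs.1]))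
    (left_mem_Icc.2 ha) (right_mem_Icc.2 ha)
  rwa [scatteringDefect_pi_div_two, zero_sub, norm_neg, norm_eq_abs, norm_eq_abs,
    abs_of_nonneg (by linarith : 0 ≤ π / 2 - a)] at this

lemma abs_scatteringDefectRight_le (hS : SolvesOn (fun x => x ^ 3 - x) φ ψ U)
    (hI : Icc 0 π ⊆ U) (hφ : ∀ s ∈ Icc 0 π, |φ s| ≤ M) {a b : ℝ}
    (ha : a ≤ π / 2) (hb : b ≤ π / 2) (hab : 0 ≤ a + b) :
    |scatteringDefectRight φ ψ a b| ≤ M ^ 3 * (π / 2 - a) := by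
  have hm : ∀ s ∈ Icc a (π / 2), s + b ∈ Icc 0 π := fun s hs =>
    ⟨by linarith [hs.1], by linarith [hs.2]⟩
  have := (convex_Icc a (π / 2)).norm_image_sub_le_of_norm_hasDerivWithin_le (C := M ^ 3)
    (fun s hs => (hasDerivAt_scatteringDefectRight hS (hI (hm s hs))).hasDerivWithinAt)
    (fun s hs => by
      rw [norm_eq_abs, abs_mul, abs_pow]
      calc _ ≤ 1 * M ^ 3 := mul_le_mul (abs_sin_le_one _)
            (pow_le_pow_left₀ (abs_nonneg _) (hφ _ (hm s hs)) 3) (by positivity) zero_le_one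
        _ = M ^ 3 := one_mul _)
    (left_mem_Icc.2 ha) (right_mem_Icc.2 ha)
  rwa [scatteringDefectRight_pi_div_two, zero_sub, norm_neg, norm_eq_abs, norm_eq_abs,
    abs_of_nonneg (by linarith : 0 ≤ π / 2 - a)] at this

end Defect

lemma SqIntegralLe.of_abs_le_div {f : ℝ → ℝ} (hf : Continuous f) {C t : ℝ} (ht : 0 < t)
    (h : ∀ r, 0 < r → |f r| ≤ C / (t + r)) : SqIntegralLe f (C ^ 2 / t) := by
  refine ⟨hf, fun R hR => ?_⟩
  have hd : ∀ r ∈ Icc 0 R, HasDerivAt (fun r => -(C ^ 2 / (t + r))) ((C / (t + r)) ^ 2) r := fun r hr => by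
    have h0 : t + r ≠ 0 := by linarith [hr.1]
    refine ((hasDerivAt_const r (C ^ 2)).fun_div ((hasDerivAt_id' r).const_add t) h0).fun_neg.congr_deriv ?_
    field_simp; ring
  have hc : ContinuousOn (fun r => (C / (t + r)) ^ 2) (Icc 0 R) :=
    (continuousOn_const.div (by fun_prop) fun r hr => by linarith [hr.1]).pow 2
  have hi : IntervalIntegrable (fun r => (C / (t + r)) ^ 2) volume 0 R :=
    ContinuousOn.intervalIntegrable (by rwa [uIcc_of_le hR])
  have e := intervalIntegral.integral_eq_sub_of_hasDerivAt
    (fun r hr => hd r (by rwa [uIcc_of_le hR] at hr)) hi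
  refine (intervalIntegral.integral_mono_on_of_le_Ioo hR ((hf.pow 2).intervalIntegrable _ _) hi
    fun r hr => ?_).trans ?_
  · change f r ^ 2 ≤ _
    rw [← sq_abs]; exact pow_le_pow_left₀ (abs_nonneg _) (h r hr.1) 2
  · rw [e, add_zero]
    have : 0 ≤ C ^ 2 / (t + R) := by positivity
    linarith

lemma pi_div_two_sub_arctan_le {z : ℝ} (hz : 0 < z) : π / 2 - arctan z ≤ 1 / z := by
  rw [← arctan_inv_of_pos hz, one_div]
  have h0 : 0 ≤ arctan z⁻¹ := arctan_nonneg.2 (by positivity)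
  calc arctan z⁻¹ ≤ tan (arctan z⁻¹) := by
        exact le_tan h0 (arctan_lt_pi_div_two _)
    _ = z⁻¹ := tan_arctan _

lemma hasDerivAt_arctan_cos_sq (z : ℝ) : HasDerivAt arctan (cos (arctan z) ^ 2) z := by
  rw [cos_sq_arctan]; exact hasDerivAt_arctan z

lemma cos_arctan_sq_le {z : ℝ} (hz : 1 ≤ z) : cos (arctan z) ^ 2 ≤ 1 / z := by
  rw [cos_sq_arctan]; exact one_div_le_one_div_of_le (by linarith) (by nlinarith)

/-- The trace at null infinity of the solution of profile `φ`, multiplied by `r`, with the opposite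
sign. -/
def radiationField (φ : ℝ → ℝ) (z : ℝ) : ℝ := -(φ (π / 2 + arctan z) * cos (arctan z))

section Scattering

variable {φ ψ : ℝ → ℝ} {U : Set ℝ} {M : ℝ}

lemma pi_div_two_add_arctan_mem (z : ℝ) : π / 2 + arctan z ∈ Icc 0 π :=
  ⟨by linarith [neg_pi_div_two_lt_arctan z], by linarith [arctan_lt_pi_div_two z]⟩

lemma arctan_add_arctan_mem {t : ℝ} (ht : 0 < t) (r : ℝ) :
    arctan (t + r) + arctan (t - r) ∈ Icc 0 π := by
  rw [← conformalTime_sq]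
  have := conformalTime_mem_Icc ht.le (sq_nonneg r)
  exact ⟨this.1, by linarith [this.2, arctan_lt_pi_div_two t]⟩

lemma contDiff_radiationField (hU : IsOpen U) (hI : Icc 0 π ⊆ U)
    (hS : SolvesOn (fun x => x ^ 3 - x) φ ψ U) : ContDiff ℝ ∞ (radiationField φ) := by
  have h1 : ContDiff ℝ ∞ fun z => π / 2 + arctan z := contDiff_const.add contDiff_arctan
  exact (((hS.contDiffOn hU (by fun_prop)).1.comp_contDiff h1
    fun z => hI (pi_div_two_add_arctan_mem z)).mul (contDiff_cos.comp contDiff_arctan)).neg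

lemma deriv_radiationField (hI : Icc 0 π ⊆ U) (hS : SolvesOn (fun x => x ^ 3 - x) φ ψ U) (z : ℝ) :
    deriv (radiationField φ) z = -(ψ (π / 2 + arctan z) * cos (arctan z) -
      φ (π / 2 + arctan z) * sin (arctan z)) * cos (arctan z) ^ 2 := by
  have ha := hasDerivAt_arctan_cos_sq z
  have e := (HasDerivAt.comp (h₂ := φ) z (hS _ (hI (pi_div_two_add_arctan_mem z))).1
    (ha.const_add (π / 2))).fun_mul ha.cos
  refine (e.fun_neg.congr_deriv ?_).deriv
  simp only [Function.comp_apply]; ring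

lemma radiationField_sq_le (hφ : ∀ s ∈ Icc 0 π, |φ s| ≤ M) (z : ℝ) :
    radiationField φ z ^ 2 ≤ 4 * M ^ 2 * (1 / (1 + z ^ 2)) := by
  rw [← cos_sq_arctan, radiationField, neg_sq, mul_pow]
  refine mul_le_mul_of_nonneg_right ?_ (sq_nonneg _)
  have := pow_le_pow_left₀ (abs_nonneg _) (hφ _ (pi_div_two_add_arctan_mem z)) 2
  rw [sq_abs] at this; nlinarith [sq_nonneg M]

lemma deriv_radiationField_sq_le (hI : Icc 0 π ⊆ U)
    (hS : SolvesOn (fun x => x ^ 3 - x) φ ψ U) (hφ : ∀ s ∈ Icc 0 π, |φ s| ≤ M)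
    (hψ : ∀ s ∈ Icc 0 π, |ψ s| ≤ M) (z : ℝ) :
    deriv (radiationField φ) z ^ 2 ≤ 4 * M ^ 2 * (1 / (1 + z ^ 2)) := by
  rw [deriv_radiationField hI hS, ← cos_sq_arctan]
  have k1 := hφ _ (pi_div_two_add_arctan_mem z)
  have k2 := hψ _ (pi_div_two_add_arctan_mem z)
  set p := φ (π / 2 + arctan z)
  set q := ψ (π / 2 + arctan z)
  have h1 : p ^ 2 ≤ M ^ 2 := by rw [← sq_abs]; exact pow_le_pow_left₀ (abs_nonneg _) k1 2
  have h2 : q ^ 2 ≤ M ^ 2 := by rw [← sq_abs]; exact pow_le_pow_left₀ (abs_nonneg _) k2 2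
  have h3 := sin_sq_add_cos_sq (arctan z)
  set c := cos (arctan z)
  set s := sin (arctan z)
  have hc : c ^ 2 ≤ 1 := by nlinarith [sq_nonneg s]
  have h4 : (q * c - p * s) ^ 2 ≤ 2 * M ^ 2 := by
    -- Cauchy-Schwarz, as `c² + s² = 1`
    have : (q * c - p * s) ^ 2 = (q ^ 2 + p ^ 2) * (s ^ 2 + c ^ 2) - (q * s + p * c) ^ 2 := by ring
    rw [this, h3]; nlinarith [sq_nonneg (q * s + p * c)]
  calc (-(q * c - p * s) * c ^ 2) ^ 2 = (q * c - p * s) ^ 2 * c ^ 2 * c ^ 2 := by ring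
    _ ≤ 2 * M ^ 2 * 1 * c ^ 2 := by gcongr
    _ ≤ 4 * M ^ 2 * c ^ 2 := by nlinarith [mul_nonneg (sq_nonneg M) (sq_nonneg c)]

lemma norm_mul_sol (φ : ℝ → ℝ) (t r : ℝ) : r * radialSol φ t (r ^ 2) =
    sin (arctan (t + r) - arctan (t - r)) * φ (arctan (t + r) + arctan (t - r)) := by
  rw [radialSol, inv_sqrt_conformalSq, conformalTime_sq, sin_sub]
  have h1 : sin (arctan (t + r)) = (t + r) * cos (arctan (t + r)) := by
    rw [← tan_mul_cos (cos_arctan_pos _).ne', tan_arctan]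
  have h2 : sin (arctan (t - r)) = (t - r) * cos (arctan (t - r)) := by
    rw [← tan_mul_cos (cos_arctan_pos _).ne', tan_arctan]
  rw [h1, h2]; ring

end Scattering

lemma Profile.continuous_timeDeriv {X Y A B : ℝ} {φ ψ : ℝ → ℝ} (h : Profile X Y A B φ ψ) {t : ℝ}
    (h1 : -lifespan A < (t : EReal)) (h2 : (t : EReal) < lifespan B) :
    Continuous (timeDeriv (sol φ) t) := by
  refine continuous_iff_continuousAt.2 fun x => ?_
  have hf : ContinuousAt (fun y : Space => fderiv ℝ (fun p : ℝ × Space => sol φ p.1 p.2) (t, y) timeVec) x := by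
    have := ((h.contDiffAt_sol (p := (t, x)) h1 h2).fderiv_right (m := ∞) (by simp)).continuousAt
    have h3 : ContinuousAt (fun y : Space => fderiv ℝ (fun p : ℝ × Space => sol φ p.1 p.2) (t, y)) x :=
      ContinuousAt.comp (g := fderiv ℝ (fun p : ℝ × Space => sol φ p.1 p.2)) this
        (Continuous.prodMk_right t).continuousAt
    exact h3.clm_apply continuousAt_const
  refine hf.congr (Eventually.of_forall fun y => ?_)
  have hd := ((h.contDiffAt_sol (p := (t, y)) h1 h2).differentiableAt (by simp)).hasFDerivAt
  exact (hd.comp_hasDerivAt t ((hasDerivAt_id t).prodMk (hasDerivAt_const t y))).deriv.symm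

section Scattering

variable {φ ψ : ℝ → ℝ} {U : Set ℝ} {X Y A : ℝ}

/-- The difference between the solution and the linear solution with the same radiation field tends
to zero, as `r` times the difference and its first derivatives are `O(1 / (t + r))`. -/
lemma Profile.exists_pairNorm_sub_le (h : Profile X Y A π φ ψ) (hI : Icc 0 π ⊆ U)
    (hU : IsOpen U) (hS : SolvesOn (fun x => x ^ 3 - x) φ ψ U) :
    ∃ C : ℝ, ∀ t : ℝ, 1 ≤ t →
      pairNorm (1 / 2) (fun x => sol φ t x - radialMean 0 (deriv (radiationField φ)) t ‖x‖)
        (fun x => timeDeriv (sol φ) t x - radialMean 0 (deriv (deriv (radiationField φ))) t ‖x‖) ≤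
        ofReal (C / t) ^ (1 / 2 : ℝ) := by
  have hcd := hS.contDiffOn hU (by fun_prop)
  obtain ⟨M₁, hM₁⟩ := isCompact_Icc.exists_bound_of_continuousOn (hcd.1.continuousOn.mono hI)
  obtain ⟨M₂, hM₂⟩ := isCompact_Icc.exists_bound_of_continuousOn (hcd.2.continuousOn.mono hI)
  set M := max (max M₁ M₂) 0
  have hφ : ∀ s ∈ Icc 0 π, |φ s| ≤ M := fun s hs =>
    (hM₁ s hs).trans ((le_max_left _ _).trans (le_max_left _ _))
  have hψ : ∀ s ∈ Icc 0 π, |ψ s| ≤ M := fun s hs =>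
    (hM₂ s hs).trans ((le_max_right _ _).trans (le_max_left _ _))
  have hM0 : 0 ≤ M := le_max_right _ _
  set C := 8 * M + M ^ 3 with hC
  have hM3 : 0 ≤ M ^ 3 := by positivity
  refine ⟨(12 * sphereArea + 30 * sphereArea) * C ^ 2, fun t ht => ?_⟩
  have ht0 : 0 < t := by linarith
  have hA := sphereArea_nonneg
  set G := radiationField φ with hG
  have hGs : ContDiff ℝ ∞ G := contDiff_radiationField hU hI hS
  have hlt : (t : EReal) < lifespan π := by simp [lifespan]
  have hgt : -lifespan A < (t : EReal) := h.neg_lifespan_neg.trans (by exact_mod_cast ht0)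
  -- `r` times the difference, and its derivatives
  set a : ℝ → ℝ → ℝ := fun τ r => arctan (τ + r) with ha
  set b : ℝ → ℝ → ℝ := fun τ r => arctan (τ - r)
  have memab : ∀ τ, 0 < τ → ∀ r, a τ r + b τ r ∈ U := fun τ hτ r => hI (arctan_add_arctan_mem hτ r)
  have mema : ∀ τ r, π / 2 + a τ r ∈ U := fun τ r => hI (pi_div_two_add_arctan_mem _)
  have memb : ∀ τ r, π / 2 + b τ r ∈ U := fun τ r => hI (pi_div_two_add_arctan_mem _)
  set ca : ℝ → ℝ := fun r => cos (a t r) ^ 2 with hca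
  set cb : ℝ → ℝ := fun r => cos (b t r) ^ 2
  set p : ℝ → ℝ := fun r => scatteringDefect φ (a t r) (b t r)
  set P₁ : ℝ → ℝ := fun r => scatteringDefectLeft φ ψ (a t r) (b t r)
  set P₂ : ℝ → ℝ := fun r => scatteringDefectRight φ ψ (a t r) (b t r)
  have hpr : ∀ r, HasDerivAt p (P₁ r * ca r + P₂ r * -cb r) r := fun r =>
    hasDerivAt_scatteringDefect hS ((hasDerivAt_arctan_cos_sq (t + r)).comp_const_add t r)
      ((hasDerivAt_arctan_cos_sq (t - r)).comp_const_sub t r) (memab t ht0 r) (mema t r) (memb t r)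
  have hpt : ∀ r, HasDerivAt (fun τ => scatteringDefect φ (a τ r) (b τ r))
      (P₁ r * ca r + P₂ r * cb r) t := fun r =>
    hasDerivAt_scatteringDefect hS ((hasDerivAt_arctan_cos_sq (t + r)).comp_add_const t r)
      ((hasDerivAt_arctan_cos_sq (t - r)).comp_sub_const t r) (memab t ht0 r) (mema t r) (memb t r)
  have hac : Continuous (a t) := continuous_arctan.comp (by fun_prop)
  have hbc : Continuous (b t) := continuous_arctan.comp (by fun_prop)
  have hcac : Continuous ca := (continuous_cos.comp hac).pow 2
  have hcbc : Continuous cb := (continuous_cos.comp hbc).pow 2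
  have hpc : Continuous p := continuous_iff_continuousAt.2 fun r => (hpr r).continuousAt
  have f1 := hcd.1.continuousOn.comp_continuous (hac.add hbc) (memab t ht0)
  have f2 := hcd.2.continuousOn.comp_continuous (hac.add hbc) (memab t ht0)
  have f3 := hcd.1.continuousOn.comp_continuous (continuous_const.add hac) (mema t)
  have f4 := hcd.2.continuousOn.comp_continuous (continuous_const.add hac) (mema t)
  have f5 := hcd.1.continuousOn.comp_continuous (continuous_const.add hbc) (memb t)
  have f6 := hcd.2.continuousOn.comp_continuous (continuous_const.add hbc) (memb t)
  have hsub := hac.sub hbc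
  have hP₁c : Continuous P₁ :=
    ((((continuous_cos.comp hsub).mul f1).add ((continuous_sin.comp hsub).mul f2)).add
      (f4.mul (continuous_cos.comp hac))).sub (f3.mul (continuous_sin.comp hac))
  have hP₂c : Continuous P₂ :=
    ((((continuous_cos.comp hsub).neg.mul f1).add ((continuous_sin.comp hsub).mul f2)).sub
      (f6.mul (continuous_cos.comp hbc))).add (f5.mul (continuous_sin.comp hbc))
  -- bounds
  have hale : ∀ r, a t r ≤ π / 2 := fun r => (arctan_lt_pi_div_two _).le
  have hble : ∀ r, b t r ≤ π / 2 := fun r => (arctan_lt_pi_div_two _).le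
  have hab0 : ∀ r, 0 ≤ a t r + b t r := fun r => (arctan_add_arctan_mem ht0 r).1
  have hz : ∀ r, 0 < r → 1 ≤ t + r := fun r hr => by linarith
  have bd0 : ∀ r, 0 < r → |p r| ≤ C / (t + r) := fun r hr => by
    have h1 := abs_scatteringDefect_le hS hI hφ hψ (hale r) (hble r) (hab0 r)
    have h2 := pi_div_two_sub_arctan_le (by linarith : 0 < t + r)
    calc |p r| ≤ 4 * M * (1 / (t + r)) := h1.trans (mul_le_mul_of_nonneg_left h2 (by positivity))
      _ = 4 * M / (t + r) := by ring
      _ ≤ C / (t + r) := div_le_div_of_nonneg_right (by linarith) (by linarith)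
  have bd1 : ∀ r, 0 < r → |P₁ r * ca r| ≤ 4 * M / (t + r) := fun r hr => by
    rw [abs_mul, abs_of_nonneg (sq_nonneg (cos (a t r)) : 0 ≤ ca r)]
    calc _ ≤ 4 * M * (1 / (t + r)) :=
          mul_le_mul (abs_scatteringDefectLeft_le hφ hψ (hale r) (hble r) (hab0 r))
            (cos_arctan_sq_le (hz r hr)) (sq_nonneg _) (by positivity)
      _ = _ := by ring
  have bd2 : ∀ r, 0 < r → |P₂ r * cb r| ≤ M ^ 3 / (t + r) := fun r hr => by
    rw [abs_mul, abs_of_nonneg (sq_nonneg (cos (b t r)) : 0 ≤ cb r)]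
    have h1 := abs_scatteringDefectRight_le (ψ := ψ) hS hI hφ (hale r) (hble r) (hab0 r)
    have h2 := pi_div_two_sub_arctan_le (by linarith : 0 < t + r)
    calc _ ≤ (M ^ 3 * (1 / (t + r))) * 1 := mul_le_mul (h1.trans (mul_le_mul_of_nonneg_left h2 hM3))
            (cos_sq_le_one _) (sq_nonneg _) (by have := hz r hr; positivity)
      _ = _ := by ring
  have bdsum : ∀ r, 0 < r → 4 * M / (t + r) + M ^ 3 / (t + r) ≤ C / (t + r) := fun r hr => by
    rw [← add_div]; exact div_le_div_of_nonneg_right (by linarith) (by linarith)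
  have s0 : SqIntegralLe p (C ^ 2 / t) := .of_abs_le_div hpc ht0 bd0
  have s1 : SqIntegralLe (fun r => P₁ r * ca r + P₂ r * -cb r) (C ^ 2 / t) :=
    .of_abs_le_div (by fun_prop) ht0 fun r hr => by
      refine (abs_add_le _ _).trans ((add_le_add (bd1 r hr) ?_).trans (bdsum r hr))
      change |P₂ r * -cb r| ≤ _
      rw [mul_neg, abs_neg]; exact bd2 r hr
  have s2 : SqIntegralLe (fun r => P₁ r * ca r + P₂ r * cb r) (C ^ 2 / t) :=
    .of_abs_le_div (by fun_prop) ht0 fun r hr =>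
      (abs_add_le _ _).trans ((add_le_add (bd1 r hr) (bd2 r hr)).trans (bdsum r hr))
  have s3 : SqIntegralLe (fun r => -p r) (C ^ 2 / t) := s0.mono hpc.neg fun r _ => (abs_neg _).le
  have s4 : SqIntegralLe (fun r => r * (2 * (P₁ r * ca r))) (C ^ 2 / t) :=
    .of_abs_le_div (by fun_prop) ht0 fun r hr => by
      have h1 := abs_scatteringDefectLeft_le hφ hψ (hale r) (hble r) (hab0 r)
      have h2 : r * ca r ≤ 1 / (t + r) := by
        rw [hca, ha]; simp only; rw [cos_sq_arctan, mul_one_div]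
        exact (div_le_div_iff₀ (by positivity) (by linarith)).2 (by nlinarith)
      have h3 : 0 ≤ r * ca r := mul_nonneg hr.le (sq_nonneg _)
      have e : r * (2 * (P₁ r * ca r)) = 2 * P₁ r * (r * ca r) := by ring
      rw [e, abs_mul, abs_of_nonneg h3, abs_mul, abs_two]
      calc 2 * |P₁ r| * (r * ca r) ≤ 2 * (4 * M) * (1 / (t + r)) :=
            mul_le_mul (by linarith) h2 h3 (by positivity)
        _ = 8 * M / (t + r) := by ring
        _ ≤ C / (t + r) := div_le_div_of_nonneg_right (by linarith) (by linarith)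
  -- identification with the difference of the two solutions
  have hid : ∀ (τ : ℝ) (x : Space), ‖x‖ * (sol φ τ x - radialMean 0 (deriv G) τ ‖x‖) =
      scatteringDefect φ (a τ ‖x‖) (b τ ‖x‖) := fun τ x => by
    rw [mul_sub, mul_radialMean_zero hGs, sol, norm_mul_sol, hG, radiationField, radiationField,
      scatteringDefect]
    ring
  have hidt : ∀ x : Space, ‖x‖ * (timeDeriv (sol φ) t x - radialMean 0 (deriv (deriv G)) t ‖x‖) =
      P₁ ‖x‖ * ca ‖x‖ + P₂ ‖x‖ * cb ‖x‖ := fun x => by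
    have d1 := h.hasDerivAt_sol hgt hlt x
    rw [← h.timeDeriv_sol hgt hlt x] at d1
    have d2 := (d1.fun_sub (hasDerivAt_radialMean_time 0 hGs.deriv_infty t ‖x‖)).const_mul ‖x‖
    simp only [hid] at d2; exact d2.unique (hpt ‖x‖)
  have hsm : ∀ {F : ℝ → ℝ} (_ : ContDiff ℝ ∞ F), ContDiff ℝ ∞ fun x : Space => radialMean 0 F t ‖x‖ :=
    fun hF => (contDiff_radialMean_norm 0 hF).comp (contDiff_prodMk_right t)
  have hsol : Differentiable ℝ (sol φ t) := fun x =>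
    ((h.contDiffAt_sol (p := (t, x)) hgt hlt).differentiableAt (by simp)).comp x
      ((differentiableAt_const t).prodMk differentiableAt_id)
  have n1 := sobolevNorm_half_le_of_radial (f := fun x => sol φ t x - radialMean 0 (deriv G) t ‖x‖)
    (hsol.sub ((hsm hGs.deriv_infty).differentiable (by simp))) (hid t) hpr s0 s1
  have n2 := sobolevNorm_neg_half_le_of_radial
    (g := fun x => timeDeriv (sol φ) t x - radialMean 0 (deriv (deriv G)) t ‖x‖)
    ((h.continuous_timeDeriv hgt hlt).sub (hsm hGs.deriv_infty.deriv_infty).continuous)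
    (q := fun r => P₁ r * ca r + P₂ r * cb r) (a := fun r => -p r)
    (a' := fun r => -(P₁ r * ca r + P₂ r * -cb r)) (h := fun r => 2 * (P₁ r * ca r)) hidt
    (fun r => (hpr r).fun_neg) (fun r => by ring) (by fun_prop) (by fun_prop) s2 s3 s4
  rw [pairNorm, show (1 / 2 - 1 : ℝ) = -1 / 2 by norm_num]
  refine ENNReal.rpow_le_rpow ((add_le_add n1 n2).trans_eq ?_) (by norm_num)
  rw [← ENNReal.ofReal_add (by positivity) (by positivity)]
  congr 1; ring

theorem Profile.scatters (h : Profile X Y A π φ ψ) (hI : Icc 0 π ⊆ U)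
    (hU : IsOpen U) (hS : SolvesOn (fun x => x ^ 3 - x) φ ψ U) :
    Scatters (lifespan π) (sol φ) := by
  have hcd := hS.contDiffOn hU (by fun_prop)
  obtain ⟨M₁, hM₁⟩ := isCompact_Icc.exists_bound_of_continuousOn (hcd.1.continuousOn.mono hI)
  obtain ⟨M₂, hM₂⟩ := isCompact_Icc.exists_bound_of_continuousOn (hcd.2.continuousOn.mono hI)
  have hφ : ∀ s ∈ Icc 0 π, |φ s| ≤ max M₁ M₂ := fun s hs => (hM₁ s hs).trans (le_max_left _ _)
  have hψ : ∀ s ∈ Icc 0 π, |ψ s| ≤ max M₁ M₂ := fun s hs => (hM₂ s hs).trans (le_max_right _ _)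
  have hGs : ContDiff ℝ ∞ (radiationField φ) := contDiff_radiationField hU hI hS
  refine ⟨by simp [lifespan], fun t x => radialMean 0 (deriv (radiationField φ)) t ‖x‖,
    contDiff_radialMean_norm 0 hGs.deriv_infty, waveOp_radialMean hGs.deriv_infty, ?_, ?_⟩
  · simp only [timeDeriv_radialMean hGs.deriv_infty]
    exact pairNorm_radialMean_le hGs (radiationField_sq_le hφ) (deriv_radiationField_sq_le hI hS hφ hψ)
  · obtain ⟨C, hC⟩ := h.exists_pairNorm_sub_le hI hU hS
    have hlim : Tendsto (fun t : ℝ => ofReal (C / t) ^ (1 / 2 : ℝ)) atTop (𝓝 0) := by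
      have h1 : Tendsto (fun t : ℝ => ofReal (C / t)) atTop (𝓝 0) := by
        simpa using ENNReal.tendsto_ofReal (tendsto_const_nhds.div_atTop tendsto_id : Tendsto
          (fun t : ℝ => C / t) atTop (𝓝 0))
      simpa using h1.ennrpow_const (1 / 2)
    refine tendsto_of_tendsto_of_tendsto_of_le_of_le' tendsto_const_nhds hlim
      (Eventually.of_forall fun _ => zero_le) ?_
    filter_upwards [eventually_ge_atTop 1] with t ht
    simp only [timeDeriv_radialMean hGs.deriv_infty]; exact hC t ht

end Scattering

/-! ### Translations and the critical Sobolev norm -/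

lemma IsFourierTransformOf.sub {f₁ f₂ : Space → ℝ} {g₁ g₂ : Space → ℂ}
    (h₁ : IsFourierTransformOf f₁ g₁) (h₂ : IsFourierTransformOf f₂ g₂) :
    IsFourierTransformOf (f₁ - f₂) (g₁ - g₂) := by
  refine ⟨fun φ => ?_, fun φ => ?_, fun φ => ?_⟩
  · exact ((h₁.1 φ).sub (h₂.1 φ)).congr (Eventually.of_forall fun x => by simp [mul_sub])
  · exact ((h₁.2.1 φ).sub (h₂.2.1 φ)).congr (Eventually.of_forall fun x => by simp [mul_sub])
  · simp only [Pi.sub_apply, Complex.ofReal_sub, mul_sub]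
    rw [integral_sub (h₁.1 (𝓕 φ)) (h₂.1 (𝓕 φ)), integral_sub (h₁.2.1 φ) (h₂.2.1 φ), h₁.2.2, h₂.2.2]

/-- The plane wave `e^{2π i v·ξ}`. -/
def planeWave (v ξ : Space) : ℂ := Complex.exp (I * ((2 * π * inner ℝ v ξ : ℝ) : ℂ))

lemma continuous_planeWave (v : Space) : Continuous (planeWave v) := by unfold planeWave; fun_prop

/-- Modulation of a Schwartz function, defined as the conjugate of a translation by the Fourier
transform. -/
def modulate (v : Space) (φ : 𝓢(Space, ℂ)) : 𝓢(Space, ℂ) :=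
  𝓕⁻ (SchwartzMap.compSubConstCLM ℂ v (𝓕 φ))

lemma fourier_modulate (v : Space) (φ : 𝓢(Space, ℂ)) (x : Space) :
    (𝓕 (modulate v φ)) x = (𝓕 φ) (x - v) := by
  rw [modulate, FourierTransform.fourier_fourierInv_eq]; rfl

lemma modulate_apply (v : Space) (φ : 𝓢(Space, ℂ)) (ξ : Space) :
    modulate v φ ξ = planeWave v ξ * φ ξ := by
  have h : φ ξ = (𝓕⁻ (𝓕 φ : 𝓢(Space, ℂ)) : 𝓢(Space, ℂ)) ξ := by
    rw [FourierTransform.fourierInv_fourier_eq]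
  rw [h, planeWave, modulate, SchwartzMap.fourierInv_coe, SchwartzMap.fourierInv_coe, fourierInv_eq',
    fourierInv_eq', ← integral_const_mul,
    ← integral_sub_right_eq_self (fun w : Space => Complex.exp (I * ((2 * π * inner ℝ v ξ : ℝ) : ℂ)) * (Complex.exp (↑(2 * π * inner ℝ w ξ) * I) •
        (𝓕 φ : 𝓢(Space, ℂ)) w)) v]
  refine integral_congr_ae (ae_of_all _ fun w => ?_)
  simp only [SchwartzMap.compSubConstCLM_apply, smul_eq_mul]
  rw [← mul_assoc, ← Complex.exp_add, inner_sub_left]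
  congr 2
  push_cast; ring

lemma IsFourierTransformOf.translate {f : Space → ℝ} {g : Space → ℂ} (h : IsFourierTransformOf f g)
    (v : Space) : IsFourierTransformOf (fun x => f (x + v))
      (fun ξ => planeWave v ξ * g ξ) := by
  have e : ∀ φ : 𝓢(Space, ℂ), ∀ ξ, modulate v φ ξ * g ξ =
      φ ξ * (planeWave v ξ * g ξ) := fun φ ξ => by
    rw [modulate_apply]; ring
  refine ⟨fun φ => ?_, fun φ => ?_, fun φ => ?_⟩
  · have := (h.1 (SchwartzMap.compSubConstCLM ℂ v φ)).comp_add_right v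
    simpa using this
  · exact (h.2.1 (modulate v φ)).congr (ae_of_all _ (e φ))
  · have h1 := h.2.2 (modulate v φ)
    simp only [e] at h1
    have h2 := integral_add_right_eq_self (μ := (volume : Measure Space))
      (fun x => (𝓕 (modulate v φ)) x * (f x : ℂ)) v
    simp only [fourier_modulate, add_sub_cancel_right] at h1 h2; rw [← h1, ← h2]

lemma lintegral_translate_sub {f : Space → ℝ} {g : Space → ℂ} (hf : MemLp f 2)
    (h : IsFourierTransformOf f g) (v : Space) :
    ∫⁻ x, ‖f (x + v) - f x‖ₑ ^ 2 =
      ∫⁻ ξ, ‖planeWave v ξ - 1‖ₑ ^ 2 * ‖g ξ‖ₑ ^ 2 := by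
  have hfv : MemLp (fun x => f (x + v)) 2 :=
    hf.comp_measurePreserving (measurePreserving_add_right volume v)
  obtain ⟨G, -, hG, hn⟩ := exists_isFourierTransformOf (hfv.sub hf)
  have hae := hG.ae_eq ((h.translate v).sub h)
  have h1 : ∫⁻ x, ‖f (x + v) - f x‖ₑ ^ 2 = eLpNorm ((fun x => f (x + v)) - f) 2 volume ^ 2 :=
    (eLpNorm_two_sq _).symm
  rw [h1, ← hn, eLpNorm_two_sq]
  refine lintegral_congr_ae ?_
  filter_upwards [hae] with ξ hξ
  rw [hξ, Pi.sub_apply, ← mul_pow, ← enorm_mul, sub_mul, one_mul]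

lemma sum_two_pow_mul_min_le (N : ℕ) {x : ℝ} (hx : 0 ≤ x) :
    ∑ k ∈ Finset.range N, 2 ^ k * min 1 ((x / 2 ^ k) ^ 2) ≤ 4 * x := by
  have key : ∀ x : ℝ, 0 ≤ x → ∑ k ∈ Finset.range N, 2 ^ k * min 1 ((x / 2 ^ k) ^ 2) ≤
      if x ≤ 1 then 2 * x ^ 2 else 4 * x - 1 := by
    induction N with
    | zero =>
      intro x hx; simp only [Finset.range_zero, Finset.sum_empty]
      split_ifs <;> nlinarith
    | succ N ih =>
      intro x hx; rw [Finset.sum_range_succ']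
      have e : ∑ k ∈ Finset.range N, (2 : ℝ) ^ (k + 1) * min 1 ((x / 2 ^ (k + 1)) ^ 2) =
          2 * ∑ k ∈ Finset.range N, 2 ^ k * min 1 (((x / 2) / 2 ^ k) ^ 2) := by
        rw [mul_sum]
        refine sum_congr rfl fun k _ => ?_
        rw [pow_succ', div_div]; ring
      rw [e, pow_zero, div_one, one_mul]
      have := ih (x / 2) (by linarith)
      have m1 := min_le_left 1 (x ^ 2)
      have m2 := min_le_right 1 (x ^ 2)
      split_ifs at this ⊢ <;> nlinarith
  refine (key x hx).trans ?_
  split_ifs <;> nlinarith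

/-- The dyadic form of the bound of differences by the critical norm: `2 ^ k |e^{iθ/2^k} - 1|²`
sums to at most a multiple of `|θ|`. -/
lemma sum_translate_le {f : Space → ℝ} (hf : MemLp f 2) {t : ℝ} (ht : 0 < t) (N : ℕ) :
    ∑ k ∈ Finset.range N, 2 ^ k * ∫⁻ x, ‖f (x + (t / 2 ^ k) • unitVec 0) - f x‖ₑ ^ 2 ≤
      ofReal (8 * t) * sobolevNorm (1 / 2) f ^ 2 := by
  obtain ⟨g, hg, hfg, -⟩ := exists_isFourierTransformOf hf
  rw [sobolevNorm_eq hfg, eLpNorm_two_sq, ← lintegral_const_mul'' _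
    ((aestronglyMeasurable_weight (1 / 2) hg.1).enorm.pow_const 2)]
  simp only [lintegral_translate_sub hf hfg]
  have e := fun k F => lintegral_const_mul' (μ := (volume : Measure Space)) ((2 : ℝ≥0∞) ^ k) F (by simp)
  have hm := fun k => ((((continuous_planeWave ((t / 2 ^ k) • unitVec 0)).sub
    (continuous_const (y := 1))).measurable.enorm.pow_const 2).aemeasurable.mul (hg.1.enorm.pow_const 2)).const_mul
      ((2 : ℝ≥0∞) ^ k)
  simp only [← e]; rw [← lintegral_finsetSum' _ fun k _ => by exact hm k]
  refine lintegral_mono fun ξ => ?_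
  simp only [← mul_assoc]; rw [← sum_mul, enorm_smul, mul_pow, ← mul_assoc]
  refine mul_le_mul_left ?_ _
  set x := π * t * |ξ 0| with hx
  have hx0 : 0 ≤ x := by positivity
  have hin : ∀ k : ℕ, inner ℝ ((t / 2 ^ k) • unitVec 0) ξ = t / 2 ^ k * ξ 0 := fun k => by
    rw [inner_smul_left, unitVec, EuclideanSpace.inner_single_left]; simp
  have hk : ∀ k : ℕ, ‖planeWave ((t / 2 ^ k) • unitVec 0) ξ - 1‖ ^ 2 ≤
      4 * min 1 ((x / 2 ^ k) ^ 2) := fun k => by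
    rw [planeWave, hin, mul_min_of_nonneg _ _ (by norm_num)]
    refine le_min ?_ ?_
    · refine (pow_le_pow_left₀ (norm_nonneg _) (norm_sub_le _ _) 2).trans ?_
      rw [mul_comm, Complex.norm_exp_ofReal_mul_I, norm_one]; norm_num
    · refine (pow_le_pow_left₀ (norm_nonneg _) norm_exp_I_mul_ofReal_sub_one_le 2).trans_eq ?_
      rw [norm_eq_abs, sq_abs, hx, div_pow, mul_pow _ |ξ 0|, sq_abs]; field_simp; ring
  have hreal : ∑ k ∈ Finset.range N, 2 ^ k * ‖planeWave ((t / 2 ^ k) • unitVec 0) ξ - 1‖ ^ 2 ≤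
      8 * t * (2 * π * ‖ξ‖) := by
    calc _ ≤ ∑ k ∈ Finset.range N, 4 * (2 ^ k * min 1 ((x / 2 ^ k) ^ 2)) := sum_le_sum fun k _ => by
            have := mul_le_mul_of_nonneg_left (hk k) (by positivity : (0 : ℝ) ≤ 2 ^ k)
            linarith
      _ ≤ 4 * (4 * x) := by rw [← mul_sum]; gcongr; exact sum_two_pow_mul_min_le N hx0
      _ ≤ _ := by
        rw [hx]
        nlinarith [mul_le_mul_of_nonneg_left (abs_apply_le_norm ξ 0) (by positivity : 0 ≤ 16 * π * t)]
  have hl : ∀ z : ℂ, ‖z‖ₑ ^ 2 = ofReal (‖z‖ ^ 2) := fun z => by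
    rw [← ofReal_norm, ofReal_pow (norm_nonneg _)]
  have h2 : ∀ k : ℕ, (2 : ℝ≥0∞) ^ k = ofReal (2 ^ k) := fun k => by
    rw [ofReal_pow (by norm_num)]; simp
  simp only [hl, h2]; simp only [← ofReal_mul (by positivity : (0 : ℝ) ≤ 2 ^ _)]
  rw [← ofReal_sum_of_nonneg fun k _ => by positivity]
  refine (ofReal_le_ofReal hreal).trans_eq ?_
  rw [ofReal_mul (by positivity), ← ofReal_norm, ← ofReal_pow (norm_nonneg _),
    norm_of_nonneg (by positivity), ← sqrt_eq_rpow, sq_sqrt (by positivity)]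

/-- The scaling invariant form of `sum_translate_le`. -/
lemma sum_translate_rescaled_le {f : Space → ℝ} (hc : Continuous f) (hf : MemLp f 2) {t : ℝ}
    (ht : 0 < t) (N : ℕ) :
    ∑ k ∈ Finset.range N, 2 ^ k * ∫⁻ y, ‖t * f (t • (y + (1 / 2 ^ k : ℝ) • unitVec 0)) -
      t * f (t • y)‖ₑ ^ 2 ≤ 8 * sobolevNorm (1 / 2) f ^ 2 := by
  have e : ∀ k : ℕ, ∫⁻ y, ‖t * f (t • (y + (1 / 2 ^ k : ℝ) • unitVec 0)) - t * f (t • y)‖ₑ ^ 2 =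
      ofReal t⁻¹ * ∫⁻ x, ‖f (x + (t / 2 ^ k) • unitVec 0) - f x‖ₑ ^ 2 := fun k => by
    have hm : Measurable fun x => ‖f (x + (t / 2 ^ k) • unitVec 0) - f x‖ₑ ^ 2 :=
      (by fun_prop : Continuous fun x => f (x + (t / 2 ^ k) • unitVec 0) - f x).measurable.enorm.pow_const 2
    have h1 := lintegral_map (μ := (volume : Measure Space)) hm (measurable_const_smul t)
    rw [Measure.map_addHaar_smul _ ht.ne', lintegral_smul_measure, finrank_euclideanSpace,
      Fintype.card_fin, abs_of_pos (by positivity), smul_eq_mul] at h1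
    have h2 : ofReal t⁻¹ = ofReal (t ^ 2) * ofReal (t ^ 3)⁻¹ := by
      rw [← ofReal_mul (by positivity)]
      congr 1; field_simp
    rw [h2, mul_assoc, h1, ← lintegral_const_mul' _ _ ofReal_ne_top]
    refine lintegral_congr fun y => ?_
    rw [← mul_sub, enorm_mul, mul_pow, smul_add, smul_smul, mul_one_div]
    congr 1; rw [← ofReal_norm, norm_of_nonneg ht.le, ofReal_pow ht.le]
  simp only [e]
  calc _ = ofReal t⁻¹ * ∑ k ∈ Finset.range N,
        2 ^ k * ∫⁻ x, ‖f (x + (t / 2 ^ k) • unitVec 0) - f x‖ₑ ^ 2 := by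
        rw [mul_sum]; exact sum_congr rfl fun k _ => by ring
    _ ≤ ofReal t⁻¹ * (ofReal (8 * t) * sobolevNorm (1 / 2) f ^ 2) := by
        gcongr; exact sum_translate_le hf ht N
    _ = _ := by
        rw [← mul_assoc, ← ofReal_mul (by positivity)]
        congr 1; rw [show t⁻¹ * (8 * t) = 8 by field_simp]; simp

/-- The indicator function of the unit ball. -/
def ballIndicator (y : Space) : ℝ := (ball (0 : Space) 1).indicator (fun _ => 1) y

/-- Translating the unit ball by a distance `r` changes it on a set of volume at least proportional
to `r`, as the first moment changes by `r` times the volume of the ball. -/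
lemma le_lintegral_ballIndicator_sub {r : ℝ} (hr : 0 ≤ r) (hr1 : r ≤ 1) :
    ofReal (r * volume.real (ball (0 : Space) 1)) ≤
      2 * ∫⁻ y, ‖ballIndicator (y + r • unitVec 0) - ballIndicator y‖ₑ ^ 2 := by
  set v := r • unitVec 0 with hv
  have hi0 : Integrable ballIndicator :=
    (integrable_indicator_iff Metric.isOpen_ball.measurableSet).2
      (integrableOn_const measure_ball_lt_top.ne)
  have hi1 : Integrable fun y : Space => ballIndicator y * y 0 := by
    refine hi0.norm.mono' (hi0.1.mul (by fun_prop : Continuous fun y : Space => y 0).aestronglyMeasurable)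
      (ae_of_all _ fun y => ?_)
    rw [norm_mul]
    by_cases hy : y ∈ ball (0 : Space) 1
    · exact mul_le_of_le_one_right (norm_nonneg _) ((abs_apply_le_norm y 0).trans (mem_ball_zero_iff.1 hy).le)
    · simp [ballIndicator, indicator_of_notMem hy]
  have hi2 : Integrable fun y : Space => ballIndicator (y + v) * y 0 := by
    have h1 := (hi1.sub (hi0.mul_const r)).comp_add_right v
    refine h1.congr (ae_of_all _ fun y => ?_)
    simp only [Pi.sub_apply, ← mul_sub]; simp [hv, unitVec]
  have hJ : ∫ y, (ballIndicator (y + v) - ballIndicator y) * y 0 =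
      -(r * volume.real (ball (0 : Space) 1)) := by
    simp only [sub_mul]; rw [integral_sub hi2 hi1]
    have h1 := integral_add_right_eq_self (μ := (volume : Measure Space))
      (fun y : Space => ballIndicator y * (y 0 - r)) v
    have h2 : ∀ y : Space, ballIndicator (y + v) * ((y + v) 0 - r) = ballIndicator (y + v) * y 0 := fun y => by
      simp [hv, unitVec]
    simp only [h2] at h1; rw [h1]; simp only [mul_sub]
    rw [integral_sub hi1 (hi0.mul_const r), integral_mul_const]
    have h3 : ∫ y, ballIndicator y = volume.real (ball (0 : Space) 1) := by
      have := integral_indicator_const (μ := (volume : Measure Space)) (1 : ℝ)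
        (Metric.isOpen_ball (x := (0 : Space)) (ε := 1)).measurableSet
      simpa [ballIndicator] using this
    rw [h3]; ring
  calc ofReal (r * volume.real (ball (0 : Space) 1))
      = ‖∫ y, (ballIndicator (y + v) - ballIndicator y) * y 0‖ₑ := by
        rw [hJ, enorm_neg, ← ofReal_norm, norm_of_nonneg (by positivity)]
    _ ≤ ∫⁻ y, ‖(ballIndicator (y + v) - ballIndicator y) * y 0‖ₑ := enorm_integral_le_lintegral_enorm _
    _ ≤ ∫⁻ y, 2 * ‖ballIndicator (y + v) - ballIndicator y‖ₑ ^ 2 := by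
        refine lintegral_mono fun y => ?_
        have hvn : ‖v‖ ≤ 1 := by rw [hv, norm_smul, norm_of_nonneg hr]; simpa [unitVec] using hr1
        have h01 : ∀ z, ballIndicator z = 0 ∨ (ballIndicator z = 1 ∧ ‖z‖ < 1) := fun z => by
          by_cases hz : z ∈ ball (0 : Space) 1
          · exact Or.inr ⟨indicator_of_mem hz _, mem_ball_zero_iff.1 hz⟩
          · exact Or.inl (indicator_of_notMem hz _)
        have hy2 : ‖y + v‖ < 1 → ‖y‖ ≤ 2 := fun h => by
          have := norm_sub_le (y + v) v
          rw [add_sub_cancel_right] at this; linarith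
        have hreal : |(ballIndicator (y + v) - ballIndicator y) * y 0| ≤
            2 * (ballIndicator (y + v) - ballIndicator y) ^ 2 := by
          have h0 := abs_apply_le_norm y 0
          rcases h01 (y + v) with e1 | ⟨e1, e1'⟩ <;> rcases h01 y with e2 | ⟨e2, e2'⟩ <;>
            rw [e1, e2] <;> norm_num
          · linarith
          · linarith [hy2 e1']
        have h3 : ∀ z : ℝ, ‖z‖ₑ = ofReal |z| := fun z => by rw [← ofReal_norm, norm_eq_abs]
        refine (h3 _).trans_le ((ofReal_le_ofReal hreal).trans_eq ?_)
        rw [h3, ← ofReal_pow (abs_nonneg _), sq_abs, ofReal_mul (by norm_num), ofReal_ofNat]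
    _ = _ := lintegral_const_mul' _ _ (by norm_num)

/-- If `t f_t(t y)` converges to a nonzero multiple of the indicator function of the unit ball, which
narrowly fails to be in `Ḣ^{1/2}`, then the critical norms of `f_t` tend to infinity. -/
lemma tendsto_sobolevNorm_half_top {f : ℝ → Space → ℝ} {c : ℝ} (hc0 : c ≠ 0)
    (hcont : ∀ t, Continuous (f t)) (hL : ∀ t, MemLp (f t) 2)
    (hlim : ∀ᵐ y : Space, Tendsto (fun t => t * f t (t • y)) atTop (𝓝 (c * ballIndicator y))) :
    Tendsto (fun t => sobolevNorm (1 / 2) (f t)) atTop (𝓝 ⊤) := by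
  set v : ℕ → Space := fun k => (1 / 2 ^ k : ℝ) • unitVec 0
  have hlimv : ∀ᵐ y : Space, ∀ k, Tendsto (fun t => t * f t (t • (y + v k))) atTop
      (𝓝 (c * ballIndicator (y + v k))) := ae_all_iff.2 fun k =>
    (measurePreserving_add_right (volume : Measure Space) (v k)).quasiMeasurePreserving.ae hlim
  set F : ℕ → ℝ → Space → ℝ≥0∞ := fun k t y =>
    2 ^ k * ‖t * f t (t • (y + v k)) - t * f t (t • y)‖ₑ ^ 2
  set g : ℕ → Space → ℝ≥0∞ := fun k y =>
    2 ^ k * ‖c * ballIndicator (y + v k) - c * ballIndicator y‖ₑ ^ 2 with hg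
  have hFm : ∀ k t, Measurable (F k t) := fun k t => by
    have := hcont t
    exact ((by fun_prop : Continuous fun y => t * f t (t • (y + v k)) - t * f t (t • y)
      ).measurable.enorm.pow_const 2).const_mul _
  have hind : Measurable ballIndicator :=
    measurable_const.indicator Metric.isOpen_ball.measurableSet
  have hgm : ∀ k, Measurable (g k) := fun k => by
    have h1 : Measurable fun y => c * ballIndicator (y + v k) - c * ballIndicator y :=
      ((hind.comp (measurable_add_const (v k))).const_mul c).sub (hind.const_mul c)
    exact (h1.enorm.pow_const 2).const_mul _
  set D := ofReal (c ^ 2 * volume.real (ball (0 : Space) 1)) with hD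
  have hD0 : D ≠ 0 := by
    rw [hD, ne_eq, ENNReal.ofReal_eq_zero, not_le]
    refine mul_pos (by positivity) (ENNReal.toReal_pos ?_ measure_ball_lt_top.ne)
    exact (Metric.measure_ball_pos _ _ one_pos).ne'
  have hgD : ∀ k, D ≤ 2 * ∫⁻ y, g k y := fun k => by
    have h1 := le_lintegral_ballIndicator_sub (r := 1 / 2 ^ k) (by positivity)
      ((div_le_one (by positivity)).2 (one_le_pow₀ (by norm_num)))
    have h2 : ∫⁻ y, g k y = 2 ^ k * (ofReal (c ^ 2) *
        ∫⁻ y, ‖ballIndicator (y + v k) - ballIndicator y‖ₑ ^ 2) := by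
      rw [← lintegral_const_mul' _ _ ofReal_ne_top, ← lintegral_const_mul' _ _ (by simp)]
      refine lintegral_congr fun y => ?_
      rw [hg]; simp only; rw [← mul_sub, enorm_mul, mul_pow]
      congr 2
      rw [← ofReal_norm, norm_eq_abs, ← ofReal_pow (abs_nonneg _), sq_abs]
    have h3 : D = 2 ^ k * (ofReal (c ^ 2) *
        ofReal (1 / 2 ^ k * volume.real (ball (0 : Space) 1))) := by
      have : (2 : ℝ≥0∞) ^ k = ofReal (2 ^ k) := by rw [ofReal_pow (by norm_num)]; simp
      rw [this, ← ofReal_mul (by positivity), ← ofReal_mul (by positivity), hD]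
      congr 1; field_simp
    rw [h2, h3]
    calc _ ≤ 2 ^ k * (ofReal (c ^ 2) *
          (2 * ∫⁻ y, ‖ballIndicator (y + v k) - ballIndicator y‖ₑ ^ 2)) := by gcongr
      _ = _ := by ring
  have hfatou : ∀ N : ℕ, ∑ k ∈ Finset.range N, ∫⁻ y, g k y ≤
      liminf (fun t => ∑ k ∈ Finset.range N, ∫⁻ y, F k t y) atTop := fun N => by
    simp only [← lintegral_finsetSum _ fun k _ => hFm k _, ← lintegral_finsetSum _ fun k _ => hgm k]
    refine le_trans (lintegral_mono_ae ?_) (lintegral_liminf_le fun t =>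
      Finset.measurable_fun_sum _ fun k _ => hFm k t)
    filter_upwards [hlim, hlimv] with y h1 h2
    refine (Tendsto.liminf_eq (tendsto_finsetSum _ fun k _ =>
      ENNReal.Tendsto.const_mul ?_ (Or.inr (by simp)))).ge
    exact (((continuous_enorm.tendsto _).comp ((h2 k).sub h1)).ennrpow_const 2).congr
      (fun t => by simp) |>.trans_eq (by simp)
  refine ENNReal.tendsto_nhds_top_iff_nnreal.2 fun M => ?_
  obtain ⟨N, hN⟩ := ENNReal.exists_nat_mul_gt hD0 (b := 2 * (8 * (M : ℝ≥0∞) ^ 2))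
    (ENNReal.mul_ne_top (by simp) (ENNReal.mul_ne_top (by simp) (by simp)))
  have h1 : 8 * (M : ℝ≥0∞) ^ 2 < liminf (fun t => ∑ k ∈ Finset.range N, ∫⁻ y, F k t y) atTop := by
    refine lt_of_mul_lt_mul_left' (hN.trans_le ?_)
    calc (N : ℝ≥0∞) * D = ∑ k ∈ Finset.range N, D := by simp
      _ ≤ ∑ k ∈ Finset.range N, 2 * ∫⁻ y, g k y := sum_le_sum fun k _ => hgD k
      _ = 2 * ∑ k ∈ Finset.range N, ∫⁻ y, g k y := (mul_sum _ _ _).symm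
      _ ≤ _ := by gcongr; exact hfatou N
  filter_upwards [eventually_lt_of_lt_liminf h1, eventually_gt_atTop 0] with t h2 ht
  have h3 : ∑ k ∈ Finset.range N, ∫⁻ y, F k t y ≤ 8 * sobolevNorm (1 / 2) (f t) ^ 2 := by
    refine le_trans (le_of_eq ?_) (sum_translate_rescaled_le (hcont t) (hL t) ht N)
    exact sum_congr rfl fun k _ => lintegral_const_mul' _ _ (by simp)
  have h4 := lt_of_mul_lt_mul_left' (h2.trans_le h3)
  exact lt_of_not_ge fun h => h4.not_ge (by gcongr)

/-! ### Growth of the critical norm at the threshold -/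

section Growth

variable {φ ψ : ℝ → ℝ} {X Y A B c : ℝ}

lemma Profile.continuous_sol (h : Profile X Y A B φ ψ) {t : ℝ} (h1 : -lifespan A < (t : EReal))
    (h2 : (t : EReal) < lifespan B) : Continuous (sol φ t) :=
  continuous_iff_continuousAt.2 fun x => ContinuousAt.comp (f := fun x : Space => (t, x)) (x := x)
      (h.contDiffAt_sol (p := (t, x)) h1 h2).continuousAt (Continuous.prodMk_right t).continuousAt

lemma inv_sqrt_conformalSq_le (t : ℝ) {ρ : ℝ} (hρ : 0 ≤ ρ) :
    (√(conformalSq t ρ))⁻¹ ≤ √(t ^ 2 + 4) / 2 * (1 + ρ)⁻¹ := by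
  have h : 2 * (1 + ρ) / √(t ^ 2 + 4) ≤ √(conformalSq t ρ) := by
    refine le_sqrt_of_sq_le ?_
    rw [div_pow, sq_sqrt (by positivity), div_le_iff₀ (by positivity), conformalSq]
    -- the difference of the two sides is a perfect square
    nlinarith [sq_nonneg (t * (1 + ρ - (t ^ 2 + 4)))]
  calc (√(conformalSq t ρ))⁻¹ ≤ (2 * (1 + ρ) / √(t ^ 2 + 4))⁻¹ := inv_anti₀ (by positivity) h
    _ = _ := by rw [inv_div]; field_simp

lemma Profile.memLp_sol (h : Profile X Y A B φ ψ) {t : ℝ} (h0 : 0 ≤ t)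
    (h2 : (t : EReal) < lifespan B) : MemLp (sol φ t) 2 := by
  have hlt := (lt_lifespan_iff h.pos t).1 h2
  have h1 : -lifespan A < (t : EReal) := h.neg_lifespan_neg.trans_le (by exact_mod_cast h0)
  obtain ⟨C, hC⟩ := isCompact_Icc.exists_bound_of_continuousOn
    (h.contDiffOn.1.continuousOn.mono (fun s (hs : s ∈ Icc 0 (2 * arctan t)) =>
      (⟨by linarith [h.neg.1, hs.1], by linarith [hs.2]⟩ : s ∈ Ioo (-A) B)))
  refine memLp_of_le_weight (h.continuous_sol h1 h2) (C := √(t ^ 2 + 4) * C) fun x => ?_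
  have e1 := inv_sqrt_conformalSq_le t (sq_nonneg ‖x‖)
  have e2 := hC _ (conformalTime_mem_Icc h0 (sq_nonneg ‖x‖))
  rw [norm_eq_abs] at e2
  rw [sol, radialSol, abs_mul, abs_of_nonneg (by positivity : 0 ≤ 2 * (√(conformalSq t (‖x‖ ^ 2)))⁻¹)]
  calc _ ≤ 2 * (√(t ^ 2 + 4) / 2 * (1 + ‖x‖ ^ 2)⁻¹) * C := by gcongr
    _ = _ := by rw [weight]; ring

lemma tendsto_mul_sol_inside {φ : ℝ → ℝ} {c : ℝ}
    (hc : Tendsto (fun s => (π - s) * φ s) (𝓝[<] π) (𝓝 c)) {y : Space} (hy0 : y ≠ 0)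
    (hy : ‖y‖ < 1) : Tendsto (fun t => t * sol φ t (t • y)) atTop (𝓝 c) := by
  have hpos := norm_pos_iff.2 hy0
  set ρ := ‖y‖
  have h1 : 0 < 1 - ρ := by linarith
  have h2 : 0 < 1 + ρ := by linarith
  -- `π/2 - a` and `π/2 - b` as functions of `ε = 1 / t`
  have d1 : HasDerivAt (fun ε => arctan (ε / (1 + ρ))) (1 / (1 + ρ)) 0 := by
    simpa using ((hasDerivAt_id' (0 : ℝ)).div_const (1 + ρ)).arctan
  have d2 : HasDerivAt (fun ε => arctan (ε / (1 - ρ))) (1 / (1 - ρ)) 0 := by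
    simpa using ((hasDerivAt_id' (0 : ℝ)).div_const (1 - ρ)).arctan
  have dD := d1.fun_add d2
  have dN := (d2.fun_sub d1).sin
  set D := fun ε => arctan (ε / (1 + ρ)) + arctan (ε / (1 - ρ)) with hD
  set N := fun ε => sin (arctan (ε / (1 - ρ)) - arctan (ε / (1 + ρ))) with hN
  have sD := dD.tendsto_slope_zero_right
  have sN := dN.tendsto_slope_zero_right
  have hD0 : D 0 = 0 := by simp [hD]
  have hN0 : N 0 = 0 := by simp [hN]
  have hDpos : ∀ ε, 0 < ε → 0 < D ε := fun ε hε =>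
    add_pos (arctan_pos.2 (by positivity)) (arctan_pos.2 (by positivity))
  have hDlim : Tendsto (fun ε => π - D ε) (𝓝[>] 0) (𝓝[<] π) := by
    refine tendsto_nhdsWithin_iff.2 ⟨?_, ?_⟩
    · have := (dD.continuousAt.tendsto.const_sub π)
      rw [hD0, sub_zero] at this; exact this.mono_left nhdsWithin_le_nhds
    · filter_upwards [self_mem_nhdsWithin] with ε hε using sub_lt_self _ (hDpos ε hε)
  have hne : 1 / (1 + ρ) + 1 / (1 - ρ) ≠ 0 := by positivity
  have hratio : Tendsto (fun ε => N ε / D ε * (D ε * φ (π - D ε)) / ρ) (𝓝[>] 0) (𝓝 c) := by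
    have q1 := sN.div sD hne
    have q2 := hc.comp hDlim
    have := (q1.mul q2).div_const ρ
    have e0 : cos (arctan (0 / (1 - ρ)) - arctan (0 / (1 + ρ))) = 1 := by simp
    rw [e0] at this
    have e : 1 * (1 / (1 - ρ) - 1 / (1 + ρ)) / (1 / (1 + ρ) + 1 / (1 - ρ)) * c / ρ = c := by
      have : ρ ≠ 0 := hpos.ne'
      field_simp; ring
    rw [e] at this
    refine this.congr' ?_
    filter_upwards [self_mem_nhdsWithin] with ε hε
    have hε0 : ε ≠ 0 := (mem_Ioi.1 hε).ne'
    have hε1 := (hDpos ε hε).ne'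
    simp only [Pi.div_apply, Function.comp_apply, zero_add, smul_eq_mul, hD0, hN0, sub_zero,
      sub_sub_cancel]
    field_simp
  refine (hratio.comp tendsto_inv_atTop_nhdsGT_zero).congr' ?_
  filter_upwards [eventually_gt_atTop 0] with t ht
  have ea : arctan (t⁻¹ / (1 + ρ)) = π / 2 - arctan (t + t * ρ) := by
    rw [← arctan_inv_of_pos (by positivity)]
    congr 1; field_simp
  have eb : arctan (t⁻¹ / (1 - ρ)) = π / 2 - arctan (t - t * ρ) := by
    rw [← arctan_inv_of_pos (by nlinarith)]
    congr 1; rw [show t - t * ρ = t * (1 - ρ) by ring, mul_inv, div_eq_mul_inv]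
  have hn : ‖t • y‖ = t * ρ := by rw [norm_smul, norm_of_nonneg ht.le]
  have hkey := norm_mul_sol φ t (t * ρ)
  have e1 : N t⁻¹ = sin (arctan (t + t * ρ) - arctan (t - t * ρ)) := by
    rw [hN]; simp only; rw [ea, eb]
    congr 1; ring
  have e2 : π - D t⁻¹ = arctan (t + t * ρ) + arctan (t - t * ρ) := by
    rw [hD]; simp only; rw [ea, eb]; ring
  rw [sol, hn]; simp only [Function.comp_apply]; rw [e2, e1]
  have hDt := (hDpos t⁻¹ (by positivity)).ne'
  have hρ0 : ρ ≠ 0 := hpos.ne'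
  rw [div_mul_eq_mul_div, mul_left_comm, mul_div_cancel_left₀ _ hDt, ← hkey, div_eq_iff hρ0]
  ring

lemma tendsto_mul_sol_outside {φ : ℝ → ℝ} (hφ : ContinuousAt φ 0) {y : Space} (hy : 1 < ‖y‖) :
    Tendsto (fun t => t * sol φ t (t • y)) atTop (𝓝 0) := by
  set ρ := ‖y‖
  have la : Tendsto (fun t : ℝ => arctan (t + t * ρ)) atTop (𝓝 (π / 2)) := by
    refine (tendsto_nhds_of_tendsto_nhdsWithin tendsto_arctan_atTop).comp ?_
    exact (tendsto_id.atTop_mul_const (by linarith : 0 < 1 + ρ)).congr fun t => by simp; ring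
  have lb : Tendsto (fun t : ℝ => arctan (t - t * ρ)) atTop (𝓝 (-(π / 2))) := by
    refine (tendsto_nhds_of_tendsto_nhdsWithin tendsto_arctan_atBot).comp ?_
    exact (tendsto_id.atTop_mul_const_of_neg (by linarith : 1 - ρ < 0)).congr fun t => by simp; ring
  have l1 : Tendsto (fun t : ℝ => sin (arctan (t + t * ρ) - arctan (t - t * ρ))) atTop (𝓝 0) := by
    have := (continuous_sin.tendsto _).comp (la.sub lb)
    rwa [show π / 2 - -(π / 2) = π by ring, sin_pi] at this
  have l2 : Tendsto (fun t : ℝ => φ (arctan (t + t * ρ) + arctan (t - t * ρ))) atTop (𝓝 (φ 0)) := by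
    have := la.add lb
    rw [add_neg_cancel] at this; exact hφ.tendsto.comp this
  have l3 := (l1.mul l2).div_const ρ
  rw [zero_mul, zero_div] at l3
  refine l3.congr' ?_
  filter_upwards [eventually_gt_atTop 0] with t ht
  have hn : ‖t • y‖ = t * ρ := by rw [norm_smul, norm_of_nonneg ht.le]
  have hkey := norm_mul_sol φ t (t * ρ)
  rw [sol, hn]
  have hρ0 : ρ ≠ 0 := by linarith
  rw [← hkey, div_eq_iff hρ0]; ring

theorem Profile.growsUp (h : Profile X Y A π φ ψ) (hc0 : c ≠ 0)
    (hc : Tendsto (fun s => (π - s) * φ s) (𝓝[<] π) (𝓝 c)) :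
    GrowsUp (lifespan π) (sol φ) := by
  refine ⟨by simp [lifespan], tendsto_nhds_top_mono' ?_ fun t => sobolevNorm_le_pairNorm _ _ _⟩
  have hlt : ∀ t : ℝ, (t : EReal) < lifespan π := fun t => by simp [lifespan]
  have hgt : ∀ t : ℝ, 0 ≤ t → -lifespan A < (t : EReal) := fun t ht =>
    h.neg_lifespan_neg.trans_le (by exact_mod_cast ht)
  have key := tendsto_sobolevNorm_half_top (f := fun t => sol φ (max t 0)) hc0
    (fun t => h.continuous_sol (hgt _ (le_max_right _ _)) (hlt _))
    (fun t => h.memLp_sol (le_max_right _ _) (hlt _)) ?_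
  · refine key.congr' ?_
    filter_upwards [eventually_ge_atTop 0] with t ht
    rw [max_eq_left ht]
  · have hφ0 : ContinuousAt φ 0 := (h.solves 0 ⟨by linarith [h.neg.1], pi_pos⟩).1.continuousAt
    have n1 : ∀ᵐ y : Space, y ≠ 0 := compl_mem_ae_iff.2 (measure_singleton (0 : Space))
    have n2 : ∀ᵐ y : Space, y ∉ Metric.sphere (0 : Space) 1 :=
      measure_eq_zero_iff_ae_notMem.1 (Measure.addHaar_sphere _ _ _)
    filter_upwards [n1, n2] with y hy0 hy1
    have hev : ∀ l : ℝ, Tendsto (fun t => t * sol φ t (t • y)) atTop (𝓝 l) →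
        Tendsto (fun t => t * sol φ (max t 0) (t • y)) atTop (𝓝 l) := fun l hl => by
      refine hl.congr' ?_
      filter_upwards [eventually_ge_atTop 0] with t ht
      rw [max_eq_left ht]
    refine hev _ ?_
    rcases lt_trichotomy ‖y‖ 1 with hy | hy | hy
    · rw [ballIndicator, indicator_of_mem (mem_ball_zero_iff.2 hy), mul_one]
      exact tendsto_mul_sol_inside hc hy0 hy
    · exact absurd (mem_sphere_zero_iff_norm.2 hy) hy1
    · rw [ballIndicator, indicator_of_notMem (fun hm => by linarith [mem_ball_zero_iff.1 hm]), mul_zero]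
      exact tendsto_mul_sol_outside hφ0 hy

end Growth

/-! ### Behaviour at the poles of the profile -/

section

variable {B E X Y : ℝ} {v θ : ℝ → ℝ}

/-- Where the angle reaches `±π/2`, its speed is `1 / √2`, so that `tan θ` has a simple pole. -/
lemma AngleSolution.tendsto_sub_mul_tan (h : AngleSolution E θ v)
    (hB : B ∈ Ioo (-10) 10) (hθ : |θ B| = π / 2) :
    ∃ c ≠ 0, Tendsto (fun s => (B - s) * tan (θ s)) (𝓝[<] B) (𝓝 c) := by
  have hcos : cos (θ B) = 0 := by rw [← cos_abs, hθ, cos_pi_div_two]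
  have hsin : sin (θ B) ^ 2 = 1 := by
    have := sin_sq_add_cos_sq (θ B); rw [hcos] at this; linarith
  have hv : v B ^ 2 = 1 / 2 := by
    rw [h.speed B hB, speedSq, hcos]; linear_combination (1 / 2) * (sin (θ B) ^ 2 + 1) * hsin
  have hs0 : sin (θ B) ≠ 0 := fun h0 => by rw [h0] at hsin; norm_num at hsin
  have hv0 : v B ≠ 0 := fun h0 => by rw [h0] at hv; norm_num at hv
  have hd0 : -sin (θ B) * v B ≠ 0 := mul_ne_zero (neg_ne_zero.2 hs0) hv0
  have hslope := (hasDerivAt_iff_tendsto_slope.1 (h.hasDerivAt hB).cos).mono_left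
    (nhdsWithin_mono B (fun s (hs : s < B) => hs.ne))
  have hsinT : Tendsto (fun s => sin (θ s)) (𝓝[<] B) (𝓝 (sin (θ B))) :=
    (h.hasDerivAt hB).sin.continuousAt.tendsto.mono_left nhdsWithin_le_nhds
  refine ⟨-(sin (θ B) * (-sin (θ B) * v B)⁻¹),
    neg_ne_zero.2 (mul_ne_zero hs0 (inv_ne_zero hd0)), ((hsinT.mul (hslope.inv₀ hd0)).neg).congr' ?_⟩
  filter_upwards with s
  rw [slope_def_field, hcos, sub_zero, inv_div, tan_eq_sin_div_cos]; ring

lemma tendsto_abs_atTop_of_pole {φ : ℝ → ℝ} {c : ℝ} (hc0 : c ≠ 0)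
    (hc : Tendsto (fun s => (B - s) * φ s) (𝓝[<] B) (𝓝 c)) :
    Tendsto (fun s => |φ s|) (𝓝[<] B) atTop := by
  have h1 : Tendsto (fun s => B - s) (𝓝[<] B) (𝓝[>] 0) := by
    refine tendsto_nhdsWithin_iff.2 ⟨?_, eventually_mem_nhdsWithin.mono fun s (hs : s < B) =>
      sub_pos.2 hs⟩
    have : Tendsto (fun s => B - s) (𝓝 B) (𝓝 (B - B)) := (continuous_const.sub continuous_id).tendsto B
    rw [sub_self] at this; exact this.mono_left nhdsWithin_le_nhds
  refine (hc.abs.pos_mul_atTop (abs_pos.2 hc0) (tendsto_inv_nhdsGT_zero.comp h1)).congr' ?_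
  filter_upwards [eventually_mem_nhdsWithin] with s (hs : s < B)
  have : 0 < B - s := sub_pos.2 hs
  simp only [Function.comp_apply, abs_mul, abs_of_pos this]; field_simp

/-! ### The profile of the solution with given data -/

/-- `tan θ` solves the profile equation on any set where the angle is regular. -/
lemma AngleSolution.solvesOn_tan (h : AngleSolution E θ v) {s : Set ℝ}
    (hs : s ⊆ Ioo (-10) 10) (hr : Regular θ s) :
    SolvesOn (fun x => x ^ 3 - x) (fun t => tan (θ t))
      (fun t => v t / cos (θ t) ^ 2) s := fun _ ht =>
  ⟨h.hasDerivAt_tan (hs ht) (hr.cos_pos ht).ne', h.hasDerivAt_tan_deriv (hs ht) (hr.cos_pos ht).ne'⟩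

lemma DataSolution.profile {A : ℝ} (h : DataSolution X Y E θ v)
    (hA : A ∈ Ioc 0 π) (hB : B ∈ Ioc 0 π)
    (hrA : Regular (fun t => θ (-t)) (Ico 0 A)) (hrB : Regular θ (Ico 0 B)) :
    Profile X Y A B (fun t => tan (θ t)) (fun t => v t / cos (θ t) ^ 2) where
  neg := hA
  pos := hB
  solves := by
    refine h.solvesOn_tan (fun t ht => ⟨?_, ?_⟩) fun t ht => ?_
    · linarith [ht.1, hA.2, pi_lt_four]
    · linarith [ht.2, hB.2, pi_lt_four]
    · rcases le_total 0 t with h0 | h0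
      · exact hrB t ⟨h0, ht.2⟩
      · simpa using hrA (-t) ⟨by linarith, by linarith [ht.1]⟩
  init := by rw [h.init, tan_arctan]
  init_deriv := by
    have : (0 : ℝ) < 1 + X ^ 2 := by positivity
    rw [h.init, h.init_vel, cos_sq_arctan]; field_simp

lemma DataSolution.exists_regular_backward (h : DataSolution X Y E θ v) :
    ∃ A ∈ Ioc 0 π, Regular (fun t => θ (-t)) (Ico 0 A) ∧
      (A < π → Tendsto (fun s => |tan (θ (-s))|) (𝓝[<] A) atTop) := by
  rcases h.backward.regular_or_exists with hr | ⟨A, hA, hr, hθ⟩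
  · exact ⟨π, ⟨pi_pos, le_rfl⟩, hr.mono Ico_subset_Icc_self, fun h => absurd h (lt_irrefl _)⟩
  · obtain ⟨c, hc0, hc⟩ := h.backward.tendsto_sub_mul_tan
      (Icc_pi_subset (Ioc_subset_Icc_self hA)) hθ
    exact ⟨A, hA, hr, fun _ => tendsto_abs_atTop_of_pole hc0 hc⟩

lemma DataSolution.scatters {A : ℝ} (h : DataSolution X Y E θ v) (hr : Regular θ (Icc 0 π))
    (hP : Profile X Y A π (fun t => tan (θ t)) (fun t => v t / cos (θ t) ^ 2)) :
    Scatters (lifespan π) (sol fun t => tan (θ t)) := by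
  have hU : IsOpen (Ioo (-10) 10 ∩ θ ⁻¹' Ioo (-(π / 2)) (π / 2)) :=
    h.continuousOn.isOpen_inter_preimage isOpen_Ioo isOpen_Ioo
  exact hP.scatters (U := Ioo (-10) 10 ∩ θ ⁻¹' Ioo (-(π / 2)) (π / 2))
    (fun t ht => ⟨Icc_pi_subset ht, hr t ht⟩) hU
    (h.solvesOn_tan inter_subset_left fun t ht => ht.2)

/-! ### Mutual exclusion of the three behaviours -/

lemma pairNorm_half_add_le (f₁ f₂ h₁ h₂ : Space → ℝ) : pairNorm (1 / 2) (f₁ + f₂) (h₁ + h₂) ≤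
      2 * pairNorm (1 / 2) f₁ h₁ + 2 * pairNorm (1 / 2) f₂ h₂ := by
  calc pairNorm (1 / 2) (f₁ + f₂) (h₁ + h₂)
      ≤ sobolevNorm (1 / 2) (f₁ + f₂) + sobolevNorm (1 / 2 - 1) (h₁ + h₂) := pairNorm_le _ _ _
    _ ≤ (sobolevNorm (1 / 2) f₁ + sobolevNorm (1 / 2) f₂) +
        (sobolevNorm (1 / 2 - 1) h₁ + sobolevNorm (1 / 2 - 1) h₂) :=
        add_le_add (sobolevNorm_add_le _ _ _) (sobolevNorm_add_le _ _ _)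
    _ ≤ (pairNorm (1 / 2) f₁ h₁ + pairNorm (1 / 2) f₂ h₂) +
        (pairNorm (1 / 2) f₁ h₁ + pairNorm (1 / 2) f₂ h₂) := by
        gcongr
        · exact sobolevNorm_le_pairNorm _ _ _
        · exact sobolevNorm_le_pairNorm _ _ _
        · exact sobolevNorm_le_pairNorm_right _ _ _
        · exact sobolevNorm_le_pairNorm_right _ _ _
    _ = _ := by ring

variable {tp : EReal} {u : ℝ → Space → ℝ}

lemma BlowsUp.ne_top (h : BlowsUp tp u) : tp ≠ ⊤ := by
  obtain ⟨T, rfl, -⟩ := h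
  exact EReal.coe_ne_top T

lemma Scatters.not_growsUp (h : Scatters tp u) : ¬ GrowsUp tp u := by
  rintro ⟨-, hgr⟩
  obtain ⟨-, v, -, -, ⟨M, hM, hv⟩, hlim⟩ := h
  have h1 : ∀ᶠ t in atTop, pairNorm (1 / 2) (u t - v t) (timeDeriv u t - timeDeriv v t) < 1 :=
    hlim.eventually (gt_mem_nhds one_pos)
  have hfin : 2 * 1 + 2 * M < ⊤ := ENNReal.add_lt_top.2 ⟨by simp, ENNReal.mul_lt_top (by simp) hM⟩
  obtain ⟨t, ht1, ht2⟩ := (h1.and (hgr.eventually (lt_mem_nhds hfin))).exists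
  have key := pairNorm_half_add_le (u t - v t) (v t) (timeDeriv u t - timeDeriv v t) (timeDeriv v t)
  rw [sub_add_cancel, sub_add_cancel] at key
  refine absurd (ht2.trans_le key) (not_lt.2 ?_)
  gcongr
  exact hv t

/-- The three behaviours, according to the time at which the profile has its pole. -/
lemma exists_isMaximalSolution (X Y : ℝ) : ∃ (tm tp : EReal) (u : ℝ → Space → ℝ),
      IsMaximalSolution X Y tm tp u ∧
      (∀ t : ℝ, tm < (t : EReal) → (t : EReal) < tp → ∀ s : ℝ, 1 / 2 ≤ s →
        pairNorm s (u t) (timeDeriv u t) < ⊤) ∧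
      ((threshold X < Y ∨ Y < -threshold (-X)) ↔ BlowsUp tp u) ∧
      ((-threshold (-X) < Y ∧ Y < threshold X) ↔ Scatters tp u) ∧
      ((Y = threshold X ∨ Y = -threshold (-X)) ↔ GrowsUp tp u) := by
  obtain ⟨E, θ, v, h⟩ := exists_dataSolution X Y
  obtain ⟨A, hA, hrA, hpA⟩ := h.exists_regular_backward
  have hlt := neg_threshold_neg_lt X
  have hπ : π ∈ Ioc 0 π := ⟨pi_pos, le_rfl⟩
  have hπt : lifespan π = ⊤ := by simp [lifespan]
  by_cases hbu : threshold X < Y ∨ Y < -threshold (-X)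
  · obtain ⟨B, hB, hrB, hθ⟩ := h.exists_pole hbu
    have hB' : B ∈ Ioc 0 π := Ioo_subset_Ioc_self hB
    obtain ⟨c, hc0, hc⟩ := h.tendsto_sub_mul_tan (Icc_pi_subset (Ioo_subset_Icc_self hB)) hθ
    have hP := h.profile hA hB' hrA hrB
    have hbl := hP.blowsUp hB.2 hc0 hc
    refine ⟨-lifespan A, lifespan B, sol _,
      hP.isMaximalSolution (fun _ => tendsto_abs_atTop_of_pole hc0 hc) hpA,
      fun t h1 h2 s hs => hP.pairNorm_sol_lt_top h1 h2 hs, iff_of_true hbu hbl,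
      iff_of_false ?_ fun hs => hbl.ne_top hs.1, iff_of_false ?_ fun hs => hbl.ne_top hs.1⟩
    · rintro ⟨h1, h2⟩
      rcases hbu with h3 | h3 <;> linarith
    · rintro (h1 | h1) <;> rcases hbu with h3 | h3 <;> linarith
  by_cases hsc : -threshold (-X) < Y ∧ Y < threshold X
  · have hr := h.regular hsc.1 hsc.2
    have hP := h.profile hA hπ hrA (hr.mono Ico_subset_Icc_self)
    have hscat := h.scatters hr hP
    refine ⟨-lifespan A, lifespan π, sol _,
      hP.isMaximalSolution (fun h => absurd h (lt_irrefl _)) hpA,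
      fun t h1 h2 s hs => hP.pairNorm_sol_lt_top h1 h2 hs, iff_of_false hbu fun hb => hb.ne_top hπt,
      iff_of_true hsc hscat, iff_of_false ?_ hscat.not_growsUp⟩
    rintro (h1 | h1) <;> linarith [hsc.1, hsc.2]
  · have hth : Y = threshold X ∨ Y = -threshold (-X) := by
      rw [not_or, not_lt, not_lt] at hbu
      rcases hbu.1.lt_or_eq with h1 | h1
      · exact Or.inr (le_antisymm (not_lt.1 fun h2 => hsc ⟨h2, h1⟩) hbu.2)
      · exact Or.inl h1
    obtain ⟨hr, hθ⟩ := h.pole_at_pi hth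
    obtain ⟨c, hc0, hc⟩ := h.tendsto_sub_mul_tan (Icc_pi_subset (Ioc_subset_Icc_self hπ)) hθ
    have hP := h.profile hA hπ hrA hr
    have hgr := hP.growsUp hc0 hc
    exact ⟨-lifespan A, lifespan π, sol _,
      hP.isMaximalSolution (fun h => absurd h (lt_irrefl _)) hpA,
      fun t h1 h2 s hs => hP.pairNorm_sol_lt_top h1 h2 hs, iff_of_false hbu fun hb => hb.ne_top hπt,
      iff_of_false hsc fun hs => hs.not_growsUp hgr, iff_of_true hth hgr⟩

end

end CubicWave

end

theorem theorem1p1 : ∃ β : ℝ → ℝ, ContDiff ℝ ∞ β ∧ StrictAnti β ∧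
      Tendsto β atTop atBot ∧ Tendsto β atBot atTop ∧
      (∀ X, -β (-X) < β X) ∧
      ∀ X Y : ℝ, ∃ (tm tp : EReal) (u : ℝ → CubicWave.Space → ℝ),
        CubicWave.IsMaximalSolution X Y tm tp u ∧
        (∀ t : ℝ, tm < (t : EReal) → (t : EReal) < tp → ∀ s : ℝ, 1 / 2 ≤ s →
          CubicWave.pairNorm s (u t) (CubicWave.timeDeriv u t) < ⊤) ∧
        ((β X < Y ∨ Y < -β (-X)) ↔ CubicWave.BlowsUp tp u) ∧
        ((-β (-X) < Y ∧ Y < β X) ↔ CubicWave.Scatters tp u) ∧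
        ((Y = β X ∨ Y = -β (-X)) ↔ CubicWave.GrowsUp tp u) :=
  ⟨CubicWave.threshold, CubicWave.contDiff_threshold, CubicWave.strictAnti_threshold,
    CubicWave.tendsto_threshold_atTop, CubicWave.tendsto_threshold_atBot,
    CubicWave.neg_threshold_neg_lt, CubicWave.exists_isMaximalSolution⟩
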